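/- **Setting.** Let $\Lambda>0$, $m>0$, $a\in\mathbb R$ be such that $\mu(r)=(r^2+a^2)\left(1-\frac{\Lambda r^2}{3}\right)-2mr$ has four distinct real roots $r_-<r_C<r_e<r_c$ (subextremality). Put $b=1+\frac{\Lambda a^2}{3}$, $c(\theta)=1+\frac{\Lambda a^2}{3}\cos^2\theta$, $\varrho^2=r^2+a^2\cos^2\theta$. Fix $r_0\in(r_e,r_c)$ with $\frac{d}{dr}\frac{\mu(r)}{r^2+a^2}\big|_{r=r_0}=0$ and $\varepsilon_M>0$ with $r_C<r_e-2\varepsilon_M$, let $M=\mathbb R_{t_*}\times(r_e-2\varepsilon_M,r_c+2\varepsilon_M)_r\times\mathbb S^2_{\phi_*,\theta}$ and $$g=-\frac{\mu}{b^2\varrho^2}(dt_*-a\sin^2\theta\,d\phi_*)^2+\varrho^2\frac{1-f^2}{\mu}dr^2-\frac2b f\,(dt_*-a\sin^2\theta\,d\phi_*)dr+\frac{c\sin^2\theta}{b^2\varrho^2}\left(a\,dt_*-(r^2+a^2)d\phi_*\right)^2+\varrho^2\frac{d\theta^2}{c},$$ where $f$ is a smooth function of $r$ with $f(r_e)=-1$,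 $f(r_c)=1$, $f(r_0)=0$, $f'>0$, such that $dt_*$ is timelike on $M$. Let $G$ be the dual metric, $G(\xi)=G(\xi,\xi)$ on $T^*M$ with Hamilton vector field $H_G$, and let $T=\partial_{t_*}+\frac{a}{r_0^2+a^2}\partial_{\phi_*}$, $\sigma=-\xi(T)$; *stationary* means invariant under the flow of $T$. For $\kappa,e,h>0$ let $\mathfrak c=g(\mathfrak c^\sharp,\cdot)$ with $\mathfrak c^\sharp=\partial_{t_*}+\frac{a}{r^2+a^2}\partial_{\phi_*}+\kappa f(r)\partial_r+\kappa^2\sin\theta\,\partial_\theta$. Let $\mathcal T u=u-\frac12\mathrm{tr}_g(u)g$, $(\delta u)_i=-\nabla^ju_{ji}$, $\delta^*$ the symmetric gradient, and $\mathcal A\omega=-h^{-1}\mathcal T^{-1}\left(\mathfrak c\otimes_s\omega-e\,G(\mathfrak c,\omega)g\right)$. The linearized gauge fixed Einstein operator on sections of $S^2T^*M$ is $$L_g=2\left(D_g\mathrm{Ric}-\Lambda+(\delta^*+\mathcal A)\delta\mathcal T\right)=\Box_g+2\mathcal A\delta\mathcal T-2\mathring R,\qquad \Box_g=-\nabla^k\nabla_k,\quad(\mathring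 Ru)_{kj}=R_{lkij}u^{li},$$ where $R_{lkij}$ is normalized by $\mathrm{Ric}_{kj}=g^{li}R_{lkij}$. With $\pi:T^*M\to M$, its subprincipal operator $S_{\mathrm{sub}}(L_g)$ is the first order operator on sections of $\pi^*S^2T^*M\otimes\mathbb C$ which in local coordinates and a local frame is $\sigma_{\mathrm{sub}}-iH_G$, where $\sigma_{\mathrm{sub}}=p_1-\frac1{2i}\sum_j\partial_{x_j}\partial_{\xi_j}G$ and $p_1$ is the degree one part of the full symbol of $|g|^{1/4}L_g|g|^{-1/4}$. Let $\Sigma^\pm=\{\xi\in T^*M\setminus0: G(\xi,\xi)=0,\ \pm G(dt_*,\xi)>0\}$. The trapped set $\Gamma^\pm\subset\Sigma^\pm$ consists of the $\xi\in\Sigma^\pm$ over $r\in(r_e,r_c)$ with $(\xi_t,\xi_\phi)\ne(0,0)$ and $\xi_r=0$ (dual variables of the Boyer–Lindquist coordinates) and such that $r$ is a minimum point of $\frac{((r^2+a^2)\xi_t+a\xi_\phi)^2}{\mu(r)}$ on $(r_e,r_c)$. **Theorem.** For every $\varepsilon>0$ there are $\kappa_0,e_0,h_0>0$ such that for all $\kappa\in(0,\kappa_0)$,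 $e\in(0,e_0)$, $h\in(0,h_0)$ there is a stationary, smooth, positive definite fiber inner product $\mathfrak C$ on $\pi^*S^2T^*M$ over an open neighborhood of $\Gamma^+\cup\Gamma^-$ such that $\sigma\ne0$ on $\Gamma^\pm$ and $$\pm\frac{1}{2i|\sigma|}\left(S_{\mathrm{sub}}(L_g)-S_{\mathrm{sub}}(L_g)^{*\mathfrak C}\right)\Big|_{\Gamma^\pm}\le\varepsilon$$ with respect to $\mathfrak C$. Here $*\mathfrak C$ is the formal adjoint with respect to (the sesquilinear extension of) $\mathfrak C$ and the symplectic volume on $T^*M$. -/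

import Mathlib

open scoped ContDiff

noncomputable section

namespace KdS

/-- Points of spacetime in the global coordinates `(t_*, x, y, z)`, where
`(x, y, z) = r (sin θ cos φ_*, sin θ sin φ_*, cos θ)`. The same type is used for the components of
covectors and vectors with respect to `dt_*, dx, dy, dz` and `∂_{t_*}, ∂_x, ∂_y, ∂_z`. -/
abbrev R4 : Type := Fin 4 → ℝ

/-- Points `(p, ξ)` of the cotangent bundle, in the coordinates induced by those on spacetime. -/
abbrev Phase : Type := R4 × R4

/-- Components of complex one-forms. -/
abbrev Form : Type := Fin 4 → ℂ

/-- Components of complex `(0,2)`-tensors. -/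
abbrev Tens : Type := Fin 4 → Fin 4 → ℂ

/-- The partial derivative in the `i`-th coordinate of spacetime. -/
def pd {F : Type*} [NormedAddCommGroup F] [NormedSpace ℝ F] (i : Fin 4) (u : R4 → F) (p : R4) : F :=
  fderiv ℝ u p (Pi.single i 1)

/-- The partial derivative `∂/∂x_j` on phase space. -/
def dX {F : Type*} [NormedAddCommGroup F] [NormedSpace ℝ F] (j : Fin 4) (u : Phase → F)
    (z : Phase) : F :=
  fderiv ℝ u z (Pi.single j 1, 0)

/-- The partial derivative `∂/∂ξ_j` on phase space. -/
def dXi {F : Type*} [NormedAddCommGroup F] [NormedSpace ℝ F] (j : Fin 4) (u : Phase → F)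
    (z : Phase) : F :=
  fderiv ℝ u z (0, Pi.single j 1)

/-- The natural pairing of a covector with a vector. -/
def dot (ξ v : R4) : ℝ := ∑ i, ξ i * v i

/-! ### Polar quantities in the coordinates `(t_*, x, y, z)` -/

/-- The radius `r`. -/
def rad (p : R4) : ℝ := Real.sqrt (p 1 ^ 2 + p 2 ^ 2 + p 3 ^ 2)

/-- `cos θ`. -/
def cosTh (p : R4) : ℝ := p 3 / rad p

/-- `sin² θ`. -/
def sinSq (p : R4) : ℝ := (p 1 ^ 2 + p 2 ^ 2) / rad p ^ 2

/-- The one-form `dt_*`. -/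
def dtForm : R4 := ![1, 0, 0, 0]

/-- The one-form `dr`. -/
def drForm (p : R4) : R4 := ![0, p 1 / rad p, p 2 / rad p, p 3 / rad p]

/-- The one-form `sin² θ dφ_* = (x dy - y dx) / r²`. -/
def rotForm (p : R4) : R4 := ![0, -p 2 / rad p ^ 2, p 1 / rad p ^ 2, 0]

/-- The round metric `dθ² + sin² θ dφ_*² = (dx² + dy² + dz² - dr²) / r²` of the unit sphere. -/
def roundMetric (p : R4) (i j : Fin 4) : ℝ :=
  ((if i = j ∧ i ≠ 0 then 1 else 0) - drForm p i * drForm p j) / rad p ^ 2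

/-- The point with polar coordinates `(t_*, r, θ, φ_*)`. -/
def polar (t r θ φ : ℝ) : R4 :=
  ![t, r * Real.sin θ * Real.cos φ, r * Real.sin θ * Real.sin φ, r * Real.cos θ]

/-- The vector `τ ∂_{t_*} + ρ ∂_r + ϑ ∂_θ + ϕ ∂_{φ_*}` at the point `polar t r θ φ`. -/
def polarVec (r θ φ τ ρ ϑ ϕ : ℝ) : R4 :=
  ![τ,
    ρ * (Real.sin θ * Real.cos φ) + ϑ * (r * Real.cos θ * Real.cos φ)
      - ϕ * (r * Real.sin θ * Real.sin φ),
    ρ * (Real.sin θ * Real.sin φ) + ϑ * (r * Real.cos θ * Real.sin φ)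
      + ϕ * (r * Real.sin θ * Real.cos φ),
    ρ * Real.cos θ - ϑ * (r * Real.sin θ)]

/-- The vector field `∂_{t_*}`. -/
def dtVec : R4 := ![1, 0, 0, 0]

/-- The vector field `∂_r` of the coordinates `(t_*, r, θ, φ_*)`. -/
def drVec (p : R4) : R4 := ![0, p 1 / rad p, p 2 / rad p, p 3 / rad p]

/-- The vector field `∂_{φ_*} = x ∂_y - y ∂_x`. -/
def dphiVec (p : R4) : R4 := ![0, -p 2, p 1, 0]

/-- The vector field `sin θ ∂_θ`. -/
def sinDthVec (p : R4) : R4 :=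
  ![0, p 1 * p 3 / rad p, p 2 * p 3 / rad p, -(p 1 ^ 2 + p 2 ^ 2) / rad p]

/-! ### Kerr–de Sitter spacetimes -/

/-- The data entering the definition of a Kerr–de Sitter spacetime extended beyond the horizons:
cosmological constant, mass, angular momentum, the roots of `μ`, the size of the extension,
the radius `r₀` defining the stationary Killing field, and the function `f`. -/
structure Data where
  Lam : ℝ
  m : ℝ
  a : ℝ
  rMinus : ℝ
  rCauchy : ℝ
  rEvent : ℝ
  rCosmo : ℝ
  epsM : ℝ
  r0 : ℝ
  f : ℝ → ℝ

namespace Data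

variable (D : Data)

/-- The polynomial `μ`. -/
def mu (r : ℝ) : ℝ := (r ^ 2 + D.a ^ 2) * (1 - D.Lam * r ^ 2 / 3) - 2 * D.m * r

/-- The constant `b = 1 + Λ a² / 3`. -/
def b : ℝ := 1 + D.Lam * D.a ^ 2 / 3

/-- The function `c(θ) = 1 + (Λ a² / 3) cos² θ`. -/
def c (p : R4) : ℝ := 1 + D.Lam * D.a ^ 2 / 3 * cosTh p ^ 2

/-- The function `ϱ² = r² + a² cos² θ`. -/
def rhoSq (p : R4) : ℝ := rad p ^ 2 + D.a ^ 2 * cosTh p ^ 2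

/-- The interval of radii of the extended spacetime. -/
def radii : Set ℝ := Set.Ioo (D.rEvent - 2 * D.epsM) (D.rCosmo + 2 * D.epsM)

/-- The extended spacetime `M = ℝ × radii × S²`, in the coordinates `(t_*, x, y, z)`. -/
def M : Set R4 := {p | rad p ∈ D.radii}

/-- The function `(1 - f²) / μ`, continued to the simple zeros of `μ` at the horizons (where
`f² = 1`) by its limit. -/
def q (r : ℝ) : ℝ :=
  if D.mu r = 0 then -(2 * D.f r * deriv D.f r) / deriv D.mu r else (1 - D.f r ^ 2) / D.mu r

/-- The one-form `dt_* - a sin² θ dφ_*`. -/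
def tauForm (p : R4) (i : Fin 4) : ℝ := dtForm i - D.a * rotForm p i

/-- The Kerr–de Sitter metric. The last three lines are
`(c sin² θ / (b² ϱ²)) (a dt_* - (r² + a²) dφ_*)² + (ϱ² / c) dθ²`, rewritten so that the smoothness
at the poles is visible, with the help of
`c (r² + a²) - b ϱ² = a² sin² θ (1 - Λ r² / 3)`; see `metric_polar`. -/
def metric (p : R4) : Matrix (Fin 4) (Fin 4) ℝ := Matrix.of fun i j =>
  -(D.mu (rad p) / (D.b ^ 2 * D.rhoSq p)) * (D.tauForm p i * D.tauForm p j)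
    + D.rhoSq p * D.q (rad p) * (drForm p i * drForm p j)
    - D.f (rad p) / D.b * (D.tauForm p i * drForm p j + drForm p i * D.tauForm p j)
    + D.c p * sinSq p * D.a ^ 2 / (D.b ^ 2 * D.rhoSq p) * (dtForm i * dtForm j)
    - D.c p * D.a * (rad p ^ 2 + D.a ^ 2) / (D.b ^ 2 * D.rhoSq p)
        * (dtForm i * rotForm p j + rotForm p i * dtForm j)
    + (D.rhoSq p / D.c p * roundMetric p i j
      + D.a ^ 2 * (1 - D.Lam * rad p ^ 2 / 3) * (D.c p * (rad p ^ 2 + D.a ^ 2) + D.b * D.rhoSq p)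
          / (D.b ^ 2 * D.rhoSq p * D.c p) * (rotForm p i * rotForm p j))

/-- The metric in polar coordinates has its usual form. -/
theorem metric_polar (hLam : 0 ≤ D.Lam) (t r θ φ τ ρ ϑ ϕ : ℝ) (hr : 0 < r) :
    let c := 1 + D.Lam * D.a ^ 2 / 3 * Real.cos θ ^ 2
    let rhoSq := r ^ 2 + D.a ^ 2 * Real.cos θ ^ 2
    let V := polarVec r θ φ τ ρ ϑ ϕ
    ∑ i, ∑ j, V i * D.metric (polar t r θ φ) i j * V j =
      -(D.mu r / (D.b ^ 2 * rhoSq)) * (τ - D.a * Real.sin θ ^ 2 * ϕ) ^ 2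
        + rhoSq * D.q r * ρ ^ 2
        - 2 / D.b * D.f r * (τ - D.a * Real.sin θ ^ 2 * ϕ) * ρ
        + c * Real.sin θ ^ 2 / (D.b ^ 2 * rhoSq) * (D.a * τ - (r ^ 2 + D.a ^ 2) * ϕ) ^ 2
        + rhoSq * ϑ ^ 2 / c := by
  intro c rhoSq V
  have hc : 0 < c := by positivity
  have hrho : 0 < rhoSq := by positivity
  have hb : 0 < D.b := by unfold b; positivity
  have e1 := Real.sin_sq_add_cos_sq φ
  have e2 := Real.sin_sq_add_cos_sq θ
  have hrad : rad (polar t r θ φ) = r := by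
    have : (polar t r θ φ 1) ^ 2 + (polar t r θ φ 2) ^ 2 + (polar t r θ φ 3) ^ 2 = r ^ 2 := by
      simp only [polar, Matrix.cons_val]
      linear_combination r ^ 2 * Real.sin θ ^ 2 * e1 + r ^ 2 * e2
    rw [rad, this, Real.sqrt_sq hr.le]
  have hcos : cosTh (polar t r θ φ) = Real.cos θ := by
    rw [cosTh, hrad]; simp only [polar, Matrix.cons_val]; field_simp
  have hsin : sinSq (polar t r θ φ) = Real.sin θ ^ 2 := by
    rw [sinSq, hrad]; simp only [polar, Matrix.cons_val]; field_simp
    linear_combination Real.sin θ ^ 2 * e1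
  have hdt : ∑ i, dtForm i * V i = τ := by
    simp [V, polarVec, dtForm, Fin.sum_univ_four]
  have hdr : ∑ i, drForm (polar t r θ φ) i * V i = ρ := by
    simp only [drForm, hrad]
    simp only [V, polarVec, polar, Fin.sum_univ_four, Matrix.cons_val]
    field_simp
    linear_combination (ρ * Real.sin θ ^ 2 + r * ϑ * Real.sin θ * Real.cos θ) * e1 + ρ * e2
  have hrot : ∑ i, rotForm (polar t r θ φ) i * V i = Real.sin θ ^ 2 * ϕ := by
    simp only [rotForm, hrad]
    simp only [V, polarVec, polar, Fin.sum_univ_four, Matrix.cons_val]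
    field_simp
    linear_combination r * Real.sin θ ^ 2 * ϕ * e1
  have hround : ∑ i, ∑ j, V i * roundMetric (polar t r θ φ) i j * V j
      = ϑ ^ 2 + Real.sin θ ^ 2 * ϕ ^ 2 := by
    have h1 : ∑ i, ∑ j, V i * roundMetric (polar t r θ φ) i j * V j
        = (V 1 ^ 2 + V 2 ^ 2 + V 3 ^ 2 - (∑ i, drForm (polar t r θ φ) i * V i) ^ 2) / r ^ 2 := by
      simp only [roundMetric, hrad, Fin.sum_univ_four]
      simp
      ring
    rw [h1, hdr]
    simp only [V, polarVec, Matrix.cons_val]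
    field_simp
    linear_combination (r ^ 2 * ϕ ^ 2 * Real.sin θ ^ 2 + ρ ^ 2 * Real.sin θ ^ 2
      + r ^ 2 * ϑ ^ 2 * Real.cos θ ^ 2 + 2 * r * ρ * ϑ * Real.sin θ * Real.cos θ) * e1
      + (ρ ^ 2 + r ^ 2 * ϑ ^ 2) * e2
  have hquad : ∀ (A B F K N P Q a : ℝ) (x y w : Fin 4 → ℝ) (S : Fin 4 → Fin 4 → ℝ),
      ∑ i, ∑ j, V i * (A * ((x i - a * w i) * (x j - a * w j)) + B * (y i * y j)
        - F * ((x i - a * w i) * y j + y i * (x j - a * w j)) + K * (x i * x j)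
        - N * (x i * w j + w i * x j) + (P * S i j + Q * (w i * w j))) * V j
      = A * ((∑ i, x i * V i) - a * ∑ i, w i * V i) ^ 2 + B * (∑ i, y i * V i) ^ 2
        - 2 * F * ((∑ i, x i * V i) - a * ∑ i, w i * V i) * (∑ i, y i * V i)
        + K * (∑ i, x i * V i) ^ 2 - 2 * N * (∑ i, x i * V i) * (∑ i, w i * V i)
        + P * (∑ i, ∑ j, V i * S i j * V j) + Q * (∑ i, w i * V i) ^ 2 := by
    intro A B F K N P Q a x y w S
    simp only [Fin.sum_univ_four]
    ring
  simp only [metric, Matrix.of_apply, tauForm]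
  rw [hquad, hdt, hdr, hrot, hround]
  simp only [Data.c, Data.rhoSq, hrad, hcos, hsin]
  change _ * _ + rhoSq * _ * _ - _ + _ - _ + rhoSq / c * _ + _ = _
  have hs : Real.sin θ ^ 2 = 1 - Real.cos θ ^ 2 := by linarith
  have hcr : c * (r ^ 2 + D.a ^ 2) - D.b * rhoSq
      = D.a ^ 2 * Real.sin θ ^ 2 * (1 - D.Lam * r ^ 2 / 3) := by
    simp only [c, rhoSq, b, hs]; ring
  have hkey : D.a ^ 2 * (1 - D.Lam * r ^ 2 / 3) * (c * (r ^ 2 + D.a ^ 2) + D.b * rhoSq)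
        / (D.b ^ 2 * rhoSq * c) * (Real.sin θ ^ 2 * ϕ) ^ 2
      = (c * (r ^ 2 + D.a ^ 2) ^ 2 / (D.b ^ 2 * rhoSq) - rhoSq / c) * Real.sin θ ^ 2 * ϕ ^ 2 := by
    have : D.a ^ 2 * (1 - D.Lam * r ^ 2 / 3) * (Real.sin θ ^ 2 * ϕ) ^ 2
        = (c * (r ^ 2 + D.a ^ 2) - D.b * rhoSq) * Real.sin θ ^ 2 * ϕ ^ 2 := by
      rw [hcr]; ring
    calc _ = (c * (r ^ 2 + D.a ^ 2) + D.b * rhoSq) / (D.b ^ 2 * rhoSq * c)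
          * (D.a ^ 2 * (1 - D.Lam * r ^ 2 / 3) * (Real.sin θ ^ 2 * ϕ) ^ 2) := by ring
      _ = _ := by
        rw [this]
        generalize c = c at *
        generalize rhoSq = R at *
        field_simp
        ring
  linear_combination hkey

/-- The dual metric, as a matrix. -/
def dual (p : R4) : Matrix (Fin 4) (Fin 4) ℝ := (D.metric p)⁻¹

/-- The dual metric `G(ξ, η)` on covectors. -/
def G (p ξ η : R4) : ℝ := ∑ i, ∑ j, D.dual p i j * ξ i * η j

/-- The conditions on the data: `Λ > 0`, positive mass, four distinct real roots of `μ`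
(subextremality), a small extension beyond the event and the cosmological horizon, and the choice
of `r₀` and of `f`, for which `dt_*` is timelike on the extended spacetime. -/
structure Subextremal : Prop where
  Lam_pos : 0 < D.Lam
  m_pos : 0 < D.m
  rMinus_lt : D.rMinus < D.rCauchy
  rCauchy_lt : D.rCauchy < D.rEvent
  rEvent_lt : D.rEvent < D.rCosmo
  mu_rMinus : D.mu D.rMinus = 0
  mu_rCauchy : D.mu D.rCauchy = 0
  mu_rEvent : D.mu D.rEvent = 0
  mu_rCosmo : D.mu D.rCosmo = 0
  epsM_pos : 0 < D.epsM
  epsM_small : D.rCauchy < D.rEvent - 2 * D.epsM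
  r0_mem : D.r0 ∈ Set.Ioo D.rEvent D.rCosmo
  r0_crit : deriv (fun r => D.mu r / (r ^ 2 + D.a ^ 2)) D.r0 = 0
  f_smooth : ContDiffOn ℝ ∞ D.f D.radii
  f_rEvent : D.f D.rEvent = -1
  f_rCosmo : D.f D.rCosmo = 1
  f_deriv_pos : ∀ r ∈ D.radii, 0 < deriv D.f r
  f_r0 : D.f D.r0 = 0
  dt_timelike : ∀ p ∈ D.M, D.G p dtForm dtForm < 0

/-! ### Tensor calculus -/

/-- The Christoffel symbols `Γ^k_{ij}` of the Levi-Civita connection. -/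
def chris (k i j : Fin 4) (p : R4) : ℝ :=
  ∑ l, D.dual p k l / 2 * (pd i (fun y => D.metric y l j) p + pd j (fun y => D.metric y i l) p
    - pd l (fun y => D.metric y i j) p)

/-- The curvature `R^l_{kij}`, where `R(∂_i, ∂_j) ∂_k = R^l_{kij} ∂_l`. -/
def riem (l k i j : Fin 4) (p : R4) : ℝ :=
  pd i (D.chris l j k) p - pd j (D.chris l i k) p
    + ∑ n, (D.chris l i n p * D.chris n j k p - D.chris l j n p * D.chris n i k p)

/-- The covariant derivative `(∇_k u)_{ij}` of a `(0,2)`-tensor field. -/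
def cov (u : R4 → Tens) (p : R4) (k i j : Fin 4) : ℂ :=
  pd k (fun y => u y i j) p
    - ∑ n, ((D.chris n k i p : ℂ) * u p n j + (D.chris n k j p : ℂ) * u p i n)

/-- The second covariant derivative `(∇²u)_{lkij} = (∇_l ∇u)_{kij}` of a `(0,2)`-tensor field. -/
def cov2 (u : R4 → Tens) (p : R4) (l k i j : Fin 4) : ℂ :=
  pd l (fun y => D.cov u y k i j) p
    - ∑ n, ((D.chris n l k p : ℂ) * D.cov u p n i j + (D.chris n l i p : ℂ) * D.cov u p k n j
        + (D.chris n l j p : ℂ) * D.cov u p k i n)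

/-- The tensor wave operator `□ = -∇^k ∇_k`, with principal symbol `G(ξ, ξ)`. -/
def box (u : R4 → Tens) (p : R4) : Tens := fun i j =>
  -∑ l, ∑ k, (D.dual p l k : ℂ) * D.cov2 u p l k i j

/-- The divergence `(δ u)_i = -∇^j u_{ji}`. -/
def delta (u : R4 → Tens) (p : R4) : Form := fun i =>
  -∑ j, ∑ k, (D.dual p j k : ℂ) * D.cov u p k j i

/-- The trace with respect to the metric. -/
def tr (p : R4) (u : Tens) : ℂ := ∑ i, ∑ j, (D.dual p i j : ℂ) * u i j

/-- The trace reversal `u - (1/2) tr(u) g`. -/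
def trev (p : R4) (u : Tens) : Tens := fun i j => u i j - D.tr p u / 2 * (D.metric p i j : ℂ)

/-- The trace reversal is an involution in four dimensions. -/
theorem trev_trev (p : R4) (hp : (D.metric p).det ≠ 0) (u : Tens) :
    D.trev p (D.trev p u) = u := by
  have hG : ∑ i, ∑ j, (D.dual p i j : ℂ) * (D.metric p i j : ℂ) = 4 := by
    have h1 : D.dual p * D.metric p = 1 := Matrix.nonsing_inv_mul _ (isUnit_iff_ne_zero.mpr hp)
    have hs : ∀ i j, D.metric p i j = D.metric p j i := by
      intro i j
      simp only [metric, Matrix.of_apply, roundMetric]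
      have : (i = j ∧ i ≠ 0) ↔ (j = i ∧ j ≠ 0) := by
        constructor <;> rintro ⟨rfl, h⟩ <;> exact ⟨rfl, h⟩
      simp only [this]
      ring
    have h2 : ∑ i, ∑ j, D.dual p i j * D.metric p i j = 4 := by
      have h3 : ∀ i, ∑ j, D.dual p i j * D.metric p i j = 1 := by
        intro i
        have := congrFun (congrFun h1 i) i
        rw [Matrix.mul_apply, Matrix.one_apply_eq] at this
        rw [← this]
        exact Finset.sum_congr rfl fun j _ => by rw [hs i j]
      simp [h3]
    exact_mod_cast congrArg (fun x : ℝ => (x : ℂ)) h2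
  have ht : D.tr p (D.trev p u) = -D.tr p u := by
    have : D.tr p (D.trev p u) = D.tr p u
        - D.tr p u / 2 * ∑ i, ∑ j, (D.dual p i j : ℂ) * (D.metric p i j : ℂ) := by
      simp only [tr, trev, Finset.mul_sum, ← Finset.sum_sub_distrib]
      exact Finset.sum_congr rfl fun i _ => Finset.sum_congr rfl fun j _ => by ring
    rw [this, hG]; ring
  funext i j
  change D.trev p u i j - D.tr p (D.trev p u) / 2 * (D.metric p i j : ℂ) = u i j
  rw [ht]
  simp only [trev]
  ring

/-- The curvature term `(R u)_{kj} = R_{lkij} u^{li}`. -/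
def curv (u : Tens) (p : R4) : Tens := fun k j =>
  ∑ l, ∑ i, ∑ n, (D.riem l k i j p : ℂ) * (D.dual p i n : ℂ) * u l n

/-- The vector field `𝔠^♯ = ∂_{t_*} + (a / (r² + a²)) ∂_{φ_*} + κ f(r) ∂_r + κ² sin θ ∂_θ`. -/
def cVec (κ : ℝ) (p : R4) (i : Fin 4) : ℝ :=
  dtVec i + D.a / (rad p ^ 2 + D.a ^ 2) * dphiVec p i + κ * D.f (rad p) * drVec p i
    + κ ^ 2 * sinDthVec p i

/-- The one-form `𝔠` dual to `𝔠^♯`. -/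
def cForm (κ : ℝ) (p : R4) (i : Fin 4) : ℝ := ∑ j, D.metric p i j * D.cVec κ p j

/-- The homomorphism `𝒜 ω = -h⁻¹ 𝒯⁻¹(𝔠 ⊗_s ω - e G(𝔠, ω) g)` from one-forms to symmetric
tensors. Here `𝒯` is the trace reversal, which is its own inverse in four dimensions
(`trev_trev`), and `G(𝔠, ω) = ω(𝔠^♯)`. -/
def damp (κ e h : ℝ) (p : R4) (w : Form) : Tens := fun i j =>
  -(h : ℂ)⁻¹ * D.trev p (fun k l =>
    ((D.cForm κ p k : ℂ) * w l + w k * (D.cForm κ p l : ℂ)) / 2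
      - (e : ℂ) * (∑ n, w n * (D.cVec κ p n : ℂ)) * (D.metric p k l : ℂ)) i j

/-- The linearized gauge fixed Einstein operator
`L u = 2 (D Ric - Λ + (δ^* + 𝒜) δ 𝒯) u = □ u + 2 𝒜 δ 𝒯 u - 2 R u`. -/
def linEinstein (κ e h : ℝ) (u : R4 → Tens) (p : R4) : Tens := fun i j =>
  D.box u p i j + 2 * D.damp κ e h p (D.delta (fun y => D.trev y (u y)) p) i j
    - 2 * D.curv (u p) p i j

/-! ### The subprincipal operator -/

/-- The density `|det g|^{1/4}`, which identifies functions with half-densities. -/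
def halfDens (p : R4) : ℝ := |(D.metric p).det| ^ (1 / 4 : ℝ)

/-- The operator `L` acting on tensor-valued half-densities, in the trivialization
`|dt_* dx dy dz|^{1/2}`. -/
def halfDensOp (L : (R4 → Tens) → R4 → Tens) (u : R4 → Tens) (p : R4) : Tens := fun i j =>
  (D.halfDens p : ℂ) * L (fun y k l => ((D.halfDens y)⁻¹ : ℂ) * u y k l) p i j

end Data

/-- The full (left) symbol `e^{-i⟨x,ξ⟩} P e^{i⟨x,ξ⟩}` of a differential operator. -/
def fullSymbol (P : (R4 → Tens) → R4 → Tens) (p ξ : R4) (v : Tens) : Tens := fun i j =>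
  Complex.exp (-Complex.I * (dot ξ p : ℂ)) *
    P (fun y k l => Complex.exp (Complex.I * (dot ξ y : ℂ)) * v k l) p i j

/-- The part of the full symbol of a differential operator of order two that is homogeneous of
degree one in `ξ`: the full symbol is a polynomial of degree two in `ξ`, and this is its odd
part. -/
def symbolOne (P : (R4 → Tens) → R4 → Tens) (p ξ : R4) (v : Tens) : Tens := fun i j =>
  (fullSymbol P p ξ v i j - fullSymbol P p (-ξ) v i j) / 2

namespace Data

variable (D : Data)

/-- The function `G(x, ξ) = G_x(ξ, ξ)` on phase space, the scalar principal symbol of `□` and of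
the linearized gauge fixed Einstein operator. -/
def Gfun (z : Phase) : ℝ := D.G z.1 z.2 z.2

/-- The Hamilton vector field `H_G = ∑_j ∂_{ξ_j} G ∂_{x_j} - ∂_{x_j} G ∂_{ξ_j}`. -/
def ham (u : Phase → ℂ) (z : Phase) : ℂ :=
  ∑ j, (((dXi j D.Gfun z : ℝ) : ℂ) * dX j u z - ((dX j D.Gfun z : ℝ) : ℂ) * dXi j u z)

/-- The subprincipal symbol `σ_sub = p₁ - (1 / 2i) ∑_j ∂_{x_j} ∂_{ξ_j} G` of a second order operator
with scalar principal symbol `G`, acting on half-densities, an endomorphism of the fibers in the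
frame `dx^k ⊗ dx^l`. -/
def subSymbol (L : (R4 → Tens) → R4 → Tens) (z : Phase) (v : Tens) : Tens := fun k l =>
  symbolOne (D.halfDensOp L) z.1 z.2 v k l
    - 1 / (2 * Complex.I) * ((∑ j, dX j (dXi j D.Gfun) z : ℝ) : ℂ) * v k l

/-- The subprincipal operator `S_sub(L) = σ_sub - i H_G` of a second order operator with
scalar principal symbol `G`, a first order differential operator on sections of the pull-back of the
bundle of `(0,2)`-tensors to phase space, in the frame `π^*(dx^k ⊗ dx^l)`. -/
def Ssub (L : (R4 → Tens) → R4 → Tens) (u : Phase → Tens) (z : Phase) : Tens := fun k l =>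
  D.subSymbol L z (u z) k l - Complex.I * D.ham (fun y => u y k l) z

/-! ### The trapped set -/

/-- The characteristic set over the extended spacetime, and its two parts `Σ^s`, `s = ±1`. -/
def Sig (s : ℝ) : Set Phase :=
  {z | z.1 ∈ D.M ∧ z.2 ≠ 0 ∧ D.Gfun z = 0 ∧ 0 < s * D.G z.1 dtForm z.2}

/-- The dual coordinate `ξ_t`, which is the same in the coordinates with and without star. -/
def xiT (z : Phase) : ℝ := dot z.2 dtVec

/-- The dual coordinate `ξ_φ`, which is the same in the coordinates with and without star. -/
def xiPhi (z : Phase) : ℝ := dot z.2 (dphiVec z.1)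

/-- The Boyer–Lindquist dual coordinate `ξ_r = ξ(∂_r)`, in the region `μ ≠ 0`. As
`t_* = t - Φ(r)` and `φ_* = φ - Ψ(r)` with `Φ' = b (r² + a²) f / μ` and `Ψ' = b a f / μ`, the
Boyer–Lindquist `∂_r` is `∂_r - Φ' ∂_{t_*} - Ψ' ∂_{φ_*}` in the coordinates with star. -/
def xiR (z : Phase) : ℝ :=
  dot z.2 (drVec z.1)
    - D.b * (rad z.1 ^ 2 + D.a ^ 2) / D.mu (rad z.1) * D.f (rad z.1) * xiT z
    - D.b * D.a / D.mu (rad z.1) * D.f (rad z.1) * xiPhi z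

/-- The function `((r² + a²) ξ_t + a ξ_φ)² / μ(r)`. -/
def radialPot (xt xphi r : ℝ) : ℝ := ((r ^ 2 + D.a ^ 2) * xt + D.a * xphi) ^ 2 / D.mu r

/-- The two parts `Γ^s`, `s = ±1`, of the trapped set: `(ξ_t, ξ_φ) ≠ (0, 0)`, `ξ_r = 0` and
`r` minimizes `((r² + a²) ξ_t + a ξ_φ)² / μ(r)` between the event and the cosmological horizon. -/
def Gam (s : ℝ) : Set Phase :=
  {z | z ∈ D.Sig s ∧ (xiT z, xiPhi z) ≠ (0, 0) ∧ rad z.1 ∈ Set.Ioo D.rEvent D.rCosmo ∧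
    D.xiR z = 0 ∧
    IsMinOn (D.radialPot (xiT z) (xiPhi z)) (Set.Ioo D.rEvent D.rCosmo) (rad z.1)}

/-! ### Stationarity and fiber inner products -/

/-- The frequency `σ = -ξ(T)` dual to the Killing field `T = ∂_{t_*} + (a / (r₀² + a²)) ∂_{φ_*}`. -/
def sigma (z : Phase) : ℝ := -(xiT z + D.a / (D.r0 ^ 2 + D.a ^ 2) * xiPhi z)

/-- The differential of the time `s` flow of `T`: the rotation by the angle `s a / (r₀² + a²)`
around the `z`-axis. -/
def rot (s : ℝ) : Matrix (Fin 4) (Fin 4) ℝ :=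
  let w := s * (D.a / (D.r0 ^ 2 + D.a ^ 2))
  !![1, 0, 0, 0; 0, Real.cos w, -Real.sin w, 0; 0, Real.sin w, Real.cos w, 0; 0, 0, 0, 1]

/-- The lift to phase space of the time `s` flow of `T`, which is `p ↦ R p + s ∂_{t_*}` with the
rotation `R` of `rot`; it acts on covectors by `R` too, as `R` is orthogonal. -/
def flow (s : ℝ) (z : Phase) : Phase :=
  ((D.rot s).mulVec z.1 + s • dtVec, (D.rot s).mulVec z.2)

/-- The action of the time `s` flow of `T` on `(0,2)`-tensors. -/
def flowTens (s : ℝ) (u : Tens) : Tens := fun i j =>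
  ∑ k, ∑ l, (D.rot s i k : ℂ) * (D.rot s j l : ℂ) * u k l

end Data

/-- The components of a real bilinear form on the fibers `π^*(T^*M ⊗ T^*M)`, of which only the
restriction to symmetric tensors is used. -/
abbrev FiberForm : Type := Phase → Fin 4 → Fin 4 → Fin 4 → Fin 4 → ℝ

/-- The sesquilinear extension, antilinear in the first argument, of a real form on the fibers. -/
def pairing (C : FiberForm) (z : Phase) (u v : Tens) : ℂ :=
  ∑ i, ∑ j, ∑ k, ∑ l, (C z i j k l : ℂ) * (starRingEnd ℂ) (u i j) * v k l

/-- Symmetric `(0,2)`-tensors. -/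
def IsSymTens {R : Type*} (u : Fin 4 → Fin 4 → R) : Prop := ∀ i j, u i j = u j i

/-- `C` is a smooth positive definite inner product on the bundle `π^* S²T^*M` over the set `U`. -/
structure IsFiberInner (U : Set Phase) (C : FiberForm) : Prop where
  smooth : ContDiffOn ℝ ∞ C U
  symm : ∀ z ∈ U, ∀ i j k l, C z i j k l = C z k l i j
  pos : ∀ z ∈ U, ∀ u : Fin 4 → Fin 4 → ℝ, IsSymTens u → u ≠ 0 →
    0 < ∑ i, ∑ j, ∑ k, ∑ l, C z i j k l * u i j * u k l

/-- `C` is stationary over `U`: both are invariant under the flow of the Killing field `T`. -/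
def IsStationary (D : Data) (U : Set Phase) (C : FiberForm) : Prop :=
  ∀ z ∈ U, ∀ s : ℝ, D.flow s z ∈ U ∧ ∀ u v : Tens, IsSymTens u → IsSymTens v →
    pairing C (D.flow s z) (D.flowTens s u) (D.flowTens s v) = pairing C z u v

/-- Smooth sections of the complexification of `π^* S²T^*M` with compact support in `U`. -/
structure IsTestSection (U : Set Phase) (u : Phase → Tens) : Prop where
  smooth : ContDiff ℝ ∞ u
  compact : HasCompactSupport u
  supp : tsupport u ⊆ U
  symm : ∀ z, IsSymTens (u z)

/-- `S'` is the formal adjoint of `S` over the open set `U`, with respect to the fiber inner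
product `C` and the symplectic volume `dx dξ`. As `S' v` is continuous, it is determined by this. -/
def IsFormalAdjoint (U : Set Phase) (C : FiberForm)
    (S S' : (Phase → Tens) → Phase → Tens) : Prop :=
  ∀ v, IsTestSection U v → ContinuousOn (S' v) U ∧ (∀ z ∈ U, IsSymTens (S' v z)) ∧
    ∀ u, IsTestSection U u →
      ∫ z, pairing C z (S u z) (v z) = ∫ z, pairing C z (u z) (S' v z)

end KdS

end

noncomputable section

namespace KdS

open Matrix

/-- Real `4 × 4` matrices. -/
abbrev Mat4 : Type := Matrix (Fin 4) (Fin 4) ℝ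

/-! ### An invariant quadratic form on symmetric tensors -/

/-- The value `u(X, Y)` of a `(0,2)`-tensor on two vectors. -/
def bl (u : Mat4) (X Y : R4) : ℝ := X ⬝ᵥ u *ᵥ Y

/-- The part of the dual metric on the complement of the span of `Z` and `Y`. -/
def screen (G : Mat4) (Z Y : R4) (n : ℝ) : Mat4 :=
  G - vecMulVec Z Y - vecMulVec Y Z + n • vecMulVec Z Z

def fA (G : Mat4) (Z Y : R4) (u : Mat4) : ℝ := bl u Z Y - trace (G * u) / 2

def fChi (ν : ℝ) (G : Mat4) (Z Y : R4) (n : ℝ) (u : Mat4) : ℝ :=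
  ν * (2 * fA G Z Y u - n * bl u Z Z) - trace (G * u) / 2

def fS (ν : ℝ) (G : Mat4) (Z Y : R4) (n : ℝ) (u : Mat4) : ℝ :=
  bl u (Y - n • Z) (Y - n • Z) - n * fChi ν G Z Y n u

/-- The bilinear form on symmetric tensors from which the fiber inner product is built. -/
def Phi (ν δ K : ℝ) (G : Mat4) (Z Y : R4) (n : ℝ) (u v : Mat4) : ℝ :=
  trace (screen G Z Y n * u * screen G Z Y n * v)
    + fChi ν G Z Y n u * trace (screen G Z Y n * v) + fChi ν G Z Y n v * trace (screen G Z Y n * u)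
    + 2 * fChi ν G Z Y n u * fChi ν G Z Y n v
    + δ ^ 2 * bl (screen G Z Y n) (u *ᵥ (Y - n • Z)) (v *ᵥ (Y - n • Z))
    + δ ^ 4 * fS ν G Z Y n u * fS ν G Z Y n v
    + bl (screen G Z Y n) (u *ᵥ Z) (v *ᵥ Z)
    + K * bl u Z Z * bl v Z Z + fA G Z Y u * fA G Z Y v

section Linear

variable (ν δ K : ℝ) (G : Mat4) (Z Y : R4) (n : ℝ)

theorem bl_add (u v : Mat4) (X Y : R4) : bl (u + v) X Y = bl u X Y + bl v X Y := by
  simp [bl, add_mulVec]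

theorem bl_smul (c : ℝ) (u : Mat4) (X Y : R4) : bl (c • u) X Y = c * bl u X Y := by
  simp [bl, smul_mulVec]

theorem bl_add_left (u : Mat4) (X X' Y : R4) : bl u (X + X') Y = bl u X Y + bl u X' Y := by
  simp [bl]

theorem bl_add_right (u : Mat4) (X Y Y' : R4) : bl u X (Y + Y') = bl u X Y + bl u X Y' := by
  simp [bl, mulVec_add]

theorem bl_sub_left (u : Mat4) (X X' Y : R4) : bl u (X - X') Y = bl u X Y - bl u X' Y := by
  simp [bl]

theorem bl_sub_right (u : Mat4) (X Y Y' : R4) : bl u X (Y - Y') = bl u X Y - bl u X Y' := by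
  simp [bl, mulVec_sub]

theorem bl_smul_left (c : ℝ) (u : Mat4) (X Y : R4) : bl u (c • X) Y = c * bl u X Y := by
  simp [bl]

theorem bl_smul_right (c : ℝ) (u : Mat4) (X Y : R4) : bl u X (c • Y) = c * bl u X Y := by
  simp [bl, mulVec_smul]

theorem bl_comm {u : Mat4} (hu : u.IsSymm) (X Y : R4) : bl u X Y = bl u Y X := by
  rw [bl, dotProduct_mulVec, ← mulVec_transpose, hu, dotProduct_comm, bl]

theorem bl_eq_sum (u : Mat4) (X Y : R4) : bl u X Y = ∑ i, ∑ j, u i j * X i * Y j := by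
  simp only [bl, dotProduct, mulVec, Finset.mul_sum]
  exact Finset.sum_congr rfl fun i _ => Finset.sum_congr rfl fun j _ => by ring

theorem fA_add (u v : Mat4) : fA G Z Y (u + v) = fA G Z Y u + fA G Z Y v := by
  simp only [fA, bl_add, mul_add, trace_add]; ring

theorem fA_smul (c : ℝ) (u : Mat4) : fA G Z Y (c • u) = c * fA G Z Y u := by
  simp only [fA, bl_smul, Matrix.mul_smul, trace_smul, smul_eq_mul]; ring

theorem fChi_add (u v : Mat4) :
    fChi ν G Z Y n (u + v) = fChi ν G Z Y n u + fChi ν G Z Y n v := by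
  simp only [fChi, fA_add, bl_add, mul_add, trace_add]; ring

theorem fChi_smul (c : ℝ) (u : Mat4) : fChi ν G Z Y n (c • u) = c * fChi ν G Z Y n u := by
  simp only [fChi, fA_smul, bl_smul, Matrix.mul_smul, trace_smul, smul_eq_mul]; ring

theorem fS_add (u v : Mat4) : fS ν G Z Y n (u + v) = fS ν G Z Y n u + fS ν G Z Y n v := by
  simp only [fS, fChi_add, bl_add]; ring

theorem fS_smul (c : ℝ) (u : Mat4) : fS ν G Z Y n (c • u) = c * fS ν G Z Y n u := by
  simp only [fS, fChi_smul, bl_smul]; ring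

theorem Phi_add_left (u u' v : Mat4) :
    Phi ν δ K G Z Y n (u + u') v = Phi ν δ K G Z Y n u v + Phi ν δ K G Z Y n u' v := by
  simp only [Phi, fA_add, fChi_add, fS_add, bl_add, mul_add, add_mul, trace_add, add_mulVec,
    bl_add_left]
  ring

theorem Phi_smul_left (c : ℝ) (u v : Mat4) :
    Phi ν δ K G Z Y n (c • u) v = c * Phi ν δ K G Z Y n u v := by
  simp only [Phi, fA_smul, fChi_smul, fS_smul, bl_smul, Matrix.mul_smul, Matrix.smul_mul,
    trace_smul,
    smul_mulVec, bl_smul_left, smul_eq_mul]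
  ring

theorem Phi_add_right (u v v' : Mat4) :
    Phi ν δ K G Z Y n u (v + v') = Phi ν δ K G Z Y n u v + Phi ν δ K G Z Y n u v' := by
  simp only [Phi, fA_add, fChi_add, fS_add, bl_add, mul_add, trace_add, add_mulVec,
    bl_add_right]
  ring

theorem Phi_smul_right (c : ℝ) (u v : Mat4) :
    Phi ν δ K G Z Y n u (c • v) = c * Phi ν δ K G Z Y n u v := by
  simp only [Phi, fA_smul, fChi_smul, fS_smul, bl_smul, Matrix.mul_smul, trace_smul,
    smul_mulVec, bl_smul_right, smul_eq_mul]
  ring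

theorem screen_isSymm (hG : G.IsSymm) : (screen G Z Y n).IsSymm := by
  ext i j
  have := hG.apply i j
  simp [screen, vecMulVec_apply]
  rw [this]; ring

theorem Phi_comm (hG : G.IsSymm) (u v : Mat4) : Phi ν δ K G Z Y n u v = Phi ν δ K G Z Y n v u := by
  have hP := screen_isSymm G Z Y n hG
  have h1 : trace (screen G Z Y n * u * screen G Z Y n * v)
      = trace (screen G Z Y n * v * screen G Z Y n * u) := by
    rw [Matrix.mul_assoc, trace_mul_comm, ← Matrix.mul_assoc]
  simp only [Phi, h1, bl_comm hP (u *ᵥ _)]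
  ring

theorem bl_conj (R u : Mat4) (X Y : R4) : bl (Rᵀ * u * R) X Y = bl u (R *ᵥ X) (R *ᵥ Y) := by
  rw [bl, bl, ← mulVec_mulVec, ← mulVec_mulVec, dotProduct_mulVec, ← mulVec_transpose,
    transpose_transpose]

theorem trace_conj (R G u : Mat4) : trace (G * (Rᵀ * u * R)) = trace (R * G * Rᵀ * u) := by
  rw [← Matrix.mul_assoc, trace_mul_comm]
  simp only [Matrix.mul_assoc]

theorem screen_conj (R : Mat4) :
    screen (R * G * Rᵀ) (R *ᵥ Z) (R *ᵥ Y) n = R * screen G Z Y n * Rᵀ := by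
  have h : ∀ X X' : R4, vecMulVec (R *ᵥ X) (R *ᵥ X') = R * vecMulVec X X' * Rᵀ := by
    intro X X'
    rw [mul_vecMulVec, vecMulVec_mul, vecMul_transpose]
  simp only [screen, h, Matrix.mul_add, Matrix.mul_sub, Matrix.add_mul, Matrix.sub_mul,
    Matrix.mul_smul, Matrix.smul_mul]

/-- The form is natural under linear changes of coordinates. -/
theorem Phi_conj (R u v : Mat4) :
    Phi ν δ K G Z Y n (Rᵀ * u * R) (Rᵀ * v * R)
      = Phi ν δ K (R * G * Rᵀ) (R *ᵥ Z) (R *ᵥ Y) n u v := by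
  have hA : ∀ w : Mat4, fA G Z Y (Rᵀ * w * R) = fA (R * G * Rᵀ) (R *ᵥ Z) (R *ᵥ Y) w := by
    intro w; rw [fA, fA, bl_conj, trace_conj]
  have hC : ∀ w : Mat4, fChi ν G Z Y n (Rᵀ * w * R)
      = fChi ν (R * G * Rᵀ) (R *ᵥ Z) (R *ᵥ Y) n w := by
    intro w; rw [fChi, fChi, bl_conj, trace_conj, hA]
  have hY : R *ᵥ (Y - n • Z) = R *ᵥ Y - n • R *ᵥ Z := by rw [mulVec_sub, mulVec_smul]
  have hS : ∀ w : Mat4, fS ν G Z Y n (Rᵀ * w * R)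
      = fS ν (R * G * Rᵀ) (R *ᵥ Z) (R *ᵥ Y) n w := by
    intro w; rw [fS, fS, bl_conj, hC, hY]
  have hB : ∀ X : R4, ∀ Q : Mat4, bl Q ((Rᵀ * u * R) *ᵥ X) ((Rᵀ * v * R) *ᵥ X)
      = bl (R * Q * Rᵀ) (u *ᵥ (R *ᵥ X)) (v *ᵥ (R *ᵥ X)) := by
    intro X Q
    have := bl_conj Rᵀ Q (u *ᵥ (R *ᵥ X)) (v *ᵥ (R *ᵥ X))
    rw [transpose_transpose] at this
    rw [this]
    simp only [mulVec_mulVec, Matrix.mul_assoc]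
  have hT : ∀ Q : Mat4, trace (Q * (Rᵀ * u * R) * Q * (Rᵀ * v * R))
      = trace ((R * Q * Rᵀ) * u * (R * Q * Rᵀ) * v) := by
    intro Q
    rw [trace_conj]
    simp only [Matrix.mul_assoc]
  simp only [Phi, hA, hC, hS, hB, hT, bl_conj, trace_conj, screen_conj, hY]

end Linear

/-! ### Variation of the form, and its components in a null frame -/

theorem hasDerivAt_bl {Q : ℝ → Mat4} {X Y : ℝ → R4} {Q' : Mat4} {X' Y' : R4} {t : ℝ}
    (hQ : ∀ i j, HasDerivAt (fun t => Q t i j) (Q' i j) t)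
    (hX : ∀ i, HasDerivAt (fun t => X t i) (X' i) t)
    (hY : ∀ i, HasDerivAt (fun t => Y t i) (Y' i) t) :
    HasDerivAt (fun t => bl (Q t) (X t) (Y t))
      (bl Q' (X t) (Y t) + bl (Q t) X' (Y t) + bl (Q t) (X t) Y') t := by
  simp only [bl_eq_sum]
  refine (HasDerivAt.fun_sum fun i _ => HasDerivAt.fun_sum fun j _ =>
    ((hQ i j).fun_mul (hX i)).fun_mul (hY j)).congr_deriv ?_
  simp only [← Finset.sum_add_distrib]
  exact Finset.sum_congr rfl fun i _ => Finset.sum_congr rfl fun j _ => by ring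

theorem hasDerivAt_trace_mul {Q : ℝ → Mat4} {Q' : Mat4} {t : ℝ}
    (hQ : ∀ i j, HasDerivAt (fun t => Q t i j) (Q' i j) t) (u : Mat4) :
    HasDerivAt (fun t => trace (Q t * u)) (trace (Q' * u)) t := by
  simp only [trace, diag, mul_apply]
  exact HasDerivAt.fun_sum fun i _ => HasDerivAt.fun_sum fun j _ => (hQ i j).mul_const _

theorem hasDerivAt_trace_mul_mul {Q : ℝ → Mat4} {Q' : Mat4} {t : ℝ}
    (hQ : ∀ i j, HasDerivAt (fun t => Q t i j) (Q' i j) t) (u : Mat4) :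
    HasDerivAt (fun t => trace (Q t * u * Q t * u)) (2 * trace (Q' * u * Q t * u)) t := by
  have h1 : trace (Q t * u * Q' * u) = trace (Q' * u * Q t * u) := by
    rw [Matrix.mul_assoc, trace_mul_comm, ← Matrix.mul_assoc]
  have h2 : 2 * trace (Q' * u * Q t * u)
      = trace (Q' * u * Q t * u) + trace (Q t * u * Q' * u) := by rw [h1]; ring
  rw [h2]
  have hu : ∀ i j, HasDerivAt (fun t => (Q t * u) i j) ((Q' * u) i j) t := by
    intro i j
    simp only [mul_apply]
    exact HasDerivAt.fun_sum fun k _ => (hQ i k).mul_const _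
  have : HasDerivAt (fun t => ∑ i, ∑ j, (Q t * u) i j * (Q t * u) j i)
      (∑ i, ∑ j, ((Q' * u) i j * (Q t * u) j i + (Q t * u) i j * (Q' * u) j i)) t :=
    HasDerivAt.fun_sum fun i _ => HasDerivAt.fun_sum fun j _ => (hu i j).mul (hu j i)
  refine (this.congr_deriv ?_).congr_of_eventuallyEq (Filter.Eventually.of_forall fun t => ?_)
  · simp only [Matrix.mul_assoc, trace, diag, Finset.sum_add_distrib]
    simp only [← Matrix.mul_assoc]
    congr 1 <;> refine Finset.sum_congr rfl fun i _ => ?_ <;>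
      rw [Matrix.mul_assoc (_ * u), mul_apply]
  · simp only [trace, diag]
    refine Finset.sum_congr rfl fun i _ => ?_
    rw [Matrix.mul_assoc (_ * u), mul_apply]

/-- The variation of the form when only `Y` and `n` vary. -/
theorem hasDerivAt_Phi {ν δ K : ℝ} {G : ℝ → Mat4} {Z Y : ℝ → R4} {n : ℝ → ℝ} {Y' : R4} {n' t : ℝ}
    (hGs : (G t).IsSymm)
    (hG : ∀ i j, HasDerivAt (fun t => G t i j) 0 t) (hZ : ∀ i, HasDerivAt (fun t => Z t i) 0 t)
    (hY : ∀ i, HasDerivAt (fun t => Y t i) (Y' i) t) (hn : HasDerivAt n n' t) (u : Mat4)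
    (hu : u.IsSymm) :
    let P := screen (G t) (Z t) (Y t) (n t)
    let P' := n' • vecMulVec (Z t) (Z t) - vecMulVec (Z t) Y' - vecMulVec Y' (Z t)
    let χ := fChi ν (G t) (Z t) (Y t) (n t) u
    let χ' := ν * (2 * bl u (Z t) Y' - n' * bl u (Z t) (Z t))
    let X := Y t - n t • Z t
    let X' := Y' - n' • Z t
    HasDerivAt (fun t => Phi ν δ K (G t) (Z t) (Y t) (n t) u u)
      (2 * trace (P' * u * P * u) + 2 * (χ' * trace (P * u) + χ * trace (P' * u)) + 4 * χ * χ'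
        + δ ^ 2 * (bl P' (u *ᵥ X) (u *ᵥ X) + 2 * bl P (u *ᵥ X') (u *ᵥ X))
        + 2 * δ ^ 4 * fS ν (G t) (Z t) (Y t) (n t) u * (2 * bl u X' X - n' * χ - n t * χ')
        + bl P' (u *ᵥ Z t) (u *ᵥ Z t) + 2 * fA (G t) (Z t) (Y t) u * bl u (Z t) Y') t := by
  intro P P' χ χ' X X'
  have hu0 : ∀ i j, HasDerivAt (fun _ : ℝ => u i j) ((0 : Mat4) i j) t :=
    fun i j => hasDerivAt_const _ _
  have hP : ∀ i j, HasDerivAt (fun t => screen (G t) (Z t) (Y t) (n t) i j) (P' i j) t := by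
    intro i j
    simp only [screen, Matrix.add_apply, Matrix.sub_apply, Matrix.smul_apply, vecMulVec_apply,
      smul_eq_mul]
    refine ((((hG i j).sub ((hZ i).mul (hY j))).sub ((hY i).mul (hZ j))).add
      (hn.mul ((hZ i).fun_mul (hZ j)))).congr_deriv ?_
    simp only [P', Matrix.sub_apply, Matrix.smul_apply, vecMulVec_apply, smul_eq_mul]
    ring
  have hX : ∀ i, HasDerivAt (fun t => (Y t - n t • Z t) i) (X' i) t := by
    intro i
    simp only [Pi.sub_apply, Pi.smul_apply, smul_eq_mul]
    refine ((hY i).sub (hn.mul (hZ i))).congr_deriv ?_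
    simp only [X', Pi.sub_apply, Pi.smul_apply, smul_eq_mul]
    ring
  have hmul : ∀ {V : ℝ → R4} {V' : R4}, (∀ i, HasDerivAt (fun t => V t i) (V' i) t) →
      ∀ i, HasDerivAt (fun t => (u *ᵥ V t) i) ((u *ᵥ V') i) t := by
    intro V V' hV i
    simp only [mulVec, dotProduct]
    exact HasDerivAt.fun_sum fun j _ => (hV j).const_mul _
  have hZ0 : ∀ i, HasDerivAt (fun t => Z t i) ((0 : R4) i) t := hZ
  have hτ : HasDerivAt (fun t => trace (G t * u)) 0 t := by
    refine (hasDerivAt_trace_mul (Q' := 0) hG u).congr_deriv ?_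
    simp
  have h0 : ∀ (Q : Mat4) (X : R4), bl Q 0 X = 0 := by intro Q X; simp [bl]
  have h0r : ∀ (Q : Mat4) (X : R4), bl Q X 0 = 0 := by intro Q X; simp [bl]
  have h0l : ∀ (X X' : R4), bl 0 X X' = 0 := by intro Q X; simp [bl]
  have ha0 : HasDerivAt (fun t => bl u (Z t) (Z t)) 0 t := by
    refine (hasDerivAt_bl hu0 hZ0 hZ0).congr_deriv ?_
    simp [h0, h0r, h0l]
  have hA : HasDerivAt (fun t => fA (G t) (Z t) (Y t) u) (bl u (Z t) Y') t := by
    refine ((hasDerivAt_bl hu0 hZ0 hY).sub (hτ.div_const 2)).congr_deriv ?_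
    simp [h0, h0l]
  have hχ : HasDerivAt (fun t => fChi ν (G t) (Z t) (Y t) (n t) u) χ' t := by
    refine ((((hA.const_mul 2).sub (hn.mul ha0)).const_mul ν).sub (hτ.div_const 2)).congr_deriv ?_
    simp only [χ']; ring
  have hS : HasDerivAt (fun t => fS ν (G t) (Z t) (Y t) (n t) u)
      (2 * bl u X' X - n' * χ - n t * χ') t := by
    refine ((hasDerivAt_bl hu0 hX hX).sub (hn.mul hχ)).congr_deriv ?_
    rw [h0l, bl_comm hu (Y t - n t • Z t) X']
    ring
  have hPs := screen_isSymm (G t) (Z t) (Y t) (n t) hGs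
  have hq : HasDerivAt (fun t => bl (screen (G t) (Z t) (Y t) (n t)) (u *ᵥ (Y t - n t • Z t))
      (u *ᵥ (Y t - n t • Z t))) (bl P' (u *ᵥ X) (u *ᵥ X) + 2 * bl P (u *ᵥ X') (u *ᵥ X)) t := by
    refine (hasDerivAt_bl hP (hmul hX) (hmul hX)).congr_deriv ?_
    rw [bl_comm hPs (u *ᵥ (Y t - n t • Z t))]
    ring
  have hp : HasDerivAt (fun t => bl (screen (G t) (Z t) (Y t) (n t)) (u *ᵥ Z t) (u *ᵥ Z t))
      (bl P' (u *ᵥ Z t) (u *ᵥ Z t)) t := by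
    refine (hasDerivAt_bl hP (hmul hZ0) (hmul hZ0)).congr_deriv ?_
    simp [h0, h0r]
  have hT := hasDerivAt_trace_mul hP u
  have hTT := hasDerivAt_trace_mul_mul hP u
  refine ((((((((hTT.add (hχ.mul hT)).add (hχ.mul hT)).add ((hχ.const_mul 2).mul hχ)).add
    (hq.const_mul (δ ^ 2))).add ((hS.const_mul (δ ^ 4)).mul hS)).add hp).add
    ((ha0.const_mul K).mul ha0)).add (hA.mul hA)).congr_deriv ?_
  simp only [P, χ]
  ring

/-- A null frame: the dual metric in terms of `Z`, `Y` and two further vectors. -/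
def IsNullFrame (G : Mat4) (Z Y : R4) (n : ℝ) (e f : R4) : Prop :=
  G = vecMulVec Z Y + vecMulVec Y Z - n • vecMulVec Z Z + vecMulVec e e + vecMulVec f f

theorem trace_vecMulVec_mul (X Y : R4) (u : Mat4) : trace (vecMulVec X Y * u) = bl u Y X := by
  rw [vecMulVec_mul, trace_vecMulVec, bl, dotProduct_mulVec, dotProduct_comm]

theorem bl_vecMulVec (A B X Y : R4) : bl (vecMulVec A B) X Y = (X ⬝ᵥ A) * (B ⬝ᵥ Y) := by
  rw [bl, vecMulVec_mulVec, op_smul_eq_smul, dotProduct_smul, smul_eq_mul, mul_comm]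

theorem trace_vecMulVec_mul_mul (X Y X' Y' : R4) (u v : Mat4) :
    trace (vecMulVec X Y * u * vecMulVec X' Y' * v) = bl u Y X' * bl v Y' X := by
  rw [Matrix.mul_assoc, vecMulVec_mul X, vecMulVec_mul X', vecMulVec_mul_vecMulVec, trace_vecMulVec]
  simp only [bl, dotProduct_mulVec, dotProduct_smul, smul_eq_mul]
  rw [dotProduct_comm X]

section Frame

variable {G : Mat4} {Z Y e f : R4} {n : ℝ}

theorem IsNullFrame.screen_eq (h : IsNullFrame G Z Y n e f) :
    screen G Z Y n = vecMulVec e e + vecMulVec f f := by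
  rw [screen, h]; abel

theorem IsNullFrame.trace_mul (h : IsNullFrame G Z Y n e f) {u : Mat4} (hu : u.IsSymm) :
    trace (G * u) = 2 * bl u Z Y - n * bl u Z Z + bl u e e + bl u f f := by
  rw [h]
  simp only [Matrix.add_mul, Matrix.sub_mul, Matrix.smul_mul, trace_add, trace_sub, trace_smul,
    trace_vecMulVec_mul, smul_eq_mul, bl_comm hu Y Z]
  ring

theorem mulVec_dotProduct_eq {u : Mat4} (hu : u.IsSymm) (X Y : R4) : (u *ᵥ X) ⬝ᵥ Y = bl u X Y := by
  rw [bl_comm hu, bl, dotProduct_comm]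

theorem dotProduct_mulVec_eq {u : Mat4} (hu : u.IsSymm) (X Y : R4) : Y ⬝ᵥ (u *ᵥ X) = bl u X Y := by
  rw [bl_comm hu, bl]

/-- The form in terms of the components in a null frame. -/
theorem IsNullFrame.Phi_eq (h : IsNullFrame G Z Y n e f) {u v : Mat4} (hu : u.IsSymm)
    (hv : v.IsSymm) (ν δ K : ℝ) :
    Phi ν δ K G Z Y n u v
      = (bl u e e + fChi ν G Z Y n u) * (bl v e e + fChi ν G Z Y n v) + 2 * bl u e f * bl v e f
        + (bl u f f + fChi ν G Z Y n u) * (bl v f f + fChi ν G Z Y n v)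
        + δ ^ 2 * (bl u (Y - n • Z) e * bl v (Y - n • Z) e
          + bl u (Y - n • Z) f * bl v (Y - n • Z) f)
        + δ ^ 4 * fS ν G Z Y n u * fS ν G Z Y n v + (bl u Z e * bl v Z e + bl u Z f * bl v Z f)
        + K * bl u Z Z * bl v Z Z + fA G Z Y u * fA G Z Y v := by
  rw [Phi, h.screen_eq]
  simp only [Matrix.add_mul, Matrix.mul_add, trace_add, trace_vecMulVec_mul,
    trace_vecMulVec_mul_mul, bl_add, bl_vecMulVec, mulVec_dotProduct_eq hu, dotProduct_mulVec_eq hv,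
    bl_comm hu f e, bl_comm hv f e]
  ring

/-- The variation of the form in terms of the components in a null frame. -/
theorem IsNullFrame.variation_eq (h : IsNullFrame G Z Y n e f) {u : Mat4} (hu : u.IsSymm)
    (ν δ y₀ y₁ y₂ : ℝ) :
    let Y' := y₀ • Z + y₁ • e + y₂ • f
    let n' := 2 * y₀
    let P := screen G Z Y n
    let P' := n' • vecMulVec Z Z - vecMulVec Z Y' - vecMulVec Y' Z
    let χ := fChi ν G Z Y n u
    let χ' := ν * (2 * bl u Z Y' - n' * bl u Z Z)
    let X := Y - n • Z
    let X' := Y' - n' • Z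
    let p₁ := bl u Z e
    let p₂ := bl u Z f
    let a₀ := bl u Z Z
    let a₁ := fA G Z Y u
    let m := ν * (2 * a₁ - n * a₀) + a₁ - n * a₀
    let q₁ := bl u X e
    let q₂ := bl u X f
    let w₁ := bl u e e + χ
    let w₂ := bl u f f + χ
    let w := bl u e f
    2 * trace (P' * u * P * u) + 2 * (χ' * trace (P * u) + χ * trace (P' * u)) + 4 * χ * χ'
        + δ ^ 2 * (bl P' (u *ᵥ X) (u *ᵥ X) + 2 * bl P (u *ᵥ X') (u *ᵥ X))
        + 2 * δ ^ 4 * fS ν G Z Y n u * (2 * bl u X' X - n' * χ - n * χ')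
        + bl P' (u *ᵥ Z) (u *ᵥ Z) + 2 * fA G Z Y u * bl u Z Y'
      = 2 * (w₁ * (-2 * y₁ * p₁ + 2 * ν * (y₁ * p₁ + y₂ * p₂)) + 2 * w * (-y₁ * p₂ - y₂ * p₁)
        + w₂ * (-2 * y₂ * p₂ + 2 * ν * (y₁ * p₁ + y₂ * p₂))
        + δ ^ 2 * (q₁ * (-y₀ * p₁ + y₁ * w₁ + y₂ * w - y₁ * m)
          + q₂ * (-y₀ * p₂ + y₁ * w + y₂ * w₂ - y₂ * m))
        + δ ^ 4 * fS ν G Z Y n u * (2 * (y₁ * q₁ + y₂ * q₂) - 2 * y₀ * m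
          - 2 * n * ν * (y₁ * p₁ + y₂ * p₂))
        + (p₁ * (-y₁ * a₀) + p₂ * (-y₂ * a₀)) + a₁ * (y₀ * a₀ + y₁ * p₁ + y₂ * p₂)) := by
  intro Y' n' P P' χ χ' X X' p₁ p₂ a₀ a₁ m q₁ q₂ w₁ w₂ w
  have hP : P = vecMulVec e e + vecMulVec f f := h.screen_eq
  have hZY : bl u Z Y = a₁ + trace (G * u) / 2 := by simp only [a₁, fA]; ring
  have hχ : χ = ν * (2 * a₁ - n * a₀) - trace (G * u) / 2 := rfl
  have hP' : P' = -(y₁ • (vecMulVec Z e + vecMulVec e Z)) - y₂ • (vecMulVec Z f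
    + vecMulVec f Z) := by
    ext i j
    simp only [P', Y', n', vecMulVec_apply, Matrix.sub_apply, Matrix.smul_apply,
      Matrix.neg_apply, Matrix.add_apply,
      Pi.add_apply, Pi.smul_apply, smul_eq_mul]
    ring
  have hX' : X' = y₁ • e + y₂ • f - y₀ • Z := by
    funext i
    simp only [X', Y', n', Pi.sub_apply, Pi.add_apply, Pi.smul_apply, smul_eq_mul]
    ring
  have hq₁ : q₁ = bl u Y e - n * p₁ := by simp only [q₁, X, bl_sub_left, bl_smul_left, p₁]
  have hq₂ : q₂ = bl u Y f - n * p₂ := by simp only [q₂, X, bl_sub_left, bl_smul_left, p₂]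
  have e1 : bl u e Z = p₁ := bl_comm hu _ _
  have e2 : bl u f Z = p₂ := bl_comm hu _ _
  have e3 : bl u f e = w := bl_comm hu _ _
  have e4 : bl u e X = q₁ := bl_comm hu _ _
  have e5 : bl u f X = q₂ := bl_comm hu _ _
  have e6 : bl u X Z = a₁ + trace (G * u) / 2 - n * a₀ := by
    rw [← hZY]; simp only [X, bl_sub_left, bl_smul_left, bl_comm hu Y Z, a₀]
  have e7 : bl u Z X = a₁ + trace (G * u) / 2 - n * a₀ := by rw [bl_comm hu, e6]
  rw [hP, hP']
  simp only [Matrix.add_mul, Matrix.mul_add, Matrix.smul_mul,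
    trace_add, trace_smul, trace_vecMulVec_mul, sub_eq_add_neg, ← neg_smul,
    trace_vecMulVec_mul_mul, bl_add, bl_smul, bl_vecMulVec, mulVec_dotProduct_eq hu,
    dotProduct_mulVec_eq hu, smul_eq_mul, mulVec_add, mulVec_smul, add_dotProduct, smul_dotProduct,
    hX']
  simp only [bl_add_left, bl_smul_left, Y', χ', n', bl_add_right, bl_smul_right]
  simp only [e1, e2, e3, e4, e5, e6, e7, ← sub_eq_add_neg]
  change _ + 2 * (_ * (_ + _) + _) + _ + δ ^ 2 * _ + _ + _ + 2 * a₁ * _ = _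
  have w1 : bl u e e = w₁ - χ := by simp only [w₁]; ring
  have w2 : bl u f f = w₂ - χ := by simp only [w₂]; ring
  have r1 : bl u Z Z = a₀ := rfl
  have r2 : bl u Z e = p₁ := rfl
  have r3 : bl u Z f = p₂ := rfl
  have r4 : bl u e f = w := rfl
  have r5 : bl u X e = q₁ := rfl
  have r6 : bl u X f = q₂ := rfl
  simp only [w1, w2, r1, r2, r3, r4, r5, r6]
  have hm : m = ν * (2 * a₁ - n * a₀) + a₁ - n * a₀ := rfl
  clear_value w₁ w₂ w q₁ q₂ p₁ p₂ a₀ a₁ χ m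
  rw [hm, hχ]
  ring

end Frame

/-! ### The basic estimate in a null frame -/

theorem mul_le_of_abs_le {x y A B : ℝ} (hx : |x| ≤ A) (hy : |y| ≤ B) : |x * y| ≤ A * B := by
  rw [abs_mul]; exact mul_le_mul hx hy (abs_nonneg _) ((abs_nonneg _).trans hx)

theorem variation_bound {N y n b ρ δ w₁ w w₂ Q₁ Q₂ T p₁ p₂ a₀ a₁ y₀ y₁ y₂ ν : ℝ}
    (hδ : 0 ≤ δ) (hδ1 : δ ≤ 1) (hN : 0 ≤ N)
    (hν : |ν| ≤ 1) (hn : |n| ≤ N) (hy₀ : |y₀| ≤ y) (hy₁ : |y₁| ≤ y) (hy₂ : |y₂| ≤ y)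
    (hw₁ : |w₁| ≤ b) (hw : |w| ≤ b) (hw₂ : |w₂| ≤ b) (hQ₁ : |Q₁| ≤ b) (hQ₂ : |Q₂| ≤ b)
    (hT : |T| ≤ b) (hp₁ : |p₁| ≤ ρ) (hp₂ : |p₂| ≤ ρ) (ha₀ : |a₀| ≤ ρ) (ha₁ : |a₁| ≤ ρ) :
    let m := ν * (2 * a₁ - n * a₀) + a₁ - n * a₀
    |w₁ * (-2 * y₁ * p₁ + 2 * ν * (y₁ * p₁ + y₂ * p₂)) + 2 * w * (-y₁ * p₂ - y₂ * p₁)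
        + w₂ * (-2 * y₂ * p₂ + 2 * ν * (y₁ * p₁ + y₂ * p₂))
        + δ * (Q₁ * (-y₀ * p₁ + y₁ * w₁ + y₂ * w - y₁ * m)
          + Q₂ * (-y₀ * p₂ + y₁ * w + y₂ * w₂ - y₂ * m))
        + δ * T * (2 * (y₁ * Q₁ + y₂ * Q₂) + δ * (- 2 * y₀ * m - 2 * n * ν * (y₁ * p₁ + y₂ * p₂)))
        + (p₁ * (-y₁ * a₀) + p₂ * (-y₂ * a₀)) + a₁ * (y₀ * a₀ + y₁ * p₁ + y₂ * p₂)|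
      ≤ 8 * δ * y * b ^ 2 + (30 + 12 * N) * y * b * ρ + 5 * y * ρ ^ 2 := by
  intro m
  have hy : 0 ≤ y := (abs_nonneg _).trans hy₀
  have hb : 0 ≤ b := (abs_nonneg _).trans hw
  have hρ : 0 ≤ ρ := (abs_nonneg _).trans hp₁
  have A : ∀ x z : ℝ, |x + z| ≤ |x| + |z| := fun x z => abs_add_le x z
  have S : ∀ x z : ℝ, |x - z| ≤ |x| + |z| := fun x z => abs_sub x z
  have hm : |m| ≤ (3 + 2 * N) * ρ := by
    have h1 := mul_le_of_abs_le hn ha₀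
    have h2 : |2 * a₁ - n * a₀| ≤ (2 + N) * ρ := by
      have := S (2 * a₁) (n * a₀)
      rw [abs_mul 2, abs_two] at this
      linarith
    have h3 := mul_le_of_abs_le hν h2
    have h4 := S (ν * (2 * a₁ - n * a₀) + a₁) (n * a₀)
    have h5 := A (ν * (2 * a₁ - n * a₀)) a₁
    simp only [m]; linarith
  have yp : ∀ {r q : ℝ}, |r| ≤ y → |q| ≤ ρ → |r * q| ≤ y * ρ := fun h h' => mul_le_of_abs_le h h'
  have d1 : |y₁ * p₁ + y₂ * p₂| ≤ 2 * (y * ρ) := by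
    linarith [A (y₁ * p₁) (y₂ * p₂), yp hy₁ hp₁, yp hy₂ hp₂]
  have d2 : |ν * (y₁ * p₁ + y₂ * p₂)| ≤ 1 * (2 * (y * ρ)) := mul_le_of_abs_le hν d1
  have two : ∀ x : ℝ, |2 * x| = 2 * |x| := fun x => by rw [abs_mul, abs_two]
  have t1 : |w₁ * (-2 * y₁ * p₁ + 2 * ν * (y₁ * p₁ + y₂ * p₂))| ≤ b * (6 * (y * ρ)) := by
    refine mul_le_of_abs_le hw₁ ?_
    have : -2 * y₁ * p₁ + 2 * ν * (y₁ * p₁ + y₂ * p₂)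
      = 2 * (ν * (y₁ * p₁ + y₂ * p₂)) - 2 * (y₁ * p₁) := by ring
    rw [this]
    linarith [S (2 * (ν * (y₁ * p₁ + y₂ * p₂))) (2 * (y₁ * p₁)), two (ν * (y₁ * p₁ + y₂ * p₂)),
      two (y₁ * p₁), yp hy₁ hp₁]
  have t3 : |w₂ * (-2 * y₂ * p₂ + 2 * ν * (y₁ * p₁ + y₂ * p₂))| ≤ b * (6 * (y * ρ)) := by
    refine mul_le_of_abs_le hw₂ ?_
    have : -2 * y₂ * p₂ + 2 * ν * (y₁ * p₁ + y₂ * p₂)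
      = 2 * (ν * (y₁ * p₁ + y₂ * p₂)) - 2 * (y₂ * p₂) := by ring
    rw [this]
    linarith [S (2 * (ν * (y₁ * p₁ + y₂ * p₂))) (2 * (y₂ * p₂)), two (ν * (y₁ * p₁ + y₂ * p₂)),
      two (y₂ * p₂), yp hy₂ hp₂]
  have t2 : |2 * w * (-y₁ * p₂ - y₂ * p₁)| ≤ b * (4 * (y * ρ)) := by
    have : 2 * w * (-y₁ * p₂ - y₂ * p₁) = w * -(2 * (y₁ * p₂ + y₂ * p₁)) := by ring
    rw [this]
    refine mul_le_of_abs_le hw ?_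
    rw [abs_neg, two]
    linarith [A (y₁ * p₂) (y₂ * p₁), yp hy₁ hp₂, yp hy₂ hp₁]
  have q1 : ∀ {Q r p v v' : ℝ}, |Q| ≤ b → |r| ≤ y → |p| ≤ ρ → |v| ≤ b → |v'| ≤ b →
      |Q * (-y₀ * p + y₁ * v + y₂ * v' - r * m)| ≤ b * (2 * (y * b) + (4 + 2 * N) * (y * ρ)) := by
    intro Q r p v v' hQ hr hp hv hv'
    refine mul_le_of_abs_le hQ ?_
    have h1 := mul_le_of_abs_le hy₁ hv
    have h2 := mul_le_of_abs_le hy₂ hv'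
    have h3 := mul_le_of_abs_le hr hm
    have h4 := yp hy₀ hp
    have e : -y₀ * p + y₁ * v + y₂ * v' - r * m = (y₁ * v + y₂ * v') - (y₀ * p + r * m) := by ring
    rw [e]
    linarith [S (y₁ * v + y₂ * v') (y₀ * p + r * m), A (y₁ * v) (y₂ * v'), A (y₀ * p) (r * m)]
  have q1' := q1 hQ₁ hy₁ hp₁ hw₁ hw
  have q2' := q1 hQ₂ hy₂ hp₂ hw hw₂
  have t4 : |δ * (Q₁ * (-y₀ * p₁ + y₁ * w₁ + y₂ * w - y₁ * m)
          + Q₂ * (-y₀ * p₂ + y₁ * w + y₂ * w₂ - y₂ * m))|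
      ≤ δ * (2 * (b * (2 * (y * b) + (4 + 2 * N) * (y * ρ)))) := by
    refine mul_le_of_abs_le (abs_of_nonneg hδ).le ?_
    linarith [A (Q₁ * (-y₀ * p₁ + y₁ * w₁ + y₂ * w - y₁ * m))
      (Q₂ * (-y₀ * p₂ + y₁ * w + y₂ * w₂ - y₂ * m))]
  have t5 : |δ * T * (2 * (y₁ * Q₁ + y₂ * Q₂)
      + δ * (- 2 * y₀ * m - 2 * n * ν * (y₁ * p₁ + y₂ * p₂)))|
      ≤ δ * b * (4 * (y * b) + δ * ((6 + 8 * N) * (y * ρ))) := by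
    refine mul_le_of_abs_le (mul_le_of_abs_le (abs_of_nonneg hδ).le hT) ?_
    have h1 := mul_le_of_abs_le hy₁ hQ₁
    have h2 := mul_le_of_abs_le hy₂ hQ₂
    have h3 := mul_le_of_abs_le hy₀ hm
    have h4 := mul_le_of_abs_le hn d2
    have h5 : |- 2 * y₀ * m - 2 * n * ν * (y₁ * p₁ + y₂ * p₂)| ≤ (6 + 8 * N) * (y * ρ) := by
      have e : - 2 * y₀ * m - 2 * n * ν * (y₁ * p₁ + y₂ * p₂)
        = -(2 * (y₀ * m + n * (ν * (y₁ * p₁ + y₂ * p₂)))) := by ring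
      rw [e, abs_neg, two]
      linarith [A (y₀ * m) (n * (ν * (y₁ * p₁ + y₂ * p₂)))]
    have h6 := mul_le_of_abs_le (abs_of_nonneg hδ).le h5
    linarith [A (2 * (y₁ * Q₁ + y₂ * Q₂)) (δ * (- 2 * y₀ * m - 2 * n * ν * (y₁ * p₁ + y₂ * p₂))),
      two (y₁ * Q₁ + y₂ * Q₂), A (y₁ * Q₁) (y₂ * Q₂)]
  have t6 : |p₁ * (-y₁ * a₀) + p₂ * (-y₂ * a₀)| ≤ 2 * (ρ * (y * ρ)) := by
    have h1 := mul_le_of_abs_le hp₁ (yp (r := -y₁) (by rwa [abs_neg]) ha₀)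
    have h2 := mul_le_of_abs_le hp₂ (yp (r := -y₂) (by rwa [abs_neg]) ha₀)
    linarith [A (p₁ * (-y₁ * a₀)) (p₂ * (-y₂ * a₀))]
  have t7 : |a₁ * (y₀ * a₀ + y₁ * p₁ + y₂ * p₂)| ≤ ρ * (3 * (y * ρ)) := by
    refine mul_le_of_abs_le ha₁ ?_
    linarith [A (y₀ * a₀ + y₁ * p₁) (y₂ * p₂), A (y₀ * a₀) (y₁ * p₁), yp hy₀ ha₀, yp hy₁ hp₁,
      yp hy₂ hp₂]
  refine (A _ _).trans ((add_le_add_left ((A _ _).trans (add_le_add_left ((A _ _).trans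
    (add_le_add_left ((A _ _).trans (add_le_add_left ((A _ _).trans (add_le_add_left
    (A _ _) _)) _)) _)) _)) _).trans ?_)
  have hδ2 : δ * δ ≤ 1 := by nlinarith
  have r1 : δ * (b * y * ρ * (4 + 2 * N)) ≤ 1 * (b * y * ρ * (4 + 2 * N)) :=
    mul_le_mul_of_nonneg_right hδ1 (by positivity)
  have r2 : δ * δ * (b * y * ρ * (6 + 8 * N)) ≤ 1 * (b * y * ρ * (6 + 8 * N)) :=
    mul_le_mul_of_nonneg_right hδ2 (by positivity)
  linarith [t1, t2, t3, t4, t5, t6, t7, r1, r2]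

theorem damping_combine {ε y M c δ s σ α h b ρ V R : ℝ} (hε : 0 < ε) (hy : 0 ≤ y)
    (hc : 0 < c) (hδy : 16 * (δ * y) ≤ ε) (hs : |s| = 1) (hσ : 0 < σ) (hα : s * α ≤ -(c * σ))
    (hh : 0 < h) (hh0 : h < c / (M ^ 2 / ε + 10 * y + 1))
    (hVm : |V| ≤ σ * (8 * (δ * y) * b ^ 2 + M * (b * ρ) + 5 * y * ρ ^ 2)) (hRρ : ρ ^ 2 / 4 ≤ R) :
    s * (2 * V + 2 * (2 / h * α * R)) ≤ 2 * ε * σ * b ^ 2 := by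
  have hsV : s * V ≤ |V| := by
    have := le_abs_self (s * V); rwa [abs_mul, hs, one_mul] at this
  have hcross : M * (b * ρ) ≤ ε / 2 * b ^ 2 + M ^ 2 / (2 * ε) * ρ ^ 2 := by
    have : ε / 2 * b ^ 2 + M ^ 2 / (2 * ε) * ρ ^ 2 - M * (b * ρ)
      = (ε * b - M * ρ) ^ 2 / (2 * ε) := by
      field_simp; ring
    have h2 : 0 ≤ (ε * b - M * ρ) ^ 2 / (2 * ε) := by positivity
    linarith
  have hdamp : s * (2 * (2 / h * α * R)) ≤ -(c / h * σ * ρ ^ 2) := by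
    have h1 : s * (2 * (2 / h * α * R)) = 4 / h * R * (s * α) := by ring
    have hR0 : 0 ≤ R := (by positivity : (0:ℝ) ≤ ρ ^ 2 / 4).trans hRρ
    have h2 : 4 / h * R * (s * α) ≤ 4 / h * R * (-(c * σ)) :=
      mul_le_mul_of_nonneg_left hα (by positivity)
    have h3 : 4 / h * (c * σ) * (ρ ^ 2 / 4) ≤ 4 / h * (c * σ) * R :=
      mul_le_mul_of_nonneg_left hRρ (by positivity)
    rw [h1]
    refine h2.trans ?_
    have : 4 / h * (c * σ) * (ρ ^ 2 / 4) = c / h * σ * ρ ^ 2 := by ring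
    linarith
  have hch : M ^ 2 / ε + 10 * y ≤ c / h := by
    rw [le_div_iff₀ hh]
    have h1 := (lt_div_iff₀ (by positivity)).1 hh0
    nlinarith
  have hch' : σ * ρ ^ 2 * (M ^ 2 / ε + 10 * y) ≤ σ * ρ ^ 2 * (c / h) :=
    mul_le_mul_of_nonneg_left hch (by positivity)
  have hδb : σ * b ^ 2 * (16 * (δ * y)) ≤ σ * b ^ 2 * ε :=
    mul_le_mul_of_nonneg_left hδy (by positivity)
  have hcr' := mul_le_mul_of_nonneg_left hcross hσ.le
  have hM2 : M ^ 2 / (2 * ε) = M ^ 2 / ε / 2 := by field_simp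
  rw [hM2] at hcr'
  rw [mul_add]
  linarith [hsV, hVm, hdamp, hch', hδb, hcr']

/-- The scalar inequality behind the theorem: `w`, `q`, `S` are the components annihilated by the
damping term, whose contribution `h⁻¹ α (⋯)` controls the remaining components. -/
theorem exists_damping_constants (ε y N c : ℝ) (hε : 0 < ε) (hy : 0 ≤ y) (hN : 0 ≤ N) (hc : 0 < c) :
    ∃ δ > 0, ∃ K > 0, ∃ h₀ > 0, ∀ (s σ α h e ν n y₀ y₁ y₂ w₁ w w₂ q₁ q₂ S p₁ p₂ a₀ a₁ : ℝ),
      |s| = 1 → 0 < σ → s * α ≤ -(c * σ) → 0 < h → h < h₀ → 0 < e → e < 1 / 8 →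
      |ν| ≤ 1 → |n| ≤ N → |y₀| ≤ y * σ → |y₁| ≤ y * σ → |y₂| ≤ y * σ →
      let m := ν * (2 * a₁ - n * a₀) + a₁ - n * a₀
      s * (2 * (w₁ * (-2 * y₁ * p₁ + 2 * ν * (y₁ * p₁ + y₂ * p₂)) + 2 * w * (-y₁ * p₂ - y₂ * p₁)
          + w₂ * (-2 * y₂ * p₂ + 2 * ν * (y₁ * p₁ + y₂ * p₂))
          + δ ^ 2 * (q₁ * (-y₀ * p₁ + y₁ * w₁ + y₂ * w - y₁ * m)
            + q₂ * (-y₀ * p₂ + y₁ * w + y₂ * w₂ - y₂ * m))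
          + δ ^ 4 * S * (2 * (y₁ * q₁ + y₂ * q₂) - 2 * y₀ * m
            - 2 * n * ν * (y₁ * p₁ + y₂ * p₂))
          + (p₁ * (-y₁ * a₀) + p₂ * (-y₂ * a₀)) + a₁ * (y₀ * a₀ + y₁ * p₁ + y₂ * p₂))
        + 2 * (2 / h * α * ((p₁ ^ 2 + p₂ ^ 2) / 2 + K * a₀ ^ 2
          + a₁ * ((1 / 2 - e) * a₁ + n * a₀ / 2))))
      ≤ 2 * ε * σ * (w₁ ^ 2 + 2 * w ^ 2 + w₂ ^ 2 + δ ^ 2 * (q₁ ^ 2 + q₂ ^ 2) + δ ^ 4 * S ^ 2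
        + (p₁ ^ 2 + p₂ ^ 2) + K * a₀ ^ 2 + a₁ ^ 2) := by
  set M : ℝ := (30 + 12 * N) * y with hM
  have hM0 : 0 ≤ M := by positivity
  refine ⟨ε / (16 * y + ε), by positivity, N ^ 2 + 1, by positivity,
    c / (M ^ 2 / ε + 10 * y + 1), by positivity, ?_⟩
  intro s σ α h e ν n y₀ y₁ y₂ w₁ w w₂ q₁ q₂ S p₁ p₂ a₀ a₁ hs hσ hα hh hh0 he he8 hν hn hy₀ hy₁
    hy₂ m
  set δ := ε / (16 * y + ε) with hδd
  have hδ : 0 < δ := by positivity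
  have hδ1 : δ ≤ 1 := by rw [hδd, div_le_one (by positivity)]; linarith
  have hδy : 16 * (δ * y) ≤ ε := by
    rw [hδd, div_mul_eq_mul_div, ← mul_div_assoc, div_le_iff₀ (by positivity)]; nlinarith [hε, hy]
  set b := Real.sqrt (w₁ ^ 2 + 2 * w ^ 2 + w₂ ^ 2 + δ ^ 2 * (q₁ ^ 2 + q₂ ^ 2)
    + δ ^ 4 * S ^ 2) with hb
  set ρ := Real.sqrt (p₁ ^ 2 + p₂ ^ 2 + a₀ ^ 2 + a₁ ^ 2) with hρ
  have hb2 : b ^ 2 = w₁ ^ 2 + 2 * w ^ 2 + w₂ ^ 2 + δ ^ 2 * (q₁ ^ 2 + q₂ ^ 2) + δ ^ 4 * S ^ 2 :=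
    Real.sq_sqrt (by positivity)
  have hρ2 : ρ ^ 2 = p₁ ^ 2 + p₂ ^ 2 + a₀ ^ 2 + a₁ ^ 2 := Real.sq_sqrt (by positivity)
  have hbb : ∀ x : ℝ, x ^ 2 ≤ b ^ 2 → |x| ≤ b :=
    fun x hx => abs_le_of_sq_le_sq hx (Real.sqrt_nonneg _)
  have hρρ : ∀ x : ℝ, x ^ 2 ≤ ρ ^ 2 → |x| ≤ ρ :=
    fun x hx => abs_le_of_sq_le_sq hx (Real.sqrt_nonneg _)
  have hbe : b ^ 2 = w₁ ^ 2 + 2 * w ^ 2 + w₂ ^ 2 + (δ * q₁) ^ 2 + (δ * q₂) ^ 2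
    + (δ ^ 2 * S) ^ 2 := by
    rw [hb2]; ring
  have s1 := sq_nonneg w₁
  have s2 := sq_nonneg w
  have s3 := sq_nonneg w₂
  have s4 := sq_nonneg (δ * q₁)
  have s5 := sq_nonneg (δ * q₂)
  have s6 := sq_nonneg (δ ^ 2 * S)
  have s7 := sq_nonneg p₁
  have s8 := sq_nonneg p₂
  have s9 := sq_nonneg a₀
  have s0 := sq_nonneg a₁
  have main := variation_bound (N := N) (y := y * σ) (n := n) (b := b) (ρ := ρ) (δ := δ) (w₁ := w₁)
    (w := w) (w₂ := w₂) (Q₁ := δ * q₁) (Q₂ := δ * q₂) (T := δ ^ 2 * S) (p₁ := p₁) (p₂ := p₂)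
    (a₀ := a₀) (a₁ := a₁) (y₀ := y₀) (y₁ := y₁) (y₂ := y₂) (ν := ν) hδ.le hδ1 hN hν hn hy₀ hy₁ hy₂
    (hbb _ (by linarith)) (hbb _ (by linarith)) (hbb _ (by linarith)) (hbb _ (by linarith))
    (hbb _ (by linarith)) (hbb _ (by linarith)) (hρρ _ (by linarith)) (hρρ _ (by linarith))
    (hρρ _ (by linarith)) (hρρ _ (by linarith))
  simp only at main
  set V := w₁ * (-2 * y₁ * p₁ + 2 * ν * (y₁ * p₁ + y₂ * p₂)) + 2 * w * (-y₁ * p₂ - y₂ * p₁)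
          + w₂ * (-2 * y₂ * p₂ + 2 * ν * (y₁ * p₁ + y₂ * p₂))
          + δ ^ 2 * (q₁ * (-y₀ * p₁ + y₁ * w₁ + y₂ * w - y₁ * m)
            + q₂ * (-y₀ * p₂ + y₁ * w + y₂ * w₂ - y₂ * m))
          + δ ^ 4 * S * (2 * (y₁ * q₁ + y₂ * q₂) - 2 * y₀ * m
            - 2 * n * ν * (y₁ * p₁ + y₂ * p₂))
          + (p₁ * (-y₁ * a₀) + p₂ * (-y₂ * a₀)) + a₁ * (y₀ * a₀ + y₁ * p₁ + y₂ * p₂) with hV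
  have hVm : |V| ≤ σ * (8 * (δ * y) * b ^ 2 + M * (b * ρ) + 5 * y * ρ ^ 2) := by
    refine (le_of_eq (congrArg abs ?_)).trans (main.trans (le_of_eq ?_))
    · rw [hV]; simp only [m]; ring
    · rw [hM]; ring
  set R := (p₁ ^ 2 + p₂ ^ 2) / 2 + (N ^ 2 + 1) * a₀ ^ 2 + a₁ * ((1 / 2 - e) * a₁
    + n * a₀ / 2) with hR
  have hRρ : ρ ^ 2 / 4 ≤ R := by
    have hn2 : n ^ 2 ≤ N ^ 2 := sq_le_sq' (by linarith [abs_le.1 hn]) (abs_le.1 hn).2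
    have h1 : n ^ 2 * a₀ ^ 2 ≤ N ^ 2 * a₀ ^ 2 := mul_le_mul_of_nonneg_right hn2 (sq_nonneg _)
    rw [hρ2, hR]
    have h2 := sq_nonneg (a₁ + 2 * n * a₀)
    have h3 := mul_nonneg (by linarith : (0 : ℝ) ≤ 1 / 8 - e) s0
    have h4 := mul_nonneg (sq_nonneg N) s9
    linarith
  have hfin : s * (2 * V + 2 * (2 / h * α * R)) ≤ 2 * ε * σ * b ^ 2 :=
    damping_combine hε hy hc hδy hs hσ hα hh hh0 hVm hRρ
  refine hfin.trans ?_
  rw [hb2]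
  refine mul_le_mul_of_nonneg_left ?_ (by positivity)
  linarith [mul_nonneg (by positivity : (0:ℝ) ≤ N ^ 2 + 1) s9]

/-! ### Null frames and the damping term -/

/-- The trace reversal of a real tensor with respect to the metric `g` with dual metric `G`. -/
def trv (g G u : Mat4) : Mat4 := u - (trace (G * u) / 2) • g

/-- The tensor `𝒯 (𝔠 ⊗_s ω - e ω(c) g)` with `ω = (𝒯 u)(X, ·)` and `𝔠 = g(c, ·)`. -/
def dampM (e : ℝ) (g G : Mat4) (c X : R4) (u : Mat4) : Mat4 :=
  trv g G ((1 / 2 : ℝ) • (vecMulVec (g *ᵥ c) (trv g G u *ᵥ X) + vecMulVec (trv g G u *ᵥ X) (g *ᵥ c))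
    - (e * bl (trv g G u) c X) • g)

theorem trv_smul (g G : Mat4) (a : ℝ) (u : Mat4) : trv g G (a • u) = a • trv g G u := by
  simp only [trv, Matrix.mul_smul, trace_smul, smul_sub, smul_smul, smul_eq_mul]
  congr 2; ring

theorem trv_isSymm {g G u : Mat4} (hg : g.IsSymm) (hu : u.IsSymm) : (trv g G u).IsSymm :=
  hu.sub (hg.smul _)

theorem dampM_smul (e : ℝ) (g G : Mat4) (a b : ℝ) (c X : R4) (u : Mat4) :
    dampM e g G (a • c) (b • X) u = (a * b) • dampM e g G c X u := by
  rw [dampM, dampM, ← trv_smul]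
  congr 1
  ext i j
  simp only [mulVec_smul, bl_smul_left, bl_smul_right, Matrix.sub_apply, Matrix.smul_apply,
    Matrix.add_apply, vecMulVec_apply, Pi.smul_apply, smul_eq_mul]
  ring

theorem dampM_isSymm {e : ℝ} {g G u : Mat4} (hg : g.IsSymm) (c X : R4) :
    (dampM e g G c X u).IsSymm := by
  refine trv_isSymm hg (IsSymm.sub (IsSymm.smul ?_ _) (hg.smul _))
  rw [IsSymm, transpose_add, transpose_vecMulVec, transpose_vecMulVec, add_comm]

/-- A null frame together with the values of the metric on it. -/
structure NullFrame (g G : Mat4) (Z Y : R4) (n : ℝ) (e f : R4) : Prop where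
  symm : g.IsSymm
  dual : IsNullFrame G Z Y n e f
  inv : G * g = 1
  ZZ : bl g Z Z = 0
  ZY : bl g Z Y = 1
  YY : bl g Y Y = n
  Ze : bl g Z e = 0
  Zf : bl g Z f = 0
  Ye : bl g Y e = 0
  Yf : bl g Y f = 0
  ee : bl g e e = 1
  ff : bl g f f = 1
  ef : bl g e f = 0

theorem exists_orthogonal (a b c : R4) : ∃ X : R4,
    X ≠ 0 ∧ a ⬝ᵥ X = 0 ∧ b ⬝ᵥ X = 0 ∧ c ⬝ᵥ X = 0 := by
  have hdet : (Matrix.of ![a, b, c, 0] : Mat4).det = 0 :=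
    det_eq_zero_of_row_eq_zero 3 fun j => rfl
  obtain ⟨X, hX, h⟩ := exists_mulVec_eq_zero_iff.2 hdet
  exact ⟨X, hX, congrFun h 0, congrFun h 1, congrFun h 2⟩

theorem exists_nullFrame {g G : Mat4} {Z Y : R4} (hg : g.IsSymm) (hG : G * g = 1)
    (hZZ : bl g Z Z = 0) (hZY : bl g Z Y = 1)
    (hpos : ∀ X, X ≠ 0 → bl g Z X = 0 → bl g Y X = 0 → 0 < bl g X X) :
    ∃ e f, NullFrame g G Z Y (bl g Y Y) e f := by
  have hdot : ∀ A X : R4, (g *ᵥ A) ⬝ᵥ X = bl g A X := fun A X => mulVec_dotProduct_eq hg A X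
  have norm : ∀ X : R4, 0 < bl g X X →
      bl g ((Real.sqrt (bl g X X))⁻¹ • X) ((Real.sqrt (bl g X X))⁻¹ • X) = 1 := by
    intro X hX
    have := Real.mul_self_sqrt hX.le
    have h0 : Real.sqrt (bl g X X) ≠ 0 := (Real.sqrt_pos.2 hX).ne'
    rw [bl_smul_left, bl_smul_right]
    field_simp
    nlinarith
  obtain ⟨X, hX, h1, h2, -⟩ := exists_orthogonal (g *ᵥ Z) (g *ᵥ Y) 0
  rw [hdot] at h1 h2
  set e := (Real.sqrt (bl g X X))⁻¹ • X with he
  have hee : bl g e e = 1 := norm X (hpos X hX h1 h2)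
  have hZe : bl g Z e = 0 := by rw [he, bl_smul_right, h1, mul_zero]
  have hYe : bl g Y e = 0 := by rw [he, bl_smul_right, h2, mul_zero]
  obtain ⟨W, hW, h3, h4, h5⟩ := exists_orthogonal (g *ᵥ Z) (g *ᵥ Y) (g *ᵥ e)
  rw [hdot] at h3 h4 h5
  set f := (Real.sqrt (bl g W W))⁻¹ • W with hf
  have hff : bl g f f = 1 := norm W (hpos W hW h3 h4)
  have hZf : bl g Z f = 0 := by rw [hf, bl_smul_right, h3, mul_zero]
  have hYf : bl g Y f = 0 := by rw [hf, bl_smul_right, h4, mul_zero]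
  have hef : bl g e f = 0 := by rw [hf, bl_smul_right, h5, mul_zero]
  refine ⟨e, f, hg, ?_, hG, hZZ, hZY, rfl, hZe, hZf, hYe, hYf, hee, hff, hef⟩
  set n := bl g Y Y
  set M : Mat4 := Matrix.of ![Z, Y, e, f] with hM
  set J : Mat4 := !![-n, 1, 0, 0; 1, 0, 0, 0; 0, 0, 1, 0; 0, 0, 0, 1] with hJ
  have hgram : M * g * Mᵀ = !![0, 1, 0, 0; 1, n, 0, 0; 0, 0, 1, 0; 0, 0, 0, 1] := by
    have hb : ∀ i j, (M * g * Mᵀ) i j = bl g (M i) (M j) := by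
      intro i j
      rw [bl, Matrix.mul_assoc]
      simp only [mul_apply, mulVec, dotProduct, transpose_apply]
    ext i j
    rw [hb]
    have m0 : M 0 = Z := rfl
    have m1 : M 1 = Y := rfl
    have m2 : M 2 = e := rfl
    have m3 : M 3 = f := rfl
    fin_cases i <;> fin_cases j <;>
      simp [m0, m1, m2, m3, hZZ, hZY, hZe, hZf, hYe, hYf, hee, hff, hef, bl_comm hg Y Z,
        bl_comm hg e Z,
        bl_comm hg f Z, bl_comm hg e Y, bl_comm hg f Y, bl_comm hg f e, n]
  have h1 : J * M * g * Mᵀ = 1 := by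
    rw [Matrix.mul_assoc, Matrix.mul_assoc, ← Matrix.mul_assoc M, hgram, hJ]
    ext i j
    fin_cases i <;> fin_cases j <;> simp [mul_apply, Fin.sum_univ_four]
  have h2 : Mᵀ * (J * M) * g = 1 := by
    have := mul_eq_one_comm.1 h1
    rw [Matrix.mul_assoc, ← this]
  have h3 : G = Mᵀ * (J * M) := by
    have := mul_eq_one_comm.1 h2
    calc G = G * (g * (Mᵀ * (J * M))) := by rw [this, Matrix.mul_one]
      _ = _ := by rw [← Matrix.mul_assoc, hG, Matrix.one_mul]
  rw [IsNullFrame, h3]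
  ext i j
  simp only [mul_apply, Fin.sum_univ_four, transpose_apply, hM, hJ, Matrix.add_apply,
    Matrix.sub_apply, Matrix.smul_apply, vecMulVec_apply, smul_eq_mul]
  simp
  ring

namespace NullFrame

variable {g G : Mat4} {Z Y e f : R4} {n : ℝ}

theorem eq_zero_of_components (F : NullFrame g G Z Y n e f) {u : Mat4} (hu : u.IsSymm)
    (h1 : bl u Z Z = 0) (h2 : bl u Z Y = 0)
    (h3 : bl u Z e = 0) (h4 : bl u Z f = 0) (h5 : bl u Y Y = 0) (h6 : bl u Y e = 0)
    (h7 : bl u Y f = 0) (h8 : bl u e e = 0) (h9 : bl u e f = 0) (h0 : bl u f f = 0) : u = 0 := by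
  have hX : ∀ X : R4, ∃ a b c d : ℝ, X = a • Z + b • Y + c • e + d • f := by
    intro X
    have : X = G *ᵥ (g *ᵥ X) := by rw [mulVec_mulVec, F.inv, one_mulVec]
    set w := g *ᵥ X
    refine ⟨Y ⬝ᵥ w - n * (Z ⬝ᵥ w), Z ⬝ᵥ w, e ⬝ᵥ w, f ⬝ᵥ w, ?_⟩
    conv_lhs => rw [this, F.dual]
    simp only [add_mulVec, sub_mulVec, smul_mulVec, vecMulVec_mulVec, op_smul_eq_smul]
    module
  have key : ∀ X X' : R4, bl u X X' = 0 := by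
    intro X X'
    obtain ⟨a, b, c, d, rfl⟩ := hX X
    obtain ⟨a', b', c', d', rfl⟩ := hX X'
    simp only [bl_add_left, bl_add_right, bl_smul_left, bl_smul_right, h1, h2, h3, h4, h5, h6, h7,
      h8, h9, h0, bl_comm hu Y Z, bl_comm hu e Z, bl_comm hu f Z, bl_comm hu e Y, bl_comm hu f Y,
      bl_comm hu f e]
    ring
  ext i j
  have := key (Pi.single i 1) (Pi.single j 1)
  simpa [bl] using this

/-- The form is positive definite on symmetric tensors. -/
theorem Phi_pos (F : NullFrame g G Z Y n e f) {ν δ K : ℝ} (hδ : 0 < δ) (hK : 0 < K)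
    {u : Mat4} (hu : u.IsSymm) (hu0 : u ≠ 0) :
    0 < Phi ν δ K G Z Y n u u := by
  rw [F.dual.Phi_eq hu hu]
  set χ := fChi ν G Z Y n u with hχ
  set a₁ := fA G Z Y u with ha₁
  set S := fS ν G Z Y n u with hS
  by_contra hcon
  refine hu0 ?_
  have hδ2 : 0 < δ ^ 2 := by positivity
  have hδ4 : 0 < δ ^ 4 := by positivity
  have t1 := mul_self_nonneg (bl u e e + χ)
  have t2 := mul_self_nonneg (bl u e f)
  have t3 := mul_self_nonneg (bl u f f + χ)
  have t4 := mul_nonneg hδ2.le (mul_self_nonneg (bl u (Y - n • Z) e))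
  have t5 := mul_nonneg hδ2.le (mul_self_nonneg (bl u (Y - n • Z) f))
  have t6 := mul_nonneg hδ4.le (mul_self_nonneg S)
  have t7 := mul_self_nonneg (bl u Z e)
  have t8 := mul_self_nonneg (bl u Z f)
  have t9 := mul_nonneg hK.le (mul_self_nonneg (bl u Z Z))
  have t0 := mul_self_nonneg a₁
  have z1 : bl u e e + χ = 0 := mul_self_eq_zero.1 (by linarith)
  have z2 : bl u e f = 0 := mul_self_eq_zero.1 (by linarith)
  have z3 : bl u f f + χ = 0 := mul_self_eq_zero.1 (by linarith)
  have z4 : bl u (Y - n • Z) e = 0 :=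
    mul_self_eq_zero.1 ((mul_eq_zero.1 (by linarith : δ ^ 2 * _ = 0)).resolve_left hδ2.ne')
  have z5 : bl u (Y - n • Z) f = 0 :=
    mul_self_eq_zero.1 ((mul_eq_zero.1 (by linarith : δ ^ 2 * _ = 0)).resolve_left hδ2.ne')
  have z6 : S = 0 :=
    mul_self_eq_zero.1 ((mul_eq_zero.1 (by linarith : δ ^ 4 * _ = 0)).resolve_left hδ4.ne')
  have z7 : bl u Z e = 0 := mul_self_eq_zero.1 (by linarith)
  have z8 : bl u Z f = 0 := mul_self_eq_zero.1 (by linarith)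
  have z9 : bl u Z Z = 0 :=
    mul_self_eq_zero.1 ((mul_eq_zero.1 (by linarith : K * _ = 0)).resolve_left hK.ne')
  have z0 : a₁ = 0 := mul_self_eq_zero.1 (by linarith)
  have hτ := F.dual.trace_mul hu
  rw [ha₁, fA] at z0
  have hχ' : χ = - trace (G * u) / 2 := by
    rw [hχ, fChi, fA]; rw [z9]; linear_combination 2 * ν * z0
  have hτ0 : trace (G * u) = 0 := by rw [z9, mul_zero] at hτ; linarith
  have hχ0 : χ = 0 := by rw [hχ', hτ0]; simp
  have zb : bl u Z Y = 0 := by rw [hτ0] at z0; linarith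
  rw [hS, fS, ← hχ, hχ0, mul_zero, sub_zero] at z6
  simp only [bl_sub_left, bl_smul_left, bl_sub_right, bl_smul_right, bl_comm hu Y Z, z7, z8, z9,
    zb, mul_zero, sub_zero] at z4 z5 z6
  exact F.eq_zero_of_components hu z9 zb z7 z8 z6 z4 z5 (by linarith) z2 (by linarith)

/-- The quadratic form evaluated on the damping term. -/
theorem Phi_dampM (F : NullFrame g G Z Y n e f) {ν δ K ed : ℝ} (hν : ν * (1 - 2 * ed) = ed)
    {u : Mat4} (hu : u.IsSymm) :
    Phi ν δ K G Z Y n u (dampM ed g G Y Z u)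
      = (bl u Z e ^ 2 + bl u Z f ^ 2) / 2 + K * bl u Z Z ^ 2
        + fA G Z Y u * ((1 / 2 - ed) * fA G Z Y u + n * bl u Z Z / 2) := by
  set v := trv g G u with hv
  have hvs : v.IsSymm := trv_isSymm F.symm hu
  set θ : Mat4 := (1 / 2 : ℝ) • (vecMulVec (g *ᵥ Y) (v *ᵥ Z) + vecMulVec (v *ᵥ Z) (g *ᵥ Y))
    - (ed * bl v Y Z) • g with hθ
  have hθb : ∀ A B : R4, bl θ A B
      = (bl g Y A * bl v Z B + bl v Z A * bl g Y B) / 2 - ed * bl v Z Y * bl g A B := by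
    intro A B
    have e1 : ∀ X, (g *ᵥ Y) ⬝ᵥ X = bl g Y X := mulVec_dotProduct_eq F.symm Y
    have e2 : ∀ X, X ⬝ᵥ (g *ᵥ Y) = bl g Y X := dotProduct_mulVec_eq F.symm Y
    have e3 : ∀ X, (v *ᵥ Z) ⬝ᵥ X = bl v Z X := mulVec_dotProduct_eq hvs Z
    have e4 : ∀ X, X ⬝ᵥ (v *ᵥ Z) = bl v Z X := dotProduct_mulVec_eq hvs Z
    rw [hθ, sub_eq_add_neg, ← neg_smul, bl_add, bl_smul, bl_smul, bl_add, bl_vecMulVec,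
      bl_vecMulVec, e1, e2, e3, e4, bl_comm hvs Y Z]
    ring
  have hθs : θ.IsSymm := by
    refine IsSymm.sub (IsSymm.smul ?_ _) (F.symm.smul _)
    rw [IsSymm, transpose_add, transpose_vecMulVec, transpose_vecMulVec, add_comm]
  have hd : dampM ed g G Y Z u = θ + (-(trace (G * θ) / 2)) • g := by
    rw [dampM, trv, ← hv, ← hθ, neg_smul, sub_eq_add_neg]
  have hub : ∀ A B, bl (dampM ed g G Y Z u) A B = bl θ A B - trace (G * θ) / 2 * bl g A B := by
    intro A B; rw [hd, bl_add, bl_smul]; ring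
  have hvb : ∀ B, bl v Z B = bl u Z B - trace (G * u) / 2 * bl g Z B := by
    intro B; rw [hv, trv, sub_eq_add_neg, ← neg_smul, bl_add, bl_smul]; ring
  have hgYZ : bl g Y Z = 1 := by rw [bl_comm F.symm, F.ZY]
  set a₁ := fA G Z Y u with ha₁
  have va1 : bl v Z Y = a₁ := by rw [hvb, F.ZY, ha₁, fA]; ring
  have va0 : bl v Z Z = bl u Z Z := by rw [hvb, F.ZZ]; ring
  have vp1 : bl v Z e = bl u Z e := by rw [hvb, F.Ze]; ring
  have vp2 : bl v Z f = bl u Z f := by rw [hvb, F.Zf]; ring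
  have tθ : trace (G * θ) = (1 - 4 * ed) * a₁ := by
    rw [F.dual.trace_mul hθs]
    simp only [hθb, F.ZZ, F.ZY, F.YY, F.Ye, F.Yf, F.ee, F.ff, va0, va1, hgYZ]
    ring
  have tg : trace (G * g) = 4 := by rw [F.inv]; simp
  have td : trace (G * dampM ed g G Y Z u) = -((1 - 4 * ed) * a₁) := by
    rw [hd, Matrix.mul_add, trace_add, Matrix.mul_smul, trace_smul, tg, tθ, smul_eq_mul]; ring
  have k1 : bl (dampM ed g G Y Z u) Z Z = bl u Z Z := by
    rw [hub, hθb, tθ, F.ZZ, va0, hgYZ]; ring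
  have k2 : fA G Z Y (dampM ed g G Y Z u) = (1 / 2 - ed) * a₁ + n * bl u Z Z / 2 := by
    rw [fA, hub, hθb, td, tθ, F.ZY, va0, va1, hgYZ, F.YY]; ring
  have k3 : fChi ν G Z Y n (dampM ed g G Y Z u) = (1 / 2 - ed) * a₁ := by
    rw [fChi, k2, k1, td]; linear_combination a₁ * hν
  have k4 : bl (dampM ed g G Y Z u) Z e = bl u Z e / 2 := by
    rw [hub, hθb, tθ, F.Ze, F.Ye, hgYZ, vp1]; ring
  have k5 : bl (dampM ed g G Y Z u) Z f = bl u Z f / 2 := by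
    rw [hub, hθb, tθ, F.Zf, F.Yf, hgYZ, vp2]; ring
  have k6 : bl (dampM ed g G Y Z u) e e = -((1 / 2 - ed) * a₁) := by
    rw [hub, hθb, tθ, F.ee, F.Ye, va1]; ring
  have k7 : bl (dampM ed g G Y Z u) f f = -((1 / 2 - ed) * a₁) := by
    rw [hub, hθb, tθ, F.ff, F.Yf, va1]; ring
  have k8 : bl (dampM ed g G Y Z u) e f = 0 := by
    rw [hub, hθb, tθ, F.ef, F.Ye, F.Yf]; ring
  have k9 : bl (dampM ed g G Y Z u) (Y - n • Z) e = 0 := by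
    rw [bl_sub_left, bl_smul_left, k4, hub, hθb, tθ, F.Ye, F.YY, va1, vp1]; ring
  have k0 : bl (dampM ed g G Y Z u) (Y - n • Z) f = 0 := by
    rw [bl_sub_left, bl_smul_left, k5, hub, hθb, tθ, F.Yf, F.YY, va1, vp2]; ring
  have ks : fS ν G Z Y n (dampM ed g G Y Z u) = 0 := by
    have hds := dampM_isSymm (e := ed) (G := G) (u := u) F.symm Y Z
    rw [fS, k3]
    simp only [bl_sub_left, bl_smul_left, bl_sub_right, bl_smul_right, bl_comm hds Y Z, k1]
    simp only [hub, hθb, tθ, F.YY, F.ZY, hgYZ, va0, va1]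
    ring
  rw [F.dual.Phi_eq hu (dampM_isSymm F.symm _ _), k1, k2, k3, k4, k5, k6, k7, k8, k9, k0, ks]
  ring

end NullFrame

/-! ### The polynomial `μ` -/

theorem depressed_quartic_factor {A B C E x y z w : ℝ} (hxy : x < y) (hyz : y < z) (hzw : z < w)
    (hx : A * x ^ 4 + B * x ^ 2 + C * x + E = 0) (hy : A * y ^ 4 + B * y ^ 2 + C * y + E = 0)
    (hz : A * z ^ 4 + B * z ^ 2 + C * z + E = 0) (hw : A * w ^ 4 + B * w ^ 2 + C * w + E = 0)
    (hA : A ≠ 0) :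
    x + y + z + w = 0 ∧ C = -(A * (x * y * z + x * y * w + x * z * w + y * z * w)) ∧
      ∀ t, A * t ^ 4 + B * t ^ 2 + C * t + E = A * ((t - x) * (t - y) * (t - z) * (t - w)) := by
  have d1 : ∀ s t : ℝ, s < t → A * s ^ 4 + B * s ^ 2 + C * s + E = 0 →
      A * t ^ 4 + B * t ^ 2 + C * t + E = 0 →
      A * (s ^ 3 + s ^ 2 * t + s * t ^ 2 + t ^ 3) + B * (s + t) + C = 0 := by
    intro s t hst hs ht
    have : (t - s) * (A * (s ^ 3 + s ^ 2 * t + s * t ^ 2 + t ^ 3) + B * (s + t) + C) = 0 := by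
      linear_combination ht - hs
    exact (mul_eq_zero.1 this).resolve_left (sub_ne_zero.2 hst.ne')
  have exy := d1 x y hxy hx hy
  have exz := d1 x z (hxy.trans hyz) hx hz
  have exw := d1 x w (hxy.trans (hyz.trans hzw)) hx hw
  have f1 : A * (x ^ 2 + y ^ 2 + z ^ 2 + x * y + y * z + z * x) + B = 0 := by
    have : (z - y) * (A * (x ^ 2 + y ^ 2 + z ^ 2 + x * y + y * z + z * x) + B) = 0 := by
      linear_combination exz - exy
    exact (mul_eq_zero.1 this).resolve_left (sub_ne_zero.2 hyz.ne')
  have f2 : A * (x ^ 2 + y ^ 2 + w ^ 2 + x * y + y * w + w * x) + B = 0 := by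
    have : (w - y) * (A * (x ^ 2 + y ^ 2 + w ^ 2 + x * y + y * w + w * x) + B) = 0 := by
      linear_combination exw - exy
    exact (mul_eq_zero.1 this).resolve_left (sub_ne_zero.2 (hyz.trans hzw).ne')
  have hsum : x + y + z + w = 0 := by
    have : (w - z) * A * (x + y + z + w) = 0 := by linear_combination f2 - f1
    exact (mul_eq_zero.1 this).resolve_left (mul_ne_zero (sub_ne_zero.2 hzw.ne') hA)
  have hw' : w = -(x + y + z) := by linarith
  have hB : B = -(A * (x ^ 2 + y ^ 2 + z ^ 2 + x * y + y * z + z * x)) := by linarith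
  have hC : C = -(A * (x ^ 3 + x ^ 2 * y + x * y ^ 2 + y ^ 3) + B * (x + y)) := by linarith
  have hE : E = -(A * x ^ 4 + B * x ^ 2 + C * x) := by linarith
  refine ⟨hsum, ?_, fun t => ?_⟩
  · rw [hC, hB, hw']; ring
  · rw [hE, hC, hB, hw']; ring

namespace Data

variable {D : Data}

theorem Subextremal.factor (h : D.Subextremal) :
    D.rMinus + D.rCauchy + D.rEvent + D.rCosmo = 0 ∧
    -(2 * D.m) = D.Lam / 3 * (D.rMinus * D.rCauchy * D.rEvent + D.rMinus * D.rCauchy * D.rCosmo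
      + D.rMinus * D.rEvent * D.rCosmo + D.rCauchy * D.rEvent * D.rCosmo) ∧
    ∀ r, D.mu r = -(D.Lam / 3)
      * ((r - D.rMinus) * (r - D.rCauchy) * (r - D.rEvent) * (r - D.rCosmo)) := by
  have hL := h.Lam_pos
  have hmu : ∀ r, D.mu r = -(D.Lam / 3) * r ^ 4 + (1 - D.Lam * D.a ^ 2 / 3) * r ^ 2
      + (-(2 * D.m)) * r + D.a ^ 2 := by
    intro r; unfold mu; ring
  obtain ⟨h1, h2, h3⟩ := depressed_quartic_factor (A := -(D.Lam / 3)) h.rMinus_lt h.rCauchy_lt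
    h.rEvent_lt ((hmu _).symm.trans h.mu_rMinus) ((hmu _).symm.trans h.mu_rCauchy)
    ((hmu _).symm.trans h.mu_rEvent) ((hmu _).symm.trans h.mu_rCosmo)
    (neg_ne_zero.2 (by positivity))
  exact ⟨h1, by linarith, fun r => (hmu r).trans (h3 r)⟩

theorem Subextremal.rEvent_pos (h : D.Subextremal) : 0 < D.rEvent := by
  obtain ⟨h1, h2, -⟩ := h.factor
  have hL := h.Lam_pos
  have hm := h.m_pos
  by_contra hcon
  have hz : 0 ≤ -D.rEvent := by linarith
  have hy : 0 ≤ -D.rCauchy := by linarith [h.rCauchy_lt]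
  have hx : 0 ≤ -D.rMinus := by linarith [h.rMinus_lt]
  have hw : D.rCosmo = -D.rMinus + -D.rCauchy + -D.rEvent := by linarith
  set x := -D.rMinus
  set y := -D.rCauchy
  set z := -D.rEvent
  have ex : D.rMinus = -x := by simp [x]
  have ey : D.rCauchy = -y := by simp [y]
  have ez : D.rEvent = -z := by simp [z]
  rw [hw, ex, ey, ez] at h2
  have h3 : 0 ≤ (x + y + z) * (x * y + x * z + y * z) - x * y * z := by
    have : (x + y + z) * (x * y + x * z + y * z) - x * y * z
      = x * x * y + x * x * z + y * y * x + y * y * z + z * z * x + z * z * y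
        + 2 * (x * y * z) := by
      ring
    rw [this]; positivity
  have h4 : 0 ≤ D.Lam / 3 * ((x + y + z) * (x * y + x * z + y * z) - x * y * z) :=
    mul_nonneg (by positivity) h3
  linarith

theorem Subextremal.mu_pos (h : D.Subextremal) {r : ℝ} (hr : r ∈ Set.Ioo D.rEvent D.rCosmo) :
    0 < D.mu r := by
  have hL := h.Lam_pos
  have e : D.mu r = D.Lam / 3
      * ((r - D.rMinus) * (r - D.rCauchy) * (r - D.rEvent) * (D.rCosmo - r)) := by
    rw [h.factor.2.2 r]; ring
  have h1 := h.rMinus_lt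
  have h2 := h.rCauchy_lt
  rw [e]
  have t1 : 0 < r - D.rEvent := by linarith [hr.1]
  have t2 : 0 < D.rCosmo - r := by linarith [hr.2]
  have t3 : 0 < r - D.rCauchy := by linarith
  have t4 : 0 < r - D.rMinus := by linarith
  positivity

/-- The region between the event and the cosmological horizon. -/
def reg (D : Data) : Set R4 := {p | rad p ∈ Set.Ioo D.rEvent D.rCosmo}

theorem continuous_rad : Continuous rad := by unfold rad; fun_prop

theorem isOpen_reg : IsOpen D.reg := isOpen_Ioo.preimage continuous_rad

theorem Subextremal.reg_subset (h : D.Subextremal) : D.reg ⊆ D.M := by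
  intro p hp
  have := h.epsM_pos
  exact ⟨by linarith [hp.1], by linarith [hp.2]⟩

theorem Subextremal.rad_pos (h : D.Subextremal) {p : R4} (hp : p ∈ D.reg) : 0 < rad p :=
  h.rEvent_pos.trans hp.1

theorem Subextremal.b_pos (h : D.Subextremal) : 0 < D.b := by
  have := h.Lam_pos
  unfold b; positivity

theorem Subextremal.c_pos (h : D.Subextremal) (p : R4) : 0 < D.c p := by
  have := h.Lam_pos
  unfold c; positivity

theorem Subextremal.rhoSq_pos (h : D.Subextremal) {p : R4} (hp : p ∈ D.reg) : 0 < D.rhoSq p := by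
  have := h.rad_pos hp
  unfold rhoSq; positivity

theorem metric_isSymm (D : Data) (p : R4) : (D.metric p).IsSymm := by
  ext i j
  simp only [metric, transpose_apply, Matrix.of_apply, roundMetric]
  have : (i = j ∧ i ≠ 0) ↔ (j = i ∧ j ≠ 0) := by
    constructor <;> rintro ⟨rfl, h⟩ <;> exact ⟨rfl, h⟩
  simp only [this]
  ring

theorem Subextremal.det_ne_zero (h : D.Subextremal) {p : R4} (hp : p ∈ D.M) :
    (D.metric p).det ≠ 0 := by
  intro h0
  have := h.dt_timelike p hp
  rw [G, dual, nonsing_inv_apply_not_isUnit _ (by rw [h0]; exact not_isUnit_zero)] at this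
  simp at this

theorem Subextremal.dual_mul (h : D.Subextremal) {p : R4} (hp : p ∈ D.M) :
    D.dual p * D.metric p = 1 := nonsing_inv_mul _ (isUnit_iff_ne_zero.2 (h.det_ne_zero hp))

theorem Subextremal.mul_dual (h : D.Subextremal) {p : R4} (hp : p ∈ D.M) :
    D.metric p * D.dual p = 1 := mul_nonsing_inv _ (isUnit_iff_ne_zero.2 (h.det_ne_zero hp))

theorem dual_isSymm (D : Data) (p : R4) : (D.dual p).IsSymm := by
  rw [IsSymm, dual, transpose_nonsing_inv, D.metric_isSymm p]

/-! ### Smoothness -/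

theorem contDiffAt_coord (i : Fin 4) (p : R4) : ContDiffAt ℝ ∞ (fun y : R4 => y i) p := by
  fun_prop

theorem contDiffAt_rad {p : R4} (hp : 0 < rad p) : ContDiffAt ℝ ∞ rad p := by
  unfold rad
  refine ContDiffAt.sqrt (by fun_prop) ?_
  have := Real.sqrt_pos.1 hp
  exact this.ne'

theorem contDiffAt_cosTh {p : R4} (hp : 0 < rad p) : ContDiffAt ℝ ∞ cosTh p :=
  (contDiffAt_coord 3 p).div (contDiffAt_rad hp) hp.ne'

theorem contDiffAt_sinSq {p : R4} (hp : 0 < rad p) : ContDiffAt ℝ ∞ sinSq p :=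
  ContDiffAt.div (by fun_prop) ((contDiffAt_rad hp).pow 2) (pow_ne_zero 2 hp.ne')

theorem contDiffAt_drForm {p : R4} (hp : 0 < rad p) (i : Fin 4) :
    ContDiffAt ℝ ∞ (fun y => drForm y i) p := by
  have h := fun j => (contDiffAt_coord j p).div (contDiffAt_rad hp) hp.ne'
  fin_cases i
  · exact contDiffAt_const
  · exact h 1
  · exact h 2
  · exact h 3

theorem contDiffAt_rotForm {p : R4} (hp : 0 < rad p) (i : Fin 4) :
    ContDiffAt ℝ ∞ (fun y => rotForm y i) p := by
  have h2 := (contDiffAt_rad hp).pow 2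
  fin_cases i
  · exact contDiffAt_const
  · exact (contDiffAt_coord 2 p).neg.div h2 (pow_ne_zero 2 hp.ne')
  · exact (contDiffAt_coord 1 p).div h2 (pow_ne_zero 2 hp.ne')
  · exact contDiffAt_const

theorem contDiffAt_roundMetric {p : R4} (hp : 0 < rad p) (i j : Fin 4) :
    ContDiffAt ℝ ∞ (fun y => roundMetric y i j) p :=
  (contDiffAt_const.sub ((contDiffAt_drForm hp i).mul (contDiffAt_drForm hp j))).div
    ((contDiffAt_rad hp).pow 2) (pow_ne_zero 2 hp.ne')

theorem contDiff_mu (D : Data) : ContDiff ℝ ∞ D.mu := by unfold mu; fun_prop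

theorem Subextremal.contDiffAt_f (h : D.Subextremal) {r : ℝ}
    (hr : r ∈ Set.Ioo D.rEvent D.rCosmo) : ContDiffAt ℝ ∞ D.f r := by
  have := h.epsM_pos
  exact h.f_smooth.contDiffAt (isOpen_Ioo.mem_nhds ⟨by linarith [hr.1], by linarith [hr.2]⟩)

theorem Subextremal.contDiffAt_q (h : D.Subextremal) {r : ℝ}
    (hr : r ∈ Set.Ioo D.rEvent D.rCosmo) : ContDiffAt ℝ ∞ D.q r := by
  have h1 : ContDiffAt ℝ ∞ (fun x => (1 - D.f x ^ 2) / D.mu x) r :=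
    (contDiffAt_const.sub ((h.contDiffAt_f hr).pow 2)).div D.contDiff_mu.contDiffAt (h.mu_pos
      hr).ne'
  refine h1.congr_of_eventuallyEq ?_
  filter_upwards [isOpen_Ioo.mem_nhds hr] with x hx
  rw [q, if_neg (h.mu_pos hx).ne']

theorem Subextremal.contDiffAt_metric (h : D.Subextremal) {p : R4} (hp : p ∈ D.reg)
    (i j : Fin 4) : ContDiffAt ℝ ∞ (fun y => D.metric y i j) p := by
  have hr := h.rad_pos hp
  have cr := contDiffAt_rad hr
  have cc : ContDiffAt ℝ ∞ D.c p := contDiffAt_const.add (contDiffAt_const.mul ((contDiffAt_cosTh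
    hr).pow 2))
  have crho : ContDiffAt ℝ ∞ D.rhoSq p :=
    (cr.pow 2).add (contDiffAt_const.mul ((contDiffAt_cosTh hr).pow 2))
  have cs := contDiffAt_sinSq hr
  have cmu : ContDiffAt ℝ ∞ (fun y => D.mu (rad y)) p := D.contDiff_mu.contDiffAt.comp p cr
  have cf : ContDiffAt ℝ ∞ (fun y => D.f (rad y)) p := (h.contDiffAt_f hp).comp p cr
  have cq : ContDiffAt ℝ ∞ (fun y => D.q (rad y)) p := (h.contDiffAt_q hp).comp p cr
  have cdr := contDiffAt_drForm hr
  have crot := contDiffAt_rotForm hr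
  have ctau : ∀ i, ContDiffAt ℝ ∞ (fun y => D.tauForm y i) p :=
    fun i => contDiffAt_const.sub (contDiffAt_const.mul (crot i))
  have crd := contDiffAt_roundMetric hr i j
  have k : ∀ x : ℝ, ContDiffAt ℝ ∞ (fun _ : R4 => x) p := fun x => contDiffAt_const
  have hc := (h.c_pos p).ne'
  have hrho := (h.rhoSq_pos hp).ne'
  have hb : D.b ^ 2 ≠ 0 := pow_ne_zero 2 h.b_pos.ne'
  have cden : ContDiffAt ℝ ∞ (fun y => D.b ^ 2 * D.rhoSq y) p := (k _).mul crho
  have hden : D.b ^ 2 * D.rhoSq p ≠ 0 := mul_ne_zero hb hrho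
  have cra : ContDiffAt ℝ ∞ (fun y => rad y ^ 2 + D.a ^ 2) p := (cr.pow 2).add (k _)
  simp only [metric, Matrix.of_apply]
  refine (((((((cmu.div cden hden).neg).mul ((ctau i).mul (ctau j))).add
    ((crho.mul cq).mul ((cdr i).mul (cdr j)))).sub
    ((cf.div (k _) h.b_pos.ne').mul (((ctau i).mul (cdr j)).add ((cdr i).mul (ctau j))))).add
    ((((cc.mul cs).mul (k _)).div cden hden).mul (k _))).sub
    ((((cc.mul (k _)).mul cra).div cden hden).mul
      (((k _).mul (crot j)).add ((crot i).mul (k _))))).add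
    (((crho.div cc hc).mul crd).add ((ContDiffAt.div (((k _).mul ((k _).sub
      (((k _).mul (cr.pow 2)).div (k 3) (by norm_num)))).mul ((cc.mul cra).add ((k _).mul crho)))
      (cden.mul cc) (mul_ne_zero hden hc)).mul ((crot i).mul (crot j))))

theorem contDiffAt_det {E : Type*} [NormedAddCommGroup E] [NormedSpace ℝ E] {A : E → Mat4} {x : E}
    (hA : ∀ i j, ContDiffAt ℝ ∞ (fun y => A y i j) x) : ContDiffAt ℝ ∞ (fun y => (A y).det) x := by
  simp only [det_apply']
  refine ContDiffAt.sum fun σ _ => ?_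
  exact contDiffAt_const.mul (contDiffAt_prod fun i _ => hA _ _)

theorem contDiffAt_inv {E : Type*} [NormedAddCommGroup E] [NormedSpace ℝ E] {A : E → Mat4} {x : E}
    (hA : ∀ i j, ContDiffAt ℝ ∞ (fun y => A y i j) x) (hx : (A x).det ≠ 0) (i j : Fin 4) :
    ContDiffAt ℝ ∞ (fun y => (A y)⁻¹ i j) x := by
  simp only [inv_def, Ring.inverse_eq_inv', Matrix.smul_apply, smul_eq_mul, adjugate_apply]
  refine ((contDiffAt_det hA).inv hx).mul (contDiffAt_det fun k l => ?_)
  by_cases hk : k = j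
  · subst hk
    simp only [updateRow_self]
    exact contDiffAt_const
  · simp only [updateRow_ne hk]
    exact hA k l

theorem Subextremal.contDiffAt_dual (h : D.Subextremal) {p : R4} (hp : p ∈ D.reg)
    (i j : Fin 4) : ContDiffAt ℝ ∞ (fun y => D.dual y i j) p :=
  contDiffAt_inv (h.contDiffAt_metric hp) (h.det_ne_zero (h.reg_subset hp)) i j

theorem contDiffAt_pd {F : Type*} [NormedAddCommGroup F] [NormedSpace ℝ F] {u : R4 → F} {p : R4}
    (hu : ContDiffAt ℝ ∞ u p) (i : Fin 4) : ContDiffAt ℝ ∞ (pd i u) p :=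
  (hu.fderiv_right (m := ∞) le_rfl).clm_apply contDiffAt_const

theorem Subextremal.contDiffAt_chris (h : D.Subextremal) {p : R4} (hp : p ∈ D.reg)
    (k i j : Fin 4) : ContDiffAt ℝ ∞ (D.chris k i j) p := by
  unfold chris
  refine ContDiffAt.sum fun l _ => ?_
  have c := fun a b c => contDiffAt_pd (h.contDiffAt_metric hp a b) c
  exact ((h.contDiffAt_dual hp k l).div_const 2).mul (((c l j i).add (c i l j)).sub (c i j l))

theorem contDiffAt_cVec {p : R4} (h : D.Subextremal) (hp : p ∈ D.reg) (κ : ℝ) (i : Fin 4) :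
    ContDiffAt ℝ ∞ (fun y => D.cVec κ y i) p := by
  have hr := h.rad_pos hp
  have cr := contDiffAt_rad hr
  have cf : ContDiffAt ℝ ∞ (fun y => D.f (rad y)) p := (h.contDiffAt_f hp).comp p cr
  have hra : rad p ^ 2 + D.a ^ 2 ≠ 0 := by positivity
  have k : ∀ x : ℝ, ContDiffAt ℝ ∞ (fun _ : R4 => x) p := fun x => contDiffAt_const
  have cdphi : ContDiffAt ℝ ∞ (fun y => dphiVec y i) p := by
    fin_cases i
    · exact contDiffAt_const
    · exact (contDiffAt_coord 2 p).neg
    · exact contDiffAt_coord 1 p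
    · exact contDiffAt_const
  have cdth : ContDiffAt ℝ ∞ (fun y => sinDthVec y i) p := by
    fin_cases i
    · exact contDiffAt_const
    · exact ((contDiffAt_coord 1 p).mul (contDiffAt_coord 3 p)).div cr hr.ne'
    · exact ((contDiffAt_coord 2 p).mul (contDiffAt_coord 3 p)).div cr hr.ne'
    · exact (((contDiffAt_coord 1 p).pow 2).add ((contDiffAt_coord 2 p).pow 2)).neg.div cr hr.ne'
  unfold cVec
  exact (((k _).add (((k _).div ((cr.pow 2).add (k _)) hra).mul cdphi)).add
    (((k _).mul cf).mul (contDiffAt_drForm hr i))).add ((k _).mul cdth)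

end Data

theorem pd_mul {u v : R4 → ℝ} {p : R4} (i : Fin 4) (hu : DifferentiableAt ℝ u p)
    (hv : DifferentiableAt ℝ v p) :
    pd i (fun y => u y * v y) p = pd i u p * v p + u p * pd i v p := by
  simp only [pd]
  rw [fderiv_fun_mul hu hv]
  simp [mul_comm, add_comm]

theorem pd_sum {F ι : Type*} [NormedAddCommGroup F] [NormedSpace ℝ F] {s : Finset ι}
    {u : ι → R4 → F} {p : R4} (i : Fin 4) (hu : ∀ m ∈ s, DifferentiableAt ℝ (u m) p) :
    pd i (fun y => ∑ m ∈ s, u m y) p = ∑ m ∈ s, pd i (u m) p := by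
  simp only [pd]
  rw [fderiv_fun_sum hu]
  simp

theorem pd_congr {F : Type*} [NormedAddCommGroup F] [NormedSpace ℝ F] {u v : R4 → F} {p : R4}
    (i : Fin 4) (h : u =ᶠ[nhds p] v) : pd i u p = pd i v p := by
  simp only [pd, h.fderiv_eq]

/-- Jacobi's formula for the derivative of a determinant. -/
theorem fderiv_det_apply {A : R4 → Mat4} {p : R4}
    (hA : ∀ i j, DifferentiableAt ℝ (fun y => A y i j) p) (h0 : (A p).det ≠ 0) (v : R4) :
    fderiv ℝ (fun y => (A y).det) p v
      = (A p).det * trace ((A p)⁻¹ * Matrix.of fun i j => fderiv ℝ (fun y => A y i j) p v) := by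
  set B : Mat4 := Matrix.of fun i j => fderiv ℝ (fun y => A y i j) p v with hB
  let dt : (Fin 4 → Fin 4 → ℝ) → ℝ := fun M => (Matrix.of M).det
  have hdt : Differentiable ℝ dt := by
    intro M
    refine (Data.contDiffAt_det (A := fun M : Fin 4 → Fin 4 → ℝ => Matrix.of M) (x := M)
      fun i j => ?_).differentiableAt (by simp)
    simp only [Matrix.of_apply]
    fun_prop
  have hA' : DifferentiableAt ℝ (fun y => (fun i j => A y i j : Fin 4 → Fin 4 → ℝ)) p :=
    differentiableAt_pi.2 fun i => differentiableAt_pi.2 fun j => hA i j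
  let A₀ : Fin 4 → Fin 4 → ℝ := fun i j => A p i j
  let B₀ : Fin 4 → Fin 4 → ℝ := fun i j => B i j
  have h1 : fderiv ℝ (fun y => (A y).det) p v = fderiv ℝ dt A₀ B₀ := by
    have : (fun y => (A y).det) = dt ∘ fun y => (fun i j => A y i j : Fin 4 → Fin 4 → ℝ) := rfl
    rw [this, fderiv_comp p (hdt _) hA']
    simp only [ContinuousLinearMap.comp_apply]
    congr 1
    rw [fderiv_pi fun i => differentiableAt_pi.2 fun j => hA i j]
    funext i j
    simp only [ContinuousLinearMap.pi_apply, B₀, hB, Matrix.of_apply]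
    rw [fderiv_pi fun j => hA i j]
    rfl
  have h2 : HasDerivAt (fun t : ℝ => dt (A₀ + t • B₀)) (fderiv ℝ dt A₀ B₀) 0 := by
    have hl : HasDerivAt (fun t : ℝ => A₀ + t • B₀) B₀ 0 := by
      simpa using ((hasDerivAt_id (0 : ℝ)).smul_const B₀).const_add A₀
    have h3 : HasFDerivAt dt (fderiv ℝ dt A₀) (A₀ + (0 : ℝ) • B₀) := by
      rw [zero_smul, add_zero]; exact (hdt _).hasFDerivAt
    exact h3.comp_hasDerivAt 0 hl
  have hinv : A p * (A p)⁻¹ = 1 := mul_nonsing_inv _ (isUnit_iff_ne_zero.2 h0)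
  set N := (A p)⁻¹ * B with hN
  have h4 : ∀ t : ℝ, dt (A₀ + t • B₀) = (A p).det * det (1 + t • N) := by
    intro t
    rw [← det_mul, Matrix.mul_add, Matrix.mul_one, Matrix.mul_smul, hN, ← Matrix.mul_assoc, hinv,
      Matrix.one_mul]
    rfl
  have h5 : HasDerivAt (fun t : ℝ => (A p).det * det (1 + t • N)) ((A p).det * trace N) 0 := by
    refine HasDerivAt.const_mul _ ?_
    set Q := (det (1 + (Polynomial.X : Polynomial ℝ) • N.map Polynomial.C)).divX.divX
    have e : (fun t : ℝ => det (1 + t • N)) = fun t => 1 + trace N * t + Q.eval t * t ^ 2 :=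
      funext fun t => det_one_add_smul t N
    rw [e]
    refine ((((hasDerivAt_id (0 : ℝ)).const_mul (trace N)).const_add 1).add
      ((Q.hasDerivAt 0).mul (hasDerivAt_pow 2 (0 : ℝ)))).congr_deriv ?_
    simp
  rw [h1]
  refine h2.unique ?_
  simpa only [h4] using h5

namespace Data

variable {D : Data}

/-- The derivatives `∂_k g_{ij}` of the metric. -/
def dgM (D : Data) (k : Fin 4) (p : R4) : Mat4 :=
    Matrix.of fun i j => pd k (fun y => D.metric y i j) p

/-- The derivatives `∂_k g^{ij}` of the dual metric. -/
def ddM (D : Data) (k : Fin 4) (p : R4) : Mat4 :=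
    Matrix.of fun i j => pd k (fun y => D.dual y i j) p

/-- The connection matrices `(Γ_k)^i_n`. -/
def conn (D : Data) (k : Fin 4) (p : R4) : Mat4 := Matrix.of fun i n => D.chris i k n p

theorem dgM_symm (D : Data) (k i j : Fin 4) (p : R4) : D.dgM k p i j = D.dgM k p j i := by
  simp only [dgM, Matrix.of_apply]
  congr 1
  funext y
  exact (D.metric_isSymm y).apply j i

theorem chris_symm (D : Data) (k i j : Fin 4) (p : R4) : D.chris k i j p = D.chris k j i p := by
  have e := fun a b c => D.dgM_symm a b c p
  simp only [dgM, Matrix.of_apply] at e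
  simp only [chris]
  refine Finset.sum_congr rfl fun l _ => ?_
  rw [e i l j, e j i l, e l i j]
  ring

theorem Subextremal.metric_mul_conn (h : D.Subextremal) {p : R4} (hp : p ∈ D.M) (k : Fin 4) :
    D.metric p * D.conn k p = Matrix.of fun m j =>
      (D.dgM k p m j + D.dgM j p k m - D.dgM m p k j) / 2 := by
  have : D.conn k p = D.dual p * Matrix.of fun m j =>
      (D.dgM k p m j + D.dgM j p k m - D.dgM m p k j) / 2 := by
    ext i j
    simp only [conn, chris, Matrix.of_apply, mul_apply, dgM]
    exact Finset.sum_congr rfl fun l _ => by ring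
  rw [this, ← Matrix.mul_assoc, h.mul_dual hp, Matrix.one_mul]

/-- The Levi-Civita connection is metric. -/
theorem Subextremal.dgM_eq (h : D.Subextremal) {p : R4} (hp : p ∈ D.M) (k : Fin 4) :
    D.dgM k p = (D.conn k p)ᵀ * D.metric p + D.metric p * D.conn k p := by
  have h1 : (D.conn k p)ᵀ * D.metric p = (D.metric p * D.conn k p)ᵀ := by
    rw [transpose_mul, D.metric_isSymm p]
  rw [h1, h.metric_mul_conn hp]
  ext i j
  simp only [Matrix.add_apply, transpose_apply, Matrix.of_apply]
  rw [D.dgM_symm k j i, D.dgM_symm i k j, D.dgM_symm j k i]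
  ring

theorem Subextremal.ddM_eq (h : D.Subextremal) {p : R4} (hp : p ∈ D.reg) (k : Fin 4) :
    D.ddM k p = -(D.conn k p * D.dual p + D.dual p * (D.conn k p)ᵀ) := by
  have hM := h.reg_subset hp
  have h1 : D.ddM k p * D.metric p + D.dual p * D.dgM k p = 0 := by
    ext i j
    have e : (fun y => ∑ m, D.dual y i m * D.metric y m j) =ᶠ[nhds p] fun _ => (1 : Mat4) i j := by
      filter_upwards [D.isOpen_reg.mem_nhds hp] with y hy
      rw [← h.dual_mul (h.reg_subset hy), mul_apply]
    have h2 := pd_congr k e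
    have d1 := fun m => (h.contDiffAt_dual hp i m).differentiableAt (by simp)
    have d2 := fun m => (h.contDiffAt_metric hp m j).differentiableAt (by simp)
    rw [pd_sum k fun m _ => (d1 m).fun_mul (d2 m)] at h2
    simp only [pd_mul k (d1 _) (d2 _)] at h2
    rw [Finset.sum_add_distrib] at h2
    simp only [Matrix.add_apply, mul_apply, ddM, dgM, Matrix.of_apply, Matrix.zero_apply]
    rw [h2]
    simp [pd]
  have h3 : D.ddM k p = -(D.dual p * D.dgM k p * D.dual p) := by
    have := congrArg (· * D.dual p) h1
    simp only [Matrix.add_mul, Matrix.mul_assoc, h.mul_dual hM, Matrix.mul_one, Matrix.zero_mul]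
      at this
    rw [Matrix.mul_assoc]
    exact eq_neg_of_add_eq_zero_left this
  rw [h3, h.dgM_eq hM]
  simp only [Matrix.mul_add, Matrix.add_mul, Matrix.mul_assoc, h.mul_dual hM, Matrix.mul_one]
  rw [← Matrix.mul_assoc (D.dual p) (D.metric p), h.dual_mul hM, Matrix.one_mul, add_comm]

theorem Subextremal.trace_conn (h : D.Subextremal) {p : R4} (hp : p ∈ D.M) (k : Fin 4) :
    trace (D.dual p * D.dgM k p) = 2 * trace (D.conn k p) := by
  rw [h.dgM_eq hp, Matrix.mul_add, trace_add, ← Matrix.mul_assoc (D.dual p) (D.metric p),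
    h.dual_mul hp, Matrix.one_mul, trace_mul_comm, Matrix.mul_assoc, h.mul_dual hp, Matrix.mul_one,
    trace_transpose]
  ring

/-- The contracted compatibility of the connection and the metric. -/
theorem Subextremal.divergence_identity (h : D.Subextremal) {p : R4} (hp : p ∈ D.reg) (n : Fin 4) :
    ∑ l, D.dual p l n * trace (D.conn l p) + ∑ l, ∑ k, D.dual p l k * D.chris n l k p
      + ∑ j, pd j (fun y => D.dual y j n) p = 0 := by
  have e : ∀ j, pd j (fun y => D.dual y j n) p
      = -(∑ m, D.chris j j m p * D.dual p m n + ∑ m, D.dual p j m * D.chris n j m p) := by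
    intro j
    have := congrFun (congrFun (h.ddM_eq hp j) j) n
    simpa [ddM, conn, mul_apply, Matrix.add_apply, add_comm] using this
  have e1 : ∑ l, D.dual p l n * trace (D.conn l p)
      = ∑ j, ∑ m, D.chris j j m p * D.dual p m n := by
    rw [Finset.sum_comm]
    refine Finset.sum_congr rfl fun m _ => ?_
    simp only [trace, diag, conn, Matrix.of_apply, Finset.mul_sum]
    exact Finset.sum_congr rfl fun j _ => by rw [D.chris_symm j m j]; ring
  simp only [e, Finset.sum_neg_distrib, Finset.sum_add_distrib, e1]
  ring

theorem Subextremal.pd_det (h : D.Subextremal) {p : R4} (hp : p ∈ D.reg) (k : Fin 4) :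
    pd k (fun y => (D.metric y).det) p = (D.metric p).det * (2 * trace (D.conn k p)) := by
  rw [← h.trace_conn (h.reg_subset hp)]
  exact fderiv_det_apply (fun i j => (h.contDiffAt_metric hp i j).differentiableAt (by simp))
    (h.det_ne_zero (h.reg_subset hp)) _

theorem halfDens_inv_eq {p : R4} (hp : (D.metric p).det ≠ 0) :
    (D.halfDens p)⁻¹ = Real.exp (-(1 / 4) * Real.log (D.metric p).det) := by
  rw [halfDens, ← Real.rpow_neg (abs_nonneg _), Real.rpow_def_of_pos (abs_pos.2 hp), Real.log_abs]
  congr 1; ring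

theorem Subextremal.contDiffAt_halfDens_inv (h : D.Subextremal) {p : R4} (hp : p ∈ D.reg) :
    ContDiffAt ℝ ∞ (fun y => (D.halfDens y)⁻¹) p := by
  have h1 : ContDiffAt ℝ ∞ (fun y => Real.exp (-(1 / 4) * Real.log (D.metric y).det)) p :=
    (contDiffAt_const.mul ((contDiffAt_det (h.contDiffAt_metric hp)).log
      (h.det_ne_zero (h.reg_subset hp)))).exp
  refine h1.congr_of_eventuallyEq ?_
  filter_upwards [D.isOpen_reg.mem_nhds hp] with y hy
  exact halfDens_inv_eq (h.det_ne_zero (h.reg_subset hy))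

theorem Subextremal.pd_halfDens_inv (h : D.Subextremal) {p : R4} (hp : p ∈ D.reg) (k : Fin 4) :
    pd k (fun y => (D.halfDens y)⁻¹) p = -(1 / 2) * trace (D.conn k p) * (D.halfDens p)⁻¹ := by
  have hdet := h.det_ne_zero (h.reg_subset hp)
  have e : (fun y => (D.halfDens y)⁻¹) =ᶠ[nhds p]
      fun y => Real.exp (-(1 / 4) * Real.log (D.metric y).det) := by
    filter_upwards [D.isOpen_reg.mem_nhds hp] with y hy
    exact halfDens_inv_eq (h.det_ne_zero (h.reg_subset hy))
  have hd : DifferentiableAt ℝ (fun y => (D.metric y).det) p :=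
    (contDiffAt_det (h.contDiffAt_metric hp)).differentiableAt (by simp)
  have hk := h.pd_det hp k
  rw [pd_congr k e, halfDens_inv_eq hdet]
  simp only [pd] at hk ⊢
  rw [(((hd.hasFDerivAt.log hdet).const_mul (-(1 / 4))).exp).fderiv]
  simp only [_root_.smul_apply, hk, smul_eq_mul]
  field_simp
  ring

end Data

/-! ### Derivatives of complex functions -/

theorem pd_mulC {u v : R4 → ℂ} {p : R4} (i : Fin 4) (hu : DifferentiableAt ℝ u p)
    (hv : DifferentiableAt ℝ v p) :
    pd i (fun y => u y * v y) p = pd i u p * v p + u p * pd i v p := by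
  simp only [pd]
  rw [fderiv_fun_mul hu hv]
  simp [mul_comm, add_comm]

theorem pd_mul_constC {u : R4 → ℂ} {p : R4} (i : Fin 4) (hu : DifferentiableAt ℝ u p) (c : ℂ) :
    pd i (fun y => u y * c) p = pd i u p * c := by
  rw [pd_mulC i hu (differentiableAt_const c)]
  simp [pd]

theorem pd_subC {u v : R4 → ℂ} {p : R4} (i : Fin 4) (hu : DifferentiableAt ℝ u p)
    (hv : DifferentiableAt ℝ v p) :
    pd i (fun y => u y - v y) p = pd i u p - pd i v p := by
  simp only [pd]
  rw [fderiv_fun_sub hu hv]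
  simp

theorem pd_addC {u v : R4 → ℂ} {p : R4} (i : Fin 4) (hu : DifferentiableAt ℝ u p)
    (hv : DifferentiableAt ℝ v p) :
    pd i (fun y => u y + v y) p = pd i u p + pd i v p := by
  simp only [pd]
  rw [fderiv_fun_add hu hv]
  simp

theorem contDiffAt_ofReal {E : Type*} [NormedAddCommGroup E] [NormedSpace ℝ E] {u : E → ℝ} {p : E}
    (hu : ContDiffAt ℝ ∞ u p) : ContDiffAt ℝ ∞ (fun y => (u y : ℂ)) p :=
  Complex.ofRealCLM.contDiff.contDiffAt.comp p hu

theorem pd_ofReal {u : R4 → ℝ} {p : R4} (i : Fin 4) (hu : DifferentiableAt ℝ u p) :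
    pd i (fun y => (u y : ℂ)) p = ((pd i u p : ℝ) : ℂ) := by
  simp only [pd]
  have := Complex.ofRealCLM.hasFDerivAt.comp p hu.hasFDerivAt
  have e : (fun y => (u y : ℂ)) = Complex.ofRealCLM ∘ u := rfl
  rw [e, this.fderiv]
  simp

/-- The exponential `e^{i⟨y, ξ⟩}`. -/
def wave (ξ y : R4) : ℂ := Complex.exp (Complex.I * (dot ξ y : ℂ))

theorem contDiff_wave (ξ : R4) : ContDiff ℝ ∞ (wave ξ) := by
  unfold wave dot
  have h1 : ContDiff ℝ ∞ fun y : R4 => ∑ i, ξ i * y i := by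
    refine ContDiff.sum fun i _ => ?_
    fun_prop
  have : ContDiff ℝ ∞ fun y : R4 => ((∑ i, ξ i * y i : ℝ) : ℂ) := Complex.ofRealCLM.contDiff.comp h1
  exact (contDiff_const.mul this).cexp

theorem pd_wave (ξ p : R4) (k : Fin 4) : pd k (wave ξ) p = Complex.I * (ξ k : ℂ) * wave ξ p := by
  have h1 : HasFDerivAt (fun y : R4 => dot ξ y)
      (∑ i, ξ i • ContinuousLinearMap.proj (R := ℝ) (φ := fun _ : Fin 4 => ℝ) i) p := by
    unfold dot
    refine HasFDerivAt.fun_sum fun i _ => ?_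
    exact (ContinuousLinearMap.proj (R := ℝ) (φ :=
      fun _ : Fin 4 => ℝ) i).hasFDerivAt.const_mul (ξ i)
  have h2 := ((Complex.ofRealCLM.hasFDerivAt.comp p h1).const_mul Complex.I).cexp
  have e : wave ξ = fun y => Complex.exp (Complex.I * (Complex.ofRealCLM ∘ fun y => dot ξ y) y)
    := rfl
  simp only [pd]
  rw [e, h2.fderiv]
  simp [Pi.single_apply]
  ring

namespace Data

variable {D : Data}

/-! ### The symbol of the linearized gauge fixed Einstein operator -/

/-- The action `Γ^n_{ki} v_{nj} + Γ^n_{kj} v_{in}` of the connection on tensors. -/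
def connC (D : Data) (k : Fin 4) (p : R4) (v : Tens) : Tens := fun i j =>
  ∑ n, ((D.chris n k i p : ℂ) * v n j + (D.chris n k j p : ℂ) * v i n)

theorem cov_smul {φ : R4 → ℂ} {p : R4} (hφ : DifferentiableAt ℝ φ p) (v : Tens) (k i j : Fin 4) :
    D.cov (fun y a b => φ y * v a b) p k i j = pd k φ p * v i j - φ p * D.connC k p v i j := by
  rw [cov, pd_mul_constC k hφ, connC, Finset.mul_sum]
  congr 1
  exact Finset.sum_congr rfl fun n _ => by ring

theorem Subextremal.differentiableAt_connC (h : D.Subextremal) {p : R4} (hp : p ∈ D.reg) (v : Tens)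
    (k i j : Fin 4) : DifferentiableAt ℝ (fun y => D.connC k y v i j) p := by
  unfold connC
  refine DifferentiableAt.fun_sum fun n _ => ?_
  have c := fun a b c => (contDiffAt_ofReal (h.contDiffAt_chris hp a b c)).differentiableAt (by
    simp)
  exact ((c n k i).mul_const _).add ((c n k j).mul_const _)

theorem Subextremal.cov2_smul (h : D.Subextremal) {φ : R4 → ℂ} {p : R4} (hp : p ∈ D.reg)
    (hφ : ContDiffAt ℝ ∞ φ p) (v : Tens) (l k i j : Fin 4) :
    D.cov2 (fun y a b => φ y * v a b) p l k i j
      = pd l (pd k φ) p * v i j - pd l φ p * D.connC k p v i j - pd k φ p * D.connC l p v i j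
        - (∑ n, (D.chris n l k p : ℂ) * pd n φ p) * v i j
        + φ p * (∑ n, ((D.chris n l k p : ℂ) * D.connC n p v i j
          + (D.chris n l i p : ℂ) * D.connC k p v n j + (D.chris n l j p : ℂ) * D.connC k p v i n)
          - pd l (fun y => D.connC k y v i j) p) := by
  have hd : DifferentiableAt ℝ φ p := hφ.differentiableAt (by simp)
  have hdk : DifferentiableAt ℝ (pd k φ) p := (contDiffAt_pd hφ k).differentiableAt (by simp)
  have e : (fun y => D.cov (fun y a b => φ y * v a b) y k i j) =ᶠ[nhds p]
      fun y => pd k φ y * v i j - φ y * D.connC k y v i j := by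
    have := (hφ.of_le (m := 1) (by simp)).eventually (by simp)
    filter_upwards [this] with y hy
    exact cov_smul (hy.differentiableAt (by simp)) v k i j
  rw [cov2, pd_congr l e]
  have hc := h.differentiableAt_connC hp v k i j
  rw [pd_subC l (hdk.mul_const _) (hd.fun_mul hc), pd_mul_constC l hdk, pd_mulC l hd hc]
  simp only [cov_smul hd]
  have e2 : D.connC l p v i j = ∑ n,
    ((D.chris n l i p : ℂ) * v n j + (D.chris n l j p : ℂ) * v i n) := rfl
  rw [e2]
  simp only [Fin.sum_univ_four]
  ring

theorem Subextremal.exists_box_smul (h : D.Subextremal) {p : R4} (hp : p ∈ D.reg) (v : Tens)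
    (i j : Fin 4) : ∃ c : ℂ, ∀ φ : R4 → ℂ, ContDiffAt ℝ ∞ φ p →
      D.box (fun y a b => φ y * v a b) p i j
        = -(∑ l, ∑ k, (D.dual p l k : ℂ) * (pd l (pd k φ) p * v i j
            - pd l φ p * D.connC k p v i j - pd k φ p * D.connC l p v i j
            - (∑ n, (D.chris n l k p : ℂ) * pd n φ p) * v i j)) + c * φ p := by
  refine ⟨-∑ l, ∑ k, (D.dual p l k : ℂ) * (∑ n, ((D.chris n l k p : ℂ) * D.connC n p v i j
          + (D.chris n l i p : ℂ) * D.connC k p v n j + (D.chris n l j p : ℂ) * D.connC k p v i n)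
          - pd l (fun y => D.connC k y v i j) p), fun φ hφ => ?_⟩
  simp only [box, h.cov2_smul hp hφ]
  rw [neg_mul, Finset.sum_mul, ← neg_add, ← Finset.sum_add_distrib]
  congr 1
  refine Finset.sum_congr rfl fun l _ => ?_
  rw [Finset.sum_mul, ← Finset.sum_add_distrib]
  exact Finset.sum_congr rfl fun k _ => by ring

theorem trev_smul (D : Data) (p : R4) (c : ℂ) (v : Tens) :
    D.trev p (fun a b => c * v a b) = fun a b => c * D.trev p v a b := by
  have : D.tr p (fun a b => c * v a b) = c * D.tr p v := by
    simp only [tr, Finset.mul_sum]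
    exact Finset.sum_congr rfl fun i _ => Finset.sum_congr rfl fun j _ => by ring
  funext a b
  simp only [trev, this]
  ring

theorem trev_add (D : Data) (p : R4) (v w : Tens) :
    D.trev p (fun a b => v a b + w a b) = fun a b => D.trev p v a b + D.trev p w a b := by
  have : D.tr p (fun a b => v a b + w a b) = D.tr p v + D.tr p w := by
    simp only [tr, ← Finset.sum_add_distrib]
    exact Finset.sum_congr rfl fun i _ => Finset.sum_congr rfl fun j _ => by ring
  funext a b
  simp only [trev, this]
  ring

theorem Subextremal.differentiableAt_trev (h : D.Subextremal) {p : R4} (hp : p ∈ D.reg) (v : Tens)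
    (i j : Fin 4) : DifferentiableAt ℝ (fun y => D.trev y v i j) p := by
  have c1 := fun a b => (contDiffAt_ofReal (h.contDiffAt_metric hp a b)).differentiableAt (by simp)
  have c2 := fun a b => (contDiffAt_ofReal (h.contDiffAt_dual hp a b)).differentiableAt (by simp)
  unfold trev tr
  have c3 : DifferentiableAt ℝ (fun y => ∑ a, ∑ b, (D.dual y a b : ℂ) * v a b) p :=
    DifferentiableAt.fun_sum fun a _ => DifferentiableAt.fun_sum fun b _ => (c2 a b).mul_const _
  simp only [div_eq_mul_inv]
  exact (differentiableAt_const _).sub ((c3.mul_const _).mul (c1 i j))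

theorem Subextremal.exists_delta_smul (h : D.Subextremal) {p : R4} (hp : p ∈ D.reg) (v : Tens) :
    ∃ c : Form, ∀ φ : R4 → ℂ, ContDiffAt ℝ ∞ φ p →
      D.delta (fun y => D.trev y (fun a b => φ y * v a b)) p
        = fun i => -(∑ j, ∑ k, (D.dual p j k : ℂ) * pd k φ p * D.trev p v j i) + φ p * c i := by
  refine ⟨fun i => -(∑ j, ∑ k, (D.dual p j k : ℂ) * (pd k (fun y => D.trev y v j i) p
    - ∑ n, ((D.chris n k j p : ℂ) * D.trev p v n i + (D.chris n k i p : ℂ) * D.trev p v j n))),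
    fun φ hφ => ?_⟩
  have hd : DifferentiableAt ℝ φ p := hφ.differentiableAt (by simp)
  funext i
  simp only [delta, cov, trev_smul]
  simp only [pd_mulC _ hd (h.differentiableAt_trev hp v _ _)]
  rw [mul_neg, ← neg_add, Finset.mul_sum, ← Finset.sum_add_distrib]
  congr 1
  refine Finset.sum_congr rfl fun j _ => ?_
  rw [Finset.mul_sum, ← Finset.sum_add_distrib]
  refine Finset.sum_congr rfl fun k _ => ?_
  simp only [Fin.sum_univ_four]
  ring

theorem damp_add (D : Data) (κ e h : ℝ) (p : R4) (w w' : Form) (i j : Fin 4) :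
    D.damp κ e h p (fun a => w a + w' a) i j = D.damp κ e h p w i j + D.damp κ e h p w' i j := by
  simp only [damp]
  rw [← mul_add, ← congrFun (congrFun (D.trev_add p _ _) i) j]
  congr 2
  funext k l
  simp only [add_mul, Finset.sum_add_distrib]
  ring

theorem damp_smul (D : Data) (κ e h : ℝ) (p : R4) (c : ℂ) (w : Form) (i j : Fin 4) :
    D.damp κ e h p (fun a => c * w a) i j = c * D.damp κ e h p w i j := by
  simp only [damp]
  rw [mul_left_comm, ← congrFun (congrFun (D.trev_smul p c _) i) j]
  congr 2
  funext k l
  simp only [mul_assoc, ← Finset.mul_sum]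
  ring

theorem curv_smul (D : Data) (p : R4) (c : ℂ) (v : Tens) (i j : Fin 4) :
    D.curv (fun a b => c * v a b) p i j = c * D.curv v p i j := by
  simp only [curv, Finset.mul_sum]
  exact Finset.sum_congr rfl fun _ _ => Finset.sum_congr rfl fun _ _ =>
    Finset.sum_congr rfl fun _ _ => by ring

/-- The first order part of the operator acting on `φ v`, up to a multiple of `φ`. -/
theorem Subextremal.exists_linEinstein_smul (hD : D.Subextremal) (κ e h : ℝ) {p : R4}
    (hp : p ∈ D.reg) (v : Tens) (i j : Fin 4) : ∃ c : ℂ, ∀ φ : R4 → ℂ, ContDiffAt ℝ ∞ φ p →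
      D.linEinstein κ e h (fun y a b => φ y * v a b) p i j
        = -(∑ l, ∑ k, (D.dual p l k : ℂ) * (pd l (pd k φ) p * v i j
            - pd l φ p * D.connC k p v i j - pd k φ p * D.connC l p v i j
            - (∑ n, (D.chris n l k p : ℂ) * pd n φ p) * v i j))
          + 2 * D.damp κ e h p
            (fun i => -(∑ j, ∑ k, (D.dual p j k :
              ℂ) * pd k φ p * D.trev p v j i)) i j + c * φ p := by
  obtain ⟨c₁, h₁⟩ := hD.exists_box_smul hp v i j
  obtain ⟨c₂, h₂⟩ := hD.exists_delta_smul hp v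
  refine ⟨c₁ + 2 * D.damp κ e h p c₂ i j - 2 * D.curv v p i j, fun φ hφ => ?_⟩
  rw [linEinstein, h₁ φ hφ, h₂ φ hφ, damp_add, damp_smul, curv_smul]
  ring

theorem Subextremal.contDiffAt_halfDens_wave (h : D.Subextremal) {p : R4} (hp : p ∈ D.reg)
    (ξ : R4) : ContDiffAt ℝ ∞ (fun y => ((D.halfDens y)⁻¹ : ℂ) * wave ξ y) p := by
  have := (contDiffAt_ofReal (h.contDiffAt_halfDens_inv hp)).mul (contDiff_wave ξ).contDiffAt
  simpa only [Complex.ofReal_inv] using this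

theorem Subextremal.pd_halfDens_wave (h : D.Subextremal) {p : R4} (hp : p ∈ D.reg) (ξ : R4)
    (k : Fin 4) : pd k (fun y => ((D.halfDens y)⁻¹ : ℂ) * wave ξ y) p
      = (((pd k (fun y => (D.halfDens y)⁻¹) p : ℝ) : ℂ)
        + Complex.I * (ξ k : ℂ) * ((D.halfDens p)⁻¹ : ℂ)) * wave ξ p := by
  have h1 := (h.contDiffAt_halfDens_inv hp).differentiableAt (by simp)
  have h2 := (contDiffAt_ofReal (h.contDiffAt_halfDens_inv hp)).differentiableAt (by simp)
  have h3 := (contDiff_wave ξ).contDiffAt.differentiableAt (x := p) (by simp)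
  simp only [← Complex.ofReal_inv]
  rw [pd_mulC k h2 h3, pd_wave, pd_ofReal k h1]
  ring

theorem Subextremal.pd_pd_halfDens_wave (h : D.Subextremal) {p : R4} (hp : p ∈ D.reg) (ξ : R4)
    (l k : Fin 4) : pd l (pd k fun y => ((D.halfDens y)⁻¹ : ℂ) * wave ξ y) p
      = (((pd l (pd k fun y => (D.halfDens y)⁻¹) p : ℝ) : ℂ)
        + Complex.I * ((ξ k : ℂ) * ((pd l (fun y => (D.halfDens y)⁻¹) p : ℝ) : ℂ)
          + (ξ l : ℂ) * ((pd k (fun y => (D.halfDens y)⁻¹) p : ℝ) : ℂ))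
        - (ξ k : ℂ) * (ξ l : ℂ) * ((D.halfDens p)⁻¹ : ℂ)) * wave ξ p := by
  have e : (pd k fun y => ((D.halfDens y)⁻¹ : ℂ) * wave ξ y) =ᶠ[nhds p] fun y =>
      (((pd k (fun y => (D.halfDens y)⁻¹) y : ℝ) : ℂ)
        + (((D.halfDens y)⁻¹ : ℝ) : ℂ) * (Complex.I * (ξ k : ℂ))) * wave ξ y := by
    filter_upwards [D.isOpen_reg.mem_nhds hp] with y hy
    rw [h.pd_halfDens_wave hy, Complex.ofReal_inv]
    ring
  have c1 := contDiffAt_pd (h.contDiffAt_halfDens_inv hp) k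
  have h1 := c1.differentiableAt (by simp)
  have h1' := (contDiffAt_ofReal c1).differentiableAt (by simp)
  have h2 := (h.contDiffAt_halfDens_inv hp).differentiableAt (by simp)
  have h2' := (contDiffAt_ofReal (h.contDiffAt_halfDens_inv hp)).differentiableAt (by simp)
  have h3 := (contDiff_wave ξ).contDiffAt.differentiableAt (x := p) (by simp)
  have h4 : pd l (fun y => ((pd k (fun y => (D.halfDens y)⁻¹) y : ℝ) : ℂ)
        + (((D.halfDens y)⁻¹ : ℝ) : ℂ) * (Complex.I * (ξ k : ℂ))) p
      = ((pd l (pd k fun y => (D.halfDens y)⁻¹) p : ℝ) : ℂ)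
        + ((pd l (fun y => (D.halfDens y)⁻¹) p : ℝ) : ℂ) * (Complex.I * (ξ k : ℂ)) := by
    rw [← pd_ofReal l h1, ← pd_ofReal l h2, ← pd_mul_constC l h2']
    exact pd_addC l h1' (h2'.mul_const _)
  rw [pd_congr l e, pd_mulC l (h1'.fun_add (h2'.mul_const _)) h3, h4, pd_wave, Complex.ofReal_inv]
  linear_combination ((ξ k : ℂ) * (ξ l : ℂ) * ((D.halfDens p)⁻¹ : ℂ) * wave ξ p) * Complex.I_sq

end Data

namespace Data

variable {D : Data}

/-- The first order symbol of the operator on half-densities, before simplification. -/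
theorem Subextremal.symbolOne_eq (hD : D.Subextremal) (κ e h : ℝ) {p : R4} (hp : p ∈ D.reg)
    (ξ : R4) (v : Tens) (i j : Fin 4) :
    symbolOne (D.halfDensOp (D.linEinstein κ e h)) p ξ v i j
      = -(∑ l, ∑ k, (D.dual p l k : ℂ) * (-(Complex.I / 2) * ((ξ k : ℂ) * ((trace (D.conn l p) :
        ℝ) : ℂ)
            + (ξ l : ℂ) * ((trace (D.conn k p) : ℝ) : ℂ)) * v i j
            - Complex.I * (ξ l : ℂ) * D.connC k p v i j - Complex.I * (ξ k : ℂ) * D.connC l p v i j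
            - (∑ n, (D.chris n l k p : ℂ) * (Complex.I * (ξ n : ℂ))) * v i j))
          + 2 * D.damp κ e h p (fun i => -(∑ j, ∑ k, (D.dual p j k : ℂ) * (Complex.I * (ξ k : ℂ))
              * D.trev p v j i)) i j := by
  obtain ⟨c, hc⟩ := hD.exists_linEinstein_smul κ e h hp v i j
  have hd0 : (D.halfDens p : ℂ) ≠ 0 := by
    rw [Complex.ofReal_ne_zero, halfDens]
    exact (Real.rpow_pos_of_pos (abs_pos.2 (hD.det_ne_zero (hD.reg_subset hp))) _).ne'
  set A : Fin 4 → Fin 4 → ℂ := fun l k =>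
    (D.halfDens p : ℂ) * ((pd l (pd k fun y => (D.halfDens y)⁻¹) p : ℝ) : ℂ) with hA
  set T : Fin 4 → ℂ := fun k => -(1 / 2) * ((trace (D.conn k p) : ℝ) : ℂ) with hT
  have full : ∀ ξ : R4, fullSymbol (D.halfDensOp (D.linEinstein κ e h)) p ξ v i j
      = -(∑ l, ∑ k, (D.dual p l k : ℂ) * ((A l k + Complex.I * ((ξ k : ℂ) * T l + (ξ l : ℂ) * T k)
            - (ξ k : ℂ) * (ξ l : ℂ)) * v i j
            - (T l + Complex.I * (ξ l : ℂ)) * D.connC k p v i j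
            - (T k + Complex.I * (ξ k : ℂ)) * D.connC l p v i j
            - (∑ n, (D.chris n l k p : ℂ) * (T n + Complex.I * (ξ n : ℂ))) * v i j))
          + 2 * D.damp κ e h p (fun i => -(∑ j, ∑ k, (D.dual p j k : ℂ)
            * (T k + Complex.I * (ξ k : ℂ)) * D.trev p v j i)) i j + c := by
    intro ξ
    have hw : Complex.exp (-Complex.I * (dot ξ p : ℂ)) * wave ξ p = 1 := by
      rw [wave, ← Complex.exp_add]; simp
    have hf : (fun y k l => ((D.halfDens y)⁻¹ : ℂ) *
        (Complex.exp (Complex.I * (dot ξ y : ℂ)) * v k l))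
        = fun y k l => (((D.halfDens y)⁻¹ : ℂ) * wave ξ y) * v k l := by
      funext y k l; rw [wave, mul_assoc]
    rw [fullSymbol, halfDensOp, hf, hc _ (hD.contDiffAt_halfDens_wave hp ξ)]
    set E := Complex.exp (-Complex.I * (dot ξ p : ℂ)) with hE
    set H := (D.halfDens p : ℂ) with hH
    have hH1 : H * H⁻¹ = 1 := mul_inv_cancel₀ hd0
    have h1 : ∀ k, E * H * pd k (fun y => ((D.halfDens y)⁻¹ : ℂ) * wave ξ y) p
        = T k + Complex.I * (ξ k : ℂ) := by
      intro k
      rw [hD.pd_halfDens_wave hp, hD.pd_halfDens_inv hp]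
      push_cast
      rw [← hH]
      linear_combination H * H⁻¹ * (T k + Complex.I * (ξ k : ℂ)) * hw
        + (T k + Complex.I * (ξ k : ℂ)) * hH1
    have h2 : ∀ l k, E * H * pd l (pd k fun y => ((D.halfDens y)⁻¹ : ℂ) * wave ξ y) p
        = A l k + Complex.I * ((ξ k : ℂ) * T l + (ξ l : ℂ) * T k) - (ξ k : ℂ) * (ξ l : ℂ) := by
      intro l k
      rw [hD.pd_pd_halfDens_wave hp, hD.pd_halfDens_inv hp, hD.pd_halfDens_inv hp]
      push_cast
      rw [← hH]
      linear_combination (A l k + H * H⁻¹ * (Complex.I * ((ξ k : ℂ) * T l + (ξ l : ℂ) * T k)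
        - (ξ k : ℂ) * (ξ l : ℂ))) * hw
        + (Complex.I * ((ξ k : ℂ) * T l + (ξ l : ℂ) * T k) - (ξ k : ℂ) * (ξ l : ℂ)) * hH1
    have h3 : E * H * (H⁻¹ * wave ξ p) = 1 := by linear_combination H * H⁻¹ * hw + hH1
    rw [← mul_assoc, mul_add, mul_add, mul_neg, Finset.mul_sum, mul_left_comm (E * H) c, h3,
      mul_one,
      mul_left_comm (E * H) 2, ← damp_smul]
    congr 2
    · congr 1
      refine Finset.sum_congr rfl fun l _ => ?_
      rw [Finset.mul_sum]
      refine Finset.sum_congr rfl fun k _ => ?_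
      simp only [← h1, ← h2]
      simp only [Fin.sum_univ_four]
      ring
    · congr 2
      funext a
      rw [mul_neg, Finset.mul_sum]
      congr 1
      refine Finset.sum_congr rfl fun l _ => ?_
      rw [Finset.mul_sum]
      refine Finset.sum_congr rfl fun k _ => ?_
      simp only [← h1]
      ring
  have hdamp : ∀ s : ℂ, D.damp κ e h p (fun i => -(∑ j, ∑ k, (D.dual p j k : ℂ)
            * (T k + Complex.I * (s * (ξ k : ℂ))) * D.trev p v j i)) i j
      = D.damp κ e h p (fun i => -(∑ j, ∑ k, (D.dual p j k : ℂ) * T k * D.trev p v j i)) i j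
        + s * D.damp κ e h p (fun i => -(∑ j, ∑ k, (D.dual p j k : ℂ) * (Complex.I * (ξ k : ℂ))
              * D.trev p v j i)) i j := by
    intro s
    rw [← damp_smul, ← damp_add]
    congr 1
    funext a
    simp only [Fin.sum_univ_four]
    ring
  have d1 := hdamp 1
  have d2 := hdamp (-1)
  simp only [one_mul, neg_one_mul] at d1 d2
  rw [symbolOne, full, full]
  simp only [Pi.neg_apply, Complex.ofReal_neg]
  rw [d1, d2]
  have hs : ∀ a b d d' c : ℂ, ((-a + 2 * (d + d') + c) - (-b + 2 * (d + -d') + c)) / 2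
      = -((a - b) / 2) + 2 * d' := by intros; ring
  rw [hs, ← Finset.sum_sub_distrib, Finset.sum_div]
  congr 2
  refine Finset.sum_congr rfl fun l _ => ?_
  rw [← Finset.sum_sub_distrib, Finset.sum_div]
  refine Finset.sum_congr rfl fun k _ => ?_
  simp only [hT, Fin.sum_univ_four]
  ring

/-! ### The Hamilton vector field -/

theorem hasDerivAt_line {E F : Type*} [NormedAddCommGroup E] [NormedSpace ℝ E]
    [NormedAddCommGroup F] [NormedSpace ℝ F] {u : E → F} {z : E} (hu : DifferentiableAt ℝ u z)
    (V : E) : HasDerivAt (fun t : ℝ => u (z + t • V)) (fderiv ℝ u z V) 0 := by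
  have hl : HasDerivAt (fun t : ℝ => z + t • V) V 0 := by
    simpa using ((hasDerivAt_id (0 : ℝ)).smul_const V).const_add z
  have h3 : HasFDerivAt u (fderiv ℝ u z) (z + (0 : ℝ) • V) := by
    rw [zero_smul, add_zero]; exact hu.hasFDerivAt
  exact h3.comp_hasDerivAt 0 hl

theorem contDiffAt_comp_fst {F : Type*} [NormedAddCommGroup F] [NormedSpace ℝ F] {u : R4 → F}
    {z : Phase} (hu : ContDiffAt ℝ ∞ u z.1) : ContDiffAt ℝ ∞ (fun y : Phase => u y.1) z :=
  hu.comp z contDiffAt_fst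

theorem contDiff_snd_apply (i : Fin 4) : ContDiff ℝ ∞ (fun y : Phase => y.2 i) := by fun_prop

theorem Subextremal.contDiffAt_Gfun (h : D.Subextremal) {z : Phase} (hz : z.1 ∈ D.reg) :
    ContDiffAt ℝ ∞ D.Gfun z := by
  unfold Gfun G
  refine ContDiffAt.sum fun i _ => ContDiffAt.sum fun j _ => ?_
  exact ((contDiffAt_comp_fst (h.contDiffAt_dual hz i j)).mul
    (contDiff_snd_apply i).contDiffAt).mul (contDiff_snd_apply j).contDiffAt

theorem Subextremal.fderiv_Gfun (h : D.Subextremal) {z : Phase} (hz : z.1 ∈ D.reg) (a b : R4) :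
    fderiv ℝ D.Gfun z (a, b)
      = ∑ i, ∑ j, fderiv ℝ (fun y => D.dual y i j) z.1 a * z.2 i * z.2 j
        + 2 * ∑ i, ∑ j, D.dual z.1 i j * b i * z.2 j := by
  have h1 := hasDerivAt_line ((h.contDiffAt_Gfun hz).differentiableAt (by simp)) (a, b)
  refine h1.unique ?_
  have hl : ∀ i, HasDerivAt (fun t : ℝ => z.2 i + t * b i) (b i) 0 := by
    intro i
    simpa using ((hasDerivAt_id (0 : ℝ)).mul_const (b i)).const_add (z.2 i)
  have h2 : HasDerivAt (fun t : ℝ => ∑ i, ∑ j, D.dual (z.1 + t • a) i j * (z.2 i + t * b i)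
      * (z.2 j + t * b j)) (∑ i, ∑ j, (fderiv ℝ (fun y => D.dual y i j) z.1 a * z.2 i * z.2 j
        + D.dual z.1 i j * b i * z.2 j + D.dual z.1 i j * z.2 i * b j)) 0 := by
    refine HasDerivAt.fun_sum fun i _ => HasDerivAt.fun_sum fun j _ => ?_
    have := ((hasDerivAt_line ((h.contDiffAt_dual hz i j).differentiableAt (by simp)) a).fun_mul
      (hl i)).fun_mul (hl j)
    refine this.congr_deriv ?_
    simp
    ring
  refine h2.congr_deriv ?_
  have hs := fun i j => (D.dual_isSymm z.1).apply i j
  simp only [Finset.sum_add_distrib]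
  have : ∑ i, ∑ j, D.dual z.1 i j * z.2 i * b j = ∑ i, ∑ j, D.dual z.1 i j * b i * z.2 j := by
    rw [Finset.sum_comm]
    exact Finset.sum_congr rfl fun i _ => Finset.sum_congr rfl fun j _ => by rw [hs i j]; ring
  rw [this]
  ring

/-- The vector `ξ^♯`. -/
def sharp (D : Data) (z : Phase) : R4 := D.dual z.1 *ᵥ z.2

theorem Subextremal.dXi_Gfun (h : D.Subextremal) {z : Phase} (hz : z.1 ∈ D.reg) (j : Fin 4) :
    dXi j D.Gfun z = 2 * D.sharp z j := by
  rw [dXi, h.fderiv_Gfun hz]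
  simp [Pi.single_apply, sharp, mulVec, dotProduct]

theorem Subextremal.dX_Gfun (h : D.Subextremal) {z : Phase} (hz : z.1 ∈ D.reg) (j : Fin 4) :
    dX j D.Gfun z = bl (D.ddM j z.1) z.2 z.2 := by
  rw [dX, h.fderiv_Gfun hz, bl_eq_sum]
  simp [ddM, pd]

theorem isOpen_fst_reg : IsOpen {z : Phase | z.1 ∈ D.reg} := D.isOpen_reg.preimage continuous_fst

theorem Subextremal.contDiffAt_sharp (h : D.Subextremal) {z : Phase} (hz : z.1 ∈ D.reg)
    (j : Fin 4) : ContDiffAt ℝ ∞ (fun y => D.sharp y j) z := by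
  simp only [sharp, mulVec, dotProduct]
  exact ContDiffAt.sum fun k _ => (contDiffAt_comp_fst (h.contDiffAt_dual hz j k)).mul
    (contDiff_snd_apply k).contDiffAt

theorem Subextremal.dX_dXi_Gfun (h : D.Subextremal) {z : Phase} (hz : z.1 ∈ D.reg) (j : Fin 4) :
    dX j (dXi j D.Gfun) z = 2 * ∑ n, pd j (fun y => D.dual y j n) z.1 * z.2 n := by
  have e : dXi j D.Gfun =ᶠ[nhds z] fun y => 2 * D.sharp y j := by
    filter_upwards [D.isOpen_fst_reg.mem_nhds hz] with y hy
    exact h.dXi_Gfun hy j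
  have hd := ((h.contDiffAt_sharp hz j).differentiableAt (by simp)).const_mul 2
  rw [dX, e.fderiv_eq]
  refine (hasDerivAt_line hd _).unique ?_
  refine HasDerivAt.const_mul 2 ?_
  simp only [sharp, mulVec, dotProduct]
  refine HasDerivAt.fun_sum fun n _ => ?_
  simpa [pd] using (hasDerivAt_line ((h.contDiffAt_dual hz j n).differentiableAt (by simp))
    (Pi.single j 1)).mul_const (z.2 n)

/-- The subprincipal symbol: the scalar terms cancel, the connection and the damping remain. -/
theorem Subextremal.subSymbol_eq (hD : D.Subextremal) (κ e h : ℝ) {z : Phase} (hz : z.1 ∈ D.reg)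
    (v : Tens) (i j : Fin 4) :
    D.subSymbol (D.linEinstein κ e h) z v i j
      = Complex.I * ∑ k, 2 * (D.sharp z k : ℂ) * D.connC k z.1 v i j
        + 2 * D.damp κ e h z.1 (fun i => -(Complex.I * ∑ j, (D.sharp z j : ℂ)
              * D.trev z.1 v j i)) i j := by
  rw [subSymbol, hD.symbolOne_eq κ e h hz]
  have hdamp : (fun i => -(∑ j, ∑ k, (D.dual z.1 j k : ℂ) * (Complex.I * (z.2 k : ℂ))
      * D.trev z.1 v j i)) = fun i => -(Complex.I * ∑ j, (D.sharp z j : ℂ) * D.trev z.1 v j i) := by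
    funext i
    rw [Finset.mul_sum]
    congr 1
    refine Finset.sum_congr rfl fun j _ => ?_
    simp only [sharp, mulVec, dotProduct, Complex.ofReal_sum, Complex.ofReal_mul, Finset.sum_mul,
      Finset.mul_sum]
    exact Finset.sum_congr rfl fun k _ => by ring
  rw [hdamp]
  have hdiv : ((∑ n, z.2 n * (∑ l, D.dual z.1 l n * trace (D.conn l z.1)
      + ∑ l, ∑ k, D.dual z.1 l k * D.chris n l k z.1
      + ∑ j, pd j (fun y => D.dual y j n) z.1) : ℝ) : ℂ) = 0 := by
    rw [Finset.sum_eq_zero, Complex.ofReal_zero]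
    intro n _
    rw [hD.divergence_identity hz, mul_zero]
  simp only [hD.dX_dXi_Gfun hz]
  have hI : (1 : ℂ) / (2 * Complex.I) = -Complex.I / 2 := by
    rw [div_eq_div_iff (by simp) two_ne_zero]
    linear_combination (2 : ℂ) * Complex.I_sq
  have hs : ∀ a b, (D.dual z.1 a b : ℂ) = (D.dual z.1 b a : ℂ) := fun a b => by
    rw [(D.dual_isSymm z.1).apply b a]
  rw [hI]
  have hsh : ∀ k, (D.sharp z k : ℂ) = ∑ l, (D.dual z.1 k l : ℂ) * (z.2 l : ℂ) := by
    intro k; simp [sharp, mulVec, dotProduct]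
  simp only [hsh]
  push_cast at hdiv ⊢
  simp only [Fin.sum_univ_four] at hdiv ⊢
  rw [hs 1 0, hs 2 0, hs 3 0, hs 2 1, hs 3 1, hs 3 2] at hdiv ⊢
  linear_combination (Complex.I * v i j) * hdiv

end Data

/-- A real tensor as a complex one. -/
def toTens (x : Mat4) : Tens := fun i j => (x i j : ℂ)

namespace Data

variable {D : Data}

/-- The connection matrix `Γ_X` along the Hamilton vector field, `X = 2 ξ^♯`. -/
def connAlong (D : Data) (z : Phase) : Mat4 := ∑ k, (2 * D.sharp z k) • D.conn k z.1

/-- The zeroth order part of the subprincipal operator divided by `i`, on symmetric tensors. -/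
def potential (D : Data) (κ e h : ℝ) (z : Phase) (u : Mat4) : Mat4 :=
  (D.connAlong z)ᵀ * u + u * D.connAlong z
    + (2 / h) • dampM e (D.metric z.1) (D.dual z.1) (D.cVec κ z.1) (D.sharp z) u

theorem connC_toTens (D : Data) (k : Fin 4) (p : R4) (x : Mat4) :
    D.connC k p (toTens x) = toTens ((D.conn k p)ᵀ * x + x * D.conn k p) := by
  funext i j
  simp only [connC, toTens, Matrix.add_apply, mul_apply, transpose_apply, conn, Matrix.of_apply,
    Complex.ofReal_add, Complex.ofReal_sum, Complex.ofReal_mul, Finset.sum_add_distrib]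
  congr 1
  exact Finset.sum_congr rfl fun n _ => mul_comm _ _

theorem trev_toTens (D : Data) (p : R4) {x : Mat4} (hx : x.IsSymm) :
    D.trev p (toTens x) = toTens (trv (D.metric p) (D.dual p) x) := by
  have h : D.tr p (toTens x) = ((trace (D.dual p * x) : ℝ) : ℂ) := by
    simp only [tr, toTens, trace, diag, mul_apply, Complex.ofReal_sum, Complex.ofReal_mul]
    exact Finset.sum_congr rfl fun i _ => Finset.sum_congr rfl fun j _ => by rw [hx.apply i j]
  funext i j
  simp [trev, h, toTens, trv]

theorem damp_toTens (D : Data) (κ e h : ℝ) (p : R4) (X : R4) {x : Mat4} (hx : x.IsSymm)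
    (i j : Fin 4) :
    D.damp κ e h p (fun a => ∑ b, (X b : ℂ) * D.trev p (toTens x) b a) i j
      = ((-h⁻¹ * dampM e (D.metric p) (D.dual p) (D.cVec κ p) X x i j : ℝ) : ℂ) := by
  have ht := trv_isSymm (G := D.dual p) (D.metric_isSymm p) hx
  set t := trv (D.metric p) (D.dual p) x with htd
  have hw : (fun a => ∑ b, (X b : ℂ) * D.trev p (toTens x) b a) = fun a => (((t *ᵥ X) a : ℝ) :
    ℂ) := by
    funext a
    rw [trev_toTens D p hx, ← htd]
    simp only [toTens, mulVec, dotProduct, Complex.ofReal_sum, Complex.ofReal_mul]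
    exact Finset.sum_congr rfl fun b _ => by rw [ht.apply a b, mul_comm]
  rw [hw, damp]
  set θ : Mat4 := (1 / 2 : ℝ) • (vecMulVec (D.metric p *ᵥ D.cVec κ p) (t *ᵥ X)
    + vecMulVec (t *ᵥ X) (D.metric p *ᵥ D.cVec κ p)) - (e * bl t (D.cVec κ p) X) • D.metric p
      with hθ
  have hθs : θ.IsSymm := by
    refine IsSymm.sub (IsSymm.smul ?_ _) ((D.metric_isSymm p).smul _)
    rw [IsSymm, transpose_add, transpose_vecMulVec, transpose_vecMulVec, add_comm]
  have hk : (fun k l => ((D.cForm κ p k : ℂ) * (((t *ᵥ X) l : ℝ) : ℂ)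
      + (((t *ᵥ X) k : ℝ) : ℂ) * (D.cForm κ p l : ℂ)) / 2
      - (e : ℂ) * (∑ n, (((t *ᵥ X) n : ℝ) : ℂ) * (D.cVec κ p n : ℂ)) * (D.metric p k l : ℂ))
      = toTens θ := by
    funext k l
    have hc : ∀ k, D.cForm κ p k = (D.metric p *ᵥ D.cVec κ p) k := fun k => rfl
    have hb : bl t (D.cVec κ p) X = ∑ n, (t *ᵥ X) n * D.cVec κ p n := by
      rw [bl, dotProduct_comm]; rfl
    simp only [toTens, hθ, Matrix.sub_apply, Matrix.smul_apply, Matrix.add_apply, vecMulVec_apply,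
      smul_eq_mul, hc, hb]
    push_cast
    ring
  rw [hk, trev_toTens D p hθs]
  simp only [toTens, dampM, ← htd, ← hθ]
  push_cast
  ring

theorem Subextremal.subSymbol_toTens (hD : D.Subextremal) (κ e h : ℝ) {z : Phase}
    (hz : z.1 ∈ D.reg) {x : Mat4} (hx : x.IsSymm) (i j : Fin 4) :
    D.subSymbol (D.linEinstein κ e h) z (toTens x) i j
      = Complex.I * (D.potential κ e h z x i j : ℂ) := by
  rw [hD.subSymbol_eq κ e h hz]
  have e1 : (fun i => -(Complex.I * ∑ j, (D.sharp z j : ℂ) * D.trev z.1 (toTens x) j i))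
      = fun i => (-Complex.I) * ∑ j, (D.sharp z j : ℂ) * D.trev z.1 (toTens x) j i := by
    funext i; ring
  rw [e1, damp_smul, damp_toTens D κ e h z.1 _ hx]
  have e2 : ∑ k, 2 * (D.sharp z k : ℂ) * D.connC k z.1 (toTens x) i j
      = ((((D.connAlong z)ᵀ * x + x * D.connAlong z) i j : ℝ) : ℂ) := by
    have : (D.connAlong z)ᵀ * x + x * D.connAlong z
        = ∑ k, (2 * D.sharp z k) • ((D.conn k z.1)ᵀ * x + x * D.conn k z.1) := by
      simp only [connAlong, transpose_sum, Matrix.sum_mul, Matrix.mul_sum, transpose_smul,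
        Matrix.smul_mul, Matrix.mul_smul, smul_add, Finset.sum_add_distrib]
    rw [this, Matrix.sum_apply, Complex.ofReal_sum]
    refine Finset.sum_congr rfl fun k _ => ?_
    rw [connC_toTens]
    simp [toTens]
  have e3 : D.potential κ e h z x i j = ((D.connAlong z)ᵀ * x + x * D.connAlong z) i j
      + 2 / h * dampM e (D.metric z.1) (D.dual z.1) (D.cVec κ z.1) (D.sharp z) x i j := rfl
  rw [e2, e3]
  push_cast
  ring

theorem Subextremal.subSymbol_add_smul (hD : D.Subextremal) (κ e h : ℝ) {z : Phase}
    (hz : z.1 ∈ D.reg) (v w : Tens) (c : ℂ) (i j : Fin 4) :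
    D.subSymbol (D.linEinstein κ e h) z (fun a b => v a b + c * w a b) i j
      = D.subSymbol (D.linEinstein κ e h) z v i j
        + c * D.subSymbol (D.linEinstein κ e h) z w i j := by
  simp only [hD.subSymbol_eq κ e h hz]
  have e1 : (fun i => -(Complex.I * ∑ j, (D.sharp z j : ℂ)
      * D.trev z.1 (fun a b => v a b + c * w a b) j i))
      = fun i => -(Complex.I * ∑ j, (D.sharp z j : ℂ) * D.trev z.1 v j i)
        + c * -(Complex.I * ∑ j, (D.sharp z j : ℂ) * D.trev z.1 w j i) := by
    funext i
    rw [D.trev_add z.1 v (fun a b => c * w a b), D.trev_smul]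
    simp only [Fin.sum_univ_four]
    ring
  rw [e1, damp_add D κ e h z.1 (fun i => -(Complex.I * ∑ j, (D.sharp z j : ℂ) * D.trev z.1 v j i))
    (fun i => c * -(Complex.I * ∑ j, (D.sharp z j : ℂ) * D.trev z.1 w j i)), damp_smul]
  have e2 : ∀ k, D.connC k z.1 (fun a b => v a b + c * w a b) i j
      = D.connC k z.1 v i j + c * D.connC k z.1 w i j := by
    intro k
    simp only [connC, Finset.mul_sum, ← Finset.sum_add_distrib]
    exact Finset.sum_congr rfl fun n _ => by ring
  simp only [e2, Fin.sum_univ_four]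
  ring

/-- Real and imaginary parts of a tensor. -/
theorem tens_eq (v : Tens) : v = fun a b =>
    toTens (Matrix.of fun i j => (v i j).re) a b
      + Complex.I * toTens (Matrix.of fun i j => (v i j).im) a b := by
  funext a b
  simp only [toTens, Matrix.of_apply, mul_comm Complex.I, Complex.re_add_im]

theorem Subextremal.subSymbol_eq_potential (hD : D.Subextremal) (κ e h : ℝ) {z : Phase}
    (hz : z.1 ∈ D.reg) {v : Tens} (hv : IsSymTens v) (i j : Fin 4) :
    D.subSymbol (D.linEinstein κ e h) z v i j
      = Complex.I * ((D.potential κ e h z (Matrix.of fun i j => (v i j).re) i j : ℂ)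
        + Complex.I * (D.potential κ e h z (Matrix.of fun i j => (v i j).im) i j : ℂ)) := by
  conv_lhs => rw [tens_eq v]
  rw [hD.subSymbol_add_smul κ e h hz, hD.subSymbol_toTens κ e h hz, hD.subSymbol_toTens κ e h hz]
  · ring
  · ext a b
    simp [hv a b]
  · ext a b
    simp [hv a b]

end Data

section Integration

open MeasureTheory

/-! ### Integration over phase space -/

instance : (volume : Measure Phase).IsAddHaarMeasure :=
  Measure.prod.instIsAddHaarMeasure (volume : Measure R4) (volume : Measure R4)

theorem contDiff_of_forall_mem_tsupport {E F : Type*} [NormedAddCommGroup E] [NormedSpace ℝ E]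
    [NormedAddCommGroup F] [NormedSpace ℝ F] {n : WithTop ℕ∞} {u : E → F}
    (h : ∀ z ∈ tsupport u, ContDiffAt ℝ n u z) : ContDiff ℝ n u := by
  refine contDiff_iff_contDiffAt.2 fun z => ?_
  by_cases hz : z ∈ tsupport u
  · exact h z hz
  · exact contDiffAt_const.congr_of_eventuallyEq (notMem_tsupport_iff_eventuallyEq.mp hz)

theorem integral_fderiv_eq_zero {φ : Phase → ℂ} (hφ : ContDiff ℝ 1 φ) (hc : HasCompactSupport φ)
    (V : Phase) :
    Integrable (fun z => fderiv ℝ φ z V) ∧ ∫ z, fderiv ℝ φ z V = 0 := by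
  have h1 : Continuous fun z => fderiv ℝ φ z V :=
    (hφ.continuous_fderiv (by norm_num)).clm_apply continuous_const
  have h2 : HasCompactSupport fun z => fderiv ℝ φ z V := by
    refine (hc.fderiv (𝕜 := ℝ)).mono ?_
    intro z hz hz'
    exact hz (by simp [hz'])
  have h3 := h1.integrable_of_hasCompactSupport (μ := volume) h2
  refine ⟨h3, ?_⟩
  have := integral_mul_fderiv_eq_neg_fderiv_mul_of_integrable (μ := (volume : Measure Phase))
    (f := fun _ => (1 : ℂ)) (g := φ) (v := V) (by simp) (by simpa using h3)
    (by simpa using hφ.continuous.integrable_of_hasCompactSupport hc)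
    (fun x _ => differentiableAt_const _) (fun x _ => (hφ.differentiable (by norm_num)) x)
  simpa using this

theorem fderiv_fderiv_comm {u : Phase → ℝ} {z : Phase} (hu : ContDiffAt ℝ ∞ u z) (V W : Phase) :
    fderiv ℝ (fun y => fderiv ℝ u y V) z W = fderiv ℝ (fun y => fderiv ℝ u y W) z V := by
  have hd : DifferentiableAt ℝ (fderiv ℝ u) z :=
    (hu.fderiv_right (m := ∞) (by simp)).differentiableAt (by simp)
  have hs := hu.isSymmSndFDerivAt (by simpa using WithTop.coe_le_coe.2 (le_top : (2 : ℕ∞) ≤ ⊤))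
  have h : ∀ V W, fderiv ℝ (fun y => fderiv ℝ u y V) z W = fderiv ℝ (fderiv ℝ u) z W V := by
    intro V W
    rw [fderiv_clm_apply hd (differentiableAt_const _)]
    simp
  rw [h, h, hs.eq]

namespace Data

variable {D : Data}

/-- The Hamilton vector field of the dual metric. -/
def hamVec (D : Data) (z : Phase) : Phase := (fun j => dXi j D.Gfun z, fun j => -dX j D.Gfun z)

theorem sum_single_fst (a : R4) : (a, (0 : R4)) = ∑ j, a j • ((Pi.single j 1 : R4), (0 : R4)) := by
  ext i <;> simp [Prod.fst_sum, Prod.snd_sum, Pi.single_apply]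

theorem sum_single_snd (a : R4) : ((0 : R4), a) = ∑ j, a j • ((0 : R4), (Pi.single j 1 : R4)) := by
  ext i <;> simp [Prod.fst_sum, Prod.snd_sum, Pi.single_apply]

theorem ham_eq_fderiv (u : Phase → ℂ) (z : Phase) : D.ham u z = fderiv ℝ u z (D.hamVec z) := by
  have : D.hamVec z = ((D.hamVec z).1, (0 : R4)) + ((0 : R4), (D.hamVec z).2) := by simp
  rw [this, map_add, sum_single_fst, sum_single_snd, map_sum, map_sum, ham,
    ← Finset.sum_add_distrib]
  refine Finset.sum_congr rfl fun j _ => ?_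
  rw [map_smul, map_smul]
  simp [hamVec, dX, dXi]
  ring

theorem Subextremal.integral_ham_eq_zero (hD : D.Subextremal) {φ : Phase → ℂ}
    (hφ : ContDiff ℝ ∞ φ) (hc : HasCompactSupport φ) (hs : ∀ z ∈ tsupport φ, z.1 ∈ D.reg) :
    Integrable (D.ham φ) ∧ ∫ z, D.ham φ z = 0 := by
  have hsm : ∀ V : Phase, ∀ z ∈ tsupport φ, ContDiffAt ℝ ∞ (fun y => fderiv ℝ D.Gfun y V) z := by
    intro V z hz
    exact ((hD.contDiffAt_Gfun (hs z hz)).fderiv_right (m := ∞) (by simp)).clm_apply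
      contDiffAt_const
  have hprod : ∀ V : Phase, ContDiff ℝ 1 (fun y => ((fderiv ℝ D.Gfun y V : ℝ) : ℂ) * φ y) ∧
      HasCompactSupport (fun y => ((fderiv ℝ D.Gfun y V : ℝ) : ℂ) * φ y) := by
    intro V
    have hsub : tsupport (fun y => ((fderiv ℝ D.Gfun y V : ℝ) : ℂ) * φ y) ⊆ tsupport φ :=
      closure_mono fun y hy hy' => hy (by simp [hy'])
    refine ⟨contDiff_of_forall_mem_tsupport fun z hz => ?_, hc.mul_left⟩
    exact ((contDiffAt_ofReal (hsm V z (hsub hz))).mul hφ.contDiffAt).of_le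
      (by exact_mod_cast le_top)
  have hd : ∀ V W z, z ∈ tsupport φ → fderiv ℝ (fun y => ((fderiv ℝ D.Gfun y V : ℝ) : ℂ) * φ y) z W
      = ((fderiv ℝ D.Gfun z V : ℝ) : ℂ) * fderiv ℝ φ z W
        + φ z * ((fderiv ℝ (fun y => fderiv ℝ D.Gfun y V) z W : ℝ) : ℂ) := by
    intro V W z hz
    have h1 := hasDerivAt_line ((hsm V z hz).differentiableAt (by simp)) W
    have h2 := hasDerivAt_line ((hφ.differentiable (by simp)) z) W
    have h3 := hasDerivAt_line ((((hprod V).1).differentiable (by norm_num)) z) W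
    refine h3.unique ((h1.ofReal_comp.fun_mul h2).congr_deriv ?_)
    simp
    ring
  have key : ∀ z, D.ham φ z = ∑ j : Fin 4,
      (fderiv ℝ (fun y => ((fderiv ℝ D.Gfun y (0,
        Pi.single j 1) : ℝ) : ℂ) * φ y) z (Pi.single j 1, 0)
      - fderiv ℝ (fun y => ((fderiv ℝ D.Gfun y (Pi.single j 1, 0) : ℝ) : ℂ) * φ y) z
          (0, Pi.single j 1)) := by
    intro z
    by_cases hz : z ∈ tsupport φ
    · rw [ham]
      refine Finset.sum_congr rfl fun j _ => ?_
      rw [hd _ _ z hz, hd _ _ z hz, fderiv_fderiv_comm (hD.contDiffAt_Gfun (hs z hz))]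
      simp only [dX, dXi]
      ring
    · have h0 : φ =ᶠ[nhds z] fun _ => 0 := notMem_tsupport_iff_eventuallyEq.mp hz
      have h1 : ∀ V : Phase, fderiv ℝ (fun y => ((fderiv ℝ D.Gfun y V : ℝ) : ℂ) * φ y) z = 0 := by
        intro V
        have : (fun y => ((fderiv ℝ D.Gfun y V : ℝ) : ℂ) * φ y) =ᶠ[nhds z] fun _ => 0 := by
          filter_upwards [h0] with y hy
          rw [hy, mul_zero]
        rw [this.fderiv_eq, fderiv_fun_const]
        rfl
      rw [ham_eq_fderiv, h0.fderiv_eq, fderiv_fun_const]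
      simp [h1]
  have hI := fun V W => integral_fderiv_eq_zero (hprod V).1 (hprod V).2 W
  have hfun : D.ham φ = fun z => _ := funext key
  rw [hfun]
  refine ⟨integrable_finsetSum _ fun j _ => (hI _ _).1.sub (hI _ _).1, ?_⟩
  refine (integral_finsetSum _ fun j _ => (hI _ _).1.sub (hI _ _).1).trans ?_
  refine Finset.sum_eq_zero fun j _ => ?_
  refine (integral_sub (hI _ _).1 (hI _ _).1).trans ?_
  rw [(hI _ _).2, (hI _ _).2, sub_zero]

end Data

/-! ### Forms on the fibers as matrices -/

/-- Pairs of tensor indices. -/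
abbrev Idx : Type := Fin 4 × Fin 4

/-- The matrix of a real form on the fibers. -/
def coef (C : FiberForm) (z : Phase) : Matrix Idx Idx ℝ :=
  Matrix.of fun a b => C z a.1 a.2 b.1 b.2

/-- The value of a real form on two real tensors. -/
def formEval (C : FiberForm) (z : Phase) (x y : Mat4) : ℝ :=
  ∑ i, ∑ j, ∑ k, ∑ l, C z i j k l * x i j * y k l

/-- The symmetrization of an elementary matrix. -/
def symE (k l : Fin 4) : Mat4 := (1 / 2 : ℝ) • (Matrix.single k l 1 + Matrix.single l k 1)

theorem symE_isSymm (k l : Fin 4) : (symE k l).IsSymm := by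
  refine IsSymm.smul ?_ _
  rw [IsSymm, transpose_add, transpose_single, transpose_single, add_comm]

theorem symE_comm (k l : Fin 4) : symE k l = symE l k := by
  rw [symE, symE, add_comm]

theorem eq_sum_symE {x : Mat4} (hx : x.IsSymm) : x = ∑ b : Idx, x b.1 b.2 • symE b.1 b.2 := by
  have h1 : x = ∑ b : Idx, x b.1 b.2 • Matrix.single b.1 b.2 (1 : ℝ) := by
    conv_lhs => rw [matrix_eq_sum_single x]
    rw [Fintype.sum_prod_type]
    simp [smul_single]
  have h2 : x = ∑ b : Idx, x b.1 b.2 • Matrix.single b.2 b.1 (1 : ℝ) := by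
    conv_lhs => rw [← hx.eq, h1]
    rw [transpose_sum]
    simp [transpose_single]
  have h3 : ∑ b : Idx, x b.1 b.2 • symE b.1 b.2 = (1 / 2 : ℝ) • (x + x) := by
    nth_rewrite 2 [h1]
    nth_rewrite 3 [h2]
    rw [← Finset.sum_add_distrib, Finset.smul_sum]
    refine Finset.sum_congr rfl fun b _ => ?_
    rw [symE, smul_comm, smul_add]
  rw [h3, ← two_smul ℝ x, smul_smul]
  norm_num

theorem pairing_eq (C : FiberForm) (z : Phase) (u v : Tens) :
    pairing C z u v = (fun a : Idx => (starRingEnd ℂ) (u a.1 a.2)) ⬝ᵥ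
      ((coef C z).map (fun r : ℝ => (r : ℂ)) *ᵥ fun a : Idx => v a.1 a.2) := by
  simp only [pairing, dotProduct, mulVec, Fintype.sum_prod_type, Finset.mul_sum, coef,
    Matrix.map_apply, Matrix.of_apply]
  refine Finset.sum_congr rfl fun i _ => Finset.sum_congr rfl fun j _ =>
    Finset.sum_congr rfl fun k _ => Finset.sum_congr rfl fun l _ => by ring

theorem formEval_eq (C : FiberForm) (z : Phase) (x y : Mat4) :
    formEval C z x y = (fun a : Idx => x a.1 a.2) ⬝ᵥ (coef C z *ᵥ fun a : Idx => y a.1 a.2) := by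
  simp only [formEval, dotProduct, mulVec, Fintype.sum_prod_type, Finset.mul_sum, coef,
    Matrix.of_apply]
  refine Finset.sum_congr rfl fun i _ => Finset.sum_congr rfl fun j _ =>
    Finset.sum_congr rfl fun k _ => Finset.sum_congr rfl fun l _ => by ring

theorem re_conj_dotProduct (Q : Matrix Idx Idx ℝ) (v : Idx → ℂ) :
    ((fun a => (starRingEnd ℂ) (v a)) ⬝ᵥ (Q.map (fun r : ℝ => (r : ℂ)) *ᵥ v)).re
      = (fun a => (v a).re) ⬝ᵥ (Q *ᵥ fun a => (v a).re)
        + (fun a => (v a).im) ⬝ᵥ (Q *ᵥ fun a => (v a).im) := by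
  simp only [dotProduct, mulVec, Finset.mul_sum, Complex.re_sum, ← Finset.sum_add_distrib,
    Matrix.map_apply]
  refine Finset.sum_congr rfl fun a _ => Finset.sum_congr rfl fun b _ => ?_
  simp

theorem trv_add (g G u v : Mat4) : trv g G (u + v) = trv g G u + trv g G v := by
  simp only [trv, Matrix.mul_add, trace_add, add_div, add_smul]
  abel

theorem dampM_add (e : ℝ) (g G : Mat4) (c X : R4) (u v : Mat4) :
    dampM e g G c X (u + v) = dampM e g G c X u + dampM e g G c X v := by
  rw [dampM, dampM, dampM, ← trv_add, trv_add g G u v]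
  congr 1
  ext i j
  simp only [add_mulVec, bl_add, Matrix.sub_apply, Matrix.smul_apply, Matrix.add_apply,
    vecMulVec_apply, Pi.add_apply, smul_eq_mul]
  ring

theorem dampM_smul_right (e : ℝ) (g G : Mat4) (c X : R4) (a : ℝ) (u : Mat4) :
    dampM e g G c X (a • u) = a • dampM e g G c X u := by
  rw [dampM, dampM, ← trv_smul, trv_smul g G a u]
  congr 1
  ext i j
  simp only [smul_mulVec, bl_smul, Matrix.sub_apply, Matrix.smul_apply, Matrix.add_apply,
    vecMulVec_apply, Pi.smul_apply, smul_eq_mul]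
  ring

theorem pairing_self_re (C : FiberForm) (z : Phase) (v : Tens) :
    (pairing C z v v).re = formEval C z (Matrix.of fun i j => (v i j).re)
        (Matrix.of fun i j => (v i j).re)
      + formEval C z (Matrix.of fun i j => (v i j).im) (Matrix.of fun i j => (v i j).im) := by
  rw [pairing_eq, re_conj_dotProduct (coef C z) fun a => v a.1 a.2, formEval_eq, formEval_eq]
  rfl

namespace Data

variable {D : Data}

theorem potential_add (D : Data) (κ e h : ℝ) (z : Phase) (u v : Mat4) :
    D.potential κ e h z (u + v) = D.potential κ e h z u + D.potential κ e h z v := by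
  rw [potential, dampM_add]
  simp only [potential, Matrix.mul_add, Matrix.add_mul, smul_add]
  abel

theorem potential_smul (D : Data) (κ e h : ℝ) (z : Phase) (a : ℝ) (u : Mat4) :
    D.potential κ e h z (a • u) = a • D.potential κ e h z u := by
  rw [potential, dampM_smul_right]
  simp only [potential, Matrix.mul_smul, Matrix.smul_mul, smul_add, smul_comm a]

theorem potential_isSymm (D : Data) (κ e h : ℝ) (z : Phase) {u : Mat4} (hu : u.IsSymm) :
    (D.potential κ e h z u).IsSymm := by
  refine IsSymm.add ?_ ((dampM_isSymm (D.metric_isSymm z.1) _ _).smul _)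
  rw [IsSymm, transpose_add, transpose_mul, transpose_mul, transpose_transpose, hu.eq, add_comm]

/-- The matrix of the zeroth order part of the subprincipal operator. -/
def potM (D : Data) (κ e h : ℝ) (z : Phase) : Matrix Idx Idx ℝ :=
  Matrix.of fun a b => D.potential κ e h z (symE b.1 b.2) a.1 a.2

theorem potential_eq_potM (D : Data) (κ e h : ℝ) (z : Phase) {x : Mat4} (hx : x.IsSymm) :
    (fun a : Idx => D.potential κ e h z x a.1 a.2)
      = D.potM κ e h z *ᵥ fun a : Idx => x a.1 a.2 := by
  have hl : IsLinearMap ℝ (D.potential κ e h z) :=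
    ⟨D.potential_add κ e h z, D.potential_smul κ e h z⟩
  funext a
  conv_lhs => rw [eq_sum_symE hx]
  have := map_sum hl.mk' (fun b : Idx => x b.1 b.2 • symE b.1 b.2) Finset.univ
  simp only [IsLinearMap.mk'_apply, D.potential_smul] at this
  rw [this, Matrix.sum_apply]
  simp only [mulVec, dotProduct, potM, Matrix.of_apply, Matrix.smul_apply, smul_eq_mul]
  exact Finset.sum_congr rfl fun b _ => mul_comm _ _

theorem potM_swap (D : Data) (κ e h : ℝ) (z : Phase) :
    (D.potM κ e h z).submatrix Prod.swap Prod.swap = D.potM κ e h z := by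
  ext a b
  simp only [potM, submatrix_apply, Matrix.of_apply, Prod.fst_swap, Prod.snd_swap]
  rw [symE_comm, (D.potential_isSymm κ e h z (symE_isSymm _ _)).apply]

theorem Subextremal.continuousAt_potM (hD : D.Subextremal) (κ e h : ℝ) {z : Phase}
    (hz : z.1 ∈ D.reg) : ContinuousAt (D.potM κ e h) z := by
  have hg : ContinuousAt (fun y : Phase => D.metric y.1) z :=
    continuousAt_pi.2 fun i => continuousAt_pi.2 fun j =>
      (contDiffAt_comp_fst (hD.contDiffAt_metric hz i j)).continuousAt
  have hG : ContinuousAt (fun y : Phase => D.dual y.1) z :=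
    continuousAt_pi.2 fun i => continuousAt_pi.2 fun j =>
      (contDiffAt_comp_fst (hD.contDiffAt_dual hz i j)).continuousAt
  have hc : ContinuousAt (fun y : Phase => D.cVec κ y.1) z :=
    continuousAt_pi.2 fun i => (contDiffAt_comp_fst (contDiffAt_cVec hD hz κ i)).continuousAt
  have hs : ContinuousAt (fun y : Phase => D.sharp y) z :=
    continuousAt_pi.2 fun i => (hD.contDiffAt_sharp hz i).continuousAt
  have hA : ContinuousAt (fun y : Phase => D.connAlong y) z := by
    unfold connAlong
    refine tendsto_finsetSum _ fun k _ => ?_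
    refine ContinuousAt.smul (continuousAt_const.mul (continuousAt_pi.1 hs k)) ?_
    exact continuousAt_pi.2 fun i => continuousAt_pi.2 fun j =>
      (contDiffAt_comp_fst (hD.contDiffAt_chris hz i k j)).continuousAt
  have hcont : ∀ u : Mat4, Continuous fun q : Mat4 × Mat4 × Mat4 × R4 × R4 =>
      q.1ᵀ * u + u * q.1 + (2 / h) • dampM e q.2.1 q.2.2.1 q.2.2.2.1 q.2.2.2.2 u := by
    intro u
    unfold dampM trv bl
    fun_prop
  refine continuousAt_pi.2 fun a => continuousAt_pi.2 fun b => ?_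
  have := (hcont (symE b.1 b.2)).continuousAt.comp
    (hA.prodMk (hg.prodMk (hG.prodMk (hc.prodMk hs))))
  exact continuousAt_pi.1 (continuousAt_pi.1 this a.1) a.2

theorem Subextremal.continuousAt_hamVec (hD : D.Subextremal) {z : Phase} (hz : z.1 ∈ D.reg) :
    ContinuousAt D.hamVec z := by
  have hf : ContinuousAt (fderiv ℝ D.Gfun) z :=
    ((hD.contDiffAt_Gfun hz).fderiv_right (m := ∞) (by simp)).continuousAt
  exact (continuousAt_pi.2 fun j => hf.clm_apply continuousAt_const).prodMk
    (continuousAt_pi.2 fun j => (hf.clm_apply continuousAt_const).neg)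

/-- The derivative of a form on the fibers along the Hamilton flow. -/
def hamCoef (D : Data) (C : FiberForm) (z : Phase) : Matrix Idx Idx ℝ :=
  Matrix.of fun a b => fderiv ℝ (fun y => C y a.1 a.2 b.1 b.2) z (D.hamVec z)

/-- The zeroth order part of the adjoint of the subprincipal operator divided by `-i`. -/
def adjM (D : Data) (κ e h : ℝ) (C : FiberForm) (z : Phase) : Matrix Idx Idx ℝ :=
  (coef C z)⁻¹ * (D.hamCoef C z + (D.potM κ e h z)ᵀ * coef C z)

/-- The formal adjoint of the subprincipal operator. -/
def adjSsub (D : Data) (κ e h : ℝ) (C : FiberForm) (v : Phase → Tens) (z : Phase) : Tens :=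
  fun i j => -Complex.I * D.ham (fun y => v y i j) z
    - Complex.I * ((D.adjM κ e h C z).map (fun r : ℝ => (r : ℂ)) *ᵥ
      fun a : Idx => v z a.1 a.2) (i, j)

theorem adjM_swap (D : Data) (κ e h : ℝ) {C : FiberForm}
    (hswap : ∀ z i j k l, C z j i l k = C z i j k l) (z : Phase) :
    (D.adjM κ e h C z).submatrix Prod.swap Prod.swap = D.adjM κ e h C z := by
  have hC : (coef C z).submatrix (Equiv.prodComm _ _) (Equiv.prodComm _ _) = coef C z := by
    ext a b
    exact hswap z _ _ _ _
  have hH : (D.hamCoef C z).submatrix (Equiv.prodComm _ _) (Equiv.prodComm _ _)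
      = D.hamCoef C z := by
    ext a b
    simp [hamCoef, hswap]
  have hN : (D.potM κ e h z).submatrix (Equiv.prodComm _ _) (Equiv.prodComm _ _)
      = D.potM κ e h z := D.potM_swap κ e h z
  change (D.adjM κ e h C z).submatrix (Equiv.prodComm _ _) (Equiv.prodComm _ _) = _
  have hNC : ((D.potM κ e h z)ᵀ * coef C z).submatrix (Equiv.prodComm _ _) (Equiv.prodComm _ _)
      = (D.potM κ e h z)ᵀ * coef C z := by
    rw [← submatrix_mul_equiv _ _ _ (Equiv.prodComm (Fin 4) (Fin 4)), ← transpose_submatrix, hN, hC]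
  have hsum : (D.hamCoef C z + (D.potM κ e h z)ᵀ * coef C z).submatrix (Equiv.prodComm _ _)
      (Equiv.prodComm _ _) = D.hamCoef C z + (D.potM κ e h z)ᵀ * coef C z := by
    conv_rhs => rw [← hH, ← hNC]
    rfl
  rw [adjM, ← submatrix_mul_equiv _ _ _ (Equiv.prodComm (Fin 4) (Fin 4)), hsum,
    ← inv_submatrix_equiv, hC]

end Data

namespace Data

variable {D : Data} {U : Set Phase} {C : FiberForm}

theorem contDiffAt_coef (hU : IsOpen U) (hC : ContDiffOn ℝ ∞ C U) {z : Phase} (hz : z ∈ U)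
    (i j k l : Fin 4) : ContDiffAt ℝ ∞ (fun y => C y i j k l) z := by
  have h := (hC z hz).contDiffAt (hU.mem_nhds hz)
  exact contDiffAt_pi.1 (contDiffAt_pi.1 (contDiffAt_pi.1 (contDiffAt_pi.1 h i) j) k) l

theorem det_coef_ne_zero {z : Phase}
    (hpos : ∀ x : Mat4, x ≠ 0 → 0 < formEval C z x x) : (coef C z).det ≠ 0 := by
  intro h0
  obtain ⟨v, hv, hv0⟩ := exists_mulVec_eq_zero_iff.2 h0
  have h1 : (Matrix.of fun i j => v (i, j) : Mat4) ≠ 0 := by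
    intro h
    refine hv (funext fun a => ?_)
    exact congrFun (congrFun h a.1) a.2
  have h2 := hpos _ h1
  rw [formEval_eq] at h2
  simp only [Matrix.of_apply, Prod.mk.eta] at h2
  change 0 < _ ⬝ᵥ (coef C z *ᵥ v) at h2
  rw [hv0, dotProduct_zero] at h2
  exact lt_irrefl _ h2

theorem continuousAt_ham (hD : D.Subextremal) {z : Phase} (hz : z.1 ∈ D.reg) {u : Phase → ℂ}
    (hu : ContDiff ℝ ∞ u) : ContinuousAt (D.ham u) z := by
  have : D.ham u = fun z => fderiv ℝ u z (D.hamVec z) := funext fun z => ham_eq_fderiv u z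
  rw [this]
  exact (hu.continuous_fderiv (by simp)).continuousAt.clm_apply (hD.continuousAt_hamVec hz)

theorem Subextremal.continuousAt_adjM (hD : D.Subextremal) (κ e h : ℝ) (hU : IsOpen U)
    (hreg : ∀ z ∈ U, z.1 ∈ D.reg) (hC : ContDiffOn ℝ ∞ C U)
    (hpos : ∀ z ∈ U, ∀ x : Mat4, x ≠ 0 → 0 < formEval C z x x) {z : Phase} (hz : z ∈ U) :
    ContinuousAt (D.adjM κ e h C) z := by
  have hc : ContinuousAt (coef C) z := continuousAt_pi.2 fun a => continuousAt_pi.2 fun b =>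
    (contDiffAt_coef hU hC hz _ _ _ _).continuousAt
  have hH : ContinuousAt (D.hamCoef C) z := continuousAt_pi.2 fun a => continuousAt_pi.2 fun b =>
    ((contDiffAt_coef hU hC hz _ _ _ _).fderiv_right (m := ∞) (by simp)).continuousAt.clm_apply
      (hD.continuousAt_hamVec (hreg z hz))
  have hi : ContinuousAt (fun y => (coef C y)⁻¹) z := by
    refine ContinuousAt.comp (g := Inv.inv) (continuousAt_matrix_inv _ ?_) hc
    rw [Ring.inverse_eq_inv']
    exact continuousAt_inv₀ (det_coef_ne_zero (hpos z hz))
  have hN := hD.continuousAt_potM κ e h (hreg z hz)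
  have hcont : Continuous fun q : Matrix Idx Idx ℝ × Matrix Idx Idx ℝ × Matrix Idx Idx ℝ
      × Matrix Idx Idx ℝ => q.1 * (q.2.1 + q.2.2.1ᵀ * q.2.2.2) := by fun_prop
  exact hcont.continuousAt.comp (hi.prodMk (hH.prodMk (hN.prodMk hc)))

theorem Subextremal.continuousAt_adjSsub (hD : D.Subextremal) (κ e h : ℝ) (hU : IsOpen U)
    (hreg : ∀ z ∈ U, z.1 ∈ D.reg) (hC : ContDiffOn ℝ ∞ C U)
    (hpos : ∀ z ∈ U, ∀ x : Mat4, x ≠ 0 → 0 < formEval C z x x) {v : Phase → Tens}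
    (hv : IsTestSection U v) {z : Phase} (hz : z ∈ U) :
    ContinuousAt (D.adjSsub κ e h C v) z := by
  have hvc : ∀ i j, ContDiff ℝ ∞ fun y => v y i j := fun i j =>
    contDiff_pi.1 (contDiff_pi.1 hv.smooth i) j
  have hA := hD.continuousAt_adjM κ e h hU hreg hC hpos hz
  refine continuousAt_pi.2 fun i => continuousAt_pi.2 fun j => ?_
  refine (continuousAt_const.mul (continuousAt_ham hD (hreg z hz) (hvc i j))).sub
    (continuousAt_const.mul ?_)
  simp only [mulVec, dotProduct, Matrix.map_apply]
  refine tendsto_finsetSum _ fun b _ => ContinuousAt.mul ?_ (hvc _ _).continuous.continuousAt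
  exact Complex.continuous_ofReal.continuousAt.comp
    (continuousAt_pi.1 (continuousAt_pi.1 hA (i, j)) b)

/-- The subprincipal operator on symmetric tensors, in terms of the matrix of its zeroth order
part. -/
theorem Subextremal.Ssub_eq (hD : D.Subextremal) (κ e h : ℝ) {v : Phase → Tens} {z : Phase}
    (hz : z.1 ∈ D.reg) (hv : IsSymTens (v z)) (a : Idx) :
    D.Ssub (D.linEinstein κ e h) v z a.1 a.2
      = Complex.I * ((D.potM κ e h z).map (fun r : ℝ => (r : ℂ)) *ᵥ fun b : Idx => v z b.1 b.2) a
        - Complex.I * D.ham (fun y => v y a.1 a.2) z := by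
  have hre : (Matrix.of fun i j => (v z i j).re : Mat4).IsSymm := by ext i j; simp [hv i j]
  have him : (Matrix.of fun i j => (v z i j).im : Mat4).IsSymm := by ext i j; simp [hv i j]
  rw [Ssub, hD.subSymbol_eq_potential κ e h hz hv]
  have h1 : D.potential κ e h z (Matrix.of fun i j => (v z i j).re) a.1 a.2 = _ :=
    congrFun (D.potential_eq_potM κ e h z hre) a
  have h2 : D.potential κ e h z (Matrix.of fun i j => (v z i j).im) a.1 a.2 = _ :=
    congrFun (D.potential_eq_potM κ e h z him) a
  rw [h1, h2]
  congr 2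
  simp only [mulVec, dotProduct, Complex.ofReal_sum, Finset.mul_sum, ← Finset.sum_add_distrib,
    Matrix.map_apply, Matrix.of_apply]
  refine Finset.sum_congr rfl fun b _ => ?_
  conv_rhs => rw [← Complex.re_add_im (v z b.1 b.2)]
  push_cast
  ring

theorem ham_conj (D : Data) (u : Phase → ℂ) (z : Phase) :
    D.ham (fun y => (starRingEnd ℂ) (u y)) z = (starRingEnd ℂ) (D.ham u z) := by
  have h : fderiv ℝ (fun y => (starRingEnd ℂ) (u y)) z
      = (Complex.conjCLE : ℂ →L[ℝ] ℂ).comp (fderiv ℝ u z) :=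
    Complex.conjCLE.comp_fderiv (f := u) (x := z)
  rw [ham_eq_fderiv, ham_eq_fderiv, h]
  rfl

theorem ham_pairing (hU : IsOpen U) (hC : ContDiffOn ℝ ∞ C U) {u v : Phase → Tens}
    (hu : IsTestSection U u) (hv : IsTestSection U v) {z : Phase} (hz : z ∈ U) :
    D.ham (fun y => pairing C y (u y) (v y)) z
      = (fun a : Idx => (starRingEnd ℂ) (u z a.1 a.2)) ⬝ᵥ
          ((D.hamCoef C z).map (fun r : ℝ => (r : ℂ)) *ᵥ fun a : Idx => v z a.1 a.2)
        + (fun a : Idx => (starRingEnd ℂ) (D.ham (fun y => u y a.1 a.2) z)) ⬝ᵥ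
          ((coef C z).map (fun r : ℝ => (r : ℂ)) *ᵥ fun a : Idx => v z a.1 a.2)
        + (fun a : Idx => (starRingEnd ℂ) (u z a.1 a.2)) ⬝ᵥ
          ((coef C z).map (fun r : ℝ => (r : ℂ)) *ᵥ fun a :
            Idx => D.ham (fun y => v y a.1 a.2) z) := by
  have huc : ∀ i j, ContDiff ℝ ∞ fun y => (starRingEnd ℂ) (u y i j) := fun i j =>
    Complex.conjCLE.contDiff.comp (contDiff_pi.1 (contDiff_pi.1 hu.smooth i) j)
  have hvc : ∀ i j, ContDiff ℝ ∞ fun y => v y i j := fun i j =>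
    contDiff_pi.1 (contDiff_pi.1 hv.smooth i) j
  simp only [pairing_eq, ← ham_conj]
  simp only [ham_eq_fderiv]
  simp only [dotProduct, mulVec, Finset.mul_sum, ← Finset.sum_add_distrib, Matrix.map_apply]
  have hd : HasDerivAt (fun t : ℝ => ∑ a : Idx, ∑ b : Idx,
      (starRingEnd ℂ) (u (z + t • D.hamVec z) a.1 a.2)
        * (((coef C (z + t • D.hamVec z) a b : ℝ) : ℂ) * v (z + t • D.hamVec z) b.1 b.2))
      (∑ a : Idx, ∑ b : Idx, ((starRingEnd ℂ) (u z a.1 a.2) * ((D.hamCoef C z a b :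
        ℂ) * v z b.1 b.2)
        + fderiv ℝ (fun y => (starRingEnd ℂ) (u y a.1 a.2)) z (D.hamVec z)
          * ((coef C z a b : ℂ) * v z b.1 b.2)
        + (starRingEnd ℂ) (u z a.1 a.2) * ((coef C z a b : ℂ)
          * fderiv ℝ (fun y => v y b.1 b.2) z (D.hamVec z)))) 0 := by
    refine HasDerivAt.fun_sum fun a _ => HasDerivAt.fun_sum fun b _ => ?_
    have h1 := hasDerivAt_line ((huc a.1 a.2).differentiable (by simp) z) (D.hamVec z)
    have h2 := hasDerivAt_line ((hvc b.1 b.2).differentiable (by simp) z) (D.hamVec z)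
    have h3 := (hasDerivAt_line ((contDiffAt_coef hU hC hz a.1 a.2 b.1 b.2).differentiableAt
      (by simp)) (D.hamVec z)).ofReal_comp
    refine (h1.fun_mul (h3.fun_mul h2)).congr_deriv ?_
    simp [hamCoef, coef]
    ring
  refine (hasDerivAt_line ?_ _).unique hd
  refine DifferentiableAt.fun_sum fun a _ => DifferentiableAt.fun_sum fun b _ => ?_
  exact ((huc a.1 a.2).differentiable (by simp) z).fun_mul
    ((contDiffAt_ofReal (contDiffAt_coef hU hC hz a.1 a.2 b.1 b.2)).differentiableAt
      (by simp) |>.fun_mul ((hvc b.1 b.2).differentiable (by simp) z))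

end Data

namespace Data

variable {D : Data} {U : Set Phase} {C : FiberForm}

/-- The adjoint relation for the zeroth order parts. -/
theorem coef_mul_adjM (D : Data) (κ e h : ℝ) {z : Phase}
    (hpos : ∀ x : Mat4, x ≠ 0 → 0 < formEval C z x x) :
    coef C z * D.adjM κ e h C z = D.hamCoef C z + (D.potM κ e h z)ᵀ * coef C z := by
  rw [adjM, ← Matrix.mul_assoc, mul_nonsing_inv _ (isUnit_iff_ne_zero.2 (det_coef_ne_zero hpos)),
    Matrix.one_mul]

theorem map_ofReal_mul (A B : Matrix Idx Idx ℝ) :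
    (A * B).map (fun r : ℝ => (r : ℂ)) = A.map (fun r : ℝ => (r : ℂ)) * B.map (fun r : ℝ => (r :
      ℂ)) :=
  Matrix.map_mul (f := Complex.ofRealHom)

theorem map_ofReal_add (A B : Matrix Idx Idx ℝ) :
    (A + B).map (fun r : ℝ => (r : ℂ)) = A.map (fun r : ℝ => (r : ℂ)) + B.map (fun r : ℝ => (r :
      ℂ)) := by
  ext a b
  simp

theorem Subextremal.pairing_Ssub (hD : D.Subextremal) (κ e h : ℝ) (hU : IsOpen U)
    (hreg : ∀ z ∈ U, z.1 ∈ D.reg) (hC : ContDiffOn ℝ ∞ C U)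
    (hpos : ∀ z ∈ U, ∀ x : Mat4, x ≠ 0 → 0 < formEval C z x x) {u v : Phase → Tens}
    (hu : IsTestSection U u) (hv : IsTestSection U v) {z : Phase} (hz : z ∈ U) :
    pairing C z (D.Ssub (D.linEinstein κ e h) u z) (v z)
      = pairing C z (u z) (D.adjSsub κ e h C v z)
        + Complex.I * D.ham (fun y => pairing C y (u y) (v y)) z := by
  rw [ham_pairing hU hC hu hv hz, pairing_eq, pairing_eq]
  set Cc := (coef C z).map (fun r : ℝ => (r : ℂ)) with hCc
  set Nc := (D.potM κ e h z).map (fun r : ℝ => (r : ℂ)) with hNc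
  set Tc := (D.adjM κ e h C z).map (fun r : ℝ => (r : ℂ)) with hTc
  set Hc := (D.hamCoef C z).map (fun r : ℝ => (r : ℂ)) with hHc
  set u' : Idx → ℂ := fun a => (starRingEnd ℂ) (u z a.1 a.2) with hu'
  set v' : Idx → ℂ := fun a => v z a.1 a.2 with hv'
  set Hu : Idx → ℂ := fun a => (starRingEnd ℂ) (D.ham (fun y => u y a.1 a.2) z) with hHu
  set Hv : Idx → ℂ := fun a => D.ham (fun y => v y a.1 a.2) z with hHv
  have hCT : Cc * Tc = Hc + Ncᵀ * Cc := by
    rw [hCc, hTc, ← map_ofReal_mul, D.coef_mul_adjM κ e h (hpos z hz), map_ofReal_add,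
      map_ofReal_mul]
    rfl
  have hS : (fun a : Idx => (starRingEnd ℂ) (D.Ssub (D.linEinstein κ e h) u z a.1 a.2))
      = Complex.I • Hu - Complex.I • (Nc *ᵥ u') := by
    funext a
    rw [hD.Ssub_eq κ e h (hreg z hz) (hu.symm z)]
    have : (starRingEnd ℂ) (((D.potM κ e h z).map (fun r : ℝ => (r : ℂ)) *ᵥ
        fun b : Idx => u z b.1 b.2) a) = (Nc *ᵥ u') a := by
      simp [mulVec, dotProduct, hNc, hu']
    simp [map_sub, map_mul, this, hHu]
    ring
  have hS' : (fun a : Idx => D.adjSsub κ e h C v z a.1 a.2)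
      = -(Complex.I • Hv) - Complex.I • (Tc *ᵥ v') := by
    funext a
    simp [adjSsub, hHv, hTc, hv']
  rw [hS, hS']
  simp only [sub_dotProduct, smul_dotProduct, mulVec_sub, mulVec_neg, mulVec_smul, dotProduct_sub,
    dotProduct_neg, dotProduct_smul, mulVec_mulVec, hCT, add_mulVec, dotProduct_add, smul_eq_mul]
  have hN : (Nc *ᵥ u') ⬝ᵥ (Cc *ᵥ v') = u' ⬝ᵥ ((Ncᵀ * Cc) *ᵥ v') := by
    rw [← mulVec_mulVec, dotProduct_mulVec u' Ncᵀ, vecMul_transpose]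
  rw [hN]
  ring

theorem Subextremal.isFormalAdjoint_adjSsub (hD : D.Subextremal) (κ e h : ℝ) (hU : IsOpen U)
    (hreg : ∀ z ∈ U, z.1 ∈ D.reg) (hC : ContDiffOn ℝ ∞ C U)
    (hswap : ∀ z i j k l, C z j i l k = C z i j k l)
    (hpos : ∀ z ∈ U, ∀ x : Mat4, x ≠ 0 → 0 < formEval C z x x) :
    IsFormalAdjoint U C (D.Ssub (D.linEinstein κ e h)) (D.adjSsub κ e h C) := by
  intro v hv
  have hcont := fun z hz => hD.continuousAt_adjSsub κ e h hU hreg hC hpos hv (z := z) hz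
  refine ⟨fun z hz => (hcont z hz).continuousWithinAt, fun z hz i j => ?_, fun u hu => ?_⟩
  · have h1 : (fun y => v y i j) = fun y => v y j i := funext fun y => hv.symm y i j
    have h2 : ((D.adjM κ e h C z).map (fun r : ℝ => (r : ℂ)) *ᵥ fun a : Idx => v z a.1 a.2) (i, j)
        = ((D.adjM κ e h C z).map (fun r : ℝ => (r : ℂ)) *ᵥ fun a : Idx => v z a.1 a.2) (j, i) := by
      simp only [mulVec, dotProduct, Matrix.map_apply]
      rw [← Equiv.sum_comp (Equiv.prodComm (Fin 4) (Fin 4))]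
      refine Finset.sum_congr rfl fun b _ => ?_
      have h3 := congrFun (congrFun (D.adjM_swap κ e h hswap z) (j, i)) b
      rw [submatrix_apply] at h3
      rw [← h3, hv.symm z b.1 b.2]
      rfl
    simp only [adjSsub]
    rw [h1, h2]
  · set φ : Phase → ℂ := fun y => pairing C y (u y) (v y) with hφd
    have hzero : ∀ z, z ∉ tsupport u → φ =ᶠ[nhds z] fun _ => 0 := by
      intro z hz
      filter_upwards [notMem_tsupport_iff_eventuallyEq.mp hz] with y hy
      simp [hφd, pairing, hy]
    have hsub : tsupport φ ⊆ tsupport u := by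
      intro z hz
      by_contra hn
      exact notMem_tsupport_iff_eventuallyEq.mpr (hzero z hn) hz
    have huc : ∀ i j, ContDiff ℝ ∞ fun y => (starRingEnd ℂ) (u y i j) := fun i j =>
      Complex.conjCLE.contDiff.comp (contDiff_pi.1 (contDiff_pi.1 hu.smooth i) j)
    have hvc : ∀ i j, ContDiff ℝ ∞ fun y => v y i j := fun i j =>
      contDiff_pi.1 (contDiff_pi.1 hv.smooth i) j
    have hφ : ContDiff ℝ ∞ φ := by
      refine contDiff_of_forall_mem_tsupport fun z hz => ?_
      have hzU := hu.supp (hsub hz)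
      refine ContDiffAt.sum fun i _ => ContDiffAt.sum fun j _ => ContDiffAt.sum fun k _ =>
        ContDiffAt.sum fun l _ => ?_
      exact ((contDiffAt_ofReal (contDiffAt_coef hU hC hzU i j k l)).mul (huc i j).contDiffAt).mul
        (hvc k l).contDiffAt
    have hφc : HasCompactSupport φ := hu.compact.of_isClosed_subset (isClosed_tsupport _) hsub
    obtain ⟨hI, hI0⟩ := hD.integral_ham_eq_zero hφ hφc fun z hz => hreg z (hu.supp (hsub hz))
    set ψ : Phase → ℂ := fun z => pairing C z (u z) (D.adjSsub κ e h C v z) with hψd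
    have hψsub : tsupport ψ ⊆ tsupport u := by
      intro z hz
      by_contra hn
      refine notMem_tsupport_iff_eventuallyEq.mpr ?_ hz
      filter_upwards [notMem_tsupport_iff_eventuallyEq.mp hn] with y hy
      simp [hψd, pairing, hy]
    have hψ : Continuous ψ := by
      refine continuous_iff_continuousAt.2 fun z => ?_
      by_cases hz : z ∈ tsupport ψ
      · have hzU := hu.supp (hψsub hz)
        refine tendsto_finsetSum _ fun i _ => tendsto_finsetSum _ fun j _ =>
          tendsto_finsetSum _ fun k _ => tendsto_finsetSum _ fun l _ => ?_
        exact ((contDiffAt_ofReal (contDiffAt_coef hU hC hzU i j k l)).continuousAt.mul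
          (huc i j).continuous.continuousAt).mul
          (continuousAt_pi.1 (continuousAt_pi.1 (hcont z hzU) k) l)
      · exact continuousAt_const.congr (notMem_tsupport_iff_eventuallyEq.mp hz).symm
    have hψI : Integrable ψ :=
      hψ.integrable_of_hasCompactSupport (hu.compact.of_isClosed_subset (isClosed_tsupport _) hψsub)
    have hid : ∀ z, pairing C z (D.Ssub (D.linEinstein κ e h) u z) (v z)
        = ψ z + Complex.I * D.ham φ z := by
      intro z
      by_cases hz : z ∈ U
      · exact hD.pairing_Ssub κ e h hU hreg hC hpos hu hv hz
      · have hu0 : u z = 0 := image_eq_zero_of_notMem_tsupport fun hh => hz (hu.supp hh)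
        have hv0 : v z = 0 := image_eq_zero_of_notMem_tsupport fun hh => hz (hv.supp hh)
        have hφ0 := hzero z fun hh => hz (hu.supp hh)
        rw [ham_eq_fderiv, hφ0.fderiv_eq, fderiv_fun_const]
        simp [hψd, pairing, hu0, hv0]
    simp only [hid]
    rw [integral_add hψI (hI.const_mul _), integral_const_mul, hI0, mul_zero, add_zero]

theorem Subextremal.adjSsub_bound (hD : D.Subextremal) (κ e h : ℝ) (hU : IsOpen U)
    (hreg : ∀ z ∈ U, z.1 ∈ D.reg) (hC : ContDiffOn ℝ ∞ C U)
    (hsymm : ∀ z i j k l, C z i j k l = C z k l i j)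
    (hpos : ∀ z ∈ U, ∀ x : Mat4, x ≠ 0 → 0 < formEval C z x x) {z : Phase} (hz : z ∈ U)
    {s ε σ : ℝ} (hσ : σ ≠ 0)
    (hbd : ∀ x : Mat4, x.IsSymm → s * (fderiv ℝ (fun y => formEval C y x x) z (D.hamVec z)
      + 2 * formEval C z x (D.potential κ e h z x)) ≤ 2 * ε * |σ| * formEval C z x x)
    {v : Phase → Tens} (hv : IsTestSection U v) :
    s * (pairing C z (v z) ((1 / (2 * Complex.I * (|σ| : ℝ))) •
      (D.Ssub (D.linEinstein κ e h) v z - D.adjSsub κ e h C v z))).re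
      ≤ ε * (pairing C z (v z) (v z)).re := by
  have hσ' : 0 < |σ| := abs_pos.2 hσ
  set Q : Matrix Idx Idx ℝ := coef C z * D.potM κ e h z
    + (D.hamCoef C z + (D.potM κ e h z)ᵀ * coef C z) with hQ
  have hct : (coef C z)ᵀ = coef C z := by
    ext a b
    exact hsymm z _ _ _ _
  have hvec : (fun a : Idx => ((1 / (2 * Complex.I * (|σ| : ℝ))) •
      (D.Ssub (D.linEinstein κ e h) v z - D.adjSsub κ e h C v z)) a.1 a.2)
      = (((1 / (2 * |σ|) : ℝ)) : ℂ) • (((D.potM κ e h z).map (fun r : ℝ => (r : ℂ))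
        + (D.adjM κ e h C z).map (fun r : ℝ => (r : ℂ))) *ᵥ fun a : Idx => v z a.1 a.2) := by
    funext a
    simp only [Pi.smul_apply, Pi.sub_apply, smul_eq_mul, add_mulVec, Pi.add_apply]
    rw [hD.Ssub_eq κ e h (hreg z hz) (hv.symm z)]
    simp only [adjSsub, Prod.mk.eta]
    have h1 : ((|σ| : ℝ) : ℂ) ≠ 0 := by exact_mod_cast hσ'.ne'
    push_cast
    field_simp
    ring
  have hmain : (pairing C z (v z) ((1 / (2 * Complex.I * (|σ| : ℝ))) •
      (D.Ssub (D.linEinstein κ e h) v z - D.adjSsub κ e h C v z))).re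
      = 1 / (2 * |σ|) * ((fun a : Idx => (v z a.1 a.2).re) ⬝ᵥ (Q *ᵥ fun a => (v z a.1 a.2).re)
        + (fun a : Idx => (v z a.1 a.2).im) ⬝ᵥ (Q *ᵥ fun a => (v z a.1 a.2).im)) := by
    rw [pairing_eq, hvec, mulVec_smul, dotProduct_smul, mulVec_mulVec, Matrix.mul_add,
      ← map_ofReal_mul, ← map_ofReal_mul, ← map_ofReal_add, D.coef_mul_adjM κ e h (hpos z hz),
      ← hQ, smul_eq_mul, Complex.re_ofReal_mul, re_conj_dotProduct Q fun a => v z a.1 a.2]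
  have hx : ∀ x : Mat4, x.IsSymm → (fun a : Idx => x a.1 a.2) ⬝ᵥ (Q *ᵥ fun a => x a.1 a.2)
      = fderiv ℝ (fun y => formEval C y x x) z (D.hamVec z)
        + 2 * formEval C z x (D.potential κ e h z x) := by
    intro x hxs
    have h1 : fderiv ℝ (fun y => formEval C y x x) z (D.hamVec z)
        = (fun a : Idx => x a.1 a.2) ⬝ᵥ (D.hamCoef C z *ᵥ fun a => x a.1 a.2) := by
      have hd := fun i j k l => (contDiffAt_coef hU hC hz i j k l).differentiableAt (by simp)
      have hd' : HasDerivAt (fun t : ℝ => formEval C (z + t • D.hamVec z) x x)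
          ((fun a : Idx => x a.1 a.2) ⬝ᵥ (D.hamCoef C z *ᵥ fun a => x a.1 a.2)) 0 := by
        simp only [formEval_eq, dotProduct, mulVec, Finset.mul_sum]
        refine HasDerivAt.fun_sum fun a _ => HasDerivAt.fun_sum fun b _ => ?_
        exact ((hasDerivAt_line (hd a.1 a.2 b.1 b.2) (D.hamVec z)).mul_const _).const_mul _
      refine (hasDerivAt_line ?_ _).unique hd'
      unfold formEval
      exact DifferentiableAt.fun_sum fun i _ => DifferentiableAt.fun_sum fun j _ =>
        DifferentiableAt.fun_sum fun k _ => DifferentiableAt.fun_sum fun l _ =>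
          ((hd i j k l).mul_const _).mul_const _
    rw [h1, formEval_eq, D.potential_eq_potM κ e h z hxs, hQ]
    simp only [add_mulVec, dotProduct_add, mulVec_mulVec]
    have h2 : (fun a : Idx => x a.1 a.2) ⬝ᵥ
        (((D.potM κ e h z)ᵀ * coef C z) *ᵥ fun a : Idx => x a.1 a.2)
        = (fun a : Idx => x a.1 a.2) ⬝ᵥ
          ((coef C z * D.potM κ e h z) *ᵥ fun a : Idx => x a.1 a.2) := by
      rw [dotProduct_comm, ← vecMul_transpose, ← dotProduct_mulVec, transpose_mul,
        transpose_transpose, hct]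
    rw [h2]
    ring
  have hre : (Matrix.of fun i j => (v z i j).re : Mat4).IsSymm := by
    ext i j; simp [hv.symm z i j]
  have him : (Matrix.of fun i j => (v z i j).im : Mat4).IsSymm := by
    ext i j; simp [hv.symm z i j]
  have e1 := hx _ hre
  have e2 := hx _ him
  simp only [Matrix.of_apply] at e1 e2
  rw [hmain, e1, e2, pairing_self_re]
  have b1 := hbd _ hre
  have b2 := hbd _ him
  rw [← mul_le_mul_iff_right₀ (show (0 : ℝ) < 2 * |σ| by positivity)]
  calc _ = s * (fderiv ℝ (fun y => formEval C y (Matrix.of fun i j => (v z i j).re)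
          (Matrix.of fun i j => (v z i j).re)) z (D.hamVec z)
        + 2 * formEval C z (Matrix.of fun i j => (v z i j).re)
          (D.potential κ e h z (Matrix.of fun i j => (v z i j).re)))
        + s * (fderiv ℝ (fun y => formEval C y (Matrix.of fun i j => (v z i j).im)
          (Matrix.of fun i j => (v z i j).im)) z (D.hamVec z)
        + 2 * formEval C z (Matrix.of fun i j => (v z i j).im)
          (D.potential κ e h z (Matrix.of fun i j => (v z i j).im))) := by
        field_simp
    _ ≤ _ := add_le_add b1 b2
    _ = _ := by ring

end Data

end Integration

/-! ### Lorentzian algebra -/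

theorem bl_sq_le {P : Mat4} (hP : P.IsSymm) (h : ∀ V, 0 ≤ bl P V V) (X Y : R4) :
    bl P X Y ^ 2 ≤ bl P X X * bl P Y Y := by
  have key : ∀ t : ℝ, 0 ≤ bl P Y Y * (t * t) + 2 * bl P X Y * t + bl P X X := by
    intro t
    have := h (X + t • Y)
    rw [bl_add_left, bl_add_right, bl_add_right, bl_smul_left, bl_smul_left, bl_smul_right,
      bl_smul_right, bl_comm hP Y X] at this
    linarith
  have := discrim_le_zero key
  rw [discrim] at this
  linarith

/-- A nondegenerate form that becomes nonnegative by adding `A ℓ ⊗ ℓ`. -/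
structure LorentzForm (g : Mat4) (A : ℝ) (ℓ : R4) : Prop where
  symm : g.IsSymm
  det : g.det ≠ 0
  pos : 0 < A
  nonneg : ∀ V, 0 ≤ bl g V V + A * (ℓ ⬝ᵥ V) ^ 2

namespace LorentzForm

variable {g : Mat4} {A : ℝ} {ℓ : R4}

theorem add_isSymm (h : LorentzForm g A ℓ) : (g + A • vecMulVec ℓ ℓ).IsSymm :=
  h.symm.add (IsSymm.smul (by rw [IsSymm, transpose_vecMulVec]) _)

theorem bl_add_eq (X Y : R4) :
    bl (g + A • vecMulVec ℓ ℓ) X Y = bl g X Y + A * ((ℓ ⬝ᵥ X) * (ℓ ⬝ᵥ Y)) := by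
  rw [bl_add, bl_smul, bl_vecMulVec, dotProduct_comm X]

theorem sq_le (h : LorentzForm g A ℓ) (X Y : R4) :
    (bl g X Y + A * ((ℓ ⬝ᵥ X) * (ℓ ⬝ᵥ Y))) ^ 2
      ≤ (bl g X X + A * (ℓ ⬝ᵥ X) ^ 2) * (bl g Y Y + A * (ℓ ⬝ᵥ Y) ^ 2) := by
  have := bl_sq_le h.add_isSymm (fun V => by
    rw [bl_add_eq]; have := h.nonneg V; rwa [sq] at this) X Y
  simpa only [bl_add_eq, sq (ℓ ⬝ᵥ X), sq (ℓ ⬝ᵥ Y)] using this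

theorem bl_pos (h : LorentzForm g A ℓ) {V : R4} (hV : V ≠ 0) (h0 : ℓ ⬝ᵥ V = 0) :
    0 < bl g V V := by
  have h1 := h.nonneg V
  rw [h0] at h1
  refine lt_of_le_of_ne (by simpa using h1) fun h2 => hV ?_
  have h3 : ∀ X, bl g X V = 0 := by
    intro X
    have := h.sq_le X V
    rw [h0, ← h2] at this
    simp only [mul_zero, add_zero, ne_eq, OfNat.ofNat_ne_zero, not_false_eq_true, zero_pow] at this
    exact pow_eq_zero_iff (two_ne_zero) |>.1 (le_antisymm this (sq_nonneg _))
  refine eq_zero_of_mulVec_eq_zero h.det (funext fun i => ?_)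
  have := h3 (Pi.single i 1)
  rwa [bl, single_one_dotProduct] at this

theorem dotProduct_ne_zero (h : LorentzForm g A ℓ) {Z : R4} (hZ : Z ≠ 0) (h0 : bl g Z Z = 0) :
    ℓ ⬝ᵥ Z ≠ 0 := fun h1 => (h.bl_pos hZ h1).ne' h0

/-- The orthogonal complement of a null vector is nonnegative, and positive modulo the vector. -/
theorem bl_nonneg_of_orthogonal (h : LorentzForm g A ℓ) {Z X : R4} (hZ : Z ≠ 0)
    (h0 : bl g Z Z = 0) (hX : bl g Z X = 0) :
    0 ≤ bl g X X ∧ (bl g X X = 0 → ∃ c : ℝ, X = c • Z) := by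
  have hl := h.dotProduct_ne_zero hZ h0
  set c := (ℓ ⬝ᵥ X) / (ℓ ⬝ᵥ Z) with hc
  have h1 : ℓ ⬝ᵥ (X - c • Z) = 0 := by
    rw [dotProduct_sub, dotProduct_smul, smul_eq_mul, hc, div_mul_cancel₀ _ hl, sub_self]
  have h2 : bl g (X - c • Z) (X - c • Z) = bl g X X := by
    rw [bl_sub_left, bl_sub_right, bl_sub_right, bl_smul_left, bl_smul_left, bl_smul_right,
      bl_smul_right, bl_comm h.symm X Z, hX, h0]
    ring
  by_cases h3 : X - c • Z = 0
  · have h4 : X = c • Z := sub_eq_zero.1 h3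
    refine ⟨?_, fun _ => ⟨c, h4⟩⟩
    rw [← h2, h3]
    simp [bl]
  · have := h.bl_pos h3 h1
    rw [h2] at this
    exact ⟨this.le, fun h => absurd h this.ne'⟩

theorem bl_pos_of_orthogonal (h : LorentzForm g A ℓ) {Z Y X : R4} (h0 : bl g Z Z = 0)
    (hZY : bl g Z Y = 1) (hX : X ≠ 0) (hZX : bl g Z X = 0) (hYX : bl g Y X = 0) : 0 < bl g X X := by
  have hZ : Z ≠ 0 := by
    rintro rfl
    simp [bl] at hZY
  obtain ⟨h1, h2⟩ := h.bl_nonneg_of_orthogonal hZ h0 hZX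
  refine lt_of_le_of_ne h1 fun h3 => hX ?_
  obtain ⟨c, rfl⟩ := h2 h3.symm
  rw [bl_smul_right, bl_comm h.symm, hZY, mul_one] at hYX
  rw [hYX, zero_smul]

/-- A timelike and a null vector: the sign of their product. -/
theorem bl_mul_neg (h : LorentzForm g A ℓ) {N Z : R4} (hN : bl g N N < 0) (hZ : Z ≠ 0)
    (h0 : bl g Z Z = 0) : bl g N Z * ((ℓ ⬝ᵥ N) * (ℓ ⬝ᵥ Z)) < 0 := by
  have hl := h.dotProduct_ne_zero hZ h0
  have hA := h.pos
  have h1 := h.sq_le N Z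
  rw [h0, zero_add] at h1
  have hl2 : 0 < (ℓ ⬝ᵥ Z) ^ 2 := by positivity
  have h2 : (bl g N N + A * (ℓ ⬝ᵥ N) ^ 2) * (A * (ℓ ⬝ᵥ Z) ^ 2)
      < A * (ℓ ⬝ᵥ N) ^ 2 * (A * (ℓ ⬝ᵥ Z) ^ 2) := by
    refine mul_lt_mul_of_pos_right (by linarith) (by positivity)
  have h3 : bl g N Z ^ 2 + 2 * A * (bl g N Z * ((ℓ ⬝ᵥ N) * (ℓ ⬝ᵥ Z))) < 0 := by
    linarith [h1, h2]
  have h4 : 2 * A * (bl g N Z * ((ℓ ⬝ᵥ N) * (ℓ ⬝ᵥ Z))) < 0 := by linarith [sq_nonneg (bl g N Z)]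
  by_contra h5
  have : 0 ≤ 2 * A * (bl g N Z * ((ℓ ⬝ᵥ N) * (ℓ ⬝ᵥ Z))) :=
    mul_nonneg (by positivity) (not_lt.1 h5)
  linarith

end LorentzForm

namespace Data

variable {D : Data}

theorem metric_quad (D : Data) (p V : R4) :
    bl (D.metric p) V V = -(D.mu (rad p) / (D.b ^ 2 * D.rhoSq p)) * (V 0 - D.a * (rotForm p ⬝ᵥ
      V)) ^ 2
      + D.rhoSq p * D.q (rad p) * (drForm p ⬝ᵥ V) ^ 2
      - 2 * (D.f (rad p) / D.b) * (V 0 - D.a * (rotForm p ⬝ᵥ V)) * (drForm p ⬝ᵥ V)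
      + (D.c p * sinSq p * D.a ^ 2 / (D.b ^ 2 * D.rhoSq p) * V 0 ^ 2
      - 2 * (D.c p * D.a * (rad p ^ 2 + D.a ^ 2) / (D.b ^ 2 * D.rhoSq p)) * V 0 * (rotForm p ⬝ᵥ V)
      + D.rhoSq p / D.c p * ((V 1 ^ 2 + V 2 ^ 2 + V 3 ^ 2 - (drForm p ⬝ᵥ V) ^ 2) / rad p ^ 2)
      + D.a ^ 2 * (1 - D.Lam * rad p ^ 2 / 3) * (D.c p * (rad p ^ 2 + D.a ^ 2) + D.b * D.rhoSq p)
          / (D.b ^ 2 * D.rhoSq p * D.c p) * (rotForm p ⬝ᵥ V) ^ 2) := by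
  have hquad : ∀ (A B F K N P Q a : ℝ) (x y w : Fin 4 → ℝ) (S : Fin 4 → Fin 4 → ℝ),
      bl (Matrix.of fun i j => A * ((x i - a * w i) * (x j - a * w j)) + B * (y i * y j)
        - F * ((x i - a * w i) * y j + y i * (x j - a * w j)) + K * (x i * x j)
        - N * (x i * w j + w i * x j) + (P * S i j + Q * (w i * w j))) V V
      = A * (x ⬝ᵥ V - a * (w ⬝ᵥ V)) ^ 2 + B * (y ⬝ᵥ V) ^ 2
        - 2 * F * (x ⬝ᵥ V - a * (w ⬝ᵥ V)) * (y ⬝ᵥ V)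
        + (K * (x ⬝ᵥ V) ^ 2 - 2 * N * (x ⬝ᵥ V) * (w ⬝ᵥ V)
        + P * bl (Matrix.of S) V V + Q * (w ⬝ᵥ V) ^ 2) := by
    intro A B F K N P Q a x y w S
    simp only [bl, mulVec, dotProduct, Fin.sum_univ_four, Matrix.of_apply]
    ring
  have hround : bl (Matrix.of fun i j => roundMetric p i j) V V
      = (V 1 ^ 2 + V 2 ^ 2 + V 3 ^ 2 - (drForm p ⬝ᵥ V) ^ 2) / rad p ^ 2 := by
    simp only [bl, mulVec, dotProduct, Fin.sum_univ_four, Matrix.of_apply, roundMetric]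
    simp
    ring
  have hdt : dtForm ⬝ᵥ V = V 0 := by simp [dtForm, dotProduct, Fin.sum_univ_four]
  have := hquad (-(D.mu (rad p) / (D.b ^ 2 * D.rhoSq p))) (D.rhoSq p * D.q (rad p))
    (D.f (rad p) / D.b) (D.c p * sinSq p * D.a ^ 2 / (D.b ^ 2 * D.rhoSq p))
    (D.c p * D.a * (rad p ^ 2 + D.a ^ 2) / (D.b ^ 2 * D.rhoSq p)) (D.rhoSq p / D.c p)
    (D.a ^ 2 * (1 - D.Lam * rad p ^ 2 / 3) * (D.c p * (rad p ^ 2 + D.a ^ 2) + D.b * D.rhoSq p)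
          / (D.b ^ 2 * D.rhoSq p * D.c p)) D.a dtForm (drForm p) (rotForm p) (roundMetric p)
  rw [hround, hdt] at this
  exact this

/-- The one-form dual, up to a factor, to the timelike vector `(r² + a²) ∂_t + a ∂_φ`. -/
def timeForm (D : Data) (p : R4) : R4 := fun i =>
  D.tauForm p i + D.b * D.rhoSq p * D.f (rad p) / D.mu (rad p) * drForm p i

theorem timeForm_dotProduct (D : Data) (p V : R4) : D.timeForm p ⬝ᵥ V
    = V 0 - D.a * (rotForm p ⬝ᵥ V)
      + D.b * D.rhoSq p * D.f (rad p) / D.mu (rad p) * (drForm p ⬝ᵥ V) := by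
  have hdt : V 0 = dtForm ⬝ᵥ V := by simp [dtForm, dotProduct, Fin.sum_univ_four]
  rw [hdt]
  simp only [timeForm, tauForm, dotProduct, Fin.sum_univ_four]
  ring

/-- The angular part of the metric. -/
def angular (D : Data) (p V : R4) : ℝ :=
  D.c p * sinSq p * D.a ^ 2 / (D.b ^ 2 * D.rhoSq p) * V 0 ^ 2
      - 2 * (D.c p * D.a * (rad p ^ 2 + D.a ^ 2) / (D.b ^ 2 * D.rhoSq p)) * V 0 * (rotForm p ⬝ᵥ V)
      + D.rhoSq p / D.c p * ((V 1 ^ 2 + V 2 ^ 2 + V 3 ^ 2 - (drForm p ⬝ᵥ V) ^ 2) / rad p ^ 2)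
      + D.a ^ 2 * (1 - D.Lam * rad p ^ 2 / 3) * (D.c p * (rad p ^ 2 + D.a ^ 2) + D.b * D.rhoSq p)
          / (D.b ^ 2 * D.rhoSq p * D.c p) * (rotForm p ⬝ᵥ V) ^ 2

theorem Subextremal.metric_add_sq (h : D.Subextremal) {p : R4} (hp : p ∈ D.reg) (V : R4) :
    bl (D.metric p) V V + D.mu (rad p) / (D.b ^ 2 * D.rhoSq p) * (D.timeForm p ⬝ᵥ V) ^ 2
      = D.rhoSq p / D.mu (rad p) * (drForm p ⬝ᵥ V) ^ 2 + D.angular p V := by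
  rw [D.metric_quad, D.timeForm_dotProduct, angular]
  have hmu := (h.mu_pos hp).ne'
  have hb := h.b_pos.ne'
  have hr := (h.rhoSq_pos hp).ne'
  rw [q, if_neg hmu]
  generalize drForm p ⬝ᵥ V = ρ
  generalize rotForm p ⬝ᵥ V = w
  generalize V 0 - D.a * w = T
  generalize D.f (rad p) = f at *
  have : -(D.mu (rad p) / (D.b ^ 2 * D.rhoSq p)) * T ^ 2
      + D.rhoSq p * ((1 - f ^ 2) / D.mu (rad p)) * ρ ^ 2 - 2 * (f / D.b) * T * ρ
      + D.mu (rad p) / (D.b ^ 2 * D.rhoSq p)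
        * (T + D.b * D.rhoSq p * f / D.mu (rad p) * ρ) ^ 2
      = D.rhoSq p / D.mu (rad p) * ρ ^ 2 := by
    field_simp
    ring
  linear_combination this

theorem rad_sq (p : R4) : rad p ^ 2 = p 1 ^ 2 + p 2 ^ 2 + p 3 ^ 2 :=
  Real.sq_sqrt (by positivity)

theorem cosTh_sq {p : R4} (hp : 0 < rad p) : cosTh p ^ 2 = 1 - sinSq p := by
  rw [cosTh, sinSq, div_pow, eq_sub_iff_add_eq, ← add_div, div_eq_one_iff_eq (by positivity),
    rad_sq]
  ring

theorem drForm_dotProduct (p V : R4) :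
    drForm p ⬝ᵥ V = (p 1 * V 1 + p 2 * V 2 + p 3 * V 3) / rad p := by
  simp [drForm, dotProduct, Fin.sum_univ_four]
  ring

theorem rotForm_dotProduct (p V : R4) :
    rotForm p ⬝ᵥ V = (p 1 * V 2 - p 2 * V 1) / rad p ^ 2 := by
  simp [rotForm, dotProduct, Fin.sum_univ_four]
  ring

theorem sinSq_nonneg (p : R4) : 0 ≤ sinSq p := by unfold sinSq; positivity

theorem Subextremal.sinSq_mul_angular (h : D.Subextremal) {p : R4} (hp : p ∈ D.reg) (V : R4) :
    sinSq p * D.angular p V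
      = D.c p / (D.b ^ 2 * D.rhoSq p)
          * (D.a * sinSq p * V 0 - (rad p ^ 2 + D.a ^ 2) * (rotForm p ⬝ᵥ V)) ^ 2
        + D.rhoSq p / D.c p * (sinSq p
          * ((V 1 ^ 2 + V 2 ^ 2 + V 3 ^ 2 - (drForm p ⬝ᵥ V) ^ 2) / rad p ^ 2)
          - (rotForm p ⬝ᵥ V) ^ 2) := by
  have hb := h.b_pos.ne'
  have hr := (h.rhoSq_pos hp).ne'
  have hc := (h.c_pos p).ne'
  have key : D.a ^ 2 * sinSq p * (1 - D.Lam * rad p ^ 2 / 3)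
      = D.c p * (rad p ^ 2 + D.a ^ 2) - D.b * D.rhoSq p := by
    simp only [Data.c, rhoSq, cosTh_sq (h.rad_pos hp), b]
    ring
  have key2 : sinSq p * (D.a ^ 2 * (1 - D.Lam * rad p ^ 2 / 3)
      * (D.c p * (rad p ^ 2 + D.a ^ 2) + D.b * D.rhoSq p) / (D.b ^ 2 * D.rhoSq p * D.c p))
      = D.c p * (rad p ^ 2 + D.a ^ 2) ^ 2 / (D.b ^ 2 * D.rhoSq p) - D.rhoSq p / D.c p := by
    have : sinSq p * (D.a ^ 2 * (1 - D.Lam * rad p ^ 2 / 3)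
      * (D.c p * (rad p ^ 2 + D.a ^ 2) + D.b * D.rhoSq p) / (D.b ^ 2 * D.rhoSq p * D.c p))
      = (D.a ^ 2 * sinSq p * (1 - D.Lam * rad p ^ 2 / 3))
        * (D.c p * (rad p ^ 2 + D.a ^ 2) + D.b * D.rhoSq p) / (D.b ^ 2 * D.rhoSq p * D.c p) := by
      ring
    rw [this, key]
    field_simp
    ring
  rw [angular]
  generalize (V 1 ^ 2 + V 2 ^ 2 + V 3 ^ 2 - (drForm p ⬝ᵥ V) ^ 2) / rad p ^ 2 = R
  linear_combination (rotForm p ⬝ᵥ V) ^ 2 * key2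

theorem round_eq {p : R4} (hp : 0 < rad p) (V : R4) :
    (V 1 ^ 2 + V 2 ^ 2 + V 3 ^ 2 - (drForm p ⬝ᵥ V) ^ 2) / rad p ^ 2
      = ((p 2 * V 3 - p 3 * V 2) ^ 2 + (p 3 * V 1 - p 1 * V 3) ^ 2 + (p 1 * V 2 - p 2 * V 1) ^ 2)
        / rad p ^ 4 := by
  rw [drForm_dotProduct, div_pow]
  have : rad p ^ 4 = rad p ^ 2 * rad p ^ 2 := by ring
  rw [this]
  field_simp
  rw [rad_sq]
  ring

theorem sinSq_mul_round {p : R4} (hp : 0 < rad p) (V : R4) :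
    sinSq p * ((V 1 ^ 2 + V 2 ^ 2 + V 3 ^ 2 - (drForm p ⬝ᵥ V) ^ 2) / rad p ^ 2)
      - (rotForm p ⬝ᵥ V) ^ 2
      = (p 1 * (p 3 * V 1 - p 1 * V 3) - p 2 * (p 2 * V 3 - p 3 * V 2)) ^ 2 / rad p ^ 6 := by
  rw [round_eq hp, rotForm_dotProduct, sinSq]
  have : rad p ^ 6 = rad p ^ 2 * rad p ^ 2 * rad p ^ 2 := by ring
  have h4 : rad p ^ 4 = rad p ^ 2 * rad p ^ 2 := by ring
  rw [this, h4]
  field_simp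
  rw [rad_sq]
  ring

theorem Subextremal.angular_nonneg (h : D.Subextremal) {p : R4} (hp : p ∈ D.reg) (V : R4) :
    0 ≤ D.angular p V := by
  have hr := h.rad_pos hp
  have hc := h.c_pos p
  have hrho := h.rhoSq_pos hp
  have hb := h.b_pos
  rcases (sinSq_nonneg p).eq_or_lt with h0 | h0
  · have h1 : p 1 ^ 2 + p 2 ^ 2 = 0 := by
      rw [sinSq, eq_comm, div_eq_zero_iff] at h0
      exact h0.resolve_right (by positivity)
    have hx : p 1 = 0 := by nlinarith [sq_nonneg (p 1), sq_nonneg (p 2)]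
    have hy : p 2 = 0 := by nlinarith [sq_nonneg (p 1), sq_nonneg (p 2)]
    have hw : rotForm p ⬝ᵥ V = 0 := by rw [rotForm_dotProduct, hx, hy]; simp
    rw [angular, hw, ← h0, round_eq hr]
    simp only [mul_zero, zero_mul, zero_div, sub_zero, zero_add, add_zero, ne_eq,
      OfNat.ofNat_ne_zero, not_false_eq_true, zero_pow]
    positivity
  · have h1 := h.sinSq_mul_angular hp V
    rw [sinSq_mul_round hr] at h1
    have h2 : 0 ≤ sinSq p * D.angular p V := by rw [h1]; positivity
    exact nonneg_of_mul_nonneg_right h2 h0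

theorem Subextremal.lorentzForm (h : D.Subextremal) {p : R4} (hp : p ∈ D.reg) :
    LorentzForm (D.metric p) (D.mu (rad p) / (D.b ^ 2 * D.rhoSq p)) (D.timeForm p) := by
  have h1 := h.mu_pos hp
  have h2 := h.b_pos
  have h3 := h.rhoSq_pos hp
  refine ⟨D.metric_isSymm p, h.det_ne_zero (h.reg_subset hp), by positivity, fun V => ?_⟩
  rw [h.metric_add_sq hp]
  have := h.angular_nonneg hp V
  positivity

end Data

namespace Data

variable {D : Data}

/-! ### Null covectors between the horizons -/

/-- The function `(r² + a²) ξ_t + a ξ_φ` of the radius `r`. -/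
def radialF (D : Data) (z : Phase) (r : ℝ) : ℝ := (r ^ 2 + D.a ^ 2) * xiT z + D.a * xiPhi z

theorem Subextremal.bl_sharp (h : D.Subextremal) {z : Phase} (hz : z.1 ∈ D.reg) (X : R4) :
    bl (D.metric z.1) (D.sharp z) X = z.2 ⬝ᵥ X := by
  rw [bl, sharp, ← vecMul_transpose (D.dual z.1), (D.dual_isSymm z.1).eq, ← dotProduct_mulVec,
    mulVec_mulVec, h.dual_mul (h.reg_subset hz), one_mulVec]

theorem Gfun_eq (D : Data) (z : Phase) : D.Gfun z = z.2 ⬝ᵥ D.sharp z := by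
  rw [Gfun, G, sharp, ← bl, bl_eq_sum]

theorem Subextremal.bl_sharp_sharp (h : D.Subextremal) {z : Phase} (hz : z.1 ∈ D.reg) :
    bl (D.metric z.1) (D.sharp z) (D.sharp z) = D.Gfun z := by
  rw [h.bl_sharp hz, D.Gfun_eq]

theorem Subextremal.sharp_ne_zero (h : D.Subextremal) {z : Phase} (hz : z.1 ∈ D.reg)
    (hξ : z.2 ≠ 0) : D.sharp z ≠ 0 := by
  intro h0
  refine hξ (funext fun i => ?_)
  have := h.bl_sharp hz (Pi.single i 1)
  rw [h0, dotProduct_single_one] at this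
  simpa [bl] using this.symm

theorem rotForm_dphiVec {p : R4} : rotForm p ⬝ᵥ dphiVec p = sinSq p := by
  rw [rotForm_dotProduct, sinSq]
  simp [dphiVec]
  ring

theorem drForm_dphiVec {p : R4} : drForm p ⬝ᵥ dphiVec p = 0 := by
  rw [drForm_dotProduct]
  simp [dphiVec]
  left
  ring

/-- The combination `x ∂_t + y ∂_φ`. -/
def killVec (p : R4) (x y : ℝ) : R4 := x • dtVec + y • dphiVec p

theorem killVec_zero (p : R4) (x y : ℝ) : killVec p x y 0 = x := by
  simp [killVec, dtVec, dphiVec]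

theorem rotForm_killVec (p : R4) (x y : ℝ) : rotForm p ⬝ᵥ killVec p x y = sinSq p * y := by
  have : rotForm p ⬝ᵥ dtVec = 0 := by rw [rotForm_dotProduct]; simp [dtVec]
  rw [killVec, dotProduct_add, dotProduct_smul, dotProduct_smul, this, rotForm_dphiVec]
  simp [mul_comm]

theorem drForm_killVec (p : R4) (x y : ℝ) : drForm p ⬝ᵥ killVec p x y = 0 := by
  have : drForm p ⬝ᵥ dtVec = 0 := by rw [drForm_dotProduct]; simp [dtVec]
  rw [killVec, dotProduct_add, dotProduct_smul, dotProduct_smul, this, drForm_dphiVec]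
  simp

theorem dotProduct_killVec (z : Phase) (x y : ℝ) :
    z.2 ⬝ᵥ killVec z.1 x y = x * xiT z + y * xiPhi z := by
  rw [killVec, dotProduct_add, dotProduct_smul, dotProduct_smul, smul_eq_mul, smul_eq_mul]
  rfl

theorem Subextremal.rhoSq_eq (h : D.Subextremal) {p : R4} (hp : p ∈ D.reg) :
    D.rhoSq p = rad p ^ 2 + D.a ^ 2 - D.a ^ 2 * sinSq p := by
  rw [rhoSq, cosTh_sq (h.rad_pos hp)]
  ring

theorem Subextremal.angular_killVec (h : D.Subextremal) {p : R4} (hp : p ∈ D.reg) (x y : ℝ) :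
    D.angular p (killVec p x y)
      = D.c p * sinSq p / (D.b ^ 2 * D.rhoSq p) * (D.a * x - (rad p ^ 2 + D.a ^ 2) * y) ^ 2 := by
  have hr := h.rad_pos hp
  have hround : ((killVec p x y) 1 ^ 2 + (killVec p x y) 2 ^ 2 + (killVec p x y) 3 ^ 2
      - (drForm p ⬝ᵥ killVec p x y) ^ 2) / rad p ^ 2 = sinSq p * y ^ 2 := by
    rw [drForm_killVec, sinSq]
    simp [killVec, dtVec, dphiVec]
    ring
  rcases (sinSq_nonneg p).eq_or_lt with h0 | h0
  · rw [angular, hround, rotForm_killVec, ← h0]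
    simp
  · have h1 := h.sinSq_mul_angular hp (killVec p x y)
    rw [hround, rotForm_killVec, killVec_zero] at h1
    refine mul_left_cancel₀ h0.ne' (h1.trans ?_)
    ring

/-- The timelike vector `(r² + a²) ∂_t + a ∂_φ`. -/
def timeVec (D : Data) (p : R4) : R4 := killVec p (rad p ^ 2 + D.a ^ 2) D.a

theorem Subextremal.timeForm_timeVec (h : D.Subextremal) {p : R4} (hp : p ∈ D.reg) :
    D.timeForm p ⬝ᵥ D.timeVec p = D.rhoSq p := by
  rw [timeForm_dotProduct, timeVec, killVec_zero, rotForm_killVec, drForm_killVec, h.rhoSq_eq hp]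
  ring

theorem Subextremal.bl_timeVec (h : D.Subextremal) {p : R4} (hp : p ∈ D.reg) (X : R4) :
    bl (D.metric p) (D.timeVec p) X = -(D.mu (rad p) / D.b ^ 2) * (D.timeForm p ⬝ᵥ X) := by
  have hL := h.lorentzForm hp
  have h1 := hL.sq_le (D.timeVec p) X
  have h2 : bl (D.metric p) (D.timeVec p) (D.timeVec p)
      + D.mu (rad p) / (D.b ^ 2 * D.rhoSq p) * (D.timeForm p ⬝ᵥ D.timeVec p) ^ 2 = 0 := by
    rw [h.metric_add_sq hp, timeVec, drForm_killVec, h.angular_killVec hp]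
    ring
  rw [h2, zero_mul, h.timeForm_timeVec hp] at h1
  have h3 := pow_eq_zero_iff (two_ne_zero) |>.1 (le_antisymm h1 (sq_nonneg _))
  have hr := (h.rhoSq_pos hp).ne'
  have hb := h.b_pos.ne'
  rw [eq_neg_of_add_eq_zero_left h3]
  field_simp

theorem Subextremal.radialF_eq (h : D.Subextremal) {z : Phase} (hz : z.1 ∈ D.reg) :
    D.radialF z (rad z.1) = -(D.mu (rad z.1) / D.b ^ 2) * (D.timeForm z.1 ⬝ᵥ D.sharp z) := by
  rw [← h.bl_timeVec hz, bl_comm (D.metric_isSymm _), h.bl_sharp hz, timeVec, dotProduct_killVec,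
    radialF]

theorem Subextremal.radialF_ne_zero (h : D.Subextremal) {z : Phase} (hz : z.1 ∈ D.reg)
    (hξ : z.2 ≠ 0) (hG : D.Gfun z = 0) : D.radialF z (rad z.1) ≠ 0 := by
  have h1 := (h.lorentzForm hz).dotProduct_ne_zero (h.sharp_ne_zero hz hξ)
    (by rw [h.bl_sharp_sharp hz, hG])
  have h2 := (h.mu_pos hz).ne'
  have h3 := h.b_pos.ne'
  rw [h.radialF_eq hz]
  exact mul_ne_zero (neg_ne_zero.2 (div_ne_zero h2 (pow_ne_zero 2 h3))) h1

theorem Subextremal.sq_mul_mu_le (h : D.Subextremal) {z : Phase} (hz : z.1 ∈ D.reg)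
    (hG : D.Gfun z = 0) :
    (D.a * sinSq z.1 * xiT z + xiPhi z) ^ 2 * D.mu (rad z.1)
      ≤ D.c z.1 * sinSq z.1 * D.radialF z (rad z.1) ^ 2 := by
  have hL := h.lorentzForm hz
  have hmu := h.mu_pos hz
  have hb := h.b_pos
  have hr := h.rhoSq_pos hz
  set W := killVec z.1 (D.a * sinSq z.1) 1 with hW
  have hl : D.timeForm z.1 ⬝ᵥ W = 0 := by
    rw [timeForm_dotProduct, hW, killVec_zero, rotForm_killVec, drForm_killVec]
    ring
  have h1 := hL.sq_le (D.sharp z) W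
  rw [h.bl_sharp_sharp hz, hG, h.metric_add_sq hz W, hl, hW, drForm_killVec, h.angular_killVec hz,
    h.bl_sharp hz, dotProduct_killVec, one_mul] at h1
  have h2 : D.a * (D.a * sinSq z.1) - (rad z.1 ^ 2 + D.a ^ 2) * 1 = -D.rhoSq z.1 := by
    rw [h.rhoSq_eq hz]; ring
  rw [h2] at h1
  rw [h.radialF_eq hz]
  have h3 := mul_le_mul_of_nonneg_right h1 hmu.le
  refine le_trans (le_of_eq (by ring)) (h3.trans (le_of_eq ?_))
  field_simp
  ring

theorem Subextremal.sharp_zero_mul_radialF (h : D.Subextremal) {z : Phase} (hz : z.1 ∈ D.reg)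
    (hξ : z.2 ≠ 0) (hG : D.Gfun z = 0) : D.G z.1 dtForm z.2 * D.radialF z (rad z.1) < 0 := by
  have hL := h.lorentzForm hz
  have hmu := h.mu_pos hz
  have hb := h.b_pos
  set N := D.sharp (z.1, dtForm) with hN
  have hdt : ∀ X, bl (D.metric z.1) N X = dtForm ⬝ᵥ X :=
    fun X => h.bl_sharp (z := (z.1, dtForm)) hz X
  have h1 : bl (D.metric z.1) N N < 0 := by
    have := h.dt_timelike z.1 (h.reg_subset hz)
    have h2 := h.bl_sharp_sharp (z := (z.1, dtForm)) hz
    rw [Gfun] at h2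
    rw [hN, h2]
    exact this
  have h2 := hL.bl_mul_neg h1 (h.sharp_ne_zero hz hξ) (by rw [h.bl_sharp_sharp hz, hG])
  rw [hdt] at h2
  have h3 : D.G z.1 dtForm z.2 = dtForm ⬝ᵥ D.sharp z := by
    rw [G, sharp, ← bl, bl_eq_sum]
  have h4 : D.mu (rad z.1) / D.b ^ 2 * (D.timeForm z.1 ⬝ᵥ N) = -(rad z.1 ^ 2 + D.a ^ 2) := by
    have h5 := h.bl_timeVec hz N
    rw [bl_comm (D.metric_isSymm _), hdt] at h5
    have h6 : dtForm ⬝ᵥ D.timeVec z.1 = rad z.1 ^ 2 + D.a ^ 2 := by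
      have : dtForm ⬝ᵥ D.timeVec z.1 = D.timeVec z.1 0 := by
        simp [dtForm, dotProduct, Fin.sum_univ_four]
      rw [this, timeVec, killVec_zero]
    rw [h6] at h5
    linarith
  have hlN : D.timeForm z.1 ⬝ᵥ N < 0 := by
    by_contra hn
    have h7 : 0 ≤ D.mu (rad z.1) / D.b ^ 2 * (D.timeForm z.1 ⬝ᵥ N) :=
      mul_nonneg (by positivity) (not_lt.1 hn)
    have := h.rad_pos hz
    have : 0 < rad z.1 ^ 2 + D.a ^ 2 := by positivity
    linarith
  rw [h3, h.radialF_eq hz]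
  have h8 : 0 < (dtForm ⬝ᵥ D.sharp z) * (D.timeForm z.1 ⬝ᵥ D.sharp z) := by
    have h9 : (D.timeForm z.1 ⬝ᵥ N) * ((dtForm ⬝ᵥ D.sharp z) * (D.timeForm z.1 ⬝ᵥ D.sharp z)) < 0
      := by
      linarith
    exact (neg_iff_pos_of_mul_neg h9).1 hlN
  have h10 : 0 < D.mu (rad z.1) / D.b ^ 2 := by positivity
  have := mul_pos h10 h8
  linarith

end Data

namespace Data

variable {D : Data}

/-! ### The trapped set -/

theorem hasDerivAt_mu (D : Data) (r : ℝ) : HasDerivAt D.mu (deriv D.mu r) r :=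
  (D.contDiff_mu.differentiable (by simp) r).hasDerivAt

theorem Subextremal.deriv_mu_rEvent_ne_zero (h : D.Subextremal) : deriv D.mu D.rEvent ≠ 0 := by
  have e : D.mu = fun r => (r - D.rEvent) * (-(D.Lam / 3)
      * ((r - D.rMinus) * (r - D.rCauchy) * (r - D.rCosmo))) := by
    funext r
    rw [h.factor.2.2 r]
    ring
  have h1 : HasDerivAt D.mu (-(D.Lam / 3) * ((D.rEvent - D.rMinus) * (D.rEvent - D.rCauchy)
      * (D.rEvent - D.rCosmo))) D.rEvent := by
    rw [e]
    have hd : DifferentiableAt ℝ (fun r => -(D.Lam / 3)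
      * ((r - D.rMinus) * (r - D.rCauchy) * (r - D.rCosmo))) D.rEvent := by fun_prop
    refine (((hasDerivAt_id D.rEvent).sub_const D.rEvent).fun_mul hd.hasDerivAt).congr_deriv ?_
    simp
  rw [h1.deriv]
  have := h.Lam_pos
  have h2 := h.rMinus_lt
  have h3 := h.rCauchy_lt
  have h4 := h.rEvent_lt
  exact mul_ne_zero (by linarith) (mul_ne_zero (mul_ne_zero (by linarith) (by linarith))
    (by linarith))

theorem Subextremal.deriv_mu_rCosmo_ne_zero (h : D.Subextremal) : deriv D.mu D.rCosmo ≠ 0 := by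
  have e : D.mu = fun r => (r - D.rCosmo) * (-(D.Lam / 3)
      * ((r - D.rMinus) * (r - D.rCauchy) * (r - D.rEvent))) := by
    funext r
    rw [h.factor.2.2 r]
    ring
  have h1 : HasDerivAt D.mu (-(D.Lam / 3) * ((D.rCosmo - D.rMinus) * (D.rCosmo - D.rCauchy)
      * (D.rCosmo - D.rEvent))) D.rCosmo := by
    rw [e]
    have hd : DifferentiableAt ℝ (fun r => -(D.Lam / 3)
      * ((r - D.rMinus) * (r - D.rCauchy) * (r - D.rEvent))) D.rCosmo := by fun_prop
    refine (((hasDerivAt_id D.rCosmo).sub_const D.rCosmo).fun_mul hd.hasDerivAt).congr_deriv ?_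
    simp
  rw [h1.deriv]
  have := h.Lam_pos
  have h2 := h.rMinus_lt
  have h3 := h.rCauchy_lt
  have h4 := h.rEvent_lt
  exact mul_ne_zero (by linarith) (mul_ne_zero (mul_ne_zero (by linarith) (by linarith))
    (by linarith))

theorem Subextremal.mu_le (h : D.Subextremal) {r : ℝ} (hr : r ∈ Set.Ioo D.rEvent D.rCosmo) :
    D.mu r ≤ D.rCosmo ^ 2 + D.a ^ 2 := by
  have h0 := h.rEvent_pos.trans hr.1
  have h1 := h.Lam_pos
  have h2 := h.m_pos
  have h3 : r ^ 2 ≤ D.rCosmo ^ 2 := pow_le_pow_left₀ h0.le hr.2.le 2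
  have h4 : 0 ≤ (r ^ 2 + D.a ^ 2) * (D.Lam * r ^ 2 / 3) := by positivity
  have h5 : 0 ≤ 2 * D.m * r := by positivity
  rw [mu]
  linarith

theorem sinSq_le_one {p : R4} (hp : 0 < rad p) : sinSq p ≤ 1 := by
  have := cosTh_sq hp
  linarith [sq_nonneg (cosTh p)]

theorem Subextremal.c_le (h : D.Subextremal) {p : R4} (hp : p ∈ D.reg) : D.c p ≤ D.b := by
  have h1 := cosTh_sq (h.rad_pos hp)
  have h2 := sinSq_nonneg p
  have h3 := h.Lam_pos
  have h4 : D.Lam * D.a ^ 2 / 3 * cosTh p ^ 2 ≤ D.Lam * D.a ^ 2 / 3 * 1 :=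
    mul_le_mul_of_nonneg_left (by linarith) (by positivity)
  rw [c, b]
  linarith

/-- Bounds for `ξ_t` on null covectors. -/
theorem Subextremal.mu_mul_xiT_sq_le (h : D.Subextremal) {z : Phase} (hz : z.1 ∈ D.reg)
    (hG : D.Gfun z = 0) :
    D.mu (rad z.1) * (D.rEvent ^ 4 * xiT z ^ 2)
      ≤ (2 * (D.rCosmo ^ 2 + D.a ^ 2) + 2 * D.a ^ 2 * D.b) * D.radialF z (rad z.1) ^ 2 := by
  have h1 := h.sq_mul_mu_le hz hG
  have hr := h.rad_pos hz
  have hmu := h.mu_pos hz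
  have hb := h.b_pos
  set F := D.radialF z (rad z.1) with hF
  set w := D.a * sinSq z.1 * xiT z + xiPhi z with hw
  have h2 : D.rhoSq z.1 * xiT z = F - D.a * w := by
    rw [h.rhoSq_eq hz, hF, hw, radialF]
    ring
  have h3 : D.rEvent ^ 2 ≤ D.rhoSq z.1 := by
    have : D.rEvent ^ 2 ≤ rad z.1 ^ 2 := pow_le_pow_left₀ h.rEvent_pos.le hz.1.le 2
    rw [rhoSq]
    have : 0 ≤ D.a ^ 2 * cosTh z.1 ^ 2 := by positivity
    linarith
  have h4 : D.rEvent ^ 4 * xiT z ^ 2 ≤ 2 * F ^ 2 + 2 * D.a ^ 2 * w ^ 2 := by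
    have h5 : D.rEvent ^ 4 ≤ D.rhoSq z.1 ^ 2 := by
      have := pow_le_pow_left₀ (sq_nonneg D.rEvent) h3 2
      calc D.rEvent ^ 4 = (D.rEvent ^ 2) ^ 2 := by ring
        _ ≤ _ := this
    have h6 := mul_le_mul_of_nonneg_right h5 (sq_nonneg (xiT z))
    have h7 : D.rhoSq z.1 ^ 2 * xiT z ^ 2 = (F - D.a * w) ^ 2 := by rw [← h2]; ring
    linarith [sq_nonneg (F + D.a * w)]
  have h8 : D.c z.1 * sinSq z.1 ≤ D.b := by
    calc D.c z.1 * sinSq z.1 ≤ D.b * 1 :=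
          mul_le_mul (h.c_le hz) (sinSq_le_one hr) (sinSq_nonneg _) hb.le
      _ = D.b := mul_one _
  have h9 := mul_le_mul_of_nonneg_right h8 (sq_nonneg F)
  have h10 := mul_le_mul_of_nonneg_left h4 hmu.le
  have h11 := mul_le_mul_of_nonneg_right (h.mu_le hz) (sq_nonneg F)
  have h12 := mul_le_mul_of_nonneg_left (h1.trans h9) (sq_nonneg D.a)
  linarith

theorem hasDerivAt_radialPot (D : Data) (xt xphi : ℝ) {r : ℝ} (hr : D.mu r ≠ 0) :
    HasDerivAt (D.radialPot xt xphi)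
      ((2 * ((r ^ 2 + D.a ^ 2) * xt + D.a * xphi) * (2 * r * xt) * D.mu r
        - ((r ^ 2 + D.a ^ 2) * xt + D.a * xphi) ^ 2 * deriv D.mu r) / D.mu r ^ 2) r := by
  have h1 : HasDerivAt (fun r : ℝ => (r ^ 2 + D.a ^ 2) * xt + D.a * xphi) (2 * r * xt) r := by
    have := (((hasDerivAt_pow 2 r).add_const (D.a ^ 2)).mul_const xt).add_const (D.a * xphi)
    simpa using this
  refine ((h1.fun_pow 2).fun_div (D.hasDerivAt_mu r) hr).congr_deriv ?_
  simp

/-- What is used of the trapped set. -/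
structure IsTrapped (D : Data) (k l : ℝ) (s : ℝ) (z : Phase) : Prop where
  mem : z.1 ∈ D.reg
  ne_zero : z.2 ≠ 0
  null : D.Gfun z = 0
  deriv_le : deriv D.mu (rad z.1) ^ 2 ≤ k * D.mu (rad z.1)
  le_mul : l * D.radialF z (rad z.1) ^ 2 ≤ D.radialF z (rad z.1) * D.radialF z D.r0
  neg : s * D.radialF z (rad z.1) < 0

theorem Subextremal.exists_isTrapped (h : D.Subextremal) :
    ∃ k l : ℝ, 0 < l ∧ ∀ s z, z ∈ D.Gam s → D.IsTrapped k l s z := by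
  have hr0 := h.r0_mem
  have hre := h.rEvent_pos
  have hrc := hre.trans h.rEvent_lt
  have hb := h.b_pos
  set K : ℝ := 2 * (D.rCosmo ^ 2 + D.a ^ 2) + 2 * D.a ^ 2 * D.b with hK
  have hKpos : 0 < K := by positivity
  have hM : 0 < D.rCosmo ^ 2 + D.a ^ 2 := by positivity
  have hmu0 := h.mu_pos hr0
  refine ⟨16 * D.rCosmo ^ 2 * K / D.rEvent ^ 4,
    Real.sqrt (D.mu D.r0 / (D.rCosmo ^ 2 + D.a ^ 2)), Real.sqrt_pos.2 (by positivity), ?_⟩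
  rintro s z ⟨⟨-, hξ, hG, hs⟩, -, hr, -, hmin⟩
  have hz : z.1 ∈ D.reg := hr
  have hF0 := h.radialF_ne_zero hz hξ hG
  have hmu := h.mu_pos hr
  set r := rad z.1 with hrd
  set F := D.radialF z r with hF
  have hpot : ∀ x, D.radialPot (xiT z) (xiPhi z) x = D.radialF z x ^ 2 / D.mu x := fun x => rfl
  have hmin' : ∀ x ∈ Set.Ioo D.rEvent D.rCosmo, F ^ 2 / D.mu r ≤ D.radialF z x ^ 2 / D.mu x := by
    intro x hx
    have := hmin hx
    simpa only [Set.mem_ofPred_eq, hpot] using this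
  have hpos : 0 < F ^ 2 / D.mu r := by positivity
  have hFF : 0 < F * D.radialF z D.r0 := by
    by_contra hn
    have hn := not_lt.1 hn
    have hcont : ContinuousOn (D.radialF z) (Set.uIcc r D.r0) := by
      unfold radialF
      fun_prop
    have h0 : (0 : ℝ) ∈ Set.uIcc (D.radialF z r) (D.radialF z D.r0) := by
      rw [Set.mem_uIcc]
      rcases mul_nonpos_iff.1 hn with h1 | h1
      · exact Or.inr ⟨h1.2, h1.1⟩
      · exact Or.inl ⟨h1.1, h1.2⟩
    obtain ⟨x, hx, hx0⟩ := intermediate_value_uIcc hcont h0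
    have hxm : x ∈ Set.Ioo D.rEvent D.rCosmo :=
      (Set.ordConnected_Ioo.uIcc_subset hr hr0) hx
    have := hmin' x hxm
    rw [hx0] at this
    have h2 : (0 : ℝ) ^ 2 / D.mu x = 0 := by simp
    linarith
  refine ⟨hz, hξ, hG, ?_, ?_, ?_⟩
  · have hloc : IsLocalMin (D.radialPot (xiT z) (xiPhi z)) r :=
      hmin.isLocalMin (isOpen_Ioo.mem_nhds hr)
    have hd := hloc.hasDerivAt_eq_zero (D.hasDerivAt_radialPot (xiT z) (xiPhi z) hmu.ne')
    rw [div_eq_zero_iff] at hd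
    have hd := hd.resolve_right (by positivity)
    change 2 * F * (2 * r * xiT z) * D.mu r - F ^ 2 * deriv D.mu r = 0 at hd
    have h1 : F * deriv D.mu r = 4 * r * xiT z * D.mu r := by
      refine mul_left_cancel₀ hF0 ?_
      linarith
    have h2 : F ^ 2 * deriv D.mu r ^ 2 = 16 * r ^ 2 * D.mu r ^ 2 * xiT z ^ 2 := by
      calc F ^ 2 * deriv D.mu r ^ 2 = (F * deriv D.mu r) ^ 2 := by ring
        _ = _ := by rw [h1]; ring
    have h3 := h.mu_mul_xiT_sq_le hz hG
    rw [← hrd, ← hF, ← hK] at h3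
    have h4 : r ^ 2 ≤ D.rCosmo ^ 2 := pow_le_pow_left₀ (hre.trans hr.1).le hr.2.le 2
    have hF2 : 0 < F ^ 2 := by positivity
    have h5 : D.rEvent ^ 4 * deriv D.mu r ^ 2 * F ^ 2
        ≤ 16 * D.rCosmo ^ 2 * K * D.mu r * F ^ 2 := by
      calc D.rEvent ^ 4 * deriv D.mu r ^ 2 * F ^ 2
          = 16 * r ^ 2 * D.mu r * (D.mu r * (D.rEvent ^ 4 * xiT z ^ 2)) := by
            linear_combination D.rEvent ^ 4 * h2
        _ ≤ 16 * D.rCosmo ^ 2 * D.mu r * (K * F ^ 2) := by gcongr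
        _ = _ := by ring
    have h6 := le_of_mul_le_mul_right h5 hF2
    rw [div_mul_eq_mul_div, le_div_iff₀ (by positivity)]
    linarith
  · have h1 := hmin' D.r0 hr0
    have h2 : F ^ 2 / (D.rCosmo ^ 2 + D.a ^ 2) ≤ F ^ 2 / D.mu r :=
      div_le_div_of_nonneg_left (sq_nonneg _) hmu (h.mu_le hr)
    have h3 := h2.trans h1
    have h4 : D.mu D.r0 / (D.rCosmo ^ 2 + D.a ^ 2) * F ^ 2 ≤ D.radialF z D.r0 ^ 2 := by
      rw [le_div_iff₀ hmu0] at h3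
      calc _ = F ^ 2 / (D.rCosmo ^ 2 + D.a ^ 2) * D.mu D.r0 := by ring
        _ ≤ _ := h3
    refine (abs_le_of_sq_le_sq' ?_ hFF.le).2
    have hq : Real.sqrt (D.mu D.r0 / (D.rCosmo ^ 2 + D.a ^ 2)) ^ 2
        = D.mu D.r0 / (D.rCosmo ^ 2 + D.a ^ 2) := Real.sq_sqrt (by positivity)
    calc _ = Real.sqrt (D.mu D.r0 / (D.rCosmo ^ 2 + D.a ^ 2)) ^ 2 * F ^ 2 * F ^ 2 := by ring
      _ ≤ D.radialF z D.r0 ^ 2 * F ^ 2 := by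
        rw [hq]
        exact mul_le_mul_of_nonneg_right h4 (sq_nonneg _)
      _ = _ := by ring
  · have h1 := h.sharp_zero_mul_radialF hz hξ hG
    rw [← hrd, ← hF] at h1
    by_contra hn
    have hn := not_lt.1 hn
    have hs2 : s ≠ 0 := by rintro rfl; simp at hs
    have h2 : 0 ≤ (s * D.G z.1 dtForm z.2) * (s * F) := mul_nonneg hs.le hn
    have h3 : (s * D.G z.1 dtForm z.2) * (s * F) = s ^ 2 * (D.G z.1 dtForm z.2 * F) := by ring
    have h4 : 0 < s ^ 2 := by positivity
    have := mul_neg_of_pos_of_neg h4 h1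
    linarith

end Data

/-! ### Stationarity -/

theorem eq_of_bl_self {u v : Mat4} (hu : u.IsSymm) (hv : v.IsSymm) (h : ∀ X, bl u X X = bl v X X) :
    u = v := by
  have key : ∀ w : Mat4, w.IsSymm → ∀ X Y, bl w X Y
      = (bl w (X + Y) (X + Y) - bl w X X - bl w Y Y) / 2 := by
    intro w hw X Y
    rw [bl_add_left, bl_add_right, bl_add_right, bl_comm hw Y X]
    ring
  have hxy : ∀ X Y, bl u X Y = bl v X Y := by
    intro X Y
    rw [key u hu, key v hv, h, h, h]
  ext i j
  have := hxy (Pi.single i 1) (Pi.single j 1)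
  simpa [bl, single_one_dotProduct, mulVec_single_one] using this

namespace Data

variable {D : Data}

/-- The image of a point under the flow of the stationary Killing field. -/
def flowPt (D : Data) (s : ℝ) (p : R4) : R4 := D.rot s *ᵥ p + s • dtVec

theorem flow_eq (D : Data) (s : ℝ) (z : Phase) : D.flow s z = (D.flowPt s z.1,
    D.rot s *ᵥ z.2) := rfl

theorem rot_mulVec (D : Data) (s : ℝ) (V : R4) : D.rot s *ᵥ V =
    ![V 0, Real.cos (s * (D.a / (D.r0 ^ 2 + D.a ^ 2))) * V 1
        - Real.sin (s * (D.a / (D.r0 ^ 2 + D.a ^ 2))) * V 2,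
      Real.sin (s * (D.a / (D.r0 ^ 2 + D.a ^ 2))) * V 1
        + Real.cos (s * (D.a / (D.r0 ^ 2 + D.a ^ 2))) * V 2, V 3] := by
  funext i
  fin_cases i <;> simp [rot, mulVec, dotProduct, Fin.sum_univ_four]
  ring

theorem rot_transpose_mul (D : Data) (s : ℝ) : (D.rot s)ᵀ * D.rot s = 1 := by
  have h := Real.sin_sq_add_cos_sq (s * (D.a / (D.r0 ^ 2 + D.a ^ 2)))
  ext i j
  fin_cases i <;> fin_cases j <;>
    simp [rot, mul_apply, Fin.sum_univ_four] <;> first | linear_combination h | ring1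

theorem rot_mul_transpose (D : Data) (s : ℝ) : D.rot s * (D.rot s)ᵀ = 1 :=
  mul_eq_one_comm.1 (D.rot_transpose_mul s)

theorem rot_dotProduct (D : Data) (s : ℝ) (X Y : R4) :
    (D.rot s *ᵥ X) ⬝ᵥ (D.rot s *ᵥ Y) = X ⬝ᵥ Y := by
  rw [dotProduct_mulVec, ← mulVec_transpose, mulVec_mulVec, D.rot_transpose_mul, one_mulVec]

theorem flowPt_apply (D : Data) (s : ℝ) (p : R4) : D.flowPt s p =
    ![p 0 + s, Real.cos (s * (D.a / (D.r0 ^ 2 + D.a ^ 2))) * p 1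
        - Real.sin (s * (D.a / (D.r0 ^ 2 + D.a ^ 2))) * p 2,
      Real.sin (s * (D.a / (D.r0 ^ 2 + D.a ^ 2))) * p 1
        + Real.cos (s * (D.a / (D.r0 ^ 2 + D.a ^ 2))) * p 2, p 3] := by
  rw [flowPt, rot_mulVec]
  funext i
  fin_cases i <;> simp [dtVec]

theorem rad_flowPt (D : Data) (s : ℝ) (p : R4) : rad (D.flowPt s p) = rad p := by
  have h := Real.sin_sq_add_cos_sq (s * (D.a / (D.r0 ^ 2 + D.a ^ 2)))
  rw [rad, rad, flowPt_apply]
  congr 1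
  simp only [Matrix.cons_val]
  linear_combination (p 1 ^ 2 + p 2 ^ 2) * h

theorem cosTh_flowPt (D : Data) (s : ℝ) (p : R4) : cosTh (D.flowPt s p) = cosTh p := by
  rw [cosTh, cosTh, rad_flowPt, flowPt_apply]
  simp only [Matrix.cons_val]

theorem sinSq_flowPt (D : Data) (s : ℝ) (p : R4) : sinSq (D.flowPt s p) = sinSq p := by
  have h := Real.sin_sq_add_cos_sq (s * (D.a / (D.r0 ^ 2 + D.a ^ 2)))
  rw [sinSq, sinSq, rad_flowPt, flowPt_apply]
  congr 1
  simp only [Matrix.cons_val]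
  linear_combination (p 1 ^ 2 + p 2 ^ 2) * h

theorem drForm_flowPt (D : Data) (s : ℝ) (p V : R4) :
    drForm (D.flowPt s p) ⬝ᵥ (D.rot s *ᵥ V) = drForm p ⬝ᵥ V := by
  have h := Real.sin_sq_add_cos_sq (s * (D.a / (D.r0 ^ 2 + D.a ^ 2)))
  rw [drForm_dotProduct, drForm_dotProduct, rad_flowPt, flowPt_apply, rot_mulVec]
  congr 1
  simp only [Matrix.cons_val]
  linear_combination (p 1 * V 1 + p 2 * V 2) * h

theorem rotForm_flowPt (D : Data) (s : ℝ) (p V : R4) :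
    rotForm (D.flowPt s p) ⬝ᵥ (D.rot s *ᵥ V) = rotForm p ⬝ᵥ V := by
  have h := Real.sin_sq_add_cos_sq (s * (D.a / (D.r0 ^ 2 + D.a ^ 2)))
  rw [rotForm_dotProduct, rotForm_dotProduct, rad_flowPt, flowPt_apply, rot_mulVec]
  congr 1
  simp only [Matrix.cons_val]
  linear_combination (p 1 * V 2 - p 2 * V 1) * h

theorem metric_flowPt (D : Data) (s : ℝ) (p : R4) :
    D.metric (D.flowPt s p) = D.rot s * D.metric p * (D.rot s)ᵀ := by
  have h1 : (D.rot s)ᵀ * D.metric (D.flowPt s p) * D.rot s = D.metric p := by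
    have hs : ((D.rot s)ᵀ * D.metric (D.flowPt s p) * D.rot s).IsSymm := by
      rw [IsSymm, transpose_mul, transpose_mul, transpose_transpose, (D.metric_isSymm _).eq,
        Matrix.mul_assoc]
    refine eq_of_bl_self hs (D.metric_isSymm p) fun V => ?_
    have h := Real.sin_sq_add_cos_sq (s * (D.a / (D.r0 ^ 2 + D.a ^ 2)))
    have hV : (D.rot s *ᵥ V) 1 ^ 2 + (D.rot s *ᵥ V) 2 ^ 2 + (D.rot s *ᵥ V) 3 ^ 2
        = V 1 ^ 2 + V 2 ^ 2 + V 3 ^ 2 := by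
      rw [rot_mulVec]
      simp only [Matrix.cons_val]
      linear_combination (V 1 ^ 2 + V 2 ^ 2) * h
    have hV0 : (D.rot s *ᵥ V) 0 = V 0 := by rw [rot_mulVec]; rfl
    rw [bl_conj, metric_quad, metric_quad, drForm_flowPt, rotForm_flowPt, hV, hV0]
    simp only [rad_flowPt, sinSq_flowPt, Data.c, Data.rhoSq, cosTh_flowPt]
  rw [← h1]
  have h2 := D.rot_mul_transpose s
  calc D.metric (D.flowPt s p) = (D.rot s * (D.rot s)ᵀ) * D.metric (D.flowPt s p)
        * (D.rot s * (D.rot s)ᵀ) := by rw [h2, Matrix.one_mul, Matrix.mul_one]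
    _ = _ := by simp only [Matrix.mul_assoc]

theorem dual_flowPt (D : Data) (s : ℝ) (p : R4) :
    D.dual (D.flowPt s p) = D.rot s * D.dual p * (D.rot s)ᵀ := by
  have h1 : (D.rot s)⁻¹ = (D.rot s)ᵀ := inv_eq_right_inv (D.rot_mul_transpose s)
  rw [dual, metric_flowPt, Matrix.mul_inv_rev, Matrix.mul_inv_rev, ← transpose_nonsing_inv, h1,
    transpose_transpose, Matrix.mul_assoc]
  rfl

theorem sharp_flow (D : Data) (s : ℝ) (z : Phase) :
    D.sharp (D.flow s z) = D.rot s *ᵥ D.sharp z := by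
  rw [flow_eq, sharp, sharp, dual_flowPt, mulVec_mulVec, Matrix.mul_assoc _ (D.rot s)ᵀ,
    rot_transpose_mul, Matrix.mul_one, mulVec_mulVec]

theorem Gfun_flow (D : Data) (s : ℝ) (z : Phase) : D.Gfun (D.flow s z) = D.Gfun z := by
  rw [Gfun_eq, Gfun_eq, sharp_flow]
  exact D.rot_dotProduct s _ _

theorem dphiVec_flowPt (D : Data) (s : ℝ) (p : R4) :
    dphiVec (D.flowPt s p) = D.rot s *ᵥ dphiVec p := by
  rw [dphiVec, flowPt_apply, rot_mulVec]
  funext i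
  fin_cases i <;> simp [dphiVec] <;> ring

theorem rot_dtVec (D : Data) (s : ℝ) : D.rot s *ᵥ dtVec = dtVec := by
  rw [rot_mulVec]
  funext i
  fin_cases i <;> simp [dtVec]

theorem drVec_flowPt (D : Data) (s : ℝ) (p : R4) :
    drVec (D.flowPt s p) = D.rot s *ᵥ drVec p := by
  rw [drVec, rad_flowPt, flowPt_apply, rot_mulVec]
  funext i
  fin_cases i <;> simp [drVec] <;> ring

theorem sinDthVec_flowPt (D : Data) (s : ℝ) (p : R4) :
    sinDthVec (D.flowPt s p) = D.rot s *ᵥ sinDthVec p := by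
  have h := Real.sin_sq_add_cos_sq (s * (D.a / (D.r0 ^ 2 + D.a ^ 2)))
  rw [sinDthVec, rad_flowPt, flowPt_apply, rot_mulVec]
  funext i
  fin_cases i <;> simp [sinDthVec] <;> try ring1
  congr 1
  linear_combination -(p 1 ^ 2 + p 2 ^ 2) * h

theorem cVec_eq (D : Data) (κ : ℝ) (p : R4) : D.cVec κ p = dtVec
    + (D.a / (rad p ^ 2 + D.a ^ 2)) • dphiVec p + (κ * D.f (rad p)) • drVec p
    + κ ^ 2 • sinDthVec p := by
  funext i
  simp [cVec]

theorem cVec_flowPt (D : Data) (κ s : ℝ) (p : R4) :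
    D.cVec κ (D.flowPt s p) = D.rot s *ᵥ D.cVec κ p := by
  rw [cVec_eq, cVec_eq, rad_flowPt, dphiVec_flowPt, drVec_flowPt, sinDthVec_flowPt]
  simp only [mulVec_add, mulVec_smul, rot_dtVec]

theorem xiT_flow (D : Data) (s : ℝ) (z : Phase) : xiT (D.flow s z) = xiT z := by
  have h : xiT (D.flow s z) = (D.rot s *ᵥ z.2) ⬝ᵥ dtVec := rfl
  rw [h, ← D.rot_dtVec s, rot_dotProduct]
  rfl

theorem xiPhi_flow (D : Data) (s : ℝ) (z : Phase) : xiPhi (D.flow s z) = xiPhi z := by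
  have h : xiPhi (D.flow s z) = (D.rot s *ᵥ z.2) ⬝ᵥ dphiVec (D.flowPt s z.1) := rfl
  rw [h, dphiVec_flowPt, rot_dotProduct]
  rfl

theorem sigma_flow (D : Data) (s : ℝ) (z : Phase) : D.sigma (D.flow s z) = D.sigma z := by
  rw [sigma, sigma, xiT_flow, xiPhi_flow]

/-- The velocity of the lifted flow. -/
theorem hasDerivAt_flow (D : Data) (z : Phase) :
    HasDerivAt (fun s => D.flow s z)
      (dtVec + (D.a / (D.r0 ^ 2 + D.a ^ 2)) • dphiVec z.1,
        (D.a / (D.r0 ^ 2 + D.a ^ 2)) • dphiVec z.2) 0 := by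
  set w := D.a / (D.r0 ^ 2 + D.a ^ 2) with hw
  have hc : HasDerivAt (fun s : ℝ => Real.cos (s * w)) 0 0 := by
    simpa using ((hasDerivAt_id (0 : ℝ)).mul_const w).cos
  have hs : HasDerivAt (fun s : ℝ => Real.sin (s * w)) w 0 := by
    simpa using ((hasDerivAt_id (0 : ℝ)).mul_const w).sin
  have hr : ∀ V : R4, HasDerivAt (fun s => D.rot s *ᵥ V) (w • dphiVec V) 0 := by
    intro V
    simp only [rot_mulVec, ← hw]
    refine hasDerivAt_pi.2 fun i => ?_
    fin_cases i
    · simpa [dphiVec] using hasDerivAt_const (0 : ℝ) (V 0)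
    · simpa [dphiVec] using (hc.mul_const (V 1)).fun_sub (hs.mul_const (V 2))
    · simpa [dphiVec] using (hs.mul_const (V 1)).fun_add (hc.mul_const (V 2))
    · simpa [dphiVec] using hasDerivAt_const (0 : ℝ) (V 3)
  have ht : HasDerivAt (fun s : ℝ => s • dtVec) dtVec 0 := by
    simpa using (hasDerivAt_id (0 : ℝ)).smul_const dtVec
  have h1 : HasDerivAt (fun s => D.rot s *ᵥ z.1 + s • dtVec) (dtVec + w • dphiVec z.1) 0 := by
    rw [add_comm dtVec]
    exact (hr z.1).add ht
  exact h1.prodMk (hr z.2)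

theorem flow_zero (D : Data) (z : Phase) : D.flow 0 z = z := by
  rw [flow_eq, flowPt, rot_mulVec, rot_mulVec]
  ext i <;> fin_cases i <;> simp

/-- The frequency is conserved along the Hamilton flow. -/
theorem Subextremal.hasDerivAt_sigma (h : D.Subextremal) {z : Phase} (hz : z.1 ∈ D.reg) :
    HasDerivAt (fun t : ℝ => D.sigma (z + t • D.hamVec z)) 0 0 := by
  set w := D.a / (D.r0 ^ 2 + D.a ^ 2) with hw
  have hG : HasFDerivAt D.Gfun (fderiv ℝ D.Gfun z) (D.flow 0 z) := by
    rw [flow_zero]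
    exact ((h.contDiffAt_Gfun hz).differentiableAt (by simp)).hasFDerivAt
  have h1 := hG.comp_hasDerivAt (0 : ℝ) (D.hasDerivAt_flow z)
  have h2 : (D.Gfun ∘ fun s => D.flow s z) = fun _ => D.Gfun z := by
    funext s
    exact D.Gfun_flow s z
  rw [h2] at h1
  have h3 := h1.unique (hasDerivAt_const _ _)
  rw [← hw] at h3
  have h4 : ∀ a b : R4, fderiv ℝ D.Gfun z (a, b)
      = ∑ j, a j * dX j D.Gfun z + ∑ j, b j * dXi j D.Gfun z := by
    intro a b
    have : (a, b) = (a, (0 : R4)) + ((0 : R4), b) := by simp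
    rw [this, map_add, sum_single_fst, sum_single_snd, map_sum, map_sum]
    simp only [map_smul, smul_eq_mul]
    rfl
  rw [h4] at h3
  set x' := (D.hamVec z).1 with hx'
  set ξ' := (D.hamVec z).2 with hξ'
  have hl : ∀ i, HasDerivAt (fun t : ℝ => (z + t • D.hamVec z).1 i) (x' i) 0 := by
    intro i
    simpa using ((hasDerivAt_id (0 : ℝ)).mul_const (x' i)).const_add (z.1 i)
  have hl2 : ∀ i, HasDerivAt (fun t : ℝ => (z + t • D.hamVec z).2 i) (ξ' i) 0 := by
    intro i
    simpa using ((hasDerivAt_id (0 : ℝ)).mul_const (ξ' i)).const_add (z.2 i)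
  have e : D.sigma = fun y => -(y.2 0 + w * (y.2 2 * y.1 1 - y.2 1 * y.1 2)) := by
    funext y
    simp only [sigma, xiT, xiPhi, dot, Fin.sum_univ_four, dtVec, dphiVec, Matrix.cons_val, ← hw]
    ring
  rw [e]
  refine ((((hl2 0).add ((((hl2 2).fun_mul (hl 1)).sub ((hl2 1).fun_mul (hl 2))).const_mul
    w)).fun_neg)
    ).congr_deriv ?_
  have e1 : ∀ j, dXi j D.Gfun z = x' j := fun j => rfl
  have e2 : ∀ j, dX j D.Gfun z = -ξ' j := fun j => by simp [hξ', hamVec]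
  simp only [e1, e2, Fin.sum_univ_four, dtVec, dphiVec, Pi.add_apply, Pi.smul_apply, smul_eq_mul,
    Matrix.cons_val] at h3
  simp
  linarith

end Data

/-! ### Smoothness of the form -/

section Smooth

variable {z : Phase} {Q R : Phase → Mat4} {X Y Z : Phase → R4} {n : Phase → ℝ}

theorem contDiffAt_bl (hQ : ∀ i j, ContDiffAt ℝ ∞ (fun y => Q y i j) z)
    (hX : ∀ i, ContDiffAt ℝ ∞ (fun y => X y i) z) (hY : ∀ i, ContDiffAt ℝ ∞ (fun y => Y y i) z) :
    ContDiffAt ℝ ∞ (fun y => bl (Q y) (X y) (Y y)) z := by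
  simp only [bl_eq_sum]
  exact ContDiffAt.sum fun i _ => ContDiffAt.sum fun j _ => ((hQ i j).mul (hX i)).mul (hY j)

theorem contDiffAt_mul_apply (hQ : ∀ i j, ContDiffAt ℝ ∞ (fun y => Q y i j) z)
    (hR : ∀ i j, ContDiffAt ℝ ∞ (fun y => R y i j) z) (i j : Fin 4) :
    ContDiffAt ℝ ∞ (fun y => (Q y * R y) i j) z := by
  simp only [mul_apply]
  exact ContDiffAt.sum fun k _ => (hQ i k).mul (hR k j)

theorem contDiffAt_trace (hQ : ∀ i j, ContDiffAt ℝ ∞ (fun y => Q y i j) z) :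
    ContDiffAt ℝ ∞ (fun y => trace (Q y)) z := by
  simp only [trace, diag]
  exact ContDiffAt.sum fun k _ => hQ k k

theorem contDiffAt_mulVec_apply (hQ : ∀ i j, ContDiffAt ℝ ∞ (fun y => Q y i j) z)
    (hX : ∀ i, ContDiffAt ℝ ∞ (fun y => X y i) z) (i : Fin 4) :
    ContDiffAt ℝ ∞ (fun y => (Q y *ᵥ X y) i) z := by
  simp only [mulVec, dotProduct]
  exact ContDiffAt.sum fun k _ => (hQ i k).mul (hX k)

theorem contDiffAt_Phi (ν δ K : ℝ) (u v : Mat4)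
    (hG : ∀ i j, ContDiffAt ℝ ∞ (fun y => Q y i j) z)
    (hZ : ∀ i, ContDiffAt ℝ ∞ (fun y => Z y i) z) (hY : ∀ i, ContDiffAt ℝ ∞ (fun y => Y y i) z)
    (hn : ContDiffAt ℝ ∞ n z) :
    ContDiffAt ℝ ∞ (fun y => Phi ν δ K (Q y) (Z y) (Y y) (n y) u v) z := by
  have hc : ∀ (w : Mat4) i j, ContDiffAt ℝ ∞ (fun _ : Phase => w i j) z :=
    fun w i j => contDiffAt_const
  have hP : ∀ i j, ContDiffAt ℝ ∞ (fun y => screen (Q y) (Z y) (Y y) (n y) i j) z := by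
    intro i j
    exact (((hG i j).sub ((hZ i).mul (hY j))).sub ((hY i).mul (hZ j))).add
      (hn.mul ((hZ i).mul (hZ j)))
  have hX : ∀ i, ContDiffAt ℝ ∞ (fun y => (Y y - n y • Z y) i) z :=
    fun i => (hY i).sub (hn.mul (hZ i))
  have hτ : ∀ w : Mat4, ContDiffAt ℝ ∞ (fun y => trace (Q y * w)) z :=
    fun w => contDiffAt_trace (contDiffAt_mul_apply hG (hc w))
  have hA : ∀ w : Mat4, ContDiffAt ℝ ∞ (fun y => fA (Q y) (Z y) (Y y) w) z :=
    fun w => (contDiffAt_bl (hc w) hZ hY).sub ((hτ w).div_const 2)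
  have hχ : ∀ w : Mat4, ContDiffAt ℝ ∞ (fun y => fChi ν (Q y) (Z y) (Y y) (n y) w) z :=
    fun w => (contDiffAt_const.mul ((contDiffAt_const.mul (hA w)).sub
      (hn.mul (contDiffAt_bl (hc w) hZ hZ)))).sub ((hτ w).div_const 2)
  have hS : ∀ w : Mat4, ContDiffAt ℝ ∞ (fun y => fS ν (Q y) (Z y) (Y y) (n y) w) z :=
    fun w => (contDiffAt_bl (hc w) hX hX).sub (hn.mul (hχ w))
  have hT : ∀ w : Mat4, ContDiffAt ℝ ∞ (fun y => trace (screen (Q y) (Z y) (Y y) (n y) * w)) z :=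
    fun w => contDiffAt_trace (contDiffAt_mul_apply hP (hc w))
  have hTT : ContDiffAt ℝ ∞ (fun y => trace (screen (Q y) (Z y) (Y y) (n y) * u
      * screen (Q y) (Z y) (Y y) (n y) * v)) z :=
    contDiffAt_trace (contDiffAt_mul_apply (contDiffAt_mul_apply (contDiffAt_mul_apply hP (hc u))
      hP)
      (hc v))
  have hu : ∀ (w : Mat4) {X : Phase → R4}, (∀ i, ContDiffAt ℝ ∞ (fun y => X y i) z) → ∀ i,
      ContDiffAt ℝ ∞ (fun y => (w *ᵥ X y) i) z := fun w X hX => contDiffAt_mulVec_apply (hc w) hX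
  exact ((((((((hTT.add ((hχ u).mul (hT v))).add ((hχ v).mul (hT u))).add
    ((contDiffAt_const.mul (hχ u)).mul (hχ v))).add
    (contDiffAt_const.mul (contDiffAt_bl hP (hu u hX) (hu v hX)))).add
    ((contDiffAt_const.mul (hS u)).mul (hS v))).add (contDiffAt_bl hP (hu u hZ) (hu v hZ))).add
    ((contDiffAt_const.mul (contDiffAt_bl (hc u) hZ hZ)).mul (contDiffAt_bl (hc v) hZ hZ))).add
    ((hA u).mul (hA v)))

end Smooth

theorem hasDerivAt_add_mul_add_sq_mul {f g k : ℝ → ℝ} {f' : ℝ} (hf : HasDerivAt f f' 0)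
    (hg : DifferentiableAt ℝ g 0) (hk : DifferentiableAt ℝ k 0) :
    HasDerivAt (fun t => f t + t * g t + t ^ 2 * k t) (f' + g 0) 0 := by
  have h1 := (hasDerivAt_id (0 : ℝ)).fun_mul hg.hasDerivAt
  have h2 := ((hasDerivAt_pow 2 (0 : ℝ))).fun_mul hk.hasDerivAt
  refine ((hf.fun_add h1).fun_add h2).congr_deriv ?_
  simp

namespace Data

variable {D : Data}

/-! ### Parallel transport along the Hamilton flow -/

/-- The function `ξ(𝔠^♯)`. -/
def alpha (D : Data) (κ : ℝ) (z : Phase) : ℝ := z.2 ⬝ᵥ D.cVec κ z.1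

/-- The vector `ξ^♯ / σ`. -/
def zVec (D : Data) (z : Phase) : R4 := (D.sigma z)⁻¹ • D.sharp z

/-- The multiple of `𝔠^♯` whose product with `zVec` is one. -/
def yVec (D : Data) (κ : ℝ) (z : Phase) : R4 := (D.sigma z / D.alpha κ z) • D.cVec κ z.1

/-- The squared length of `yVec`. -/
def nVal (D : Data) (κ : ℝ) (z : Phase) : ℝ := bl (D.metric z.1) (D.yVec κ z) (D.yVec κ z)

/-- The covariant derivative of `𝔠^♯` along the Hamilton flow. -/
def dcVec (D : Data) (κ : ℝ) (z : Phase) : R4 :=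
  (fun i => fderiv ℝ (fun y => D.cVec κ y i) z.1 ((2 : ℝ) • D.sharp z))
    + D.connAlong z *ᵥ D.cVec κ z.1

/-- The covariant derivative of `yVec` along the Hamilton flow. -/
def covY (D : Data) (κ : ℝ) (z : Phase) : R4 :=
  (D.sigma z / D.alpha κ z) • D.dcVec κ z
    - (D.sigma z * (z.2 ⬝ᵥ D.dcVec κ z) / D.alpha κ z ^ 2) • D.cVec κ z.1

/-- The form on the fibers attached to a null vector. -/
def phiForm (D : Data) (κ ν δ K : ℝ) (z : Phase) (u v : Mat4) : ℝ :=
  Phi ν δ K (D.dual z.1) (D.zVec z) (D.yVec κ z) (D.nVal κ z) u v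

theorem contDiff_sigma (D : Data) : ContDiff ℝ ∞ D.sigma := by
  have e : D.sigma = fun y => -(y.2 0 + D.a / (D.r0 ^ 2 + D.a ^ 2)
      * (y.2 2 * y.1 1 - y.2 1 * y.1 2)) := by
    funext y
    simp only [sigma, xiT, xiPhi, dot, Fin.sum_univ_four, dtVec, dphiVec, Matrix.cons_val]
    ring
  rw [e]
  fun_prop

theorem Subextremal.contDiffAt_alpha (h : D.Subextremal) {z : Phase} (hz : z.1 ∈ D.reg) (κ : ℝ) :
    ContDiffAt ℝ ∞ (D.alpha κ) z := by
  unfold alpha dotProduct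
  exact ContDiffAt.sum fun i _ => (contDiff_snd_apply i).contDiffAt.mul
    (contDiffAt_comp_fst (contDiffAt_cVec h hz κ i))

theorem Subextremal.contDiffAt_zVec (h : D.Subextremal) {z : Phase} (hz : z.1 ∈ D.reg)
    (hσ : D.sigma z ≠ 0) (i : Fin 4) : ContDiffAt ℝ ∞ (fun y => D.zVec y i) z :=
  (D.contDiff_sigma.contDiffAt.inv hσ).mul (h.contDiffAt_sharp hz i)

theorem Subextremal.contDiffAt_yVec (h : D.Subextremal) {z : Phase} (hz : z.1 ∈ D.reg) {κ : ℝ}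
    (hα : D.alpha κ z ≠ 0) (i : Fin 4) : ContDiffAt ℝ ∞ (fun y => D.yVec κ y i) z :=
  (D.contDiff_sigma.contDiffAt.div (h.contDiffAt_alpha hz κ) hα).mul
    (contDiffAt_comp_fst (contDiffAt_cVec h hz κ i))

theorem Subextremal.contDiffAt_nVal (h : D.Subextremal) {z : Phase} (hz : z.1 ∈ D.reg) {κ : ℝ}
    (hα : D.alpha κ z ≠ 0) : ContDiffAt ℝ ∞ (D.nVal κ) z :=
  contDiffAt_bl (fun i j => contDiffAt_comp_fst (h.contDiffAt_metric hz i j))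
    (h.contDiffAt_yVec hz hα) (h.contDiffAt_yVec hz hα)

theorem Subextremal.contDiffAt_phiForm (h : D.Subextremal) {z : Phase} (hz : z.1 ∈ D.reg) {κ : ℝ}
    (hσ : D.sigma z ≠ 0) (hα : D.alpha κ z ≠ 0) (ν δ K : ℝ) (u v : Mat4) :
    ContDiffAt ℝ ∞ (fun y => D.phiForm κ ν δ K y u v) z :=
  contDiffAt_Phi ν δ K u v (fun i j => contDiffAt_comp_fst (h.contDiffAt_dual hz i j))
    (h.contDiffAt_zVec hz hσ) (h.contDiffAt_yVec hz hα) (h.contDiffAt_nVal hz hα)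

theorem Subextremal.hamVec_eq (h : D.Subextremal) {z : Phase} (hz : z.1 ∈ D.reg) :
    D.hamVec z = ((2 : ℝ) • D.sharp z, (D.connAlong z)ᵀ *ᵥ z.2) := by
  refine Prod.ext (funext fun j => ?_) (funext fun j => ?_)
  · exact h.dXi_Gfun hz j
  · change -dX j D.Gfun z = _
    rw [h.dX_Gfun hz, h.ddM_eq hz]
    have h1 : bl (-(D.conn j z.1 * D.dual z.1 + D.dual z.1 * (D.conn j z.1)ᵀ)) z.2 z.2
        = -(2 * (z.2 ⬝ᵥ D.conn j z.1 *ᵥ D.sharp z)) := by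
      have h2 : bl (D.conn j z.1 * D.dual z.1) z.2 z.2 = z.2 ⬝ᵥ D.conn j z.1 *ᵥ D.sharp z := by
        rw [bl, sharp, mulVec_mulVec]
      have h3 : bl (D.dual z.1 * (D.conn j z.1)ᵀ) z.2 z.2
        = bl (D.conn j z.1 * D.dual z.1) z.2 z.2 := by
        have : D.dual z.1 * (D.conn j z.1)ᵀ = (D.conn j z.1 * D.dual z.1)ᵀ := by
          rw [transpose_mul, (D.dual_isSymm z.1).eq]
        rw [this, bl, bl, mulVec_transpose, dotProduct_comm, ← dotProduct_mulVec]
      rw [← neg_one_smul ℝ, bl_smul, bl_add, h3, h2]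
      ring
    rw [h1]
    simp only [connAlong, mulVec, dotProduct, transpose_apply, Matrix.sum_apply, Matrix.smul_apply,
      conn, Matrix.of_apply, smul_eq_mul, Finset.mul_sum, Finset.sum_mul]
    rw [neg_neg]
    refine Finset.sum_congr rfl fun i _ => Finset.sum_congr rfl fun k _ => ?_
    rw [D.chris_symm i j k]
    ring

theorem fderiv_eq_sum_pd (u : R4 → ℝ) (p X : R4) : fderiv ℝ u p X = ∑ k, X k * pd k u p := by
  conv_lhs => rw [pi_eq_sum_univ' X]
  rw [map_sum]
  refine Finset.sum_congr rfl fun k _ => ?_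
  rw [map_smul, smul_eq_mul, pd]

section Transport

variable {z : Phase}

theorem Subextremal.hasDerivAt_base (h : D.Subextremal) (hz : z.1 ∈ D.reg) {u : R4 → ℝ}
    (hu : ContDiffAt ℝ ∞ u z.1) :
    HasDerivAt (fun t : ℝ => u (z + t • D.hamVec z).1) (fderiv ℝ u z.1 ((2 :
      ℝ) • D.sharp z)) 0 := by
  have := hasDerivAt_line (hu.differentiableAt (by simp)) ((2 : ℝ) • D.sharp z)
  rw [h.hamVec_eq hz]
  exact this

theorem Subextremal.hasDerivAt_metric (h : D.Subextremal) (hz : z.1 ∈ D.reg) (i j : Fin 4) :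
    HasDerivAt (fun t : ℝ => D.metric (z + t • D.hamVec z).1 i j)
      (((D.connAlong z)ᵀ * D.metric z.1 + D.metric z.1 * D.connAlong z) i j) 0 := by
  refine (h.hasDerivAt_base hz (h.contDiffAt_metric hz i j)).congr_deriv ?_
  rw [fderiv_eq_sum_pd]
  have e : (D.connAlong z)ᵀ * D.metric z.1 + D.metric z.1 * D.connAlong z
      = ∑ k, (2 * D.sharp z k) • D.dgM k z.1 := by
    simp only [connAlong, transpose_sum, Matrix.sum_mul, Matrix.mul_sum, transpose_smul,
      Matrix.smul_mul, Matrix.mul_smul, ← Finset.sum_add_distrib, ← smul_add,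
      h.dgM_eq (h.reg_subset hz)]
  rw [e, Matrix.sum_apply]
  rfl

theorem Subextremal.hasDerivAt_dual (h : D.Subextremal) (hz : z.1 ∈ D.reg) (i j : Fin 4) :
    HasDerivAt (fun t : ℝ => D.dual (z + t • D.hamVec z).1 i j)
      (-(D.connAlong z * D.dual z.1 + D.dual z.1 * (D.connAlong z)ᵀ) i j) 0 := by
  refine (h.hasDerivAt_base hz (h.contDiffAt_dual hz i j)).congr_deriv ?_
  rw [fderiv_eq_sum_pd]
  have e : -(D.connAlong z * D.dual z.1 + D.dual z.1 * (D.connAlong z)ᵀ)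
      = ∑ k, (2 * D.sharp z k) • D.ddM k z.1 := by
    simp only [connAlong, transpose_sum, Matrix.sum_mul, Matrix.mul_sum, transpose_smul,
      Matrix.smul_mul, Matrix.mul_smul, ← Finset.sum_add_distrib, ← smul_add,
      h.ddM_eq hz, smul_neg, Finset.sum_neg_distrib]
  rw [← Matrix.neg_apply, e, Matrix.sum_apply]
  rfl

theorem Subextremal.hasDerivAt_covector (h : D.Subextremal) (hz : z.1 ∈ D.reg) (i : Fin 4) :
    HasDerivAt (fun t : ℝ => (z + t • D.hamVec z).2 i) (((D.connAlong z)ᵀ *ᵥ z.2) i) 0 := by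
  rw [h.hamVec_eq hz]
  simpa using ((hasDerivAt_id (0 : ℝ)).mul_const (((D.connAlong z)ᵀ *ᵥ z.2) i)).const_add (z.2 i)

theorem Subextremal.hasDerivAt_sharp (h : D.Subextremal) (hz : z.1 ∈ D.reg) (i : Fin 4) :
    HasDerivAt (fun t : ℝ => D.sharp (z
      + t • D.hamVec z) i) (-(D.connAlong z *ᵥ D.sharp z) i) 0 := by
  have h1 : HasDerivAt (fun t : ℝ => D.sharp (z + t • D.hamVec z) i)
      (∑ k, ((-(D.connAlong z * D.dual z.1 + D.dual z.1 * (D.connAlong z)ᵀ) i k) * z.2 k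
        + D.dual z.1 i k * ((D.connAlong z)ᵀ *ᵥ z.2) k)) 0 := by
    simp only [sharp, mulVec, dotProduct]
    refine HasDerivAt.fun_sum fun k _ => ?_
    refine ((h.hasDerivAt_dual hz i k).fun_mul (h.hasDerivAt_covector hz k)).congr_deriv ?_
    simp only [zero_smul, add_zero]
    rfl
  refine h1.congr_deriv ?_
  have h2 : ∑ k, ((-(D.connAlong z * D.dual z.1 + D.dual z.1 * (D.connAlong z)ᵀ) i k) * z.2 k
        + D.dual z.1 i k * ((D.connAlong z)ᵀ *ᵥ z.2) k)
      = (-((D.connAlong z * D.dual z.1 + D.dual z.1 * (D.connAlong z)ᵀ) *ᵥ z.2)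
        + D.dual z.1 *ᵥ ((D.connAlong z)ᵀ *ᵥ z.2)) i := by
    simp only [Finset.sum_add_distrib, Pi.add_apply, Pi.neg_apply, neg_mul, Finset.sum_neg_distrib]
    rfl
  rw [h2, add_mulVec, ← mulVec_mulVec, ← mulVec_mulVec, neg_add, add_assoc, neg_add_cancel,
    add_zero]
  rfl

theorem Subextremal.hasDerivAt_alpha (h : D.Subextremal) (hz : z.1 ∈ D.reg) (κ : ℝ) :
    HasDerivAt (fun t : ℝ => D.alpha κ (z + t • D.hamVec z)) (z.2 ⬝ᵥ D.dcVec κ z) 0 := by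
  have h1 : HasDerivAt (fun t : ℝ => D.alpha κ (z + t • D.hamVec z))
      (∑ k, (((D.connAlong z)ᵀ *ᵥ z.2) k * D.cVec κ z.1 k
        + z.2 k * fderiv ℝ (fun y => D.cVec κ y k) z.1 ((2 : ℝ) • D.sharp z))) 0 := by
    simp only [alpha, dotProduct]
    refine HasDerivAt.fun_sum fun k _ => ?_
    have := (h.hasDerivAt_covector hz k).fun_mul (h.hasDerivAt_base hz (contDiffAt_cVec h hz κ k))
    simpa using this
  refine h1.congr_deriv ?_
  rw [dcVec, dotProduct_add, dotProduct_mulVec, ← mulVec_transpose, add_comm,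
    Finset.sum_add_distrib]
  rfl

theorem Subextremal.hasDerivAt_yVec (h : D.Subextremal) (hz : z.1 ∈ D.reg) {κ : ℝ}
    (hα : D.alpha κ z ≠ 0) (i : Fin 4) :
    HasDerivAt (fun t : ℝ => D.yVec κ (z + t • D.hamVec z) i)
      (D.covY κ z i - (D.connAlong z *ᵥ D.yVec κ z) i) 0 := by
  have hα0 : D.alpha κ (z + (0 : ℝ) • D.hamVec z) ≠ 0 := by simpa using hα
  have h1 := ((h.hasDerivAt_sigma hz).fun_div (h.hasDerivAt_alpha hz κ) hα0).fun_mul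
    (h.hasDerivAt_base hz (contDiffAt_cVec h hz κ i))
  refine h1.congr_deriv ?_
  simp only [zero_smul, add_zero, covY, yVec, dcVec, mulVec_smul, Pi.add_apply, Pi.sub_apply,
    Pi.smul_apply, smul_eq_mul]
  ring

theorem Subextremal.hasDerivAt_nVal (h : D.Subextremal) (hz : z.1 ∈ D.reg) {κ : ℝ}
    (hα : D.alpha κ z ≠ 0) :
    HasDerivAt (fun t : ℝ => D.nVal κ (z + t • D.hamVec z))
      (2 * bl (D.metric z.1) (D.yVec κ z) (D.covY κ z)) 0 := by
  have h1 := hasDerivAt_bl (h.hasDerivAt_metric hz) (h.hasDerivAt_yVec hz hα)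
    (h.hasDerivAt_yVec hz hα) (Y' := D.covY κ z - D.connAlong z *ᵥ D.yVec κ z)
    (X' := D.covY κ z - D.connAlong z *ᵥ D.yVec κ z)
  refine h1.congr_deriv ?_
  have hs := D.metric_isSymm z.1
  simp only [zero_smul, add_zero]
  have e1 : bl ((D.connAlong z)ᵀ * D.metric z.1) (D.yVec κ z) (D.yVec κ z)
      = bl (D.metric z.1) (D.connAlong z *ᵥ D.yVec κ z) (D.yVec κ z) := by
    rw [bl, bl, ← mulVec_mulVec, dotProduct_mulVec, vecMul_transpose]
  have e2 : bl (D.metric z.1 * D.connAlong z) (D.yVec κ z) (D.yVec κ z)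
      = bl (D.metric z.1) (D.yVec κ z) (D.connAlong z *ᵥ D.yVec κ z) := by
    rw [bl, bl, mulVec_mulVec]
  rw [bl_add, e1, e2, bl_sub_left, bl_sub_right, bl_comm hs (D.covY κ z)]
  ring

end Transport

end Data

namespace Data

variable {D : Data} {z : Phase}

/-- The derivative of the form along the Hamilton flow is its variation by parallel transport. -/
theorem Subextremal.ham_phiForm (h : D.Subextremal) (hz : z.1 ∈ D.reg) {κ : ℝ}
    (hσ : D.sigma z ≠ 0) (hα : D.alpha κ z ≠ 0) (ν δ K : ℝ) {u : Mat4} (hu : u.IsSymm) :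
    let G := D.dual z.1
    let Z := D.zVec z
    let Y := D.yVec κ z
    let n := D.nVal κ z
    let Y' := D.covY κ z
    let n' := 2 * bl (D.metric z.1) (D.yVec κ z) (D.covY κ z)
    let P := screen G Z Y n
    let P' := n' • vecMulVec Z Z - vecMulVec Z Y' - vecMulVec Y' Z
    let χ := fChi ν G Z Y n u
    let χ' := ν * (2 * bl u Z Y' - n' * bl u Z Z)
    let X := Y - n • Z
    let X' := Y' - n' • Z
    fderiv ℝ (fun y => D.phiForm κ ν δ K y u u) z (D.hamVec z)
      + 2 * D.phiForm κ ν δ K z u ((D.connAlong z)ᵀ * u + u * D.connAlong z)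
      = 2 * trace (P' * u * P * u) + 2 * (χ' * trace (P * u) + χ * trace (P' * u)) + 4 * χ * χ'
        + δ ^ 2 * (bl P' (u *ᵥ X) (u *ᵥ X) + 2 * bl P (u *ᵥ X') (u *ᵥ X))
        + 2 * δ ^ 4 * fS ν G Z Y n u * (2 * bl u X' X - n' * χ - n * χ')
        + bl P' (u *ᵥ Z) (u *ᵥ Z) + 2 * fA G Z Y u * bl u Z Y' := by
  intro G Z Y n Y' n' P P' χ χ' X X'
  set A := D.connAlong z with hA
  set c : ℝ → Phase := fun t => z + t • D.hamVec z with hc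
  have hc0 : c 0 = z := by simp [hc]
  set R : ℝ → Mat4 := fun t => 1 + t • A with hR
  have hR0 : R 0 = 1 := by simp [hR]
  have hline : ∀ {w : Phase → ℝ}, ContDiffAt ℝ ∞ w z → DifferentiableAt ℝ (fun t => w (c t)) 0 :=
    fun hw => (hasDerivAt_line (hw.differentiableAt (by simp)) (D.hamVec z)).differentiableAt
  have hdual : ∀ i j, DifferentiableAt ℝ (fun t => D.dual (c t).1 i j) 0 := fun i j =>
    (h.hasDerivAt_dual hz i j).differentiableAt
  have hmulG : ∀ (B C : Mat4) i j,
    DifferentiableAt ℝ (fun t => (B * D.dual (c t).1 * C) i j) 0 := by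
    intro B C i j
    simp only [mul_apply, Finset.sum_mul]
    exact DifferentiableAt.fun_sum fun k _ => DifferentiableAt.fun_sum fun l _ =>
      ((hdual l k).const_mul _).mul_const _
  have hmulV : ∀ {V : Phase → R4}, (∀ i,
    DifferentiableAt ℝ (fun t => V (c t) i) 0) → ∀ (B : Mat4) i,
      DifferentiableAt ℝ (fun t => (B *ᵥ V (c t)) i) 0 := by
    intro V hV B i
    simp only [mulVec, dotProduct]
    exact DifferentiableAt.fun_sum fun k _ => (hV k).const_mul _
  have hGs : (R 0 * D.dual (c 0).1 * (R 0)ᵀ).IsSymm := by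
    rw [hR0, hc0, transpose_one, Matrix.one_mul, Matrix.mul_one]
    exact D.dual_isSymm z.1
  have hG' : ∀ i j, HasDerivAt (fun t => (R t * D.dual (c t).1 * (R t)ᵀ) i j) 0 0 := by
    intro i j
    have e : (fun t => (R t * D.dual (c t).1 * (R t)ᵀ) i j) = fun t => D.dual (c t).1 i j
        + t * (A * D.dual (c t).1 * 1 + 1 * D.dual (c t).1 * Aᵀ) i j
        + t ^ 2 * (A * D.dual (c t).1 * Aᵀ) i j := by
      funext t
      have : R t * D.dual (c t).1 * (R t)ᵀ = D.dual (c t).1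
          + t • (A * D.dual (c t).1 * 1 + 1 * D.dual (c t).1 * Aᵀ)
          + t ^ 2 • (A * D.dual (c t).1 * Aᵀ) := by
        simp only [hR, transpose_add, transpose_one, transpose_smul, Matrix.add_mul, Matrix.mul_add,
          Matrix.one_mul, Matrix.mul_one, Matrix.smul_mul, Matrix.mul_smul, smul_smul, sq, smul_add]
        abel
      rw [this]
      rfl
    rw [e]
    refine (hasDerivAt_add_mul_add_sq_mul (h.hasDerivAt_dual hz i j)
      ((hmulG A 1 i j).fun_add (hmulG 1 Aᵀ i j)) (hmulG A Aᵀ i j)).congr_deriv ?_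
    rw [hc0, Matrix.mul_one, Matrix.one_mul, ← hA]
    exact neg_add_cancel _
  have hzd : ∀ i, HasDerivAt (fun t => D.zVec (c t) i) (-(A *ᵥ D.zVec z) i) 0 := by
    intro i
    have hσ0 : D.sigma (c 0) ≠ 0 := by rw [hc0]; exact hσ
    have h1 := ((h.hasDerivAt_sigma hz).fun_inv hσ0).fun_mul (h.hasDerivAt_sharp hz i)
    refine h1.congr_deriv ?_
    simp only [zero_smul, add_zero, zVec, mulVec_smul, Pi.smul_apply, smul_eq_mul, ← hA]
    simp
  have hRV : ∀ (V : Phase → R4) (V' : R4), (∀ i, HasDerivAt (fun t => V (c t) i)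
      (V' i - (A *ᵥ V z) i) 0) → ∀ i, HasDerivAt (fun t => (R t *ᵥ V (c t)) i) (V' i) 0 := by
    intro V V' hV i
    have e : (fun t => (R t *ᵥ V (c t)) i) = fun t => V (c t) i + t * (A *ᵥ V (c t)) i
        + t ^ 2 * 0 := by
      funext t
      simp [hR, add_mulVec, smul_mulVec]
    rw [e]
    refine (hasDerivAt_add_mul_add_sq_mul (hV i) (hmulV (fun k => (hV k).differentiableAt) A i)
      (differentiableAt_const 0)).congr_deriv ?_
    rw [hc0, sub_add_cancel]
  have hZ' : ∀ i, HasDerivAt (fun t => (R t *ᵥ D.zVec (c t)) i) 0 0 := by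
    intro i
    refine hRV D.zVec 0 (fun k => ?_) i
    simpa using hzd k
  have hY' := hRV (D.yVec κ) (D.covY κ z) (h.hasDerivAt_yVec hz hα)
  have hmain := hasDerivAt_Phi (ν := ν) (δ := δ) (K := K) hGs hG' hZ' hY' (h.hasDerivAt_nVal hz hα)
    u hu
  have hGe : R 0 * D.dual (c 0).1 * (R 0)ᵀ = G := by
    rw [hR0, hc0, transpose_one, Matrix.one_mul, Matrix.mul_one]
  have hZe : R 0 *ᵥ D.zVec (c 0) = Z := by rw [hR0, hc0, one_mulVec]
  have hYe : R 0 *ᵥ D.yVec κ (c 0) = Y := by rw [hR0, hc0, one_mulVec]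
  have hne : D.nVal κ (z + (0 : ℝ) • D.hamVec z) = n := by rw [zero_smul, add_zero]
  simp only [hGe, hZe, hYe, hne] at hmain
  refine HasDerivAt.unique ?_ hmain
  set w := Aᵀ * u + u * A with hw
  set v := Aᵀ * u * A with hv
  have hsm := fun a b => hline (h.contDiffAt_phiForm hz hσ hα ν δ K a b)
  have e : (fun t => Phi ν δ K (R t * D.dual (c t).1 * (R t)ᵀ) (R t *ᵥ D.zVec (c t))
      (R t *ᵥ D.yVec κ (c t)) (D.nVal κ (z + t • D.hamVec z)) u u)
      = fun t => D.phiForm κ ν δ K (c t) u u + t * (2 * D.phiForm κ ν δ K (c t) u w)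
        + t ^ 2 * (D.phiForm κ ν δ K (c t) w w + 2 * D.phiForm κ ν δ K (c t) u v
          + t * (2 * D.phiForm κ ν δ K (c t) w v) + t ^ 2 * D.phiForm κ ν δ K (c t) v v) := by
    funext t
    rw [← Phi_conj]
    have e2 : (R t)ᵀ * u * R t = u + t • w + t ^ 2 • v := by
      simp only [hR, transpose_add, transpose_one, transpose_smul, Matrix.add_mul, Matrix.mul_add,
        Matrix.one_mul, Matrix.mul_one, Matrix.smul_mul, Matrix.mul_smul, smul_smul, sq, smul_add,
        hw, hv]
      abel
    rw [e2]
    have hs := D.dual_isSymm (c t).1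
    simp only [Phi_add_left, Phi_add_right, Phi_smul_left, Phi_smul_right]
    rw [Phi_comm ν δ K _ _ _ _ hs w u, Phi_comm ν δ K _ _ _ _ hs v u, Phi_comm ν δ K _ _ _ _ hs v w]
    simp only [phiForm, hc]
    ring
  rw [e]
  have hf := hasDerivAt_line ((h.contDiffAt_phiForm hz hσ hα ν δ K u u).differentiableAt (by simp))
    (D.hamVec z)
  refine (hasDerivAt_add_mul_add_sq_mul hf ((hsm u w).const_mul 2) ?_).congr_deriv ?_
  · exact (((hsm w w).fun_add ((hsm u v).const_mul 2)).fun_add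
      (differentiableAt_id.fun_mul ((hsm w v).const_mul 2))).fun_add
      ((differentiableAt_id.fun_pow 2).fun_mul (hsm v v))
  · rw [hc0]

end Data

/-- The expansion of a vector in a null frame. -/
theorem NullFrame.eq_components {g G : Mat4} {Z Y e f : R4} {n : ℝ} (F : NullFrame g G Z Y n e f)
    {X : R4} (hX : bl g Z X = 0) :
    X = bl g Y X • Z + bl g e X • e + bl g f X • f := by
  have h1 : X = G *ᵥ (g *ᵥ X) := by rw [mulVec_mulVec, F.inv, one_mulVec]
  have hv : ∀ A B : R4, vecMulVec A B *ᵥ (g *ᵥ X) = bl g B X • A := by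
    intro A B
    rw [vecMulVec_mulVec, bl]
    simp
  conv_lhs => rw [h1, F.dual]
  simp only [add_mulVec, sub_mulVec, smul_mulVec, hv, hX, zero_smul, smul_zero, add_zero, sub_zero]

theorem NullFrame.bl_self {g G : Mat4} {Z Y e f : R4} {n : ℝ} (F : NullFrame g G Z Y n e f)
    {X : R4} (hX : bl g Z X = 0) : bl g X X = bl g e X ^ 2 + bl g f X ^ 2 := by
  conv_lhs => rw [F.eq_components hX]
  simp only [bl_add_left, bl_add_right, bl_smul_left, bl_smul_right, bl_comm F.symm e Z,
    bl_comm F.symm f Z, bl_comm F.symm f e, F.ZZ, F.Ze, F.Zf, F.ee, F.ff, F.ef]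
  ring

namespace Data

variable {D : Data} {z : Phase}

theorem Subextremal.bl_zVec (h : D.Subextremal) (hz : z.1 ∈ D.reg) (X : R4) :
    bl (D.metric z.1) (D.zVec z) X = (D.sigma z)⁻¹ * (z.2 ⬝ᵥ X) := by
  rw [zVec, bl_smul_left, h.bl_sharp hz]

theorem Subextremal.bl_zVec_covY (h : D.Subextremal) (hz : z.1 ∈ D.reg) {κ : ℝ}
    (hα : D.alpha κ z ≠ 0) : bl (D.metric z.1) (D.zVec z) (D.covY κ z) = 0 := by
  rw [h.bl_zVec hz, covY, dotProduct_sub, dotProduct_smul, dotProduct_smul, smul_eq_mul,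
    smul_eq_mul, ← alpha]
  field_simp
  ring

theorem Subextremal.exists_nullFrame (h : D.Subextremal) (hz : z.1 ∈ D.reg) (hG : D.Gfun z = 0)
    {κ : ℝ} (hσ : D.sigma z ≠ 0) (hα : D.alpha κ z ≠ 0) :
    ∃ e f, NullFrame (D.metric z.1) (D.dual z.1) (D.zVec z) (D.yVec κ z) (D.nVal κ z) e f := by
  have hZZ : bl (D.metric z.1) (D.zVec z) (D.zVec z) = 0 := by
    rw [h.bl_zVec hz, zVec, dotProduct_smul, ← Gfun_eq, hG]
    simp
  have hZY : bl (D.metric z.1) (D.zVec z) (D.yVec κ z) = 1 := by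
    rw [h.bl_zVec hz, yVec, dotProduct_smul, ← alpha, smul_eq_mul]
    field_simp
  exact KdS.exists_nullFrame (D.metric_isSymm z.1) (h.dual_mul (h.reg_subset hz)) hZZ hZY
    fun X hX hZX hYX => (h.lorentzForm hz).bl_pos_of_orthogonal hZZ hZY hX hZX hYX

/-- The damping constants of the fiber inner product. -/
theorem Subextremal.exists_form_constants (hD : D.Subextremal) (ε y N c : ℝ) (hε : 0 < ε)
    (hy : 0 ≤ y) (hN : 0 ≤ N) (hc : 0 < c) :
    ∃ δ > 0, ∃ K > 0, ∃ h₀ > 0, ∀ (κ e h s : ℝ) (z : Phase), |s| = 1 → z.1 ∈ D.reg →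
      D.Gfun z = 0 → 0 < e → e < 1 / 8 → 0 < h → h < h₀ → D.sigma z ≠ 0 →
      s * D.alpha κ z ≤ -(c * |D.sigma z|) → |D.nVal κ z| ≤ N →
      |bl (D.metric z.1) (D.yVec κ z) (D.covY κ z)| ≤ y * |D.sigma z| →
      bl (D.metric z.1) (D.covY κ z) (D.covY κ z) ≤ (y * |D.sigma z|) ^ 2 →
      ∀ u : Mat4, u.IsSymm →
        s * (fderiv ℝ (fun x => D.phiForm κ (e / (1 - 2 * e)) δ K x u u) z (D.hamVec z)
          + 2 * D.phiForm κ (e / (1 - 2 * e)) δ K z u (D.potential κ e h z u))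
        ≤ 2 * ε * |D.sigma z| * D.phiForm κ (e / (1 - 2 * e)) δ K z u u := by
  obtain ⟨δ, hδ, K, hK, h₀, hh₀, H⟩ := exists_damping_constants ε y N c hε hy hN hc
  refine ⟨δ, hδ, K, hK, h₀, hh₀, ?_⟩
  intro κ e h s z hs hz hG he he8 hh hhh hσ hα hn hy0 hyy u hu
  have hσ' : 0 < |D.sigma z| := abs_pos.2 hσ
  have hα0 : D.alpha κ z ≠ 0 := by
    intro h0
    rw [h0, mul_zero] at hα
    have : 0 < c * |D.sigma z| := by positivity
    linarith
  obtain ⟨e₁, e₂, F⟩ := hD.exists_nullFrame hz hG hσ hα0 (κ := κ)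
  set ν := e / (1 - 2 * e) with hν
  have h12 : 0 < 1 - 2 * e := by linarith
  have hν1 : ν * (1 - 2 * e) = e := div_mul_cancel₀ _ h12.ne'
  have hνabs : |ν| ≤ 1 := by
    rw [abs_of_nonneg (by positivity), hν, div_le_one h12]
    linarith
  have hZc := hD.bl_zVec_covY hz hα0 (κ := κ)
  have hcov := F.eq_components hZc
  set y₀ := bl (D.metric z.1) (D.yVec κ z) (D.covY κ z) with hy₀
  set y₁ := bl (D.metric z.1) e₁ (D.covY κ z) with hy₁
  set y₂ := bl (D.metric z.1) e₂ (D.covY κ z) with hy₂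
  have hyb : 0 ≤ y * |D.sigma z| := by positivity
  have hsq := F.bl_self hZc
  rw [← hy₁, ← hy₂] at hsq
  have hy1 : |y₁| ≤ y * |D.sigma z| :=
    abs_le_of_sq_le_sq (by linarith [sq_nonneg y₂]) hyb
  have hy2 : |y₂| ≤ y * |D.sigma z| :=
    abs_le_of_sq_le_sq (by linarith [sq_nonneg y₁]) hyb
  have hvar := F.dual.variation_eq hu ν δ y₀ y₁ y₂
  have hham := hD.ham_phiForm hz hσ hα0 ν δ K hu
  simp only at hvar hham
  rw [← hcov] at hvar
  rw [← hy₀] at hham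
  have hdamp := F.Phi_dampM (δ := δ) (K := K) hν1 hu
  have hpot : D.phiForm κ ν δ K z u (D.potential κ e h z u)
      = D.phiForm κ ν δ K z u ((D.connAlong z)ᵀ * u + u * D.connAlong z)
        + 2 / h * D.alpha κ z * ((bl u (D.zVec z) e₁ ^ 2 + bl u (D.zVec z) e₂ ^ 2) / 2
          + K * bl u (D.zVec z) (D.zVec z) ^ 2
          + fA (D.dual z.1) (D.zVec z) (D.yVec κ z) u
            * ((1 / 2 - e) * fA (D.dual z.1) (D.zVec z) (D.yVec κ z) u
              + D.nVal κ z * bl u (D.zVec z) (D.zVec z) / 2)) := by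
    have e1 : D.cVec κ z.1 = (D.alpha κ z / D.sigma z) • D.yVec κ z := by
      rw [yVec, smul_smul]
      have : D.alpha κ z / D.sigma z * (D.sigma z / D.alpha κ z) = 1 := by field_simp
      rw [this, one_smul]
    have e2 : D.sharp z = D.sigma z • D.zVec z := by
      rw [zVec, smul_smul, mul_inv_cancel₀ hσ, one_smul]
    have e3 : dampM e (D.metric z.1) (D.dual z.1) (D.cVec κ z.1) (D.sharp z) u
        = D.alpha κ z • dampM e (D.metric z.1) (D.dual z.1) (D.yVec κ z) (D.zVec z) u := by
      rw [e1, e2, dampM_smul, div_mul_cancel₀ _ hσ]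
    rw [potential, e3, phiForm, Phi_add_right, Phi_smul_right, Phi_smul_right, hdamp, phiForm]
    ring
  have hfin := H s |D.sigma z| (D.alpha κ z) h e ν (D.nVal κ z) y₀ y₁ y₂
    (bl u e₁ e₁ + fChi ν (D.dual z.1) (D.zVec z) (D.yVec κ z) (D.nVal κ z) u) (bl u e₁ e₂)
    (bl u e₂ e₂ + fChi ν (D.dual z.1) (D.zVec z) (D.yVec κ z) (D.nVal κ z) u)
    (bl u (D.yVec κ z - D.nVal κ z • D.zVec z) e₁) (bl u (D.yVec κ z - D.nVal κ z • D.zVec z) e₂)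
    (fS ν (D.dual z.1) (D.zVec z) (D.yVec κ z) (D.nVal κ z) u) (bl u (D.zVec z) e₁)
    (bl u (D.zVec z) e₂) (bl u (D.zVec z) (D.zVec z)) (fA (D.dual z.1) (D.zVec z) (D.yVec κ z) u)
    hs hσ' hα hh hhh he he8 hνabs hn hy0 hy1 hy2
  have hself := F.dual.Phi_eq hu hu ν δ K
  simp only at hfin
  have hL : fderiv ℝ (fun x => D.phiForm κ ν δ K x u u) z (D.hamVec z)
      + 2 * D.phiForm κ ν δ K z u (D.potential κ e h z u)
      = (fderiv ℝ (fun x => D.phiForm κ ν δ K x u u) z (D.hamVec z)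
        + 2 * D.phiForm κ ν δ K z u ((D.connAlong z)ᵀ * u + u * D.connAlong z))
        + 2 * (2 / h * D.alpha κ z * ((bl u (D.zVec z) e₁ ^ 2 + bl u (D.zVec z) e₂ ^ 2) / 2
          + K * bl u (D.zVec z) (D.zVec z) ^ 2
          + fA (D.dual z.1) (D.zVec z) (D.yVec κ z) u
            * ((1 / 2 - e) * fA (D.dual z.1) (D.zVec z) (D.yVec κ z) u
              + D.nVal κ z * bl u (D.zVec z) (D.zVec z) / 2))) := by
    rw [hpot]; ring
  rw [hL, hham, hvar, phiForm, hself]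
  refine hfin.trans (le_of_eq ?_)
  ring

end Data

namespace Data

variable {D : Data}

/-! ### Time translations and dilations of the fibers -/

theorem add_dtVec_apply (p : R4) (τ : ℝ) :
    (p + τ • dtVec) 1 = p 1 ∧ (p + τ • dtVec) 2 = p 2 ∧ (p + τ • dtVec) 3 = p 3 := by
  simp [dtVec]

theorem rad_add_dtVec (p : R4) (τ : ℝ) : rad (p + τ • dtVec) = rad p := by
  obtain ⟨h1, h2, h3⟩ := add_dtVec_apply p τ
  rw [rad, rad, h1, h2, h3]

theorem metric_add_dtVec (D : Data) (p : R4) (τ : ℝ) : D.metric (p + τ • dtVec) = D.metric p := by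
  obtain ⟨h1, h2, h3⟩ := add_dtVec_apply p τ
  ext i j
  simp only [metric, Matrix.of_apply, tauForm, Data.c, rhoSq, cosTh, sinSq, roundMetric, drForm,
    rotForm, rad_add_dtVec, h1, h2, h3]

theorem dual_add_dtVec (D : Data) (p : R4) (τ : ℝ) : D.dual (p + τ • dtVec) = D.dual p := by
  rw [dual, dual, metric_add_dtVec]

theorem cVec_add_dtVec (D : Data) (κ : ℝ) (p : R4) (τ : ℝ) :
    D.cVec κ (p + τ • dtVec) = D.cVec κ p := by
  obtain ⟨h1, h2, h3⟩ := add_dtVec_apply p τ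
  funext i
  simp only [cVec, dphiVec, drVec, sinDthVec, rad_add_dtVec, h1, h2, h3]

theorem fderiv_add_dtVec {u : R4 → ℝ} {τ : ℝ} (hu : ∀ y, u (y + τ • dtVec) = u y) (p : R4) :
    fderiv ℝ u (p + τ • dtVec) = fderiv ℝ u p := by
  rw [← fderiv_comp_add_right]
  congr 1
  funext y
  exact hu y

theorem chris_add_dtVec (D : Data) (k i j : Fin 4) (p : R4) (τ : ℝ) :
    D.chris k i j (p + τ • dtVec) = D.chris k i j p := by
  have h : ∀ a b, fderiv ℝ (fun y => D.metric y a b) (p + τ • dtVec)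
      = fderiv ℝ (fun y => D.metric y a b) p :=
    fun a b => fderiv_add_dtVec (fun y => by rw [metric_add_dtVec]) p
  simp only [chris, pd, dual_add_dtVec, h]

theorem conn_add_dtVec (D : Data) (k : Fin 4) (p : R4) (τ : ℝ) :
    D.conn k (p + τ • dtVec) = D.conn k p := by
  ext i j
  exact D.chris_add_dtVec i k j p τ

variable (D : Data) (z : Phase) (τ : ℝ)

theorem sharp_add_dtVec : D.sharp (z.1 + τ • dtVec, z.2) = D.sharp z := by
  simp only [sharp, dual_add_dtVec]

theorem Gfun_add_dtVec : D.Gfun (z.1 + τ • dtVec, z.2) = D.Gfun z := by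
  rw [Gfun_eq, Gfun_eq, sharp_add_dtVec]

theorem xiPhi_add_dtVec : xiPhi (z.1 + τ • dtVec, z.2) = xiPhi z := by
  obtain ⟨h1, h2, h3⟩ := add_dtVec_apply z.1 τ
  simp only [xiPhi, dphiVec, h1, h2]

theorem sigma_add_dtVec : D.sigma (z.1 + τ • dtVec, z.2) = D.sigma z := by
  rw [sigma, sigma, xiPhi_add_dtVec]
  rfl

theorem radialF_add_dtVec (r : ℝ) : D.radialF (z.1 + τ • dtVec, z.2) r = D.radialF z r := by
  rw [radialF, radialF, xiPhi_add_dtVec]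
  rfl

theorem alpha_add_dtVec (κ : ℝ) : D.alpha κ (z.1 + τ • dtVec, z.2) = D.alpha κ z := by
  simp only [alpha, cVec_add_dtVec]

theorem connAlong_add_dtVec : D.connAlong (z.1 + τ • dtVec, z.2) = D.connAlong z := by
  simp only [connAlong, sharp_add_dtVec, conn_add_dtVec]

theorem yVec_add_dtVec (κ : ℝ) : D.yVec κ (z.1 + τ • dtVec, z.2) = D.yVec κ z := by
  simp only [yVec, sigma_add_dtVec, alpha_add_dtVec, cVec_add_dtVec]

theorem dcVec_add_dtVec (κ : ℝ) : D.dcVec κ (z.1 + τ • dtVec, z.2) = D.dcVec κ z := by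
  have h : ∀ i, fderiv ℝ (fun y => D.cVec κ y i) (z.1 + τ • dtVec)
      = fderiv ℝ (fun y => D.cVec κ y i) z.1 :=
    fun i => fderiv_add_dtVec (fun y => by rw [cVec_add_dtVec]) z.1
  simp only [dcVec, sharp_add_dtVec, connAlong_add_dtVec, cVec_add_dtVec, h]

theorem covY_add_dtVec (κ : ℝ) : D.covY κ (z.1 + τ • dtVec, z.2) = D.covY κ z := by
  simp only [covY, sigma_add_dtVec, alpha_add_dtVec, cVec_add_dtVec, dcVec_add_dtVec]



theorem sharp_smul (τ : ℝ) : D.sharp (z.1, τ • z.2) = τ • D.sharp z := by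
  rw [sharp, mulVec_smul]
  rfl

theorem Gfun_smul (τ : ℝ) : D.Gfun (z.1, τ • z.2) = τ ^ 2 * D.Gfun z := by
  rw [Gfun_eq, Gfun_eq, sharp_smul, dotProduct_smul, smul_dotProduct, smul_eq_mul, smul_eq_mul]
  ring

theorem xiT_smul (τ : ℝ) : xiT (z.1, τ • z.2) = τ * xiT z := smul_dotProduct τ z.2 dtVec

theorem xiPhi_smul (τ : ℝ) : xiPhi (z.1, τ • z.2) = τ * xiPhi z :=
  smul_dotProduct τ z.2 (dphiVec z.1)

theorem sigma_smul (τ : ℝ) : D.sigma (z.1, τ • z.2) = τ * D.sigma z := by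
  rw [sigma, sigma, xiT_smul, xiPhi_smul]
  ring

theorem radialF_smul (τ r : ℝ) : D.radialF (z.1, τ • z.2) r = τ * D.radialF z r := by
  rw [radialF, radialF, xiT_smul, xiPhi_smul]
  ring

theorem alpha_smul (κ τ : ℝ) : D.alpha κ (z.1, τ • z.2) = τ * D.alpha κ z :=
  smul_dotProduct τ z.2 (D.cVec κ z.1)

theorem connAlong_smul (τ : ℝ) : D.connAlong (z.1, τ • z.2) = τ • D.connAlong z := by
  simp only [connAlong, sharp_smul, Finset.smul_sum, smul_smul, Pi.smul_apply, smul_eq_mul]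
  exact Finset.sum_congr rfl fun k _ => by congr 1; ring

theorem dcVec_smul (κ τ : ℝ) : D.dcVec κ (z.1, τ • z.2) = τ • D.dcVec κ z := by
  rw [dcVec, dcVec, connAlong_smul, sharp_smul, smul_mulVec, smul_add, smul_comm (2 : ℝ) τ]
  congr 1
  funext i
  simp only [map_smul, Pi.smul_apply]

theorem yVec_smul (κ : ℝ) {τ : ℝ} (hτ : τ ≠ 0) : D.yVec κ (z.1, τ • z.2) = D.yVec κ z := by
  rw [yVec, yVec, sigma_smul, alpha_smul, mul_div_mul_left _ _ hτ]

theorem covY_smul (κ : ℝ) {τ : ℝ} (hτ : τ ≠ 0) :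
    D.covY κ (z.1, τ • z.2) = τ • D.covY κ z := by
  rw [covY, covY, dcVec_smul, sigma_smul, alpha_smul, mul_div_mul_left _ _ hτ, smul_dotProduct,
    dotProduct_smul, smul_sub, smul_eq_mul, smul_eq_mul]
  simp only [smul_smul]
  have e1 : τ * D.sigma z * (τ * (τ * (z.2 ⬝ᵥ D.dcVec κ z))) / (τ * D.alpha κ z) ^ 2
      = τ * (D.sigma z * (z.2 ⬝ᵥ D.dcVec κ z) / D.alpha κ z ^ 2) := by
    rw [mul_pow, show τ * D.sigma z * (τ * (τ * (z.2 ⬝ᵥ D.dcVec κ z)))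
      = τ ^ 2 * (τ * (D.sigma z * (z.2 ⬝ᵥ D.dcVec κ z))) by ring,
        mul_div_mul_left _ _ (by positivity),
      mul_div_assoc]
  rw [e1, mul_comm (D.sigma z / D.alpha κ z) τ]

end Data

namespace Data

variable {D : Data}

/-! ### Uniform bounds on the trapped set -/

theorem continuous_xiT : Continuous xiT := by
  unfold xiT dot
  fun_prop

theorem continuous_xiPhi : Continuous xiPhi := by
  have e : xiPhi = fun y : Phase => y.2 2 * y.1 1 - y.2 1 * y.1 2 := by
    funext y
    simp only [xiPhi, dot, Fin.sum_univ_four, dphiVec, Matrix.cons_val]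
    ring
  rw [e]
  fun_prop

theorem abs_apply_le_rad (p : R4) (i : Fin 4) (hi : i ≠ 0) : |p i| ≤ rad p := by
  refine Real.abs_le_sqrt ?_
  fin_cases i
  · exact absurd rfl hi
  · change p 1 ^ 2 ≤ _; nlinarith [sq_nonneg (p 2), sq_nonneg (p 3)]
  · change p 2 ^ 2 ≤ _; nlinarith [sq_nonneg (p 1), sq_nonneg (p 3)]
  · change p 3 ^ 2 ≤ _; nlinarith [sq_nonneg (p 1), sq_nonneg (p 2)]

/-- A compact set of normalized null covectors. -/
def trapK (D : Data) (k l : ℝ) : Set Phase :=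
  {z | (z.1 0 = 0 ∧ rad z.1 ∈ Set.Icc D.rEvent D.rCosmo ∧
      deriv D.mu (rad z.1) ^ 2 ≤ k * D.mu (rad z.1) ∧ ‖z.2‖ = 1) ∧ D.Gfun z = 0 ∧
    l * D.radialF z (rad z.1) ^ 2 ≤ D.radialF z (rad z.1) * D.radialF z D.r0}

theorem Subextremal.rad_mem (h : D.Subextremal) {k r : ℝ} (hr : r ∈ Set.Icc D.rEvent D.rCosmo)
    (hk : deriv D.mu r ^ 2 ≤ k * D.mu r) : r ∈ Set.Ioo D.rEvent D.rCosmo := by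
  refine ⟨lt_of_le_of_ne hr.1 ?_, lt_of_le_of_ne hr.2 ?_⟩
  · rintro rfl
    rw [h.mu_rEvent, mul_zero] at hk
    exact h.deriv_mu_rEvent_ne_zero (pow_eq_zero_iff two_ne_zero |>.1 (le_antisymm hk (sq_nonneg
      _)))
  · rintro rfl
    rw [h.mu_rCosmo, mul_zero] at hk
    exact h.deriv_mu_rCosmo_ne_zero (pow_eq_zero_iff two_ne_zero |>.1 (le_antisymm hk (sq_nonneg
      _)))

theorem Subextremal.isCompact_trapK (h : D.Subextremal) (k l : ℝ) : IsCompact (D.trapK k l) := by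
  set A : Set Phase := {z | z.1 0 = 0 ∧ rad z.1 ∈ Set.Icc D.rEvent D.rCosmo ∧
      deriv D.mu (rad z.1) ^ 2 ≤ k * D.mu (rad z.1) ∧ ‖z.2‖ = 1} with hA
  have hrad : Continuous fun z : Phase => rad z.1 := continuous_rad.comp continuous_fst
  have hmu : Continuous D.mu := D.contDiff_mu.continuous
  have hmu' : Continuous (deriv D.mu) := D.contDiff_mu.continuous_deriv (by simp)
  have hAc : IsClosed A := by
    refine IsClosed.inter (isClosed_eq (by fun_prop) continuous_const) (IsClosed.inter
      (isClosed_Icc.preimage hrad) (IsClosed.inter (isClosed_le ((hmu'.comp hrad).pow 2)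
        (continuous_const.mul (hmu.comp hrad))) (isClosed_eq (by fun_prop) continuous_const)))
  have hAb : Bornology.IsBounded A := by
    refine (Metric.isBounded_closedBall (x := (0 : Phase)) (r := max D.rCosmo 1)).subset ?_
    rintro z ⟨h0, hr, -, h1⟩
    rw [mem_closedBall_zero_iff, Prod.norm_def]
    refine max_le_max ?_ h1.le
    have hc : 0 ≤ D.rCosmo := (h.rEvent_pos.trans h.rEvent_lt).le
    refine (pi_norm_le_iff_of_nonneg hc).2 fun i => ?_
    by_cases hi : i = 0
    · rw [hi, h0, norm_zero]; exact hc
    · exact (abs_apply_le_rad z.1 i hi).trans hr.2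
  have hAK : IsCompact A := Metric.isCompact_of_isClosed_isBounded hAc hAb
  have hreg : ∀ z ∈ A, z.1 ∈ D.reg := fun z hz => h.rad_mem hz.2.1 hz.2.2.1
  have hG : ContinuousOn D.Gfun A := fun z hz =>
    (h.contDiffAt_Gfun (hreg z hz)).continuousAt.continuousWithinAt
  have h1 := hG.preimage_isClosed_of_isClosed hAc (isClosed_singleton (x := (0 : ℝ)))
  have hF : Continuous fun z : Phase => D.radialF z (rad z.1) := by
    unfold radialF
    exact (((hrad.pow 2).add continuous_const).mul continuous_xiT).add
      (continuous_const.mul continuous_xiPhi)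
  have hF0 : Continuous fun z : Phase => D.radialF z D.r0 := by
    unfold radialF
    exact (continuous_const.mul continuous_xiT).add (continuous_const.mul continuous_xiPhi)
  have h2 : IsClosed {z : Phase | l * D.radialF z (rad z.1) ^ 2
      ≤ D.radialF z (rad z.1) * D.radialF z D.r0} :=
    isClosed_le (continuous_const.mul (hF.pow 2)) (hF.mul hF0)
  refine hAK.of_isClosed_subset (t := D.trapK k l) ?_ fun z hz => hz.1
  have e : D.trapK k l = (A ∩ D.Gfun ⁻¹' {0}) ∩ {z : Phase | l * D.radialF z (rad z.1) ^ 2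
      ≤ D.radialF z (rad z.1) * D.radialF z D.r0} := by
    ext z
    exact ⟨fun hz => ⟨⟨hz.1, hz.2.1⟩, hz.2.2⟩, fun hz => ⟨hz.1.1, hz.1.2, hz.2⟩⟩
  rw [e]
  exact h1.inter h2

theorem Subextremal.reg_of_mem_trapK (h : D.Subextremal) {k l : ℝ} {z : Phase}
    (hz : z ∈ D.trapK k l) : z.1 ∈ D.reg := h.rad_mem hz.1.2.1 hz.1.2.2.1

theorem Subextremal.sigma_eq (h : D.Subextremal) (z : Phase) :
    D.radialF z D.r0 = -((D.r0 ^ 2 + D.a ^ 2) * D.sigma z) := by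
  have : 0 < D.r0 := h.rEvent_pos.trans h.r0_mem.1
  have : D.r0 ^ 2 + D.a ^ 2 ≠ 0 := by positivity
  rw [radialF, sigma]
  field_simp

theorem Subextremal.alpha_zero_eq (h : D.Subextremal) {z : Phase} (hz : z.1 ∈ D.reg) :
    D.radialF z (rad z.1) = (rad z.1 ^ 2 + D.a ^ 2) * D.alpha 0 z := by
  have : 0 < rad z.1 := h.rad_pos hz
  have hne : rad z.1 ^ 2 + D.a ^ 2 ≠ 0 := by positivity
  have e : D.alpha 0 z = xiT z + D.a / (rad z.1 ^ 2 + D.a ^ 2) * xiPhi z := by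
    rw [alpha, cVec_eq]
    have : (0 : ℝ) ^ 2 = 0 := by norm_num
    rw [zero_mul, this, zero_smul, zero_smul, add_zero, add_zero, dotProduct_add, dotProduct_smul]
    rfl
  rw [e, radialF]
  field_simp

theorem Subextremal.radialF_mul_pos (h : D.Subextremal) {l : ℝ} (hl : 0 < l) {z : Phase}
    (hz : z.1 ∈ D.reg) (hξ : z.2 ≠ 0) (hG : D.Gfun z = 0)
    (hle : l * D.radialF z (rad z.1) ^ 2 ≤ D.radialF z (rad z.1) * D.radialF z D.r0) :
    0 < D.radialF z (rad z.1) * D.radialF z D.r0 := by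
  have := h.radialF_ne_zero hz hξ hG
  exact lt_of_lt_of_le (by positivity) hle

theorem Subextremal.alpha_mul_sigma_neg (h : D.Subextremal) {l : ℝ} (hl : 0 < l) {z : Phase}
    (hz : z.1 ∈ D.reg) (hξ : z.2 ≠ 0) (hG : D.Gfun z = 0)
    (hle : l * D.radialF z (rad z.1) ^ 2 ≤ D.radialF z (rad z.1) * D.radialF z D.r0) :
    D.alpha 0 z * D.sigma z < 0 := by
  have h1 := h.radialF_mul_pos hl hz hξ hG hle
  rw [h.sigma_eq, h.alpha_zero_eq hz] at h1
  have hr : 0 < rad z.1 := h.rad_pos hz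
  have hr0 : 0 < D.r0 := h.rEvent_pos.trans h.r0_mem.1
  have hp : 0 < (rad z.1 ^ 2 + D.a ^ 2) * (D.r0 ^ 2 + D.a ^ 2) := by positivity
  by_contra hn
  have h2 := mul_nonneg hp.le (not_lt.1 hn)
  linarith

theorem cVec_interp (D : Data) (κ : ℝ) (p : R4) (i : Fin 4) :
    D.cVec κ p i = (1 - κ ^ 2) * D.cVec 0 p i + (κ ^ 2 + κ) / 2 * D.cVec 1 p i
      + (κ ^ 2 - κ) / 2 * D.cVec (-1) p i := by
  simp only [cVec]
  ring

theorem alpha_interp (D : Data) (κ : ℝ) (z : Phase) :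
    D.alpha κ z = (1 - κ ^ 2) * D.alpha 0 z + (κ ^ 2 + κ) / 2 * D.alpha 1 z
      + (κ ^ 2 - κ) / 2 * D.alpha (-1) z := by
  simp only [alpha, dotProduct, Finset.mul_sum, ← Finset.sum_add_distrib]
  refine Finset.sum_congr rfl fun i _ => ?_
  rw [D.cVec_interp κ]
  ring

theorem Subextremal.dcVec_interp (h : D.Subextremal) (κ : ℝ) {z : Phase} (hz : z.1 ∈ D.reg)
    (i : Fin 4) :
    D.dcVec κ z i = (1 - κ ^ 2) * D.dcVec 0 z i + (κ ^ 2 + κ) / 2 * D.dcVec 1 z i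
      + (κ ^ 2 - κ) / 2 * D.dcVec (-1) z i := by
  have hd := fun κ i => (contDiffAt_cVec h hz κ i).differentiableAt (by simp)
  have h1 : fderiv ℝ (fun y => D.cVec κ y i) z.1 ((2 : ℝ) • D.sharp z)
      = (1 - κ ^ 2) * fderiv ℝ (fun y => D.cVec 0 y i) z.1 ((2 : ℝ) • D.sharp z)
        + (κ ^ 2 + κ) / 2 * fderiv ℝ (fun y => D.cVec 1 y i) z.1 ((2 : ℝ) • D.sharp z)
        + (κ ^ 2 - κ) / 2 * fderiv ℝ (fun y => D.cVec (-1) y i) z.1 ((2 : ℝ) • D.sharp z) := by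
    have hl := fun κ => hasDerivAt_line (hd κ i) ((2 : ℝ) • D.sharp z)
    refine (hl κ).unique ?_
    have e : (fun t : ℝ => D.cVec κ (z.1 + t • (2 : ℝ) • D.sharp z) i)
        = fun t : ℝ => (1 - κ ^ 2) * D.cVec 0 (z.1 + t • (2 : ℝ) • D.sharp z) i
          + (κ ^ 2 + κ) / 2 * D.cVec 1 (z.1 + t • (2 : ℝ) • D.sharp z) i
          + (κ ^ 2 - κ) / 2 * D.cVec (-1) (z.1 + t • (2 : ℝ) • D.sharp z) i :=
      funext fun t => D.cVec_interp κ _ i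
    rw [e]
    exact (((hl 0).const_mul _).fun_add ((hl 1).const_mul _)).fun_add ((hl (-1)).const_mul _)
  have h2 : (D.connAlong z *ᵥ D.cVec κ z.1) i = (1 - κ ^ 2) * (D.connAlong z *ᵥ D.cVec 0 z.1) i
        + (κ ^ 2 + κ) / 2 * (D.connAlong z *ᵥ D.cVec 1 z.1) i
        + (κ ^ 2 - κ) / 2 * (D.connAlong z *ᵥ D.cVec (-1) z.1) i := by
    simp only [mulVec, dotProduct, Finset.mul_sum, ← Finset.sum_add_distrib]
    refine Finset.sum_congr rfl fun j _ => ?_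
    rw [D.cVec_interp κ]
    ring
  simp only [dcVec, Pi.add_apply]
  rw [h1, h2]
  ring

theorem Subextremal.continuousAt_dcVec (h : D.Subextremal) (κ : ℝ) {z : Phase} (hz : z.1 ∈ D.reg)
    (i : Fin 4) : ContinuousAt (fun y => D.dcVec κ y i) z := by
  have hs : ContinuousAt (fun y : Phase => D.sharp y) z :=
    continuousAt_pi.2 fun i => (h.contDiffAt_sharp hz i).continuousAt
  have h1 : ContinuousAt (fun y : Phase => fderiv ℝ (fun x => D.cVec κ x i) y.1) z :=
    ContinuousAt.comp (g := fderiv ℝ (fun x => D.cVec κ x i)) (f := Prod.fst)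
      ((contDiffAt_cVec h hz κ i).fderiv_right (m := ∞) (by simp)).continuousAt continuousAt_fst
  simp only [dcVec, Pi.add_apply, connAlong, mulVec, dotProduct, Matrix.sum_apply,
    Matrix.smul_apply, smul_eq_mul]
  refine (h1.clm_apply (hs.const_smul (2 : ℝ))).add ?_
  refine tendsto_finsetSum _ fun j _ => ContinuousAt.mul (tendsto_finsetSum _ fun k _ => ?_)
    (contDiffAt_comp_fst (contDiffAt_cVec h hz κ j)).continuousAt
  exact (continuousAt_const.mul (h.contDiffAt_sharp hz k).continuousAt).mul
    (contDiffAt_comp_fst (h.contDiffAt_chris hz i k j)).continuousAt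

end Data

theorem continuousOn_bl {E : Type*} [TopologicalSpace E] {S : Set E} {Q : E → Mat4} {X Y : E → R4}
    (hQ : ∀ i j, ContinuousOn (fun y => Q y i j) S) (hX : ∀ i, ContinuousOn (fun y => X y i) S)
    (hY : ∀ i, ContinuousOn (fun y => Y y i) S) :
    ContinuousOn (fun y => bl (Q y) (X y) (Y y)) S := by
  simp only [bl_eq_sum]
  exact continuousOn_finsetSum _ fun i _ => continuousOn_finsetSum _ fun j _ =>
    ((hQ i j).mul (hX i)).mul (hY j)

namespace Data

variable {D : Data}

/-- The bounds entering the choice of the damping constants. -/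
structure IsBounded (D : Data) (c y N κ s : ℝ) (z : Phase) : Prop where
  sigma_ne_zero : D.sigma z ≠ 0
  alpha_le : s * D.alpha κ z ≤ -(c * |D.sigma z|)
  nVal_le : |D.nVal κ z| ≤ N
  covY_le : |bl (D.metric z.1) (D.yVec κ z) (D.covY κ z)| ≤ y * |D.sigma z|
  covY_covY_le : bl (D.metric z.1) (D.covY κ z) (D.covY κ z) ≤ (y * |D.sigma z|) ^ 2

theorem Subextremal.exists_alpha_bound (h : D.Subextremal) (k : ℝ) {l : ℝ} (hl : 0 < l) :
    ∃ κ₀ > 0, ∃ c > 0, ∀ z ∈ D.trapK k l, D.sigma z ≠ 0 ∧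
      ∀ κ ∈ Set.Icc 0 κ₀, D.alpha κ z / D.sigma z ≤ -c := by
  have hK := h.isCompact_trapK k l
  have hne : ∀ z ∈ D.trapK k l, D.alpha 0 z * D.sigma z < 0 := by
    intro z hz
    refine h.alpha_mul_sigma_neg hl (h.reg_of_mem_trapK hz) ?_ hz.2.1 hz.2.2
    intro h0
    have := hz.1.2.2.2
    rw [h0, norm_zero] at this
    exact zero_ne_one this
  have hσ : ∀ z ∈ D.trapK k l, D.sigma z ≠ 0 := by
    intro z hz h0
    have := hne z hz
    rw [h0, mul_zero] at this
    exact lt_irrefl _ this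
  have hcont : ∀ κ, ContinuousOn (fun z => D.alpha κ z / D.sigma z) (D.trapK k l) := by
    intro κ z hz
    exact ((h.contDiffAt_alpha (h.reg_of_mem_trapK hz) κ).continuousAt.div
      D.contDiff_sigma.continuous.continuousAt (hσ z hz)).continuousWithinAt
  have hneg : ContinuousOn (fun z => -(D.alpha 0 z / D.sigma z)) (D.trapK k l) := (hcont 0).neg
  obtain ⟨c, hc, hmin⟩ := hK.exists_forall_le' hneg (a := 0) (by
    intro z hz
    have h1 := hσ z hz
    have h2 : 0 < D.sigma z ^ 2 := by positivity
    have h3 : D.alpha 0 z / D.sigma z = D.alpha 0 z * D.sigma z / D.sigma z ^ 2 := by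
      field_simp
    have h4 := div_neg_of_neg_of_pos (hne z hz) h2
    simp only [h3]
    linarith)
  obtain ⟨B₁, hB₁⟩ := hK.exists_bound_of_continuousOn (hcont 1)
  obtain ⟨B₂, hB₂⟩ := hK.exists_bound_of_continuousOn (hcont (-1))
  set B := |B₁| + |B₂| + 1 with hB
  have hBpos : 0 < B := by positivity
  refine ⟨min (1 / 2) (c / (4 * B)), lt_min (by norm_num) (by positivity), c / 4, by positivity,
    fun z hz => ⟨hσ z hz, fun κ hκ => ?_⟩⟩
  have hκ1 : κ ≤ 1 / 2 := hκ.2.trans (min_le_left _ _)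
  have hκ2 : κ * (4 * B) ≤ c := by
    have := hκ.2.trans (min_le_right _ _)
    rwa [le_div_iff₀ (by positivity)] at this
  have hκ0 : 0 ≤ κ := hκ.1
  have h0 : D.alpha 0 z / D.sigma z ≤ -c := by linarith [hmin z hz]
  have h1 : |D.alpha 1 z / D.sigma z| ≤ B := by
    refine (hB₁ z hz).trans ?_
    linarith [le_abs_self B₁, abs_nonneg B₂]
  have h2 : |D.alpha (-1) z / D.sigma z| ≤ B := by
    refine (hB₂ z hz).trans ?_
    linarith [le_abs_self B₂, abs_nonneg B₁]
  have e : D.alpha κ z / D.sigma z = (1 - κ ^ 2) * (D.alpha 0 z / D.sigma z)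
      + (κ ^ 2 + κ) / 2 * (D.alpha 1 z / D.sigma z)
      + (κ ^ 2 - κ) / 2 * (D.alpha (-1) z / D.sigma z) := by
    rw [D.alpha_interp κ]
    ring
  have hk2 : κ ^ 2 ≤ κ / 2 := by
    have := mul_le_mul_of_nonneg_left hκ1 hκ0
    linarith [sq κ]
  have t0 : (1 - κ ^ 2) * (D.alpha 0 z / D.sigma z) ≤ (1 - κ ^ 2) * -c :=
    mul_le_mul_of_nonneg_left h0 (by linarith)
  have t0' : κ ^ 2 * c ≤ 1 / 4 * c := mul_le_mul_of_nonneg_right (by linarith) hc.le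
  have t1 : (κ ^ 2 + κ) / 2 * (D.alpha 1 z / D.sigma z) ≤ (κ ^ 2 + κ) / 2 * B :=
    mul_le_mul_of_nonneg_left ((le_abs_self _).trans h1) (by positivity)
  have t1' : (κ ^ 2 + κ) / 2 * B ≤ κ * B := mul_le_mul_of_nonneg_right (by linarith) hBpos.le
  have t2 : (κ - κ ^ 2) / 2 * (-(D.alpha (-1) z / D.sigma z)) ≤ (κ - κ ^ 2) / 2 * B :=
    mul_le_mul_of_nonneg_left ((neg_le_abs _).trans h2) (by linarith)
  have t2' : (κ - κ ^ 2) / 2 * B ≤ κ / 2 * B := by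
    refine mul_le_mul_of_nonneg_right ?_ hBpos.le
    linarith [sq_nonneg κ]
  rw [e]
  linarith

theorem Subextremal.exists_trapK_bounds (h : D.Subextremal) (k : ℝ) {l : ℝ} (hl : 0 < l) :
    ∃ κ₀ > 0, ∃ c > 0, ∃ y ≥ 0, ∃ N ≥ 0, ∀ z ∈ D.trapK k l, ∀ κ ∈ Set.Icc 0 κ₀,
      D.sigma z ≠ 0 ∧ D.alpha κ z / D.sigma z ≤ -c ∧ |D.nVal κ z| ≤ N ∧
      |bl (D.metric z.1) (D.yVec κ z) (D.covY κ z) / D.sigma z| ≤ y ∧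
      bl (D.metric z.1) (D.covY κ z) (D.covY κ z) / D.sigma z ^ 2 ≤ y ^ 2 := by
  obtain ⟨κ₀, hκ₀, c, hc, H⟩ := h.exists_alpha_bound k hl
  set S : Set (ℝ × Phase) := Set.Icc 0 κ₀ ×ˢ D.trapK k l with hS
  have hSc : IsCompact S := isCompact_Icc.prod (h.isCompact_trapK k l)
  have hreg : ∀ q ∈ S, q.2.1 ∈ D.reg := fun q hq => h.reg_of_mem_trapK hq.2
  have hσ : ∀ q ∈ S, D.sigma q.2 ≠ 0 := fun q hq => (H q.2 hq.2).1
  have hα : ∀ q ∈ S, D.alpha q.1 q.2 ≠ 0 := by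
    intro q hq h0
    have := (H q.2 hq.2).2 q.1 hq.1
    rw [h0, zero_div] at this
    linarith
  have hsnd : ∀ {w : Phase → ℝ}, (∀ z : Phase, z.1 ∈ D.reg → ContinuousAt w z) →
      ContinuousOn (fun q : ℝ × Phase => w q.2) S := fun hw q hq =>
    (ContinuousAt.comp (f := fun q : ℝ × Phase => q.2) (hw q.2 (hreg q hq))
      continuousAt_snd).continuousWithinAt
  have hfst : ContinuousOn (fun q : ℝ × Phase => q.1) S := continuousOn_fst
  have hinterp : ∀ {w : ℝ → Phase → ℝ}, (∀ κ, ∀ z : Phase, z.1 ∈ D.reg → ContinuousAt (w κ) z) →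
      (∀ κ, ∀ z : Phase, z.1 ∈ D.reg → w κ z = (1 - κ ^ 2) * w 0 z + (κ ^ 2 + κ) / 2 * w 1 z
        + (κ ^ 2 - κ) / 2 * w (-1) z) → ContinuousOn (fun q : ℝ × Phase => w q.1 q.2) S := by
    intro w hw hi
    have h1 : ContinuousOn (fun q : ℝ × Phase => (1 - q.1 ^ 2) * w 0 q.2
        + (q.1 ^ 2 + q.1) / 2 * w 1 q.2 + (q.1 ^ 2 - q.1) / 2 * w (-1) q.2) S :=
      (((continuousOn_const.sub (hfst.pow 2)).mul (hsnd (hw 0))).add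
        ((((hfst.pow 2).add hfst).div_const 2).mul (hsnd (hw 1)))).add
        ((((hfst.pow 2).sub hfst).div_const 2).mul (hsnd (hw (-1))))
    exact h1.congr fun q hq => hi q.1 q.2 (hreg q hq)
  have cσ : ContinuousOn (fun q : ℝ × Phase => D.sigma q.2) S :=
    hsnd fun z _ => D.contDiff_sigma.continuous.continuousAt
  have cα : ContinuousOn (fun q : ℝ × Phase => D.alpha q.1 q.2) S :=
    hinterp (fun κ z hz => (h.contDiffAt_alpha hz κ).continuousAt) fun κ z _ => D.alpha_interp κ z
  have cc : ∀ i, ContinuousOn (fun q : ℝ × Phase => D.cVec q.1 q.2.1 i) S := fun i =>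
    hinterp (w := fun κ z => D.cVec κ z.1 i)
      (fun κ z hz => (contDiffAt_comp_fst (contDiffAt_cVec h hz κ i)).continuousAt)
      fun κ z _ => D.cVec_interp κ z.1 i
  have cd : ∀ i, ContinuousOn (fun q : ℝ × Phase => D.dcVec q.1 q.2 i) S := fun i =>
    hinterp (w := fun κ z => D.dcVec κ z i) (fun κ z hz => h.continuousAt_dcVec κ hz i)
      fun κ z hz => h.dcVec_interp κ hz i
  have cg : ∀ i j, ContinuousOn (fun q : ℝ × Phase => D.metric q.2.1 i j) S := fun i j =>
    hsnd (w := fun z => D.metric z.1 i j)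
      fun z hz => (contDiffAt_comp_fst (h.contDiffAt_metric hz i j)).continuousAt
  have cξ : ContinuousOn (fun q : ℝ × Phase => q.2.2 ⬝ᵥ D.dcVec q.1 q.2) S := by
    simp only [dotProduct]
    refine continuousOn_finsetSum _ fun i _ => ContinuousOn.mul ?_ (cd i)
    exact hsnd (w := fun z => z.2 i) fun z _ => (contDiff_snd_apply i).continuous.continuousAt
  have cY : ∀ i, ContinuousOn (fun q : ℝ × Phase => D.yVec q.1 q.2 i) S := fun i =>
    (cσ.div cα hα).mul (cc i)
  have cV : ∀ i, ContinuousOn (fun q : ℝ × Phase => D.covY q.1 q.2 i) S := fun i =>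
    ((cσ.div cα hα).mul (cd i)).sub
      (((cσ.mul cξ).div (cα.pow 2) fun q hq => pow_ne_zero 2 (hα q hq)).mul (cc i))
  obtain ⟨N, hN⟩ := hSc.exists_bound_of_continuousOn (continuousOn_bl cg cY cY)
  obtain ⟨y₁, hy₁⟩ := hSc.exists_bound_of_continuousOn ((continuousOn_bl cg cY cV).div cσ hσ)
  obtain ⟨y₂, hy₂⟩ := hSc.exists_bound_of_continuousOn ((continuousOn_bl cg cV cV).div (cσ.pow 2)
    fun q hq => pow_ne_zero 2 (hσ q hq))
  refine ⟨κ₀, hκ₀, c, hc, |y₁| + |y₂| + 1, by positivity, |N|, abs_nonneg _, ?_⟩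
  intro z hz κ hκ
  have hq : (κ, z) ∈ S := ⟨hκ, hz⟩
  refine ⟨(H z hz).1, (H z hz).2 κ hκ, (hN _ hq).trans (le_abs_self _), ?_, ?_⟩
  · refine (hy₁ _ hq).trans ?_
    linarith [le_abs_self y₁, abs_nonneg y₂]
  · refine ((le_abs_self _).trans (hy₂ _ hq)).trans ?_
    have h1 := le_abs_self y₂
    have h2 := abs_nonneg y₂
    have h3 := abs_nonneg y₁
    nlinarith

theorem Subextremal.exists_uniform_bounds (h : D.Subextremal) :
    ∃ κ₀ > 0, ∃ c > 0, ∃ y ≥ 0, ∃ N ≥ 0, ∀ κ ∈ Set.Ioo 0 κ₀, ∀ s : ℝ, |s| = 1 → ∀ z ∈ D.Gam s,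
      D.IsBounded c y N κ s z := by
  obtain ⟨k, l, hl, hT⟩ := h.exists_isTrapped
  obtain ⟨κ₀, hκ₀, c, hc, y, hy, N, hN, H⟩ := h.exists_trapK_bounds k hl
  refine ⟨κ₀, hκ₀, c, hc, y, hy, N, hN, fun κ hκ s hs z hz => ?_⟩
  have T := hT s z hz
  set b : ℝ := ‖z.2‖⁻¹ with hb
  have hbpos : 0 < b := inv_pos.2 (norm_pos_iff.2 T.ne_zero)
  set z₁ : Phase := (z.1 + (-z.1 0) • dtVec, z.2) with hz₁
  set z₂ : Phase := (z₁.1, b • z₁.2) with hz₂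
  have hrad : rad z₂.1 = rad z.1 := rad_add_dtVec z.1 _
  have hF : ∀ r, D.radialF z₂ r = b * D.radialF z r := by
    intro r
    rw [hz₂, radialF_smul, hz₁, radialF_add_dtVec]
  have hmem : z₂ ∈ D.trapK k l := by
    refine ⟨⟨?_, ?_, ?_, ?_⟩, ?_, ?_⟩
    · change (z.1 + (-z.1 0) • dtVec) 0 = 0
      simp [dtVec]
    · rw [hrad]
      exact ⟨T.mem.1.le, T.mem.2.le⟩
    · rw [hrad]
      exact T.deriv_le
    · change ‖b • z.2‖ = 1
      rw [norm_smul, hb, norm_inv, norm_norm, inv_mul_cancel₀ (norm_ne_zero_iff.2 T.ne_zero)]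
    · rw [hz₂, Gfun_smul, hz₁, Gfun_add_dtVec, T.null, mul_zero]
    · rw [hrad, hF, hF]
      have := mul_le_mul_of_nonneg_left T.le_mul (sq_nonneg b)
      linarith
  obtain ⟨h1, h2, h3, h4, h5⟩ := H z₂ hmem κ ⟨hκ.1.le, hκ.2.le⟩
  have eσ : D.sigma z₂ = b * D.sigma z := by rw [hz₂, sigma_smul, hz₁, sigma_add_dtVec]
  have eα : D.alpha κ z₂ = b * D.alpha κ z := by rw [hz₂, alpha_smul, hz₁, alpha_add_dtVec]
  have eg : D.metric z₂.1 = D.metric z.1 := D.metric_add_dtVec z.1 _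
  have eY : D.yVec κ z₂ = D.yVec κ z := by rw [hz₂, yVec_smul _ _ _ hbpos.ne', hz₁, yVec_add_dtVec]
  have eV : D.covY κ z₂ = b • D.covY κ z := by
    rw [hz₂, covY_smul _ _ _ hbpos.ne', hz₁, covY_add_dtVec]
  rw [eσ, eα, mul_div_mul_left _ _ hbpos.ne'] at h2
  rw [nVal, eg, eY] at h3
  rw [eg, eY, eV, bl_smul_right, eσ, mul_div_mul_left _ _ hbpos.ne'] at h4
  rw [eg, eV, bl_smul_right, bl_smul_left, eσ, mul_pow, ← mul_assoc, ← sq,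
    mul_div_mul_left _ _ (by positivity)] at h5
  rw [eσ] at h1
  have hσ : D.sigma z ≠ 0 := right_ne_zero_of_mul h1
  have hσp : 0 < |D.sigma z| := abs_pos.2 hσ
  have hsσ : s * D.sigma z = |D.sigma z| := by
    have hpos := h.radialF_mul_pos hl T.mem T.ne_zero T.null T.le_mul
    rw [h.sigma_eq] at hpos
    have hr0 : 0 < D.r0 := h.rEvent_pos.trans h.r0_mem.1
    have hr : 0 < D.r0 ^ 2 + D.a ^ 2 := by positivity
    have h6 : 0 < s * D.sigma z := by
      by_contra hn
      have hs2 : s * s = 1 := by rw [← abs_mul_abs_self, hs, one_mul]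
      have h7 : 0 ≤ (-(s * D.radialF z (rad z.1))) * (-(s * D.sigma z)) :=
        mul_nonneg (by linarith [T.neg]) (by linarith)
      have h8 := mul_nonneg hr.le h7
      have h9 : (D.r0 ^ 2 + D.a ^ 2) * ((-(s * D.radialF z (rad z.1))) * (-(s * D.sigma z)))
          = (s * s) * ((D.r0 ^ 2 + D.a ^ 2) * (D.radialF z (rad z.1) * D.sigma z)) := by ring
      rw [h9, hs2, one_mul] at h8
      linarith
    rw [← abs_of_pos h6, abs_mul, hs, one_mul]
  refine ⟨hσ, ?_, h3, ?_, ?_⟩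
  · have e : s * D.alpha κ z = D.alpha κ z / D.sigma z * |D.sigma z| := by
      rw [← hsσ]
      field_simp
    rw [e]
    have := mul_le_mul_of_nonneg_right h2 hσp.le
    linarith
  · rw [abs_div, div_le_iff₀ hσp] at h4
    exact h4
  · rw [div_le_iff₀ (by positivity)] at h5
    rw [mul_pow, sq_abs]
    exact h5

end Data

/-! ### The fiber inner product -/

/-- The coefficients of the Euclidean inner product of the skew-symmetric parts of two tensors. -/
def skewCoef (i j k l : Fin 4) : ℝ :=
  ((if i = k ∧ j = l then 1 else 0) - (if i = l ∧ j = k then 1 else 0)) / 2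

theorem skewCoef_swap (i j k l : Fin 4) : skewCoef j i l k = skewCoef i j k l := by
  simp only [skewCoef, and_comm]

theorem skewCoef_symm (i j k l : Fin 4) : skewCoef i j k l = skewCoef k l i j := by
  have h1 : (i = k ∧ j = l) ↔ (k = i ∧ l = j) := by simp only [eq_comm]
  have h2 : (i = l ∧ j = k) ↔ (k = j ∧ l = i) := by rw [and_comm, eq_comm, @eq_comm _ i]
  simp only [skewCoef, h1, h2]

theorem sum_skewCoef (x y : Mat4) : ∑ i, ∑ j, ∑ k, ∑ l, skewCoef i j k l * x i j * y k l
    = ∑ i, ∑ j, x i j * (y i j - y j i) / 2 := by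
  refine Finset.sum_congr rfl fun i _ => Finset.sum_congr rfl fun j _ => ?_
  have h1 : ∑ k, ∑ l, (if i = k ∧ j = l then (1 : ℝ) else 0) * (x i j * y k l) = x i j * y i j := by
    rw [Finset.sum_eq_single i _ (by simp), Finset.sum_eq_single j _ (by simp)]
    · simp
    · intro l _ hl
      simp [hl.symm]
    · intro k _ hk
      simp [hk.symm]
  have h2 : ∑ k, ∑ l, (if i = l ∧ j = k then (1 : ℝ) else 0) * (x i j * y k l) = x i j * y j i := by
    rw [Finset.sum_eq_single j _ (by simp), Finset.sum_eq_single i _ (by simp)]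
    · simp
    · intro l _ hl
      simp [hl.symm]
    · intro k _ hk
      simp [hk.symm]
  have e : ∑ k, ∑ l, skewCoef i j k l * x i j * y k l
      = ((∑ k, ∑ l, (if i = k ∧ j = l then (1 : ℝ) else 0) * (x i j * y k l))
        - ∑ k, ∑ l, (if i = l ∧ j = k then (1 : ℝ) else 0) * (x i j * y k l)) / 2 := by
    simp only [← Finset.sum_sub_distrib, Finset.sum_div, skewCoef]
    exact Finset.sum_congr rfl fun k _ => Finset.sum_congr rfl fun l _ => by ring
  rw [e, h1, h2]
  ring

theorem sum_mul_sub_swap (x : Mat4) :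
    ∑ i, ∑ j, x i j * (x i j - x j i) / 2 = ∑ i, ∑ j, (x i j - x j i) ^ 2 / 4 := by
  have h : ∑ i, ∑ j, x i j * (x i j - x j i) / 2 = ∑ i, ∑ j, x j i * (x j i - x i j) / 2 :=
    Finset.sum_comm
  have h2 : ∑ i, ∑ j, (x i j - x j i) ^ 2 / 4 = (∑ i, ∑ j, x i j * (x i j - x j i) / 2
      + ∑ i, ∑ j, x j i * (x j i - x i j) / 2) / 2 := by
    simp only [← Finset.sum_add_distrib, Finset.sum_div]
    exact Finset.sum_congr rfl fun i _ => Finset.sum_congr rfl fun j _ => by ring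
  rw [h2, ← h]
  ring

theorem sum_smul_symE (x : Mat4) :
    ∑ b : Idx, x b.1 b.2 • symE b.1 b.2 = (1 / 2 : ℝ) • (x + xᵀ) := by
  have hs : ((1 / 2 : ℝ) • (x + xᵀ)).IsSymm := by
    rw [IsSymm, transpose_smul, transpose_add, transpose_transpose, add_comm]
  conv_rhs => rw [eq_sum_symE hs]
  have h : ∑ b : Idx, x b.2 b.1 • symE b.1 b.2 = ∑ b : Idx, x b.1 b.2 • symE b.1 b.2 := by
    rw [← (Equiv.prodComm (Fin 4) (Fin 4)).sum_comp]
    refine Finset.sum_congr rfl fun b _ => ?_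
    simp only [Equiv.prodComm_apply, Prod.fst_swap, Prod.snd_swap]
    rw [symE_comm]
  have e : ∀ b : Idx, ((1 / 2 : ℝ) • (x + xᵀ)) b.1 b.2 • symE b.1 b.2
      = (1 / 2 : ℝ) • (x b.1 b.2 • symE b.1 b.2) + (1 / 2 : ℝ) • (x b.2 b.1 • symE b.1 b.2) := by
    intro b
    simp only [Matrix.smul_apply, Matrix.add_apply, transpose_apply, smul_eq_mul, smul_smul,
      ← add_smul]
    congr 1
    ring
  simp only [e, Finset.sum_add_distrib, ← Finset.smul_sum, h]
  rw [← add_smul]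
  norm_num

/-- The value of the sesquilinear extension in terms of real and imaginary parts. -/
theorem pairing_eq_formEval (C : FiberForm) (z : Phase) (u v : Tens) : pairing C z u v =
    ((formEval C z (of fun i j => (u i j).re) (of fun i j => (v i j).re)
      + formEval C z (of fun i j => (u i j).im) (of fun i j => (v i j).im) : ℝ) : ℂ)
    + Complex.I * ((formEval C z (of fun i j => (u i j).re) (of fun i j => (v i j).im)
      - formEval C z (of fun i j => (u i j).im) (of fun i j => (v i j).re) : ℝ) : ℂ) := by
  simp only [formEval, ← Finset.sum_add_distrib, ← Finset.sum_sub_distrib, Complex.ofReal_sum,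
    Finset.mul_sum, pairing, Matrix.of_apply]
  refine Finset.sum_congr rfl fun i _ => Finset.sum_congr rfl fun j _ =>
    Finset.sum_congr rfl fun k _ => Finset.sum_congr rfl fun l _ => ?_
  apply Complex.ext
  · simp
  · simp
    ring

/-- Positive definiteness is an open condition. -/
theorem eventually_formEval_pos {C : FiberForm} {z : Phase} (hC : ContinuousAt C z)
    (hpos : ∀ x : Mat4, x ≠ 0 → 0 < formEval C z x x) :
    ∀ᶠ y in nhds z, ∀ x : Mat4, x ≠ 0 → 0 < formEval C y x x := by
  have hc : ∀ i j k l, ContinuousAt (fun y => C y i j k l) z := fun i j k l =>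
    continuousAt_pi.1 (continuousAt_pi.1 (continuousAt_pi.1 (continuousAt_pi.1 hC i) j) k) l
  have hK := isCompact_sphere (0 : Idx → ℝ) 1
  have key := hK.eventually_forall_of_forall_eventually (x₀ := z)
    (P := fun y w => 0 < formEval C y (of fun i j => w (i, j)) (of fun i j => w (i, j))) (by
      intro w hw
      have hw0 : (of fun i j => w (i, j) : Mat4) ≠ 0 := by
        intro h0
        have : w = 0 := by
          funext b
          exact congrFun (congrFun h0 b.1) b.2
        rw [this] at hw
        simp at hw
      have hcont : ContinuousAt (fun q : Phase × (Idx → ℝ) =>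
          formEval C q.1 (of fun i j => q.2 (i, j)) (of fun i j => q.2 (i, j))) (z, w) := by
        simp only [formEval, Matrix.of_apply]
        refine tendsto_finsetSum _ fun i _ => tendsto_finsetSum _ fun j _ =>
          tendsto_finsetSum _ fun k _ => tendsto_finsetSum _ fun l _ => ?_
        have h1 : ContinuousAt (fun q : Phase × (Idx → ℝ) => C q.1 i j k l) (z, w) :=
          ContinuousAt.comp (f := Prod.fst) (g :=
            fun y => C y i j k l) (hc i j k l) continuousAt_fst
        have h2 : ∀ b : Idx, ContinuousAt (fun q : Phase × (Idx → ℝ) => q.2 b) (z, w) :=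
          fun b => ((continuous_apply b).comp continuous_snd).continuousAt
        exact (h1.mul (h2 (i, j))).mul (h2 (k, l))
      have := hcont.eventually (lt_mem_nhds (hpos _ hw0))
      exact this)
  filter_upwards [key] with y hy x hx
  set w : Idx → ℝ := fun b => x b.1 b.2 with hw
  have hw0 : w ≠ 0 := by
    intro h0
    refine hx ?_
    ext i j
    exact congrFun h0 (i, j)
  have hn : 0 < ‖w‖ := norm_pos_iff.2 hw0
  have h1 := hy (‖w‖⁻¹ • w) (by simp [norm_smul, hn.ne'])
  have e : formEval C y (of fun i j => (‖w‖⁻¹ • w) (i, j)) (of fun i j => (‖w‖⁻¹ • w) (i, j))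
      = ‖w‖⁻¹ ^ 2 * formEval C y x x := by
    simp only [formEval, Finset.mul_sum, Matrix.of_apply, Pi.smul_apply, smul_eq_mul, hw]
    refine Finset.sum_congr rfl fun i _ => Finset.sum_congr rfl fun j _ =>
      Finset.sum_congr rfl fun k _ => Finset.sum_congr rfl fun l _ => by ring
  rw [e] at h1
  exact (pos_iff_pos_of_mul_pos h1).1 (by positivity)

namespace Data

variable {D : Data}

/-- The fiber inner product: `phiForm` on symmetric tensors, and the Euclidean inner product on
skew-symmetric ones. -/
def fiberForm (D : Data) (κ ν δ K : ℝ) : FiberForm := fun z i j k l =>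
  D.phiForm κ ν δ K z (symE i j) (symE k l) + skewCoef i j k l

theorem fiberForm_swap (D : Data) (κ ν δ K : ℝ) (z : Phase) (i j k l : Fin 4) :
    D.fiberForm κ ν δ K z j i l k = D.fiberForm κ ν δ K z i j k l := by
  rw [fiberForm, fiberForm, skewCoef_swap, symE_comm j i, symE_comm l k]

theorem fiberForm_symm (D : Data) (κ ν δ K : ℝ) (z : Phase) (i j k l : Fin 4) :
    D.fiberForm κ ν δ K z i j k l = D.fiberForm κ ν δ K z k l i j := by
  rw [fiberForm, fiberForm, skewCoef_symm, phiForm, Phi_comm ν δ K _ _ _ _ (D.dual_isSymm z.1)]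
  rfl

theorem formEval_fiberForm (D : Data) (κ ν δ K : ℝ) (z : Phase) (x y : Mat4) :
    formEval (D.fiberForm κ ν δ K) z x y
      = D.phiForm κ ν δ K z ((1 / 2 : ℝ) • (x + xᵀ)) ((1 / 2 : ℝ) • (y + yᵀ))
        + ∑ i, ∑ j, x i j * (y i j - y j i) / 2 := by
  set B : Mat4 →ₗ[ℝ] Mat4 →ₗ[ℝ] ℝ := LinearMap.mk₂ ℝ (D.phiForm κ ν δ K z)
    (Phi_add_left ν δ K _ _ _ _) (Phi_smul_left ν δ K _ _ _ _)
    (Phi_add_right ν δ K _ _ _ _) (Phi_smul_right ν δ K _ _ _ _) with hB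
  have hBa : ∀ u v, D.phiForm κ ν δ K z u v = B u v := fun u v => rfl
  rw [← sum_skewCoef, ← sum_smul_symE, ← sum_smul_symE, hBa]
  simp only [formEval, fiberForm, hBa, map_sum, LinearMap.sum_apply, map_smul, LinearMap.smul_apply,
    smul_eq_mul, Fintype.sum_prod_type, add_mul, Finset.sum_add_distrib, Finset.mul_sum]
  congr 1
  have e : ∀ f : Fin 4 → Fin 4 → Fin 4 → Fin 4 → ℝ,
      ∑ i, ∑ j, ∑ k, ∑ l, f i j k l = ∑ k, ∑ l, ∑ i, ∑ j, f i j k l := by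
    intro f
    simp only [Fin.sum_univ_four]
    ring
  rw [e]
  exact Finset.sum_congr rfl fun i _ => Finset.sum_congr rfl fun j _ =>
    Finset.sum_congr rfl fun k _ => Finset.sum_congr rfl fun l _ => by ring

theorem half_smul_add_transpose {x : Mat4} (hx : x.IsSymm) : (1 / 2 : ℝ) • (x + xᵀ) = x := by
  rw [hx.eq, ← two_smul ℝ x, smul_smul]
  norm_num

theorem formEval_fiberForm_of_isSymm (D : Data) (κ ν δ K : ℝ) (z : Phase) {x y : Mat4}
    (hx : x.IsSymm) (hy : y.IsSymm) :
    formEval (D.fiberForm κ ν δ K) z x y = D.phiForm κ ν δ K z x y := by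
  rw [formEval_fiberForm, half_smul_add_transpose hx, half_smul_add_transpose hy, add_eq_left]
  refine Finset.sum_eq_zero fun i _ => Finset.sum_eq_zero fun j _ => ?_
  rw [hy.apply]
  simp

theorem formEval_fiberForm_pos (D : Data) {κ ν δ K : ℝ} {z : Phase}
    (hpos : ∀ x : Mat4, x.IsSymm → x ≠ 0 → 0 < D.phiForm κ ν δ K z x x) {x : Mat4} (hx : x ≠ 0) :
    0 < formEval (D.fiberForm κ ν δ K) z x x := by
  have hs : ((1 / 2 : ℝ) • (x + xᵀ)).IsSymm := by
    rw [IsSymm, transpose_smul, transpose_add, transpose_transpose, add_comm]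
  have h2 : 0 ≤ ∑ i, ∑ j, (x i j - x j i) ^ 2 / 4 :=
    Finset.sum_nonneg fun i _ => Finset.sum_nonneg fun j _ => by positivity
  rw [formEval_fiberForm, sum_mul_sub_swap]
  by_cases h0 : (1 / 2 : ℝ) • (x + xᵀ) = 0
  · have h1 : D.phiForm κ ν δ K z ((1 / 2 : ℝ) • (x + xᵀ)) ((1 / 2 : ℝ) • (x + xᵀ)) = 0 := by
      rw [phiForm, h0, ← zero_smul ℝ (0 : Mat4), Phi_smul_left, zero_mul]
    rw [h1, zero_add]
    refine lt_of_le_of_ne h2 fun h3 => hx ?_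
    have h4 : ∀ i j, x i j = x j i := by
      intro i j
      have h5 := (Finset.sum_eq_zero_iff_of_nonneg
        fun i _ => Finset.sum_nonneg fun j _ => by positivity).1 h3.symm i (Finset.mem_univ _)
      have h6 := (Finset.sum_eq_zero_iff_of_nonneg
        fun j _ => by positivity).1 h5 j (Finset.mem_univ _)
      have h7 : (x i j - x j i) ^ 2 = 0 := by linarith
      exact sub_eq_zero.1 (pow_eq_zero_iff two_ne_zero |>.1 h7)
    have hsx : x.IsSymm := IsSymm.ext fun i j => h4 j i
    rwa [half_smul_add_transpose hsx] at h0
  · have := hpos _ hs h0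
    linarith

theorem Subextremal.contDiffAt_fiberForm (h : D.Subextremal) {z : Phase} (hz : z.1 ∈ D.reg)
    {κ : ℝ} (hσ : D.sigma z ≠ 0) (hα : D.alpha κ z ≠ 0) (ν δ K : ℝ) :
    ContDiffAt ℝ ∞ (D.fiberForm κ ν δ K) z := by
  refine contDiffAt_pi.2 fun i => contDiffAt_pi.2 fun j => contDiffAt_pi.2 fun k =>
    contDiffAt_pi.2 fun l => ?_
  exact (h.contDiffAt_phiForm hz hσ hα ν δ K _ _).add contDiffAt_const

/-- The open set where the fiber form is defined and positive definite. -/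
def posSet (D : Data) (κ ν δ K : ℝ) : Set Phase :=
  {z | z.1 ∈ D.reg ∧ D.sigma z ≠ 0 ∧ D.alpha κ z ≠ 0 ∧
    ∀ x : Mat4, x.IsSymm → x ≠ 0 → 0 < D.phiForm κ ν δ K z x x}

theorem Subextremal.isOpen_posSet (h : D.Subextremal) (κ ν δ K : ℝ) :
    IsOpen (D.posSet κ ν δ K) := by
  refine isOpen_iff_mem_nhds.2 fun z hz => ?_
  obtain ⟨hr, hσ, hα, hp⟩ := hz
  have hr' : ∀ᶠ y : Phase in nhds z, y.1 ∈ D.reg :=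
    continuousAt_fst.eventually (D.isOpen_reg.mem_nhds hr)
  have hσ' := D.contDiff_sigma.continuous.continuousAt.eventually_ne hσ
  have hα' := (h.contDiffAt_alpha hr κ).continuousAt.eventually_ne hα
  have hp' := eventually_formEval_pos (h.contDiffAt_fiberForm hr hσ hα ν δ K).continuousAt
    fun x hx => D.formEval_fiberForm_pos hp hx
  filter_upwards [hr', hσ', hα', hp'] with y h1 h2 h3 h4
  refine ⟨h1, h2, h3, fun x hx hx0 => ?_⟩
  rw [← D.formEval_fiberForm_of_isSymm κ ν δ K y hx hx]
  exact h4 x hx0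

/-! ### Stationarity -/

theorem alpha_flow (D : Data) (κ s : ℝ) (z : Phase) : D.alpha κ (D.flow s z) = D.alpha κ z := by
  have e : D.alpha κ (D.flow s z) = (D.rot s *ᵥ z.2) ⬝ᵥ D.cVec κ (D.flowPt s z.1) := rfl
  rw [e, cVec_flowPt, rot_dotProduct]
  rfl

theorem zVec_flow (D : Data) (s : ℝ) (z : Phase) : D.zVec (D.flow s z) = D.rot s *ᵥ D.zVec z := by
  rw [zVec, zVec, sigma_flow, sharp_flow, mulVec_smul]

theorem yVec_flow (D : Data) (κ s : ℝ) (z : Phase) :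
    D.yVec κ (D.flow s z) = D.rot s *ᵥ D.yVec κ z := by
  rw [yVec, yVec, sigma_flow, alpha_flow, mulVec_smul, ← cVec_flowPt]
  rfl

theorem nVal_flow (D : Data) (κ s : ℝ) (z : Phase) : D.nVal κ (D.flow s z) = D.nVal κ z := by
  rw [nVal, nVal, yVec_flow]
  have e : D.metric (D.flow s z).1 = D.rot s * D.metric z.1 * (D.rot s)ᵀ := D.metric_flowPt s z.1
  rw [e, bl, bl, mulVec_mulVec, Matrix.mul_assoc _ (D.rot s)ᵀ, rot_transpose_mul, Matrix.mul_one,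
    ← mulVec_mulVec, rot_dotProduct]

theorem phiForm_flow (D : Data) (κ ν δ K s : ℝ) (z : Phase) (u v : Mat4) :
    D.phiForm κ ν δ K (D.flow s z) u v
      = D.phiForm κ ν δ K z ((D.rot s)ᵀ * u * D.rot s) ((D.rot s)ᵀ * v * D.rot s) := by
  have e : D.dual (D.flow s z).1 = D.rot s * D.dual z.1 * (D.rot s)ᵀ := D.dual_flowPt s z.1
  rw [phiForm, phiForm, Phi_conj, e, zVec_flow, yVec_flow, nVal_flow]

theorem transpose_rot_mul_mul (D : Data) (s : ℝ) (u : Mat4) :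
    (D.rot s)ᵀ * (D.rot s * u * (D.rot s)ᵀ) * D.rot s = u := by
  rw [Matrix.mul_assoc, Matrix.mul_assoc (D.rot s * u), rot_transpose_mul, Matrix.mul_one,
    ← Matrix.mul_assoc, rot_transpose_mul, Matrix.one_mul]

theorem flow_mem_posSet (D : Data) {κ ν δ K : ℝ} (s : ℝ) {z : Phase} (hz : z ∈ D.posSet κ ν δ K) :
    D.flow s z ∈ D.posSet κ ν δ K := by
  obtain ⟨hr, hσ, hα, hp⟩ := hz
  refine ⟨?_, by rwa [sigma_flow], by rwa [alpha_flow], fun x hx hx0 => ?_⟩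
  · have e : rad (D.flow s z).1 = rad z.1 := D.rad_flowPt s z.1
    change rad (D.flow s z).1 ∈ Set.Ioo D.rEvent D.rCosmo
    rw [e]
    exact hr
  · rw [phiForm_flow]
    refine hp _ ?_ fun h0 => hx0 ?_
    · rw [IsSymm, transpose_mul, transpose_mul, transpose_transpose, hx.eq, Matrix.mul_assoc]
    · have e : D.rot s * ((D.rot s)ᵀ * x * D.rot s) * (D.rot s)ᵀ = x := by
        rw [Matrix.mul_assoc, Matrix.mul_assoc ((D.rot s)ᵀ * x), rot_mul_transpose, Matrix.mul_one,
          ← Matrix.mul_assoc, rot_mul_transpose, Matrix.one_mul]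
      rw [← e, h0, Matrix.mul_zero, Matrix.zero_mul]

theorem flowTens_re (D : Data) (s : ℝ) (u : Tens) :
    (of fun i j => (D.flowTens s u i j).re : Mat4)
      = D.rot s * (of fun i j => (u i j).re) * (D.rot s)ᵀ := by
  ext i j
  simp only [flowTens, Matrix.of_apply, mul_apply, transpose_apply, Complex.re_sum, Finset.sum_mul]
  rw [Finset.sum_comm]
  refine Finset.sum_congr rfl fun k _ => Finset.sum_congr rfl fun l _ => ?_
  simp
  ring

theorem flowTens_im (D : Data) (s : ℝ) (u : Tens) :
    (of fun i j => (D.flowTens s u i j).im : Mat4)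
      = D.rot s * (of fun i j => (u i j).im) * (D.rot s)ᵀ := by
  ext i j
  simp only [flowTens, Matrix.of_apply, mul_apply, transpose_apply, Complex.im_sum, Finset.sum_mul]
  rw [Finset.sum_comm]
  refine Finset.sum_congr rfl fun k _ => Finset.sum_congr rfl fun l _ => ?_
  simp
  ring

theorem formEval_fiberForm_flow (D : Data) (κ ν δ K s : ℝ) (z : Phase) {x y : Mat4}
    (hx : x.IsSymm) (hy : y.IsSymm) :
    formEval (D.fiberForm κ ν δ K) (D.flow s z) (D.rot s * x * (D.rot s)ᵀ)
      (D.rot s * y * (D.rot s)ᵀ) = formEval (D.fiberForm κ ν δ K) z x y := by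
  have hs : ∀ w : Mat4, w.IsSymm → (D.rot s * w * (D.rot s)ᵀ).IsSymm := by
    intro w hw
    rw [IsSymm, transpose_mul, transpose_mul, transpose_transpose, hw.eq, Matrix.mul_assoc]
  rw [D.formEval_fiberForm_of_isSymm κ ν δ K _ (hs x hx) (hs y hy),
    D.formEval_fiberForm_of_isSymm κ ν δ K _ hx hy, phiForm_flow, transpose_rot_mul_mul,
    transpose_rot_mul_mul]

theorem isStationary_fiberForm (D : Data) (κ ν δ K : ℝ) :
    IsStationary D (D.posSet κ ν δ K) (D.fiberForm κ ν δ K) := by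
  intro z hz s
  refine ⟨D.flow_mem_posSet s hz, fun u v hu hv => ?_⟩
  have hre : ∀ w : Tens, IsSymTens w → (of fun i j => (w i j).re : Mat4).IsSymm :=
    fun w hw => IsSymm.ext fun i j => congrArg Complex.re (hw j i)
  have him : ∀ w : Tens, IsSymTens w → (of fun i j => (w i j).im : Mat4).IsSymm :=
    fun w hw => IsSymm.ext fun i j => congrArg Complex.im (hw j i)
  rw [pairing_eq_formEval, pairing_eq_formEval, flowTens_re, flowTens_im, flowTens_re, flowTens_im,
    D.formEval_fiberForm_flow κ ν δ K s z (hre u hu) (hre v hv),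
    D.formEval_fiberForm_flow κ ν δ K s z (him u hu) (him v hv),
    D.formEval_fiberForm_flow κ ν δ K s z (hre u hu) (him v hv),
    D.formEval_fiberForm_flow κ ν δ K s z (him u hu) (hre v hv)]

theorem Subextremal.isFiberInner_fiberForm (h : D.Subextremal) (κ ν δ K : ℝ) :
    IsFiberInner (D.posSet κ ν δ K) (D.fiberForm κ ν δ K) where
  smooth _ hz := (h.contDiffAt_fiberForm hz.1 hz.2.1 hz.2.2.1 ν δ K).contDiffWithinAt
  symm _ _ := D.fiberForm_symm κ ν δ K _
  pos _ hz u _ hu0 := D.formEval_fiberForm_pos hz.2.2.2 (x := of u) hu0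

theorem reg_of_mem_Gam {s : ℝ} {z : Phase} (hz : z ∈ D.Gam s) : z.1 ∈ D.reg := hz.2.2.1

theorem Subextremal.mem_posSet (h : D.Subextremal) {c y N κ s : ℝ} (hc : 0 < c) {z : Phase}
    (hz : z ∈ D.Gam s) (hb : D.IsBounded c y N κ s z) (ν : ℝ) {δ K : ℝ} (hδ : 0 < δ) (hK : 0 < K) :
    z ∈ D.posSet κ ν δ K := by
  have hα : D.alpha κ z ≠ 0 := by
    intro h0
    have h1 := hb.alpha_le
    rw [h0, mul_zero] at h1
    have := mul_pos hc (abs_pos.2 hb.sigma_ne_zero)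
    linarith
  have hr := reg_of_mem_Gam hz
  refine ⟨hr, hb.sigma_ne_zero, hα, fun x hx hx0 => ?_⟩
  obtain ⟨e, f, F⟩ := h.exists_nullFrame hr hz.1.2.2.1 hb.sigma_ne_zero hα
  exact F.Phi_pos hδ hK hx hx0

end Data

end KdS

theorem theorem3p1 (D : KdS.Data) (hD : D.Subextremal) (ε : ℝ) (hε : 0 < ε) :
    ∃ κ₀ > 0, ∃ e₀ > 0, ∃ h₀ > 0,
      ∀ κ ∈ Set.Ioo (0 : ℝ) κ₀, ∀ e ∈ Set.Ioo (0 : ℝ) e₀, ∀ h ∈ Set.Ioo (0 : ℝ) h₀,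
        ∃ (U : Set KdS.Phase) (C : KdS.FiberForm)
          (S' : (KdS.Phase → KdS.Tens) → KdS.Phase → KdS.Tens),
          IsOpen U ∧ (∀ z ∈ U, z.1 ∈ D.M) ∧ D.Gam 1 ∪ D.Gam (-1) ⊆ U ∧
          KdS.IsFiberInner U C ∧ KdS.IsStationary D U C ∧
          KdS.IsFormalAdjoint U C (D.Ssub (D.linEinstein κ e h)) S' ∧
          ∀ s : ℝ, s = 1 ∨ s = -1 → ∀ z ∈ D.Gam s, D.sigma z ≠ 0 ∧
            ∀ v, KdS.IsTestSection U v →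
              s * (KdS.pairing C z (v z) ((1 / (2 * Complex.I * (|D.sigma z| : ℝ))) •
                (D.Ssub (D.linEinstein κ e h) v z - S' v z))).re
                ≤ ε * (KdS.pairing C z (v z) (v z)).re := by
  obtain ⟨κ₀, hκ₀, c, hc, y, hy, N, hN, hbd⟩ := hD.exists_uniform_bounds
  obtain ⟨δ, hδ, K, hK, h₀, hh₀, hform⟩ := hD.exists_form_constants ε y N c hε hy hN hc
  refine ⟨κ₀, hκ₀, 1 / 8, by norm_num, h₀, hh₀, fun κ hκ e he h hh => ?_⟩
  have hs1 : ∀ s : ℝ, s = 1 ∨ s = -1 → |s| = 1 := by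
    rintro s (rfl | rfl) <;> simp
  have hU := hD.isOpen_posSet κ (e / (1 - 2 * e)) δ K
  have hC := (hD.isFiberInner_fiberForm κ (e / (1 - 2 * e)) δ K).smooth
  have hpos : ∀ z ∈ D.posSet κ (e / (1 - 2 * e)) δ K, ∀ x : KdS.Mat4, x ≠ 0 →
      0 < KdS.formEval (D.fiberForm κ (e / (1 - 2 * e)) δ K) z x x :=
    fun z hz x hx => D.formEval_fiberForm_pos hz.2.2.2 hx
  have hmem : ∀ s : ℝ, s = 1 ∨ s = -1 → D.Gam s ⊆ D.posSet κ (e / (1 - 2 * e)) δ K :=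
    fun s hs z hz => hD.mem_posSet hc hz (hbd κ hκ s (hs1 s hs) z hz) _ hδ hK
  refine ⟨D.posSet κ (e / (1 - 2 * e)) δ K, D.fiberForm κ (e / (1 - 2 * e)) δ K,
    D.adjSsub κ e h (D.fiberForm κ (e / (1 - 2 * e)) δ K), hU,
    fun z hz => hD.reg_subset hz.1, Set.union_subset (hmem 1 (.inl rfl)) (hmem (-1) (.inr rfl)),
    hD.isFiberInner_fiberForm _ _ _ _, D.isStationary_fiberForm _ _ _ _,
    hD.isFormalAdjoint_adjSsub κ e h hU (fun z hz => hz.1) hC (D.fiberForm_swap _ _ _ _) hpos, ?_⟩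
  intro s hs z hz
  have hb := hbd κ hκ s (hs1 s hs) z hz
  refine ⟨hb.sigma_ne_zero, fun v hv => ?_⟩
  refine hD.adjSsub_bound κ e h hU (fun z hz => hz.1) hC (D.fiberForm_symm _ _ _ _) hpos
    (hmem s hs hz) hb.sigma_ne_zero (fun x hx => ?_) hv
  have e1 : (fun y => KdS.formEval (D.fiberForm κ (e / (1 - 2 * e)) δ K) y x x)
      = fun y => D.phiForm κ (e / (1 - 2 * e)) δ K y x x :=
    funext fun y => D.formEval_fiberForm_of_isSymm _ _ _ _ y hx hx
  rw [e1, D.formEval_fiberForm_of_isSymm _ _ _ _ z hx hx,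
    D.formEval_fiberForm_of_isSymm _ _ _ _ z hx (D.potential_isSymm κ e h z hx)]
  exact hform κ e h s z (hs1 s hs) (KdS.Data.reg_of_mem_Gam hz) hz.1.2.2.1 he.1 he.2 hh.1 hh.2
    hb.sigma_ne_zero hb.alpha_le hb.nVal_le hb.covY_le hb.covY_covY_le x hx

end
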